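/- **Conventions.** An *orbispace* is a topological space $X$ with a base $\mathcal U$ of connected open sets and the following data. Each $U\in\mathcal U$ carries a $G$-structure $(\widehat U,G_U,\pi_U)$: a connected, locally connected space $\widehat U$ with a continuous action of a topological group $G_U$ (not necessarily effective) and a map $\pi_U:\widehat U\to U$ that induces a homeomorphism $\widehat U/G_U\cong U$. For $U,V\in\mathcal U$ there is a set $\mathrm{Tran}(U,V)$ of transition maps. Each $\xi\in\mathrm{Tran}(U,V)$ has an underlying isomorphism $(\phi_\xi,\lambda_\xi)$: $\phi_\xi$ is a homeomorphism over $X$ from a connected component of $\pi_U^{-1}(U\cap V)$ to a connected component of $\pi_V^{-1}(U\cap V)$, and $\lambda_\xi$ is an isomorphism of topological groups between the subgroups of $G_U$, $G_V$ preserving these components, for which $\phi_\xi$ is equivariant. Every point of $\pi_U^{-1}(U\cap V)$ lies in the domain of some transition map. The group $G_V$ acts on $\mathrm{Tran}(U,V)$ from the left and $G_U$ from the right, compatibly with the underlying maps; transition maps over the same component of $U\cap V$ are translates $g\circ\xi\circ h$ of each other; and $g^{-1}\circ\xi\circ h=\xi$ if and only if $h$ is in the domain of $\lambda_\xi$ and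 $\lambda_\xi(h)=g$. Transition maps compose (on each connected component of the set where the underlying maps compose) associatively and compatibly with these actions, and $\mathrm{Tran}(U,U)$ contains an identity, whence $\mathrm{Tran}(U,U)\cong G_U$. $\mathrm{Tran}(U,V)$ has the topology for which each orbit of the free left $G_V$-action is open and is homeomorphic to $G_V$ by $g\mapsto g\circ\xi$. A *base-point structure* $p$ of $X$ is a chart $U_p\in\mathcal U$ with a point $\hat p\in\widehat U_p$. A *based morphism* $\tilde i:(Y,q)\to(X,p)$ is represented by a system: indices $\alpha\in\Lambda$, basic open sets $V_\alpha$ of $Y$ that cover $Y$ and $W_\alpha$ of $X$, continuous maps $f_\alpha:\widehat V_\alpha\to\widehat W_\alpha$ and $\rho_{\beta\alpha}:\mathrm{Tran}(V_\alpha,V_\beta)\to\mathrm{Tran}(W_\alpha,W_\beta)$ with $f_\beta\circ\phi_\xi=\phi_{\rho_{\beta\alpha}(\xi)}\circ f_\alpha$ and $\rho_{\gamma\alpha}(\eta\circ\xi)=\rho_{\gamma\beta}(\eta)\circ\rho_{\beta\alpha}(\xi)$, and an index $o$ for which $V_o$, $W_o$ are the charts of $q$, $p$ and $f_o(\hat q)=\hat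 p$. Let $\rho_\alpha:G_{V_\alpha}\to G_{W_\alpha}$ be the homomorphism given by $\rho_{\alpha\alpha}$. The morphism is a *based pseudo-embedding* if it has a representing system (fixed below) in which each $f_\alpha$ is a topological embedding, each $\rho_\alpha$ is a monomorphism of topological groups (an isomorphism onto its image with the subspace topology), and each projection $G_{W_\alpha}\to G_{W_\alpha}/\rho_\alpha(G_{V_\alpha})$ is a weak fibration, i.e. has the homotopy lifting property for all disks. A *path system* of $X$ consists of a subdivision of $[0,1]$ into at least two consecutive closed intervals $I_k$, of charts $U_k\in\mathcal U$, of continuous maps $f_k:I_k\to\widehat U_k$, and of transition maps $\xi_k\in\mathrm{Tran}(U_k,U_{k+1})$ with $\phi_{\xi_k}\circ f_k=f_{k+1}$ at the common end point of $I_k$, $I_{k+1}$. It is refined by a path system on a finer subdivision (also by one on the same subdivision) that is carried to it, interval by interval, by transition maps compatible with the $f_k$ and the $\xi_k$. The *based loop space* $\Omega(X,p)$ is the set of path systems that start and end at $p$ (in the chart $U_p$, at $\hat p$), modulo the equivalence relation generated by refinements whose first and last transition maps are identities. The *based relative loop space* $\Omega(X,Y,\tilde i)$ is the set of path systems of $X$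 that start at $p$ and end in a chart $W_\alpha$ at $f_\alpha(v)$ for a specified $v\in\widehat V_\alpha$, modulo the equivalence relation generated by refinements whose first transition map is the identity and whose last one is $\rho_{\beta\alpha}(\zeta)$ for a transition map $\zeta$ of $Y$ with $\phi_\zeta(v)=v'$ for the specified points $v$, $v'$. Both have the compact-open topology: a subbase is given, for each choice of a subdivision, charts (and $\alpha$), compact $K_k\subset I_k$, open $D_k\subset\widehat U_k$ and open $A_k\subset\mathrm{Tran}(U_k,U_{k+1})$, by the set of classes that have a representative over this subdivision and these charts with $f_k(K_k)\subset D_k$, $\xi_k\in A_k$ for all $k$. The base points are the classes of the constant system. For $k\ge1$, $$\pi_k(X):=\pi_{k-1}(\Omega(X,p)),\qquad \pi_k(X,Y,\tilde i):=\pi_{k-1}(\Omega(X,Y,\tilde i)),$$ similarly $\pi_k(Y):=\pi_{k-1}(\Omega(Y,q))$; the group law of $\pi_1(X)$, $\pi_1(Y)$ is concatenation; $\pi_0(X)$ and $\pi_0(Y)$ are the pointed sets of classes of points that are joined by path systems. **Theorem.** Let $\tilde i:(Y,q)\to(X,p)$ be a based pseudo-embedding of orbispaces. Composition with $\tilde i$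 is a well-defined continuous based map $\Omega(Y,q)\to\Omega(X,p)$ and a well-defined continuous map $\Omega(Y,Y,\mathrm{id})\to\Omega(X,Y,\tilde i)$; regarding a based loop as a based relative loop is a continuous based map $\Omega(X,p)\to\Omega(X,Y,\tilde i)$; $\tilde i$ induces a map $\pi_0(Y)\to\pi_0(X)$; and concatenation does define groups $\pi_1(X)$, $\pi_1(Y)$. Let $i_\#:\pi_k(Y)\to\pi_k(X)$ and $j_\#:\pi_k(X)\to\pi_k(X,Y,\tilde i)$ be induced by these maps. There are connecting maps $\partial:\pi_{k+1}(X,Y,\tilde i)\to\pi_k(Y)$, $k\ge0$, which send the class of a family of based relative loops to the class of the family of its end points in $Y$. (For $k\ge1$ this means: if a $(k-1)$-cube $\gamma$ in $\Omega(Y,q)$ with boundary at the base point is contracted, relative to the boundary, by $H'$ in $\Omega(Y,Y,\mathrm{id})$ and its image under $\tilde i$ is contracted by $H$ in $\Omega(X,p)$, then $\partial$ sends the class of the $k$-cube in $\Omega(X,Y,\tilde i)$ obtained by running from the base point through the image of $H'$ and then back through $H$ to the class of $\gamma$.) The sequence $$\cdots\to\pi_{k+1}(X,Y,\tilde i)\xrightarrow{\partial}\pi_k(Y)\xrightarrow{i_\#}\pi_k(X)\xrightarrow{j_\#}\pi_k(X,Y,\tilde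 i)\xrightarrow{\partial}\cdots\xrightarrow{j_\#}\pi_1(X,Y,\tilde i)\xrightarrow{\partial}\pi_0(Y)\xrightarrow{i_\#}\pi_0(X)$$ is exact (at every term with both an incoming and an outgoing map: the image of the former is the preimage of the base point under the latter), and its maps are homomorphisms wherever source and target are groups, i.e. $i_\#$ for $k\ge1$, and $j_\#$ and $\partial:\pi_{k+1}(X,Y,\tilde i)\to\pi_k(Y)$ for $k\ge2$ and $k\ge1$ respectively. -/

import Mathlib

open Set Topology

universe u v w

/-- A map has the homotopy lifting property with respect to all disks; the disk of dimension `n`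
is taken in the shape of the cube `[0,1]^n`. -/
def IsWeakFibration {E B : Type*} [TopologicalSpace E] [TopologicalSpace B] (p : E → B) : Prop :=
  Continuous p ∧
    ∀ (n : ℕ) (u : C(Fin n → unitInterval, E)) (H : C((Fin n → unitInterval) × unitInterval, B)), (∀ x, H (x, 0) = p (u x)) →
      ∃ H' : C((Fin n → unitInterval) × unitInterval, E), (∀ x, H' (x, 0) = u x) ∧ ∀ z, p (H' z) = H z

open scoped Pointwise in
/-- An orbispace structure on `X`. The basic open sets are `U i`, `i : ι`, and the `G`-structure of
`U i` is `(C i, G i, proj i)`.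

An element `ξ` of `Tran i j` has an underlying isomorphism `(map ξ, hom ξ)` from a `G`-structure of
a connected component of `U i ∩ U j` induced from that of `U i` to one induced from that of `U j`:
`map ξ` is a homeomorphism between connected components of the preimages of `U i ∩ U j` in `C i`
and in `C j`, and `hom ξ` is an isomorphism between the subgroups that preserve these components.
As the actions need not be effective, different transition maps may have the same underlying
isomorphism. `act g ξ h` is `g ∘ ξ ∘ h`. `comp ξ η x` is the composition `η ∘ ξ` (first `ξ`, then
`η`) taken on the connected component of `x` in the set on which `η ∘ ξ` makes sense as a map. -/
structure Orbispace (X : Type u) [TopologicalSpace X] where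
  ι : Type u
  U : ι → Set X
  U_injective : Function.Injective U
  isOpen_U : ∀ i, IsOpen (U i)
  isConnected_U : ∀ i, IsConnected (U i)
  isBasis : TopologicalSpace.IsTopologicalBasis (range U)
  C : ι → Type u
  [topC : ∀ i, TopologicalSpace (C i)]
  [connectedC : ∀ i, ConnectedSpace (C i)]
  [locallyConnectedC : ∀ i, LocallyConnectedSpace (C i)]
  G : ι → Type u
  [groupG : ∀ i, Group (G i)]
  [topG : ∀ i, TopologicalSpace (G i)]
  [topGroupG : ∀ i, IsTopologicalGroup (G i)]
  [actionG : ∀ i, MulAction (G i) (C i)]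
  [continuousG : ∀ i, ContinuousSMul (G i) (C i)]
  /-- `proj i` induces a homeomorphism from the orbit space of `C i` onto `U i`. -/
  proj : ∀ i, C i → U i
  proj_isQuotientMap : ∀ i, IsQuotientMap (proj i)
  proj_eq_iff : ∀ i (x y : C i), proj i x = proj i y ↔ ∃ g : G i, g • x = y
  Tran : ι → ι → Type u
  map : ∀ {i j}, Tran i j → OpenPartialHomeomorph (C i) (C j)
  map_proj : ∀ {i j} (ξ : Tran i j), ∀ x ∈ (map ξ).source, (proj j (map ξ x) : X) = proj i x
  source_nonempty : ∀ {i j} (ξ : Tran i j), (map ξ).source.Nonempty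
  source_eq : ∀ {i j} (ξ : Tran i j), ∀ x ∈ (map ξ).source,
    (map ξ).source = connectedComponentIn {z | (proj i z : X) ∈ U j} x
  target_eq : ∀ {i j} (ξ : Tran i j), ∀ y ∈ (map ξ).target,
    (map ξ).target = connectedComponentIn {z | (proj j z : X) ∈ U i} y
  hom : ∀ {i j} (ξ : Tran i j),
    MulAction.stabilizer (G i) (map ξ).source ≃ₜ* MulAction.stabilizer (G j) (map ξ).target
  map_smul : ∀ {i j} (ξ : Tran i j) (h : MulAction.stabilizer (G i) (map ξ).source),
    ∀ x ∈ (map ξ).source, map ξ ((h : G i) • x) = (hom ξ h : G j) • map ξ x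
  /-- Every connected component of `U i ∩ U j` carries a transition map. -/
  exists_tran : ∀ i j (x : C i), (proj i x : X) ∈ U j → ∃ ξ : Tran i j, x ∈ (map ξ).source
  act : ∀ {i j}, G j → Tran i j → G i → Tran i j
  one_act_one : ∀ {i j} (ξ : Tran i j), act 1 ξ 1 = ξ
  act_act : ∀ {i j} (g g' : G j) (ξ : Tran i j) (h h' : G i),
    act g (act g' ξ h') h = act (g * g') ξ (h' * h)
  map_act : ∀ {i j} (g : G j) (ξ : Tran i j) (h : G i),
    map (act g ξ h) ≈ (((Homeomorph.smul h).toOpenPartialHomeomorph.trans (map ξ)).trans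
      (Homeomorph.smul g).toOpenPartialHomeomorph)
  /-- Transition maps over the same connected component of `U i ∩ U j` are translates of each
  other. -/
  exists_act : ∀ {i j} (ξ η : Tran i j),
    proj i '' (map ξ).source = proj i '' (map η).source → ∃ g h, η = act g ξ h
  act_eq_iff : ∀ {i j} (ξ : Tran i j) (g : G j) (h : G i), act g⁻¹ ξ h = ξ ↔
    ∃ hh : h ∈ MulAction.stabilizer (G i) (map ξ).source, (hom ξ ⟨h, hh⟩ : G j) = g
  one : ∀ i, Tran i i
  map_one : ∀ i, map (one i) ≈ OpenPartialHomeomorph.refl (C i)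
  hom_one : ∀ i (h : MulAction.stabilizer (G i) (map (one i)).source),
    (hom (one i) h : G i) = h
  comp : ∀ {i j k} (ξ : Tran i j) (η : Tran j k) (x : C i),
    x ∈ ((map ξ).trans (map η)).source → Tran i k
  mem_source_comp : ∀ {i j k} (ξ : Tran i j) (η : Tran j k) (x : C i)
    (hx : x ∈ ((map ξ).trans (map η)).source), x ∈ (map (comp ξ η x hx)).source
  map_comp : ∀ {i j k} (ξ : Tran i j) (η : Tran j k) (x : C i)
    (hx : x ∈ ((map ξ).trans (map η)).source),
    ∀ y ∈ connectedComponentIn ((map ξ).trans (map η)).source x,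
      map (comp ξ η x hx) y = map η (map ξ y)
  comp_eq_comp : ∀ {i j k} (ξ : Tran i j) (η : Tran j k) (x y : C i)
    (hx : x ∈ ((map ξ).trans (map η)).source) (hy : y ∈ ((map ξ).trans (map η)).source),
    y ∈ connectedComponentIn ((map ξ).trans (map η)).source x → comp ξ η y hy = comp ξ η x hx
  comp_assoc : ∀ {i j k l} (ξ : Tran i j) (η : Tran j k) (ζ : Tran k l) (x : C i)
    (h₁ : x ∈ ((map ξ).trans (map η)).source)
    (h₂ : x ∈ ((map (comp ξ η x h₁)).trans (map ζ)).source)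
    (h₃ : map ξ x ∈ ((map η).trans (map ζ)).source)
    (h₄ : x ∈ ((map ξ).trans (map (comp η ζ (map ξ x) h₃))).source),
    comp (comp ξ η x h₁) ζ x h₂ = comp ξ (comp η ζ (map ξ x) h₃) x h₄
  comp_aut : ∀ {i j} (ξ : Tran i j) (g : G j) (x : C i)
    (hx : x ∈ ((map ξ).trans (map (act g (one j) 1))).source),
    comp ξ (act g (one j) 1) x hx = act g ξ 1
  aut_comp : ∀ {i j} (h : G i) (ξ : Tran i j) (x : C i)
    (hx : x ∈ ((map (act 1 (one i) h)).trans (map ξ)).source),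
    comp (act 1 (one i) h) ξ x hx = act 1 ξ h

attribute [instance] Orbispace.topC Orbispace.connectedC Orbispace.locallyConnectedC
  Orbispace.groupG Orbispace.topG Orbispace.topGroupG Orbispace.actionG Orbispace.continuousG

namespace Orbispace

variable {X : Type u} [TopologicalSpace X] (𝒳 : Orbispace X)

/-- The topology of `Tran i j`: every orbit of the free left action of `G j` is open and carries
the topology of `G j`. -/
instance topTran (i j : 𝒳.ι) : TopologicalSpace (𝒳.Tran i j) :=
  ⨆ ξ : 𝒳.Tran i j, TopologicalSpace.coinduced (fun g : 𝒳.G j => 𝒳.act g ξ 1) inferInstance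

/-- A base-point structure `(o, U_o, ô)`: a chart together with a point of it; the underlying
point `o` of `X` is the image of `ô`. -/
def BasePoint : Type u := Σ i : 𝒳.ι, 𝒳.C i

/-- Transition maps between arbitrary basic open sets; used to compare transition maps whose
charts are only propositionally equal. -/
def AnyTran : Type u := Σ i : 𝒳.ι, Σ j : 𝒳.ι, 𝒳.Tran i j

variable {𝒳}

/-- A transition map as an element of `AnyTran`. -/
def toAny {i j : 𝒳.ι} (ξ : 𝒳.Tran i j) : 𝒳.AnyTran := ⟨i, j, ξ⟩

variable (𝒳)

open scoped Pointwise in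
lemma act_one_mul (i : 𝒳.ι) (g : 𝒳.G i) : 𝒳.act g⁻¹ (𝒳.one i) g = 𝒳.one i := by
  have hs : g ∈ MulAction.stabilizer (𝒳.G i) (𝒳.map (𝒳.one i)).source := by
    rw [(𝒳.map_one i).1]
    simp
  exact (𝒳.act_eq_iff (𝒳.one i) g g).2 ⟨hs, 𝒳.hom_one i ⟨g, hs⟩⟩

lemma source_eq_univ {i : 𝒳.ι} (η : 𝒳.Tran i i) : (𝒳.map η).source = univ := by
  obtain ⟨x, hx⟩ := 𝒳.source_nonempty η
  have huniv : {z : 𝒳.C i | (𝒳.proj i z : X) ∈ 𝒳.U i} = univ :=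
    eq_univ_of_forall fun z => (𝒳.proj i z).2
  rw [𝒳.source_eq η x hx, huniv, connectedComponentIn_univ]
  exact PreconnectedSpace.connectedComponent_eq_univ x

open scoped Pointwise in
lemma aut_bijective (i : 𝒳.ι) :
    Function.Bijective (fun g : 𝒳.G i => 𝒳.act g (𝒳.one i) 1) := by
  constructor
  · intro g g' h
    have h1 : 𝒳.act (g'⁻¹ * g) (𝒳.one i) 1 = 𝒳.one i := by
      have := congrArg (fun ξ => 𝒳.act g'⁻¹ ξ 1) h
      simpa [𝒳.act_act, 𝒳.one_act_one] using this
    have h2 := (𝒳.act_eq_iff (𝒳.one i) (g'⁻¹ * g)⁻¹ 1).1 (by simpa using h1)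
    obtain ⟨hh, h3⟩ := h2
    have h4 : (⟨1, hh⟩ : MulAction.stabilizer (𝒳.G i) (𝒳.map (𝒳.one i)).source) = 1 := rfl
    rw [h4, _root_.map_one] at h3
    have h5 : (g'⁻¹ * g) = 1 := by
      rw [← inv_inv (g'⁻¹ * g), ← h3]; simp
    exact (inv_mul_eq_one.1 h5).symm
  · intro ξ
    obtain ⟨g, h, e⟩ := 𝒳.exists_act (𝒳.one i) ξ (by rw [𝒳.source_eq_univ, 𝒳.source_eq_univ])
    refine ⟨g * h, ?_⟩
    have := congrArg (fun η => 𝒳.act (g * h) η 1) (𝒳.act_one_mul i h)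
    simp only [𝒳.act_act, mul_one, mul_inv_cancel_right] at this
    rw [e]
    exact this.symm

/-- The identification of `G i`, the automorphism group of the `G`-structure of `U i`, with
`Tran i i`. -/
noncomputable def aut (i : 𝒳.ι) : 𝒳.G i ≃ 𝒳.Tran i i :=
  Equiv.ofBijective _ (𝒳.aut_bijective i)

lemma aut_apply (i : 𝒳.ι) (g : 𝒳.G i) : 𝒳.aut i g = 𝒳.act g (𝒳.one i) 1 := rfl

lemma aut_one (i : 𝒳.ι) : 𝒳.aut i 1 = 𝒳.one i := by rw [aut_apply, 𝒳.one_act_one]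

lemma mem_source_trans {i : 𝒳.ι} (ξ η : 𝒳.Tran i i) (x : 𝒳.C i) :
    x ∈ ((𝒳.map ξ).trans (𝒳.map η)).source := by
  simp [𝒳.source_eq_univ]

lemma comp_aut_aut {i : 𝒳.ι} (g h : 𝒳.G i) (x : 𝒳.C i) (hx) :
    𝒳.comp (𝒳.aut i h) (𝒳.aut i g) x hx = 𝒳.aut i (g * h) := by
  have := 𝒳.comp_aut (𝒳.aut i h) g x hx
  simpa [aut_apply, 𝒳.act_act] using this


end Orbispace

/-- A system of maps from the based orbispace `(Y, q)` to the based orbispace `(X, p)`: local maps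
`f α` between the charts `V α` and `W α`, and continuous maps `ρ α β` between the spaces of
transition maps, compatible with each other and with compositions. The index `o` is that of the
base-point structures. -/
structure BasedSystem {Y : Type u} {X : Type v} [TopologicalSpace Y] [TopologicalSpace X]
    (𝒴 : Orbispace Y) (𝒳 : Orbispace X) (q : 𝒴.BasePoint) (p : 𝒳.BasePoint) where
  Λ : Type w
  V : Λ → 𝒴.ι
  W : Λ → 𝒳.ι
  cover : ∀ y : Y, ∃ α, y ∈ 𝒴.U (V α)
  f : ∀ α, C(𝒴.C (V α), 𝒳.C (W α))
  ρ : ∀ α β, 𝒴.Tran (V α) (V β) → 𝒳.Tran (W α) (W β)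
  continuous_ρ : ∀ α β, Continuous (ρ α β)
  mem_source : ∀ {α β} (ξ : 𝒴.Tran (V α) (V β)), ∀ x ∈ (𝒴.map ξ).source,
    f α x ∈ (𝒳.map (ρ α β ξ)).source
  f_map : ∀ {α β} (ξ : 𝒴.Tran (V α) (V β)), ∀ x ∈ (𝒴.map ξ).source,
    f β (𝒴.map ξ x) = 𝒳.map (ρ α β ξ) (f α x)
  ρ_comp : ∀ {α β γ} (ξ : 𝒴.Tran (V α) (V β)) (η : 𝒴.Tran (V β) (V γ)) (x : 𝒴.C (V α))
    (hx : x ∈ ((𝒴.map ξ).trans (𝒴.map η)).source)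
    (hx' : f α x ∈ ((𝒳.map (ρ α β ξ)).trans (𝒳.map (ρ β γ η))).source),
    ρ α γ (𝒴.comp ξ η x hx) = 𝒳.comp (ρ α β ξ) (ρ β γ η) (f α x) hx'
  o : Λ
  pt : 𝒴.C (V o)
  base_source : (⟨V o, pt⟩ : 𝒴.BasePoint) = q
  base_target : (⟨W o, f o pt⟩ : 𝒳.BasePoint) = p

namespace BasedSystem

variable {Y : Type u} {X : Type v} [TopologicalSpace Y] [TopologicalSpace X]
  {𝒴 : Orbispace Y} {𝒳 : Orbispace X} {q : 𝒴.BasePoint} {p : 𝒳.BasePoint}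

/-- The homomorphism `ρ_α : G_{V_α} → G_{W_α}` that `ρ α α` is under the identification of
`Tran i i` with `G i`. -/
noncomputable def groupHom (σ : BasedSystem.{u, v, w} 𝒴 𝒳 q p) (α : σ.Λ) :
    𝒴.G (σ.V α) →* 𝒳.G (σ.W α) :=
  MonoidHom.mk' (fun g => (𝒳.aut (σ.W α)).symm (σ.ρ α α (𝒴.aut (σ.V α) g))) (by
    intro g h
    obtain ⟨x⟩ : Nonempty (𝒴.C (σ.V α)) := inferInstance
    rw [Equiv.symm_apply_eq, ← 𝒳.comp_aut_aut _ _ (σ.f α x) (𝒳.mem_source_trans _ _ _),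
      ← 𝒴.comp_aut_aut g h x (𝒴.mem_source_trans _ _ _)]
    simp only [Equiv.apply_symm_apply]
    exact σ.ρ_comp _ _ x _ (𝒳.mem_source_trans _ _ _))

lemma ρ_one (σ : BasedSystem.{u, v, w} 𝒴 𝒳 q p) (α : σ.Λ) :
    σ.ρ α α (𝒴.one (σ.V α)) = 𝒳.one (σ.W α) := by
  have h : (𝒳.aut (σ.W α)).symm (σ.ρ α α (𝒴.aut (σ.V α) 1)) = 1 := _root_.map_one (σ.groupHom α)
  rwa [Equiv.symm_apply_eq, 𝒳.aut_one, 𝒴.aut_one] at h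

/-- The conditions on a representing system of a based pseudo-embedding. A monomorphism of
topological groups is an isomorphism onto a subgroup with the subspace topology. -/
structure IsPseudoEmbedding (σ : BasedSystem.{u, v, w} 𝒴 𝒳 q p) : Prop where
  isEmbedding : ∀ α, IsEmbedding (σ.f α)
  isEmbedding_groupHom : ∀ α, IsEmbedding (σ.groupHom α)
  isWeakFibration : ∀ α, IsWeakFibration
    (QuotientGroup.mk : 𝒳.G (σ.W α) → 𝒳.G (σ.W α) ⧸ (σ.groupHom α).range)

variable (q) in
/-- The identity of a based orbispace. -/
def identity : BasedSystem.{u, u, u} 𝒴 𝒴 q q where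
  Λ := 𝒴.ι
  V := id
  W := id
  cover y := by
    obtain ⟨_, ⟨i, rfl⟩, hy, -⟩ := 𝒴.isBasis.exists_subset_of_mem_open (mem_univ y) isOpen_univ
    exact ⟨i, hy⟩
  f α := ContinuousMap.id _
  ρ _ _ ξ := ξ
  continuous_ρ _ _ := continuous_id
  mem_source _ _ hx := hx
  f_map _ _ _ := rfl
  ρ_comp _ _ _ _ _ := rfl
  o := q.1
  pt := q.2
  base_source := rfl
  base_target := rfl

end BasedSystem

/-- A subdivision `0 = t 0 < t 1 < ⋯ < t (n + 2) = 1` of `[0, 1]` into at least two intervals. -/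
structure Subdivision where
  n : ℕ
  t : Fin (n + 3) → ℝ
  strictMono : StrictMono t
  zero : t 0 = 0
  one : t (Fin.last (n + 2)) = 1

namespace Subdivision

/-- The intervals of a subdivision. -/
def piece (P : Subdivision) (k : Fin (P.n + 2)) : Set ℝ := Icc (P.t k.castSucc) (P.t k.succ)

/-- The common point of the interval `l` and the next one. -/
def brk (P : Subdivision) (l : Fin (P.n + 1)) : ℝ := P.t l.castSucc.succ

/-- The subdivision of `[0, 1]` at `1 / 2`. -/
noncomputable def half : Subdivision where
  n := 0
  t := ![0, 1 / 2, 1]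
  strictMono := by
    rw [Fin.strictMono_iff_lt_succ]
    intro i
    fin_cases i
    · change (0 : ℝ) < 1 / 2
      norm_num
    · change (1 / 2 : ℝ) < 1
      norm_num
  zero := rfl
  one := rfl

end Subdivision

namespace Orbispace

variable {X : Type u} [TopologicalSpace X] {𝒳 : Orbispace X}

/-- A system from `[0, 1]` to `X` over a subdivision `P` and charts `c`: paths `f k` in the charts,
of which only the values on the `k`-th interval matter, and transition maps `ξ l` that match
consecutive paths. -/
structure PathSys (P : Subdivision) (c : Fin (P.n + 2) → 𝒳.ι) where
  f : ∀ k, ℝ → 𝒳.C (c k)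
  continuousOn : ∀ k, ContinuousOn (f k) (P.piece k)
  ξ : ∀ l : Fin (P.n + 1), 𝒳.Tran (c l.castSucc) (c l.succ)
  mem_source : ∀ l, f l.castSucc (P.brk l) ∈ (𝒳.map (ξ l)).source
  glue : ∀ l, 𝒳.map (ξ l) (f l.castSucc (P.brk l)) = f l.succ (P.brk l)

/-- The transition maps of a system, together with the convention that the transition map from a
piece to itself is the identity. -/
inductive PathSys.Link {P : Subdivision} {c : Fin (P.n + 2) → 𝒳.ι} (τ : PathSys P c) :
    ∀ a b, 𝒳.Tran (c a) (c b) → Prop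
  | same (a) : PathSys.Link τ a a (𝒳.one (c a))
  | step (l) : PathSys.Link τ l.castSucc l.succ (τ.ξ l)

/-- The system `τ` is a refinement of `τ'`, through the index map `θ` and the transition maps
`j k`: on the `k`-th interval `j k ∘ f k = f' (θ k)`, and
`j (k + 1) ∘ ξ k = ξ'_{θ (k + 1), θ k} ∘ j k`. Isomorphisms are the case `θ = id`. -/
structure Refinement {P P' : Subdivision} {c : Fin (P.n + 2) → 𝒳.ι} {c' : Fin (P'.n + 2) → 𝒳.ι}
    (τ : PathSys P c) (τ' : PathSys P' c') where
  θ : Fin (P.n + 2) → Fin (P'.n + 2)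
  θ_zero : θ 0 = 0
  θ_last : θ (Fin.last _) = Fin.last _
  piece_subset : ∀ k, P.piece k ⊆ P'.piece (θ k)
  j : ∀ k, 𝒳.Tran (c k) (c' (θ k))
  mem_source : ∀ k, ∀ s ∈ P.piece k, τ.f k s ∈ (𝒳.map (j k)).source
  map_eq : ∀ k, ∀ s ∈ P.piece k, 𝒳.map (j k) (τ.f k s) = τ'.f (θ k) s
  comp_eq : ∀ l : Fin (P.n + 1), ∃ ζ : 𝒳.Tran (c' (θ l.castSucc)) (c' (θ l.succ)),
    τ'.Link (θ l.castSucc) (θ l.succ) ζ ∧ ∃ h₁ h₂,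
      𝒳.comp (τ.ξ l) (j l.succ) (τ.f l.castSucc (P.brk l)) h₁ =
        𝒳.comp (j l.castSucc) ζ (τ.f l.castSucc (P.brk l)) h₂

variable (𝒳) in
/-- The set of path components of an orbispace: two points are identified if they are joined by a
path system. -/
def Pi0 : Type u :=
  Quot fun a b : X => ∃ (P : Subdivision) (c : Fin (P.n + 2) → 𝒳.ι) (τ : PathSys P c),
    (𝒳.proj _ (τ.f 0 0) : X) = a ∧ (𝒳.proj _ (τ.f (Fin.last _) 1) : X) = b

variable (𝒳) in
/-- The class of a point. -/
def Pi0.mk (a : X) : 𝒳.Pi0 := Quot.mk _ a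

/-- A system of a based loop: a path system that starts and ends at the base-point structure. -/
structure LoopSys (p : 𝒳.BasePoint) (P : Subdivision) (c : Fin (P.n + 2) → 𝒳.ι)
    extends PathSys P c where
  start : (⟨c 0, f 0 0⟩ : 𝒳.BasePoint) = p
  finish : (⟨c (Fin.last _), f (Fin.last _) 1⟩ : 𝒳.BasePoint) = p

/-- Systems of based loops over arbitrary subdivisions and charts. -/
structure LoopSystem (p : 𝒳.BasePoint) where
  P : Subdivision
  c : Fin (P.n + 2) → 𝒳.ι
  sys : LoopSys p P c

/-- Refinement of systems of based loops: the transition maps at the two ends are the identity. -/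
def LoopSystem.Refines {p : 𝒳.BasePoint} (τ τ' : LoopSystem p) : Prop :=
  ∃ r : Refinement τ.sys.toPathSys τ'.sys.toPathSys,
    toAny (r.j 0) = toAny (𝒳.one p.1) ∧ toAny (r.j (Fin.last _)) = toAny (𝒳.one p.1)

/-- The based loop space: systems modulo the equivalence relation generated by refinement. -/
def Loop (p : 𝒳.BasePoint) : Type u := Quot (LoopSystem.Refines (p := p))

namespace Loop

variable {p : 𝒳.BasePoint}

/-- The based loop of a system. -/
def mk {P : Subdivision} {c : Fin (P.n + 2) → 𝒳.ι} (τ : LoopSys p P c) : Loop p :=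
  Quot.mk _ ⟨P, c, τ⟩

/-- The compact-open topology of the based loop space. -/
instance : TopologicalSpace (Loop p) :=
  TopologicalSpace.generateFrom {O | ∃ (P : Subdivision) (c : Fin (P.n + 2) → 𝒳.ι)
    (K : Fin (P.n + 2) → Set ℝ) (D : ∀ k, Set (𝒳.C (c k)))
    (A : ∀ l : Fin (P.n + 1), Set (𝒳.Tran (c l.castSucc) (c l.succ))),
    (∀ k, IsCompact (K k) ∧ K k ⊆ P.piece k) ∧ (∀ k, IsOpen (D k)) ∧ (∀ l, IsOpen (A l)) ∧
    O = {γ | ∃ τ : LoopSys p P c,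
      mk τ = γ ∧ (∀ k, MapsTo (τ.f k) (K k) (D k)) ∧ ∀ l, τ.ξ l ∈ A l}}

/-- The constant system at the base point. -/
noncomputable def constSys (p : 𝒳.BasePoint) : LoopSys p Subdivision.half (fun _ => p.1) where
  f _ _ := p.2
  continuousOn _ := continuousOn_const
  ξ _ := 𝒳.one p.1
  mem_source _ := by rw [(𝒳.map_one p.1).1]; trivial
  glue _ := (𝒳.map_one p.1).2 (by rw [(𝒳.map_one p.1).1]; trivial)
  start := rfl
  finish := rfl

/-- The constant based loop. -/
noncomputable def const (p : 𝒳.BasePoint) : Loop p := mk (constSys p)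

end Loop

/-- The system `τ''` is the concatenation of `τ` (run through on `[0, 1/2]`) and `τ'` (run through
on `[1/2, 1]`), with the identity as the transition map at `1/2`. -/
structure IsConcat {p : 𝒳.BasePoint} (τ τ' τ'' : LoopSystem p) : Prop where
  n_eq : τ''.P.n = τ.P.n + τ'.P.n + 2
  left : ∀ (k : Fin (τ.P.n + 2)) (k'' : Fin (τ''.P.n + 2)), (k'' : ℕ) = k →
    τ''.P.t k''.castSucc = τ.P.t k.castSucc / 2 ∧
    ∀ s ∈ τ.P.piece k,
      (⟨τ''.c k'', τ''.sys.f k'' (s / 2)⟩ : 𝒳.BasePoint) = ⟨τ.c k, τ.sys.f k s⟩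
  right : ∀ (k : Fin (τ'.P.n + 2)) (k'' : Fin (τ''.P.n + 2)), (k'' : ℕ) = τ.P.n + 2 + k →
    τ''.P.t k''.castSucc = (1 + τ'.P.t k.castSucc) / 2 ∧
    ∀ s ∈ τ'.P.piece k,
      (⟨τ''.c k'', τ''.sys.f k'' ((1 + s) / 2)⟩ : 𝒳.BasePoint) = ⟨τ'.c k, τ'.sys.f k s⟩
  left_tran : ∀ (l : Fin (τ.P.n + 1)) (l'' : Fin (τ''.P.n + 1)), (l'' : ℕ) = l →
    toAny (τ''.sys.ξ l'') = toAny (τ.sys.ξ l)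
  middle_tran : ∀ l'' : Fin (τ''.P.n + 1), (l'' : ℕ) = τ.P.n + 1 →
    toAny (τ''.sys.ξ l'') = toAny (𝒳.one p.1)
  right_tran : ∀ (l : Fin (τ'.P.n + 1)) (l'' : Fin (τ''.P.n + 1)), (l'' : ℕ) = τ.P.n + 2 + l →
    toAny (τ''.sys.ξ l'') = toAny (τ'.sys.ξ l)

end Orbispace

namespace BasedSystem

open Orbispace

variable {Y : Type u} {X : Type v} [TopologicalSpace Y] [TopologicalSpace X]
  {𝒴 : Orbispace Y} {𝒳 : Orbispace X} {q : 𝒴.BasePoint} {p : 𝒳.BasePoint}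
  (σ : BasedSystem.{u, v, w} 𝒴 𝒳 q p)

/-- A system of a based relative loop: a path system that starts at the base-point structure and
ends, in the chart `W α`, at the point `f α v` of the image of `f α`. -/
structure RelSys (P : Subdivision) (c : Fin (P.n + 2) → 𝒳.ι) (α : σ.Λ)
    extends PathSys P c where
  start : (⟨c 0, f 0 0⟩ : 𝒳.BasePoint) = p
  v : 𝒴.C (σ.V α)
  finish : (⟨c (Fin.last _), f (Fin.last _) 1⟩ : 𝒳.BasePoint) = ⟨σ.W α, σ.f α v⟩

/-- Systems of based relative loops over arbitrary subdivisions and charts. -/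
structure RelSystem where
  P : Subdivision
  c : Fin (P.n + 2) → 𝒳.ι
  α : σ.Λ
  sys : σ.RelSys P c α

/-- Refinement of systems of based relative loops: the first transition map is the identity and
the last one is the image of a transition map of `Y` that matches the end points in `Y`. -/
def RelSystem.Refines (τ τ' : σ.RelSystem) : Prop :=
  ∃ r : Refinement τ.sys.toPathSys τ'.sys.toPathSys,
    toAny (r.j 0) = toAny (𝒳.one p.1) ∧
    ∃ ζ : 𝒴.Tran (σ.V τ.α) (σ.V τ'.α), τ.sys.v ∈ (𝒴.map ζ).source ∧
      𝒴.map ζ τ.sys.v = τ'.sys.v ∧ toAny (r.j (Fin.last _)) = toAny (σ.ρ τ.α τ'.α ζ)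

/-- The based relative loop space: systems modulo the equivalence relation generated by
refinement. -/
def RelLoop : Type (max u v w) := Quot (RelSystem.Refines σ)

namespace RelLoop

variable {σ}

/-- The based relative loop of a system. -/
def mk {P : Subdivision} {c : Fin (P.n + 2) → 𝒳.ι} {α : σ.Λ} (τ : σ.RelSys P c α) : σ.RelLoop :=
  Quot.mk _ ⟨P, c, α, τ⟩

/-- The compact-open topology of the based relative loop space. -/
instance : TopologicalSpace σ.RelLoop :=
  TopologicalSpace.generateFrom {O | ∃ (P : Subdivision) (c : Fin (P.n + 2) → 𝒳.ι) (α : σ.Λ)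
    (K : Fin (P.n + 2) → Set ℝ) (D : ∀ k, Set (𝒳.C (c k)))
    (A : ∀ l : Fin (P.n + 1), Set (𝒳.Tran (c l.castSucc) (c l.succ))),
    (∀ k, IsCompact (K k) ∧ K k ⊆ P.piece k) ∧ (∀ k, IsOpen (D k)) ∧ (∀ l, IsOpen (A l)) ∧
    O = {γ | ∃ τ : σ.RelSys P c α,
      mk τ = γ ∧ (∀ k, MapsTo (τ.f k) (K k) (D k)) ∧ ∀ l, τ.ξ l ∈ A l}}

/-- The point of `Y` at which a based relative loop ends. -/
def endpoint : σ.RelLoop → Y :=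
  Quot.lift (fun τ => (𝒴.proj _ τ.sys.v : Y)) (by
    rintro τ τ' ⟨r, -, ζ, hζ, h, -⟩
    rw [← h, 𝒴.map_proj ζ _ hζ])

end RelLoop

/-- A system of a based loop as a system of a based relative loop. -/
def toRelSys {P : Subdivision} {c : Fin (P.n + 2) → 𝒳.ι} (τ : LoopSys p P c) :
    σ.RelSys P c σ.o where
  toPathSys := τ.toPathSys
  start := τ.start
  v := σ.pt
  finish := τ.finish.trans σ.base_target.symm

/-- The natural map from the based loop space to the based relative loop space. -/
def toRelLoop : Loop p → σ.RelLoop :=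
  Quot.map (fun τ => ⟨τ.P, τ.c, σ.o, σ.toRelSys τ.sys⟩) (by
    rintro τ τ' ⟨r, h0, h1⟩
    have hm : σ.pt ∈ (𝒴.map (𝒴.one (σ.V σ.o))).source := by
      rw [𝒴.source_eq_univ]; trivial
    refine ⟨r, h0, 𝒴.one _, hm, (𝒴.map_one _).2 hm, h1.trans ?_⟩
    rw [σ.ρ_one]
    exact congrArg (fun b : 𝒳.BasePoint => toAny (𝒳.one b.1)) σ.base_target.symm)

/-- The constant based relative loop. -/
noncomputable def constRel : σ.RelLoop := σ.toRelLoop (Loop.const p)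

/-- The image of a path system of `Y`, all of whose charts belong to the system `σ`. -/
def pushPath {P : Subdivision} {a : Fin (P.n + 2) → σ.Λ} (τ : PathSys P (fun k => σ.V (a k))) :
    PathSys P (fun k => σ.W (a k)) where
  f k s := σ.f (a k) (τ.f k s)
  continuousOn k := (σ.f (a k)).continuous.comp_continuousOn (τ.continuousOn k)
  ξ l := σ.ρ _ _ (τ.ξ l)
  mem_source l := σ.mem_source _ _ (τ.mem_source l)
  glue l := by rw [← σ.f_map _ _ (τ.mem_source l), τ.glue]

lemma push_base {β : σ.Λ} (hβ : β = σ.o) {x : 𝒴.C (σ.V β)}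
    (hx : (⟨σ.V β, x⟩ : 𝒴.BasePoint) = q) : (⟨σ.W β, σ.f β x⟩ : 𝒳.BasePoint) = p := by
  subst hβ
  have := hx.trans σ.base_source.symm
  obtain rfl : x = σ.pt := eq_of_heq (Sigma.mk.inj this).2
  exact σ.base_target

/-- The image of a system of a based loop of `Y`, all of whose charts belong to `σ`. -/
def pushLoop {P : Subdivision} {a : Fin (P.n + 2) → σ.Λ}
    (τ : LoopSys q P (fun k => σ.V (a k))) (h0 : a 0 = σ.o) (h1 : a (Fin.last _) = σ.o) :
    LoopSys p P (fun k => σ.W (a k)) where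
  toPathSys := σ.pushPath τ.toPathSys
  start := σ.push_base h0 τ.start
  finish := σ.push_base h1 τ.finish

/-- The image of a system of a based relative loop of `(Y, Y, id)`, all of whose charts belong to
`σ`. -/
def pushRel {P : Subdivision} {a : Fin (P.n + 2) → σ.Λ}
    (τ : (identity q).RelSys P (fun k => σ.V (a k)) (σ.V (a (Fin.last _)))) (h0 : a 0 = σ.o) :
    σ.RelSys P (fun k => σ.W (a k)) (a (Fin.last _)) where
  toPathSys := σ.pushPath τ.toPathSys
  start := σ.push_base h0 τ.start
  v := τ.v
  finish := by
    have h : τ.f (Fin.last _) 1 = τ.v := eq_of_heq (Sigma.mk.inj τ.finish).2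
    change (⟨_, σ.f _ (τ.f (Fin.last _) 1)⟩ : 𝒳.BasePoint) = _
    rw [h]

/-- `i` is the map of based loop spaces `γ ↦ ĩ ∘ γ` induced by the morphism. -/
def IsLoopMap (i : Loop q → Loop p) : Prop :=
  ∀ (P : Subdivision) (a : Fin (P.n + 2) → σ.Λ) (τ : LoopSys q P (fun k => σ.V (a k)))
    (h0 : a 0 = σ.o) (h1 : a (Fin.last _) = σ.o),
    i (Loop.mk τ) = Loop.mk (σ.pushLoop τ h0 h1)

/-- `e` is the map `γ ↦ ĩ ∘ γ` from the based relative loop space of `(Y, Y, id)` to that of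
`(X, Y, ĩ)`. -/
def IsRelMap (e : (identity q).RelLoop → σ.RelLoop) : Prop :=
  ∀ (P : Subdivision) (a : Fin (P.n + 2) → σ.Λ)
    (τ : (identity q).RelSys P (fun k => σ.V (a k)) (σ.V (a (Fin.last _)))) (h0 : a 0 = σ.o),
    e (RelLoop.mk τ) = RelLoop.mk (σ.pushRel τ h0)

/-- `i₀` is the map of sets of path components induced by the morphism. -/
def IsPi0Map (i₀ : 𝒴.Pi0 → 𝒳.Pi0) : Prop :=
  ∀ (α : σ.Λ) (y : 𝒴.C (σ.V α)),
    i₀ (Pi0.mk 𝒴 (𝒴.proj _ y)) = Pi0.mk 𝒳 (𝒳.proj _ (σ.f α y))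

/-- `d` is the connecting map. Let `γ` be an `m`-cube of based loops of `Y`, let `H'` contract `γ`,
seen as a family of based relative loops of `(Y, Y, id)`, to the constant one, and let `H` contract
`i ∘ γ` to the constant loop. Gluing the image of `H'` to the reverse of `H` gives an
`(m + 1)`-cube `F` of based relative loops of `(X, Y, ĩ)`, whose end points in `Y` run through the
loops `γ`; the connecting map sends the class of `F` to the class of `γ`. -/
def IsConnecting (i : Loop q → Loop p) (e : (identity q).RelLoop → σ.RelLoop) (m : ℕ)
    (d : HomotopyGroup.Pi (m + 1) σ.RelLoop σ.constRel →
      HomotopyGroup.Pi m (Loop q) (Loop.const q)) : Prop :=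
  ∀ (γ : GenLoop (Fin m) (Loop q) (Loop.const q))
    (H' : C(unitInterval × (Fin m → unitInterval), (identity q).RelLoop))
    (H : C(unitInterval × (Fin m → unitInterval), Loop p))
    (F : GenLoop (Fin (m + 1)) σ.RelLoop σ.constRel),
    (∀ x, H' (0, x) = (identity q).constRel) →
    (∀ x, H' (1, x) = (identity q).toRelLoop (γ x)) →
    (∀ s, ∀ x ∈ Cube.boundary (Fin m), H' (s, x) = (identity q).constRel) →
    (∀ x, H (0, x) = Loop.const p) →
    (∀ x, H (1, x) = i (γ x)) →
    (∀ s, ∀ x ∈ Cube.boundary (Fin m), H (s, x) = Loop.const p) →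
    (∀ (y : Fin (m + 1) → unitInterval) (s : unitInterval), (y 0 : ℝ) = s / 2 →
      F y = e (H' (s, fun k => y k.succ))) →
    (∀ (y : Fin (m + 1) → unitInterval) (s : unitInterval), (y 0 : ℝ) = 1 - s / 2 →
      F y = σ.toRelLoop (H (s, fun k => y k.succ))) →
    d (Quotient.mk _ F) = Quotient.mk _ γ

end BasedSystem

/-- The map induced on homotopy groups (sets for `n = 0`) by a based continuous map. -/
def piMap {A : Type u} {B : Type v} [TopologicalSpace A] [TopologicalSpace B] {a : A} {b : B}
    (f : C(A, B)) (hf : f a = b) (n : ℕ) : HomotopyGroup.Pi n A a → HomotopyGroup.Pi n B b :=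
  Quotient.map (fun g => ⟨f.comp g.1, fun y hy => by
    rw [ContinuousMap.comp_apply, g.2 y hy, hf]⟩) (by
    rintro g g' ⟨H⟩
    exact ⟨H.compContinuousMap f⟩)

/-- The class in the `n`-th homotopy group of a cube that sends the boundary to the base point. -/
def piMk {A : Type u} [TopologicalSpace A] {a : A} {n : ℕ} (f : GenLoop (Fin n) A a) :
    HomotopyGroup.Pi n A a := Quotient.mk _ f

/-- The path component of a point as an element of the `0`-th homotopy set. -/
def piZeroMk {A : Type u} [TopologicalSpace A] (a x : A) : HomotopyGroup.Pi 0 A a :=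
  piMk ((genLoopHomeoOfIsEmpty (Fin 0) a).symm x)

/-- The base point of the `n`-th homotopy group. -/
def piBase {A : Type u} [TopologicalSpace A] (a : A) (n : ℕ) : HomotopyGroup.Pi n A a :=
  piMk GenLoop.const

/-- The group law on the first homotopy group of an orbispace, which is the set of path components
of the based loop space, is induced by concatenation. -/
def Orbispace.IsPi1Group {X : Type u} [TopologicalSpace X] {𝒳 : Orbispace X} (p : 𝒳.BasePoint)
    (g : Group (HomotopyGroup.Pi 0 (Orbispace.Loop p) (Orbispace.Loop.const p))) : Prop :=
  ∀ τ τ' τ'' : Orbispace.LoopSystem p, Orbispace.IsConcat τ τ' τ'' →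
    g.mul (piZeroMk _ (Orbispace.Loop.mk τ.sys)) (piZeroMk _ (Orbispace.Loop.mk τ'.sys)) =
      piZeroMk _ (Orbispace.Loop.mk τ''.sys)

noncomputable section

open Orbispace BasedSystem CategoryTheory Filter

variable {TY : Type u} {TX : Type v} [TopologicalSpace TY] [TopologicalSpace TX]
  {Y : Orbispace TY} {X : Orbispace TX} {q : Y.BasePoint} {p : X.BasePoint}
  {σ : BasedSystem.{u, v, w} Y X q p} {T T' T'' : Type*} [TopologicalSpace T] [TopologicalSpace T']
  [TopologicalSpace T''] {c c' c'' : X.ι} {a : C(T, X.C c)} {b : C(T, X.C c')} {d : C(T, X.C c'')}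
  {α α' : σ.Λ} {v : C(T, Y.C (σ.V α))} {v' : C(T, Y.C (σ.V α'))}

namespace Orbispace

section Groupoid

variable (X) in
/-- The objects of the germ groupoid: the points of the charts. -/
@[ext]
structure Obj where
  ch : X.ι
  pt : X.C ch

/-- A morphism of the germ groupoid: a transition map, taken at a point of its domain. -/
@[ext]
structure Mor (x y : X.Obj) where
  tr : X.Tran x.ch y.ch
  mem : x.pt ∈ (X.map tr).source
  eq : X.map tr x.pt = y.pt

lemma mem_trans_source {i j k : X.ι} {ξ : X.Tran i j} {η : X.Tran j k} {x : X.C i}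
    (h : x ∈ (X.map ξ).source) (h' : X.map ξ x ∈ (X.map η).source) :
    x ∈ ((X.map ξ).trans (X.map η)).source := by
  rw [OpenPartialHomeomorph.trans_source]
  exact ⟨h, h'⟩

lemma mem_source_one (i : X.ι) (x : X.C i) : x ∈ (X.map (X.one i)).source := by rw [X.source_eq_univ]; trivial

lemma map_one_apply (i : X.ι) (x : X.C i) : X.map (X.one i) x = x := (X.map_one i).2 (mem_source_one i x)

lemma comp_congr {i j k : X.ι} {ξ ξ' : X.Tran i j} {η η' : X.Tran j k} {x x' : X.C i}
    (e1 : ξ = ξ') (e2 : η = η') (e3 : x = x') (h : x ∈ ((X.map ξ).trans (X.map η)).source)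
    (h' : x' ∈ ((X.map ξ').trans (X.map η')).source) :
    X.comp ξ η x h = X.comp ξ' η' x' h' := by
  subst e1 e2 e3; rfl

lemma comp_map_eq {i j k : X.ι} (ξ : X.Tran i j) (η : X.Tran j k) (x : X.C i)
    (hx : x ∈ ((X.map ξ).trans (X.map η)).source) :
    X.map (X.comp ξ η x hx) x = X.map η (X.map ξ x) :=
  X.map_comp ξ η x hx x (mem_connectedComponentIn hx)

lemma act_one_left (i : X.ι) (h : X.G i) : X.act 1 (X.one i) h = X.act h (X.one i) 1 := by
  simpa [X.act_act] using (congrArg (fun η => X.act h η 1) (X.act_one_mul i h))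

instance : Category X.Obj where
  Hom x y := Mor x y
  id x := ⟨X.one x.ch, mem_source_one _ _, map_one_apply _ _⟩
  comp {x y z} m n :=
    ⟨X.comp m.tr n.tr x.pt (mem_trans_source m.mem (by rw [m.eq]; exact n.mem)),
      X.mem_source_comp _ _ _ _, by rw [comp_map_eq, m.eq, n.eq]⟩
  id_comp {x y} m := by
    refine Mor.ext ?_
    have key := X.aut_comp 1 m.tr x.pt (mem_trans_source (by rw [X.one_act_one]; exact mem_source_one _ _)
      (by rw [X.one_act_one, map_one_apply]; exact m.mem))
    exact (comp_congr (X.one_act_one _).symm rfl rfl _ _).trans (key.trans (X.one_act_one _))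
  comp_id {x y} m := by
    refine Mor.ext ?_
    have key := X.comp_aut m.tr 1 x.pt (mem_trans_source m.mem (by rw [X.one_act_one]; exact mem_source_one _ _))
    exact (comp_congr rfl (X.one_act_one _).symm rfl _ _).trans (key.trans (X.one_act_one _))
  assoc {a b c d} m n l := by
    refine Mor.ext ?_
    have h3 : X.map m.tr a.pt ∈ ((X.map n.tr).trans (X.map l.tr)).source :=
      mem_trans_source (by rw [m.eq]; exact n.mem) (by rw [m.eq, n.eq]; exact l.mem)
    have e : X.comp n.tr l.tr (X.map m.tr a.pt) h3 =
        X.comp n.tr l.tr b.pt (mem_trans_source n.mem (by rw [n.eq]; exact l.mem)) :=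
      comp_congr rfl rfl m.eq _ _
    have key := X.comp_assoc m.tr n.tr l.tr a.pt (mem_trans_source m.mem (by rw [m.eq]; exact n.mem))
      (mem_trans_source (X.mem_source_comp _ _ _ _) (by rw [comp_map_eq, m.eq, n.eq]; exact l.mem))
      h3 (mem_trans_source m.mem (X.mem_source_comp _ _ _ _))
    refine key.trans ?_
    exact comp_congr rfl e rfl _ _

@[ext]
lemma hom_ext {x y : X.Obj} {m n : x ⟶ y} (h : m.tr = n.tr) : m = n := Mor.ext h

@[simp] lemma id_tr (x : X.Obj) : Mor.tr (𝟙 x) = X.one x.ch := rfl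

lemma comp_tr {x y z : X.Obj} (m : x ⟶ y) (n : y ⟶ z) :
    (m ≫ n).tr = X.comp m.tr n.tr x.pt (mem_trans_source m.mem (by rw [m.eq]; exact n.mem)) := rfl

/-- The morphism that a transition map gives at a point. -/
def germ {i j : X.ι} (ξ : X.Tran i j) (x : X.C i) (hx : x ∈ (X.map ξ).source) :
    (⟨i, x⟩ : X.Obj) ⟶ ⟨j, X.map ξ x⟩ := ⟨ξ, hx, rfl⟩

lemma source_act_left {i j : X.ι} (g : X.G j) (ξ : X.Tran i j) : (X.map (X.act g ξ 1)).source = (X.map ξ).source := by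
  rw [(X.map_act g ξ 1).1]
  ext x
  simp

lemma map_act_left {i j : X.ι} (g : X.G j) (ξ : X.Tran i j) {x : X.C i}
    (hx : x ∈ (X.map ξ).source) : X.map (X.act g ξ 1) x = g • X.map ξ x := by
  rw [((X.map_act g ξ 1).2 (by rw [source_act_left]; exact hx))]
  simp

/-- The morphism given by an element of the group of a chart. -/
def smulMor {i : X.ι} (g : X.G i) (x : X.C i) : (⟨i, x⟩ : X.Obj) ⟶ ⟨i, g • x⟩ :=
  ⟨X.act g (X.one i) 1, by rw [source_act_left]; exact mem_source_one _ _, by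
    change X.map _ x = g • x
    rw [map_act_left _ _ (mem_source_one _ _), map_one_apply]⟩

@[simp] lemma smulMor_tr {i : X.ι} (g : X.G i) (x : X.C i) : (smulMor g x).tr = X.act g (X.one i) 1 := rfl

lemma comp_smulMor_tr {i j : X.ι} {x : X.C i} {y : X.C j} (m : (⟨i, x⟩ : X.Obj) ⟶ ⟨j, y⟩) (g : X.G j) :
    (m ≫ smulMor g y).tr = X.act g m.tr 1 := X.comp_aut m.tr g x _

lemma smulMor_comp_tr {i j : X.ι} {x : X.C i} {y : X.C j} (g : X.G i) (m : (⟨i, g • x⟩ : X.Obj) ⟶ ⟨j, y⟩) :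
    (smulMor g x ≫ m).tr = X.act 1 m.tr g := by
  have h := X.aut_comp g m.tr x (by
    rw [act_one_left]
    exact mem_trans_source (smulMor g x).mem (by
      have e : X.map (X.act g (X.one i) 1) x = g • x := (smulMor g x).eq
      rw [e]; exact m.mem))
  rw [← h]
  exact comp_congr (act_one_left i g).symm rfl rfl _ _

lemma exists_left_inv {x y : X.Obj} (m : x ⟶ y) : ∃ n : y ⟶ x, m ≫ n = 𝟙 x := by
  obtain ⟨i, x⟩ := x
  obtain ⟨j, y⟩ := y
  have hy : (X.proj j y : TX) ∈ X.U i := by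
    have h1 := X.map_proj m.tr x m.mem
    rw [m.eq] at h1
    rw [h1]; exact (X.proj i x).2
  obtain ⟨η, hη⟩ := X.exists_tran j i y hy
  obtain ⟨g, hg⟩ := (X.aut i).surjective (m ≫ germ η y hη : (⟨i, x⟩ : X.Obj) ⟶ ⟨i, _⟩).tr
  have hgx : X.map η y = g • x := by
    have := (m ≫ germ η y hη : (⟨i, x⟩ : X.Obj) ⟶ ⟨i, _⟩).eq
    rw [← hg, aut_apply] at this
    exact this.symm.trans ((smulMor g x).eq)
  refine ⟨⟨X.act g⁻¹ η 1, by rwa [source_act_left], ?_⟩, ?_⟩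
  · change X.map _ y = x
    rw [map_act_left _ _ hη, hgx, inv_smul_smul]
  · apply hom_ext
    have h1 : (m ≫ (germ η y hη ≫ smulMor g⁻¹ _)).tr = X.one i := by
      rw [← Category.assoc, comp_smulMor_tr, ← hg, aut_apply, X.act_act]
      simp [X.one_act_one]
    rw [comp_tr] at h1
    rw [comp_tr, id_tr, ← h1]
    exact comp_congr rfl (comp_smulMor_tr (germ η y hη) g⁻¹).symm rfl _ _

instance : Groupoid X.Obj where
  inv m := (exists_left_inv m).choose
  inv_comp m := by
    set n := (exists_left_inv m).choose
    have h1 : m ≫ n = 𝟙 _ := (exists_left_inv m).choose_spec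
    obtain ⟨l, h2⟩ := exists_left_inv n
    have h3 : m = l := by
      calc m = m ≫ (n ≫ l) := by rw [h2, Category.comp_id]
        _ = l := by rw [← Category.assoc, h1, Category.id_comp]
    rw [h3]; exact h2
  comp_inv m := (exists_left_inv m).choose_spec

lemma toAny_eqToHom {x y : X.Obj} (e : x = y) : toAny (Mor.tr (eqToHom e)) = toAny (X.one y.ch) := by subst e; rfl

lemma toAny_eqToHom' {x y : X.Obj} (e : x = y) : toAny (Mor.tr (eqToHom e)) = toAny (X.one x.ch) := by subst e; rfl

lemma toAny_comp_eqToHom {x y z : X.Obj} (m : x ⟶ y) (e : y = z) :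
    toAny (m ≫ eqToHom e).tr = toAny m.tr := by subst e; simp

lemma toAny_eqToHom_comp {x y z : X.Obj} (e : x = y) (m : y ⟶ z) :
    toAny (eqToHom e ≫ m).tr = toAny m.tr := by subst e; simp

lemma toAny_injective {i j : X.ι} {ξ η : X.Tran i j} (h : toAny ξ = toAny η) : ξ = η := by
  exact eq_of_heq (Sigma.mk.inj (eq_of_heq (Sigma.mk.inj h).2)).2

/-- Two objects over the same point are isomorphic. -/
lemma nonempty_hom {x y : X.Obj} (h : (X.proj x.ch x.pt : TX) = X.proj y.ch y.pt) : Nonempty (x ⟶ y) := by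
  obtain ⟨i, x⟩ := x
  obtain ⟨j, y⟩ := y
  obtain ⟨ξ, hξ⟩ := X.exists_tran i j x (by
    rw [h]; exact (X.proj j y).2)
  obtain ⟨g, hg⟩ := (X.proj_eq_iff j (X.map ξ x) y).1 (Subtype.ext ((X.map_proj ξ x hξ).trans h))
  exact ⟨germ ξ x hξ ≫ smulMor g _ ≫ eqToHom (by rw [hg])⟩

lemma proj_eq_of_hom {x y : X.Obj} (m : x ⟶ y) : (X.proj x.ch x.pt : TX) = X.proj y.ch y.pt := by
  rw [← m.eq, X.map_proj _ _ m.mem]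

end Groupoid

section TranTopology

variable {i j k : X.ι}

lemma isOpen_tran_iff {A : Set (X.Tran i j)} : IsOpen A ↔ ∀ ξ : X.Tran i j, IsOpen {g : X.G j | X.act g ξ 1 ∈ A} := by
  simp only [isOpen_iSup_iff, isOpen_coinduced]
  rfl

open scoped Pointwise in
lemma act_left_injective (ξ : X.Tran i j) : Function.Injective fun g : X.G j => X.act g ξ 1 := by
  intro g g' h
  have h1 : X.act (g'⁻¹ * g) ξ 1 = ξ := by
    simpa [X.act_act, X.one_act_one] using (congrArg (fun ξ => X.act g'⁻¹ ξ 1) h)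
  obtain ⟨hh, h3⟩ := (X.act_eq_iff ξ (g'⁻¹ * g)⁻¹ 1).1 (by simpa using h1)
  have h4 : (⟨1, hh⟩ : MulAction.stabilizer (X.G i) (X.map ξ).source) = 1 := rfl
  rw [h4, _root_.map_one] at h3
  exact (inv_mul_eq_one.1 (by rw [← inv_inv (g'⁻¹ * g), ← h3]; simp)).symm

lemma continuous_act_left (ξ : X.Tran i j) : Continuous fun g : X.G j => X.act g ξ 1 :=
  ⟨fun _ hA => isOpen_tran_iff.1 hA ξ⟩

lemma isOpenMap_act_left (ξ : X.Tran i j) : IsOpenMap fun g : X.G j => X.act g ξ 1 := by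
  intro U hU
  rw [isOpen_tran_iff]
  intro η
  by_cases h : ∃ a : X.G j, η = X.act a ξ 1
  · obtain ⟨a, rfl⟩ := h
    have : {g : X.G j | X.act g (X.act a ξ 1) 1 ∈ (fun g => X.act g ξ 1) '' U} = (fun g => g * a) ⁻¹' U := by
      ext g
      simp only [X.act_act, mul_one, mem_ofPred_eq, mem_preimage]
      exact (act_left_injective ξ).mem_set_image
    rw [this]
    exact hU.preimage (continuous_mul_const a)
  · have : {g : X.G j | X.act g η 1 ∈ (fun g => X.act g ξ 1) '' U} = ∅ := by
      ext g
      simp only [mem_ofPred_eq, mem_image, mem_empty_iff_false, iff_false]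
      rintro ⟨a, -, ha⟩
      refine h ⟨g⁻¹ * a, ?_⟩
      have := congrArg (fun ξ => X.act g⁻¹ ξ 1) ha
      simp only [X.act_act, mul_one, inv_mul_cancel, X.one_act_one] at this
      exact this.symm
    rw [this]; exact isOpen_empty

lemma isOpenEmbedding_act_left (ξ : X.Tran i j) : IsOpenEmbedding fun g : X.G j => X.act g ξ 1 :=
  .of_continuous_injective_isOpenMap (continuous_act_left ξ) (act_left_injective ξ) (isOpenMap_act_left ξ)

lemma nhds_tran (ξ : X.Tran i j) : 𝓝 ξ = Filter.map (fun g : X.G j => X.act g ξ 1) (𝓝 1) := by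
  rw [((isOpenEmbedding_act_left ξ).map_nhds_eq 1), X.one_act_one]

/-- The element of the group that carries one transition map to another one (`1` if there is none). -/
def div (ξ η : X.Tran i j) : X.G j := by classical exact if h : ∃ g : X.G j, X.act g ξ 1 = η then h.choose else 1

lemma div_act (ξ : X.Tran i j) (g : X.G j) : div ξ (X.act g ξ 1) = g := by
  have h : ∃ g' : X.G j, X.act g' ξ 1 = X.act g ξ 1 := ⟨g, rfl⟩
  rw [div, dif_pos h]
  exact act_left_injective ξ h.choose_spec

lemma div_self (ξ : X.Tran i j) : div ξ ξ = 1 := by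
  conv_lhs => rw [← X.one_act_one ξ]
  rw [X.one_act_one, ← X.one_act_one ξ, X.one_act_one]
  simpa [X.one_act_one] using div_act ξ (1 : X.G j)

lemma continuousAt_div (ξ : X.Tran i j) : ContinuousAt (div ξ) ξ := by
  rw [ContinuousAt, div_self, nhds_tran, tendsto_map'_iff]
  refine tendsto_id.congr fun g => ?_
  simp [div_act]

lemma eventually_act_div (ξ : X.Tran i j) : ∀ᶠ η in 𝓝 ξ, X.act (div ξ η) ξ 1 = η := by
  rw [nhds_tran, eventually_map]
  exact Eventually.of_forall fun g => by rw [div_act]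

open scoped Pointwise

lemma smul_mem_preimage_U {i j : X.ι} (g : X.G i) {z : X.C i} (hz : (X.proj i z : TX) ∈ X.U j) :
    (X.proj i (g • z) : TX) ∈ X.U j := by
  rwa [← (X.proj_eq_iff i z (g • z)).2 ⟨g, rfl⟩]

lemma source_subset_preimage_U (ξ : X.Tran i j) {x : X.C i} (hx : x ∈ (X.map ξ).source) :
    (X.proj i x : TX) ∈ X.U j := by
  rw [(X.source_eq ξ x hx)] at hx
  exact connectedComponentIn_subset {z : X.C i | (X.proj i z : TX) ∈ X.U j} _ hx

lemma mem_stabilizer_of_mem (ξ : X.Tran i j) {g : X.G i} {x : X.C i}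
    (hx : x ∈ (X.map ξ).source) (hg : g • x ∈ (X.map ξ).source) :
    g ∈ MulAction.stabilizer (X.G i) (X.map ξ).source := by
  rw [MulAction.mem_stabilizer_iff]
  have sub : ∀ (g : X.G i) (x : X.C i), x ∈ (X.map ξ).source → g • x ∈ (X.map ξ).source →
      g • (X.map ξ).source ⊆ (X.map ξ).source := by
    intro g x hx hg
    conv_rhs => rw [X.source_eq ξ _ hg]
    have hc : IsPreconnected (g • (X.map ξ).source) := by
      rw [X.source_eq ξ x hx]
      exact isPreconnected_connectedComponentIn.image _ (continuous_const_smul g).continuousOn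
    refine hc.subset_connectedComponentIn (smul_mem_smul_set hx) ?_
    rintro _ ⟨y, hy, rfl⟩
    exact smul_mem_preimage_U g (source_subset_preimage_U ξ hy)
  refine (sub g x hx hg).antisymm ?_
  rw [subset_smul_set_iff]
  exact sub g⁻¹ (g • x) hg (by rwa [inv_smul_smul])

lemma eventually_mem_stabilizer (ξ : X.Tran i j) :
    ∀ᶠ g : X.G i in 𝓝 1, g ∈ MulAction.stabilizer (X.G i) (X.map ξ).source := by
  obtain ⟨x, hx⟩ := X.source_nonempty ξ
  have h : Tendsto (fun g : X.G i => g • x) (𝓝 1) (𝓝 x) := by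
    have : Continuous fun g : X.G i => g • x := by fun_prop
    simpa using this.tendsto 1
  filter_upwards [h.eventually ((X.map ξ).open_source.mem_nhds hx)] with g hg
  exact mem_stabilizer_of_mem ξ hx hg

/-- The homomorphism of a transition map, extended by `1` outside its domain. -/
def lam (ξ : X.Tran i j) (g : X.G i) : X.G j := by
  classical exact if h : g ∈ MulAction.stabilizer (X.G i) (X.map ξ).source then X.hom ξ ⟨g, h⟩ else 1

lemma act_lam (ξ : X.Tran i j) {g : X.G i} (h : g ∈ MulAction.stabilizer (X.G i) (X.map ξ).source) :
    X.act (lam ξ g) ξ 1 = X.act 1 ξ g := by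
  have := congrArg (fun η => X.act (lam ξ g) η 1) ((X.act_eq_iff ξ (lam ξ g) g).2 ⟨h, by rw [lam, dif_pos h]⟩)
  simpa [X.act_act] using this.symm

lemma lam_one (ξ : X.Tran i j) : lam ξ (1 : X.G i) = 1 := by
  have h : (1 : X.G i) ∈ MulAction.stabilizer (X.G i) (X.map ξ).source := one_mem _
  rw [lam, dif_pos h]
  have h4 : (⟨1, h⟩ : MulAction.stabilizer (X.G i) (X.map ξ).source) = 1 := rfl
  rw [h4, _root_.map_one]; rfl

lemma continuousAt_lam (ξ : X.Tran i j) : ContinuousAt (lam ξ) (1 : X.G i) := by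
  set S := MulAction.stabilizer (X.G i) (X.map ξ).source
  have hc : Continuous fun g : S => lam ξ (g : X.G i) := by
    have : (fun g : S => lam ξ (g : X.G i)) = fun g => (X.hom ξ g : X.G j) := by
      funext g
      rw [lam, dif_pos g.2]
    rw [this]
    exact continuous_subtype_val.comp (X.hom ξ).continuous_toFun
  exact (continuousOn_iff_continuous_domRestrict.2 hc).continuousAt (eventually_mem_stabilizer ξ)

lemma eventually_comp_eq {ξ : X.Tran i j} {η : X.Tran j k} {x0 : X.C i}
    (h0 : x0 ∈ ((X.map ξ).trans (X.map η)).source) :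
    ∀ᶠ x in 𝓝 x0, ∀ hx, X.comp ξ η x hx = X.comp ξ η x0 h0 := by
  filter_upwards [(((X.map ξ).trans (X.map η)).open_source.connectedComponentIn).mem_nhds (mem_connectedComponentIn h0)] with x hx hx'
  exact X.comp_eq_comp ξ η x0 x h0 hx' hx

lemma comp_act {ξ : X.Tran i j} {η : X.Tran j k} {x : X.C i} (h : X.G k) (hx : x ∈ ((X.map ξ).trans (X.map η)).source)
    (hx' : x ∈ ((X.map ξ).trans (X.map (X.act h η 1))).source) :
    X.comp ξ (X.act h η 1) x hx' = X.act h (X.comp ξ η x hx) 1 := by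
  rw [OpenPartialHomeomorph.trans_source] at hx
  have e1 : (germ ξ x hx.1 ≫ (germ η _ hx.2 ≫ smulMor h _)).tr = X.act h (germ ξ x hx.1 ≫ germ η _ hx.2).tr 1 := by
    rw [← Category.assoc, comp_smulMor_tr]
  exact Eq.trans (comp_congr rfl (comp_smulMor_tr (germ η _ hx.2) h).symm rfl _ _) e1

lemma comp_act_left {ξ : X.Tran i j} {η : X.Tran j k} {x : X.C i} (g : X.G j) (h : X.G k)
    (hg : g ∈ MulAction.stabilizer (X.G j) (X.map η).source)
    (hx : x ∈ ((X.map ξ).trans (X.map η)).source)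
    (hx' : x ∈ ((X.map (X.act g ξ 1)).trans (X.map (X.act h η 1))).source) :
    X.comp (X.act g ξ 1) (X.act h η 1) x hx' = X.act (h * lam η g) (X.comp ξ η x hx) 1 := by
  have hx2 := hx
  rw [OpenPartialHomeomorph.trans_source] at hx2
  have hgs : g • X.map ξ x ∈ (X.map η).source := by
    have := smul_mem_smul_set (a := g) (show X.map ξ x ∈ (X.map η).source from hx2.2)
    rwa [MulAction.mem_stabilizer_iff.1 hg] at this
  have e1 : (smulMor g (X.map ξ x) ≫ germ η _ hgs).tr = X.act (lam η g) η 1 := by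
    rw [smulMor_comp_tr, act_lam η hg]; rfl
  have e2 : (germ ξ x hx2.1 ≫ (smulMor g (X.map ξ x) ≫ germ η _ hgs)).tr = X.act (lam η g) (X.comp ξ η x hx) 1 := by
    rw [← comp_act (lam η g) hx (mem_trans_source hx2.1 (by rw [source_act_left]; exact hx2.2))]
    exact comp_congr rfl e1 rfl _ _
  have e4 : ((germ ξ x hx2.1 ≫ smulMor g _) ≫ (germ η _ hgs ≫ smulMor h _)) =
      (germ ξ x hx2.1 ≫ (smulMor g (X.map ξ x) ≫ germ η _ hgs)) ≫ smulMor h _ := by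
    simp only [Category.assoc]
  have e5 : ((germ ξ x hx2.1 ≫ smulMor g _) ≫ (germ η _ hgs ≫ smulMor h _)).tr =
      X.act (h * lam η g) (X.comp ξ η x hx) 1 := by
    rw [e4, comp_smulMor_tr, e2, X.act_act, mul_one]
  exact Eq.trans (comp_congr (comp_smulMor_tr (germ ξ x hx2.1) g).symm (comp_smulMor_tr (germ η _ hgs) h).symm rfl _ _) e5

/-- Composition of transition maps is locally a continuous function of the transition maps. -/
lemma comp_local {ξ0 : X.Tran i j} {η0 : X.Tran j k} {x0 : X.C i} (h0 : x0 ∈ ((X.map ξ0).trans (X.map η0)).source) :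
    ∃ F : X.Tran i j × X.Tran j k → X.Tran i k, ContinuousAt F (ξ0, η0) ∧
      ∀ᶠ w in 𝓝 ((ξ0, η0), x0), ∀ hx, X.comp w.1.1 w.1.2 w.2 hx = F w.1 := by
  refine ⟨fun w => X.act (div η0 w.2 * lam η0 (div ξ0 w.1)) (X.comp ξ0 η0 x0 h0) 1, ?_, ?_⟩
  · refine (continuous_act_left _).continuousAt.comp (ContinuousAt.mul ?_ ?_)
    · exact ContinuousAt.comp (x := (ξ0, η0)) (continuousAt_div η0) continuousAt_snd
    · refine ContinuousAt.comp (g := lam η0) ?_ ?_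
      · simp only [div_self]; exact continuousAt_lam η0
      · exact ContinuousAt.comp (x := (ξ0, η0)) (continuousAt_div ξ0) continuousAt_fst
  · have c1 : Tendsto (fun w => w.1.1) (𝓝 ((ξ0, η0), x0)) (𝓝 ξ0) :=
      (continuous_fst.comp continuous_fst).tendsto _
    have c2 : Tendsto (fun w : (X.Tran i j × X.Tran j k) × X.C i => w.1.2) (𝓝 ((ξ0, η0), x0)) (𝓝 η0) :=
      (continuous_snd.comp continuous_fst).tendsto _
    have c3 : Tendsto (fun w => w.2) (𝓝 ((ξ0, η0), x0)) (𝓝 x0) :=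
      continuous_snd.tendsto _
    have c4 : Tendsto (div ξ0) (𝓝 ξ0) (𝓝 1) := by have := continuousAt_div ξ0; rwa [ContinuousAt, div_self] at this
    filter_upwards [c1.eventually (eventually_act_div ξ0), c2.eventually (eventually_act_div η0),
      c3.eventually (eventually_comp_eq h0),
      c3.eventually (((X.map ξ0).trans (X.map η0)).open_source.mem_nhds h0),
      (c4.comp c1).eventually (eventually_mem_stabilizer η0)] with w e1 e2 e3 e4 e5 hx
    simp only [Function.comp] at e5
    rw [comp_congr e1.symm e2.symm rfl hx (by rw [e1, e2]; exact hx), comp_act_left _ _ e5 e4, e3]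

lemma eventually_mem_source {ξ0 : X.Tran i j} {x0 : X.C i} (h0 : x0 ∈ (X.map ξ0).source) :
    ∀ᶠ w in 𝓝 (ξ0, x0), w.2 ∈ (X.map w.1).source := by
  filter_upwards [(continuous_fst.tendsto (ξ0, x0)).eventually (eventually_act_div ξ0),
    (continuous_snd.tendsto (ξ0, x0)).eventually ((X.map ξ0).open_source.mem_nhds h0)] with w e1 e2
  rwa [← e1, source_act_left]

lemma continuousAt_map {ξ0 : X.Tran i j} {x0 : X.C i} (h0 : x0 ∈ (X.map ξ0).source) :
    ContinuousAt (fun w : X.Tran i j × X.C i => X.map w.1 w.2) (ξ0, x0) := by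
  have e : (fun w => X.map w.1 w.2) =ᶠ[𝓝 (ξ0, x0)] fun w => div ξ0 w.1 • X.map ξ0 w.2 := by
    filter_upwards [(continuous_fst.tendsto (ξ0, x0)).eventually (eventually_act_div ξ0),
      (continuous_snd.tendsto (ξ0, x0)).eventually ((X.map ξ0).open_source.mem_nhds h0)] with w e1 e2
    conv_lhs => rw [← e1]
    rw [map_act_left _ _ e2]
  refine ContinuousAt.congr ?_ e.symm
  refine ContinuousAt.smul ?_ ?_
  · exact ContinuousAt.comp (x := (ξ0, x0)) (continuousAt_div ξ0) continuousAt_fst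
  · exact ContinuousAt.comp ((X.map ξ0).continuousAt h0) continuousAt_snd

/-- Inversion of transition maps is locally a continuous function of the transition map. -/
lemma inv_local {ξ0 : X.Tran i j} {x0 : X.C i} (h0 : x0 ∈ (X.map ξ0).source) :
    ∃ F : X.Tran i j → X.Tran j i, ContinuousAt F ξ0 ∧
      ∀ᶠ w in 𝓝 (ξ0, x0), ∀ (y : X.C j) (m : (⟨i, w.2⟩ : X.Obj) ⟶ ⟨j, y⟩), m.tr = w.1 → (inv m).tr = F w.1 := by
  set n := inv (germ ξ0 x0 h0) with hn
  set η0 := n.tr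
  have h1 : x0 ∈ ((X.map ξ0).trans (X.map η0)).source := mem_trans_source h0 n.mem
  have h2 : X.comp ξ0 η0 x0 h1 = X.one i := by
    have : (germ ξ0 x0 h0 ≫ n).tr = X.one i := by rw [hn, IsIso.hom_inv_id]; rfl
    rw [← this]; rfl
  refine ⟨fun ξ => X.act (lam η0 (div ξ0 ξ)⁻¹) η0 1, ?_, ?_⟩
  · refine (continuous_act_left _).continuousAt.comp ?_
    refine ContinuousAt.comp (g := lam η0) ?_ (continuousAt_div ξ0).inv
    simp only [div_self, inv_one]; exact continuousAt_lam η0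
  · have c1 : Tendsto (fun w => w.1) (𝓝 (ξ0, x0)) (𝓝 ξ0) := continuous_fst.tendsto _
    have c3 : Tendsto (fun w => w.2) (𝓝 (ξ0, x0)) (𝓝 x0) := continuous_snd.tendsto _
    have c4 : Tendsto (fun ξ => (div ξ0 ξ)⁻¹) (𝓝 ξ0) (𝓝 1) := by
      have : Tendsto (fun ξ => (div ξ0 ξ)⁻¹) (𝓝 ξ0) (𝓝 (div ξ0 ξ0)⁻¹) := (continuousAt_div ξ0).inv
      rwa [div_self, inv_one] at this
    filter_upwards [c1.eventually (eventually_act_div ξ0), c3.eventually (eventually_comp_eq h1),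
      c3.eventually (((X.map ξ0).trans (X.map η0)).open_source.mem_nhds h1),
      (c4.comp c1).eventually (eventually_mem_stabilizer η0)] with w e1 e3 e4 e5 y m hm
    obtain ⟨ξ, x⟩ := w
    simp only [Function.comp] at e1 e3 e4 e5 hm ⊢
    set g := div ξ0 ξ
    have e4' : x ∈ ((X.map ξ0).trans (X.map η0)).source := e4
    have e3' := e3 e4'
    rw [h2] at e3'
    rw [OpenPartialHomeomorph.trans_source] at e4'
    have hy : y = g • X.map ξ0 x := by
      have := m.eq
      rw [hm, ← e1] at this
      rw [← map_act_left _ _ e4'.1]; exact this.symm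
    subst hy
    have hm' : m = germ ξ0 x e4'.1 ≫ smulMor g _ := by
      apply hom_ext
      rw [comp_smulMor_tr, hm, ← e1]; rfl
    have e6 : X.map η0 (X.map ξ0 x) = x := by
      have := (germ ξ0 x e4'.1 ≫ germ η0 _ e4'.2).eq
      have e : (germ ξ0 x e4'.1 ≫ germ η0 _ e4'.2).tr = X.one i := e3'
      rw [e] at this
      exact this.symm.trans (map_one_apply i x)
    have e7 : ∀ z, z = X.map ξ0 x → z ∈ (X.map η0).source ∧ X.map η0 z = x := by rintro _ rfl; exact ⟨e4'.2, e6⟩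
    obtain ⟨h8, h9⟩ := e7 (g⁻¹ • (g • X.map ξ0 x)) (inv_smul_smul _ _)
    set b : (⟨j, g⁻¹ • (g • X.map ξ0 x)⟩ : X.Obj) ⟶ ⟨i, x⟩ := ⟨η0, h8, h9⟩
    set b' : (⟨j, X.map ξ0 x⟩ : X.Obj) ⟶ ⟨i, x⟩ := ⟨η0, e4'.2, e6⟩
    have hinv : inv m = smulMor g⁻¹ _ ≫ b := by
      symm
      apply IsIso.eq_inv_of_hom_inv_id
      rw [hm']
      have e10 : smulMor g (X.map ξ0 x) ≫ smulMor g⁻¹ _ ≫ b = b' := by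
        apply hom_ext
        rw [← Category.assoc, comp_tr]
        have e11 : (smulMor g (X.map ξ0 x) ≫ smulMor g⁻¹ _).tr = X.one j := by
          rw [comp_smulMor_tr, smulMor_tr, X.act_act]
          simp [X.one_act_one]
        have e12 : (𝟙 _ ≫ b').tr = η0 := by rw [Category.id_comp]
        refine Eq.trans ?_ e12
        exact comp_congr e11 rfl rfl _ _
      rw [Category.assoc, e10]
      apply hom_ext
      exact e3'
    rw [hinv, smulMor_comp_tr, act_lam η0 e5]

end TranTopology

section Sections

lemma inv_comp_tr_eq_one {x : X.Obj} {y y' : X.C c} (m : x ⟶ ⟨c, y⟩) (n : x ⟶ ⟨c, y'⟩)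
    (h : m.tr = n.tr) : (inv m ≫ n).tr = X.one c := by
  obtain rfl : y = y' := by
    have h1 := m.eq
    rw [h] at h1
    exact h1.symm.trans n.eq
  obtain rfl : m = n := hom_ext h
  simp

/-- A local section over `N` of a family `r` of objects of the germ groupoid: a continuous map to
a chart and isomorphisms with its values. -/
structure Sec (r : T × ℝ → X.Obj) (c : X.ι) where
  N : Set (T × ℝ)
  f : T × ℝ → X.C c
  cont : ContinuousOn f N
  h : ∀ z ∈ N, r z ⟶ ⟨c, f z⟩

lemma tendsto_level (z : T × ℝ) : Tendsto (fun z' : T × ℝ => (z'.1, z.2)) (𝓝 z) (𝓝 z) :=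
  Continuous.tendsto' (by fun_prop) _ _ rfl

namespace Sec

variable {r r' : T × ℝ → X.Obj}

/-- The change of sections. -/
def trans (a : Sec r c) (b : Sec r c') (z : T × ℝ) (ha : z ∈ a.N) (hb : z ∈ b.N) :
    (⟨c, a.f z⟩ : X.Obj) ⟶ ⟨c', b.f z⟩ := inv (a.h z ha) ≫ b.h z hb

/-- Near `z0` the change of sections depends continuously on `t` and not on `s`. -/
def SmoothAt (a : Sec r c) (b : Sec r c') (z0 : T × ℝ) : Prop :=
  ∃ G : T → X.Tran c c', ContinuousAt G z0.1 ∧ ∀ᶠ z in 𝓝 z0, ∀ ha hb, (a.trans b z ha hb).tr = G z.1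

lemma SmoothAt.symm {a : Sec r c} {b : Sec r c'} {z0 : T × ℝ} (h : a.SmoothAt b z0)
    (ha0 : z0 ∈ a.N) (hb0 : z0 ∈ b.N) : b.SmoothAt a z0 := by
  obtain ⟨G, hG, hE⟩ := h
  have hm : a.f z0 ∈ (X.map (G z0.1)).source := by rw [← (hE.self_of_nhds ha0 hb0)]; exact (a.trans b z0 ha0 hb0).mem
  obtain ⟨F, hF, hFE⟩ := inv_local hm
  refine ⟨fun t => F (G t), ContinuousAt.comp hF hG, ?_⟩
  have ht : Tendsto (fun z : T × ℝ => (G z.1, a.f z)) (𝓝[a.N] z0) (𝓝 (G z0.1, a.f z0)) :=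
    Tendsto.prodMk_nhds ((hG.tendsto.comp continuous_fst.continuousAt).mono_left nhdsWithin_le_nhds) (a.cont z0 ha0)
  filter_upwards [hE, eventually_nhdsWithin_iff.1 (ht.eventually hFE)] with z h1 h2 hb ha
  rw [← h2 ha _ (a.trans b z ha hb) (h1 ha hb)]
  simp [trans]

lemma SmoothAt.trans {a : Sec r c} {b : Sec r c'} {d : Sec r c''} {z0 : T × ℝ}
    (h : a.SmoothAt b z0) (h' : b.SmoothAt d z0) (ha0 : z0 ∈ a.N) (hb0 : z0 ∈ b.N) (hd0 : z0 ∈ d.N)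
    (hN : ∀ᶠ z in 𝓝 z0, z ∈ a.N → z ∈ d.N → z ∈ b.N) : a.SmoothAt d z0 := by
  obtain ⟨G, hG, hE⟩ := h
  obtain ⟨G', hG', hE'⟩ := h'
  have hm : a.f z0 ∈ ((X.map (G z0.1)).trans (X.map (G' z0.1))).source := by
    rw [← (hE.self_of_nhds ha0 hb0), ← (hE'.self_of_nhds hb0 hd0)]
    exact mem_trans_source (a.trans b z0 ha0 hb0).mem
      (by rw [(a.trans b z0 ha0 hb0).eq]; exact (b.trans d z0 hb0 hd0).mem)
  obtain ⟨F, hF, hFE⟩ := comp_local hm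
  refine ⟨fun t => F (G t, G' t), ContinuousAt.comp hF (hG.prodMk hG'), ?_⟩
  have ht : Tendsto (fun z : T × ℝ => ((G z.1, G' z.1), a.f z)) (𝓝[a.N] z0) (𝓝 ((G z0.1, G' z0.1), a.f z0)) :=
    Tendsto.prodMk_nhds (((hG.prodMk hG').tendsto.comp continuous_fst.continuousAt).mono_left
      nhdsWithin_le_nhds) (a.cont z0 ha0)
  filter_upwards [hE, hE', hN, eventually_nhdsWithin_iff.1 (ht.eventually hFE)] with z h1 h2 h3 h4 ha hd
  have hb := h3 ha hd
  have e : a.trans d z ha hd = a.trans b z ha hb ≫ b.trans d z hb hd := by simp [Sec.trans]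
  have hz : a.f z ∈ ((X.map (G z.1)).trans (X.map (G' z.1))).source := by
    rw [← h1 ha hb, ← h2 hb hd]
    exact mem_trans_source (a.trans b z ha hb).mem (by rw [(a.trans b z ha hb).eq]; exact (b.trans d z hb hd).mem)
  rw [e, comp_tr, ← h4 ha hz]
  exact comp_congr (h1 ha hb) (h2 hb hd) rfl _ _

/-- The restriction of a section. -/
def restrict (a : Sec r c) (S : Set (T × ℝ)) : Sec r c where
  N := a.N ∩ S
  f := a.f
  cont := a.cont.mono inter_subset_left
  h z hz := a.h z hz.1

lemma SmoothAt.restrict {a : Sec r c} {b : Sec r c'} {z0 : T × ℝ} (h : a.SmoothAt b z0)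
    (S : Set (T × ℝ)) : (a.restrict S).SmoothAt b z0 := by
  obtain ⟨G, hG, hE⟩ := h
  exact ⟨G, hG, hE.mono fun z hz ha hb => hz ha.1 hb⟩

/-- Smoothness may be checked on two sides. -/
lemma SmoothAt.of_sides {a : Sec r c} {b : Sec r c'} {z0 : T × ℝ} {S S' : Set (T × ℝ)}
    (h : (a.restrict S).SmoothAt b z0) (h' : (a.restrict S').SmoothAt b z0)
    (hE : ∀ᶠ z in 𝓝 z0, z ∈ a.N → z ∈ b.N → ((z.1, z0.2) ∈ a.N ∧ (z.1, z0.2) ∈ S ∧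
      (z.1, z0.2) ∈ S' ∧ (z.1, z0.2) ∈ b.N ∧ (z ∈ S ∨ z ∈ S'))) : a.SmoothAt b z0 := by
  obtain ⟨G, hG, h1⟩ := h
  obtain ⟨G', hG', h1'⟩ := h'
  refine ⟨G, hG, ?_⟩
  filter_upwards [h1, h1', hE, (tendsto_level _).eventually h1, (tendsto_level _).eventually h1'] with z e1 e2 e3 e4 e5 ha hb
  obtain ⟨ha', hS, hS', hb', hz⟩ := e3 ha hb
  rcases hz with hz | hz
  · exact e1 ⟨ha, hz⟩ hb
  · exact (e2 ⟨ha, hz⟩ hb).trans ((e5 ⟨ha', hS'⟩ hb').symm.trans (e4 ⟨ha', hS⟩ hb'))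

/-- The pull-back of a section under a family of isomorphisms. -/
def pull (b : Sec r' c) (S : Set (T × ℝ)) (J : ∀ z ∈ S, r z ⟶ r' z) : Sec r c where
  N := S ∩ b.N
  f := b.f
  cont := b.cont.mono inter_subset_right
  h z hz := J z hz.1 ≫ b.h z hz.2

lemma SmoothAt.pull {a : Sec r' c} {b : Sec r' c'} {z0 : T × ℝ} (h : a.SmoothAt b z0)
    (S : Set (T × ℝ)) (J : ∀ z ∈ S, r z ⟶ r' z) : (a.pull S J).SmoothAt (b.pull S J) z0 := by
  obtain ⟨G, hG, hE⟩ := h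
  refine ⟨G, hG, hE.mono fun z hz ha hb => ?_⟩
  rw [← hz ha.2 hb.2]
  simp [Sec.trans, Sec.pull]

/-- The composition of a section with a reparametrization. -/
def comap (a : Sec r c) (g : C(T', T)) (w : C(T' × ℝ, ℝ)) : Sec (fun z => r (g z.1, w z)) c where
  N := {z | (g z.1, w z) ∈ a.N}
  f z := a.f (g z.1, w z)
  cont := a.cont.comp (Continuous.continuousOn (by fun_prop)) fun _ hz => hz
  h z hz := a.h _ hz

lemma SmoothAt.comap {a : Sec r c} {b : Sec r c'} (g : C(T', T)) (w : C(T' × ℝ, ℝ)) {z0 : T' × ℝ}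
    (h : a.SmoothAt b (g z0.1, w z0)) : (a.comap g w).SmoothAt (b.comap g w) z0 := by
  obtain ⟨G, hG, hE⟩ := h
  refine ⟨fun t => G (g t), ContinuousAt.comp hG g.continuous.continuousAt, ?_⟩
  have ht : Tendsto (fun z : T' × ℝ => (g z.1, w z)) (𝓝 z0) (𝓝 (g z0.1, w z0)) := Continuous.tendsto (by fun_prop) _
  exact (ht.eventually hE).mono fun z hz ha hb => hz ha hb

/-- Composition of a section with a family of transition maps. -/
def post (a : Sec r c) (N : Set (T × ℝ)) (hN : N ⊆ a.N) (ξ : T → X.Tran c c')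
    (hξ : ∀ z ∈ N, ContinuousAt ξ z.1) (hm : ∀ z ∈ N, a.f z ∈ (X.map (ξ z.1)).source) :
    Sec r c' where
  N := N
  f z := X.map (ξ z.1) (a.f z)
  cont z hz := by
    have h1 : Tendsto (fun z : T × ℝ => (ξ z.1, a.f z)) (𝓝[N] z) (𝓝 (ξ z.1, a.f z)) :=
      Tendsto.prodMk_nhds (((hξ z hz).tendsto.comp continuous_fst.continuousAt).mono_left
        nhdsWithin_le_nhds) (a.cont.mono hN z hz)
    exact (continuousAt_map (hm z hz)).tendsto.comp h1
  h z hz := a.h z (hN hz) ≫ germ (ξ z.1) (a.f z) (hm z hz)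

lemma smoothAt_post (a : Sec r c) (N : Set (T × ℝ)) (hN : N ⊆ a.N) (ξ : T → X.Tran c c')
    (hξ : ∀ z ∈ N, ContinuousAt ξ z.1) (hm : ∀ z ∈ N, a.f z ∈ (X.map (ξ z.1)).source)
    {z0 : T × ℝ} (h0 : z0 ∈ N) : a.SmoothAt (a.post N hN ξ hξ hm) z0 := by
  refine ⟨ξ, hξ z0 h0, Eventually.of_forall fun z ha hb => ?_⟩
  have : a.trans (a.post N hN ξ hξ hm) z ha hb = germ (ξ z.1) (a.f z) (hm z hb) := by simp [Sec.trans, post]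
  rw [this]; rfl

end Sec

lemma continuousOn_of_sides {α : Type*} [TopologicalSpace α] {f : T × ℝ → α} {N : Set (T × ℝ)}
    {s0 : ℝ} (h : ContinuousOn f (N ∩ {z | z.2 ≤ s0})) (h' : ContinuousOn f (N ∩ {z | s0 ≤ z.2})) :
    ContinuousOn f N := by
  intro z hz
  have hN : N = (N ∩ {z | z.2 ≤ s0}) ∪ (N ∩ {z | s0 ≤ z.2}) := by
    ext z
    simp only [mem_union, mem_inter_iff, mem_ofPred_eq]
    have := le_total z.2 s0
    tauto
  have aux : ∀ (S : Set (T × ℝ)), IsClosed S → ContinuousOn f (N ∩ S) → ContinuousWithinAt f (N ∩ S) z := by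
    intro S hS hf
    by_cases hzS : z ∈ S
    · exact hf z ⟨hz, hzS⟩
    · apply continuousWithinAt_of_notMem_closure
      intro hc
      exact hzS (closure_minimal inter_subset_right hS hc)
  rw [hN]
  exact (aux _ (isClosed_le continuous_snd continuous_const) h).union
    (aux _ (isClosed_le continuous_const continuous_snd) h')

variable (X) in
/-- A family of flat paths in `X` parametrized by `T`. -/
structure Pth (T : Type*) [TopologicalSpace T] where
  r : T × ℝ → X.Obj
  atlas : Set (Σ c, Sec r c)
  isOpen : ∀ a ∈ atlas, IsOpen a.2.N
  compat : ∀ a ∈ atlas, ∀ b ∈ atlas, ∀ z, z ∈ a.2.N → z ∈ b.2.N → a.2.SmoothAt b.2 z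
  cover : ∀ z, ∃ a ∈ atlas, z ∈ a.2.N

namespace Pth

variable {A B D : Pth X T}

variable (A) in
/-- The sections compatible with the atlas. -/
def IsSec (a : Sec A.r c) : Prop := ∀ b ∈ A.atlas, ∀ z, z ∈ a.N → z ∈ b.2.N → a.SmoothAt b.2 z

lemma isSec_atlas {a : Σ c, Sec A.r c} (ha : a ∈ A.atlas) : A.IsSec a.2 := fun b hb z h h' =>
  A.compat a ha b hb z h h'

variable (A) in
lemma exists_isSec (z : T × ℝ) : ∃ (c : X.ι) (a : Sec A.r c), A.IsSec a ∧ IsOpen a.N ∧ z ∈ a.N := by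
  obtain ⟨a, ha, hz⟩ := A.cover z
  exact ⟨a.1, a.2, isSec_atlas ha, A.isOpen a ha, hz⟩

lemma IsSec.smoothAt {a : Sec A.r c} {b : Sec A.r c'} (ha : A.IsSec a) (hb : A.IsSec b)
    {z : T × ℝ} (hza : z ∈ a.N) (hzb : z ∈ b.N) : a.SmoothAt b z := by
  obtain ⟨d, hd, hzd⟩ := A.cover z
  exact (ha d hd z hza hzd).trans ((hb d hd z hzb hzd).symm hzb hzd) hza hzd hzb
    (mem_of_superset ((A.isOpen d hd).mem_nhds hzd) fun z hz _ _ => hz)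

lemma isSec_of_local {a : Sec A.r c} (h : ∀ z ∈ a.N, ∃ (c' : X.ι) (b : Sec A.r c'), A.IsSec b ∧
    z ∈ b.N ∧ (∀ᶠ z' in 𝓝 z, z' ∈ a.N → z' ∈ b.N) ∧ a.SmoothAt b z) : A.IsSec a := by
  intro d hd z hz hzd
  obtain ⟨c', b, hb, hzb, hN, hs⟩ := h z hz
  exact hs.trans (hb d hd z hzb hzd) hz hzb hzd (hN.mono fun z' h' h'' _ => h' h'')

lemma IsSec.restrict {a : Sec A.r c} (ha : A.IsSec a) (S : Set (T × ℝ)) :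
    A.IsSec (a.restrict S) := fun b hb z h h' => (ha b hb z h.1 h').restrict S

lemma IsSec.post {a : Sec A.r c} (ha : A.IsSec a) (N : Set (T × ℝ)) (hN : N ⊆ a.N)
    (ξ : T → X.Tran c c') (hξ : ∀ z ∈ N, ContinuousAt ξ z.1)
    (hm : ∀ z ∈ N, a.f z ∈ (X.map (ξ z.1)).source) : A.IsSec (a.post N hN ξ hξ hm) :=
  isSec_of_local fun z hz => ⟨c, a, ha, hN hz, Eventually.of_forall fun _ h => hN h,
    (a.smoothAt_post N hN ξ hξ hm hz).symm (hN hz) hz⟩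

/-- A section with the same transition maps as another one on a smaller domain. -/
lemma IsSec.congr {a b : Sec A.r c} (ha : A.IsSec a) (hN : b.N ⊆ a.N)
    (h : ∀ z (hb : z ∈ b.N), (b.h z hb).tr = (a.h z (hN hb)).tr) : A.IsSec b :=
  isSec_of_local fun z hz => ⟨c, a, ha, hN hz, Eventually.of_forall fun _ h => hN h,
    ⟨fun _ => X.one c, continuousAt_const, Eventually.of_forall fun z hb _ => inv_comp_tr_eq_one _ _ (h z hb)⟩⟩

lemma isSec_of_sides {a : Sec A.r c} (h : ∀ z ∈ a.N, ∃ S S' : Set (T × ℝ),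
    A.IsSec (a.restrict S) ∧ A.IsSec (a.restrict S') ∧ z ∈ S ∧ z ∈ S' ∧
    ∀ᶠ z' in 𝓝 z, z' ∈ a.N → ((z'.1, z.2) ∈ a.N ∧ (z'.1, z.2) ∈ S ∧ (z'.1, z.2) ∈ S' ∧
      (z' ∈ S ∨ z' ∈ S'))) : A.IsSec a := by
  intro b hb z hza hzb
  obtain ⟨S, S', h1, h2, hS, hS', hE⟩ := h z hza
  refine Sec.SmoothAt.of_sides (h1 b hb z ⟨hza, hS⟩ hzb) (h2 b hb z ⟨hza, hS'⟩ hzb) ?_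
  filter_upwards [hE, (tendsto_level _).eventually ((A.isOpen b hb).mem_nhds hzb)] with z' h1 h2 ha _
  obtain ⟨h3, h4, h5, h6⟩ := h1 ha
  exact ⟨h3, h4, h5, h2, h6⟩

/-- Reparametrization of a family of paths. -/
def comap (A : Pth X T) (g : C(T', T)) (w : C(T' × ℝ, ℝ)) : Pth X T' where
  r z := A.r (g z.1, w z)
  atlas := {a | ∃ b ∈ A.atlas, a = ⟨b.1, b.2.comap g w⟩}
  isOpen := by
    rintro _ ⟨b, hb, rfl⟩
    exact (A.isOpen b hb).preimage (f := fun z : T' × ℝ => (g z.1, w z)) (by fun_prop)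
  compat := by
    rintro _ ⟨a, ha, rfl⟩ _ ⟨b, hb, rfl⟩ z hza hzb
    exact (A.compat a ha b hb _ hza hzb).comap g w
  cover z := by
    obtain ⟨b, hb, hz⟩ := A.cover (g z.1, w z)
    exact ⟨_, ⟨b, hb, rfl⟩, hz⟩

lemma IsSec.comap {a : Sec A.r c} (ha : A.IsSec a) (g : C(T', T)) (w : C(T' × ℝ, ℝ)) :
    (A.comap g w).IsSec (a.comap g w) := by
  rintro _ ⟨b, hb, rfl⟩ z hza hzb
  exact (ha b hb _ hza hzb).comap g w

end Pth

/-- An isomorphism, over `S`, of families of paths. -/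
structure PIso (A B : Pth X T) (S : Set (T × ℝ)) where
  J : ∀ z ∈ S, A.r z ⟶ B.r z
  smooth : ∀ b ∈ B.atlas, A.IsSec (b.2.pull S J)

namespace PIso

variable {A B D : Pth X T} {S S' : Set (T × ℝ)}

lemma isSec_pull (j : PIso A B S) {b : Sec B.r c} (hb : B.IsSec b) : A.IsSec (b.pull S j.J) := by
  refine Pth.isSec_of_local fun z hz => ?_
  obtain ⟨d, hd, hzd⟩ := B.cover z
  exact ⟨d.1, _, j.smooth d hd, ⟨hz.1, hzd⟩,
    mem_of_superset ((B.isOpen d hd).mem_nhds hzd) fun z hz h => ⟨h.1, hz⟩,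
    (hb d hd z hz.2 hzd).pull S j.J⟩

/-- The identity. -/
def refl (A : Pth X T) (S : Set (T × ℝ)) : PIso A A S where
  J z _ := 𝟙 _
  smooth b hb := (Pth.isSec_atlas hb).congr (fun _ h => h.2) fun z h => by simp [Sec.pull]

/-- The inverse of an isomorphism. -/
def symm (j : PIso A B S) : PIso B A S where
  J z hz := inv (j.J z hz)
  smooth a ha := by
    refine Pth.isSec_of_local fun z hz => ?_
    obtain ⟨d, hd, hzd⟩ := B.cover z
    refine ⟨d.1, d.2, Pth.isSec_atlas hd, hzd,
      mem_of_superset ((B.isOpen d hd).mem_nhds hzd) fun z hz h => hz, ?_⟩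
    obtain ⟨G, hG, hE⟩ := (Pth.isSec_atlas ha).smoothAt (j.smooth d hd) hz.2 ⟨hz.1, hzd⟩
    refine ⟨G, hG, hE.mono fun z h h1 h2 => ?_⟩
    rw [← h h1.2 ⟨h1.1, h2⟩]
    simp [Sec.trans, Sec.pull]

/-- The composition of isomorphisms. -/
def trans (j : PIso A B S) (k : PIso B D S) : PIso A D S where
  J z hz := j.J z hz ≫ k.J z hz
  smooth d hd := (j.isSec_pull (k.smooth d hd)).congr (fun _ h => ⟨h.1, h.1, h.2⟩) fun z h => by simp [Sec.pull]

/-- The restriction of an isomorphism. -/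
def mono (j : PIso A B S) (h : S' ⊆ S) : PIso A B S' where
  J z hz := j.J z (h hz)
  smooth d hd := (j.smooth d hd).congr (fun _ h' => ⟨h h'.1, h'.2⟩) fun z h => rfl

/-- Reparametrization of an isomorphism. -/
def comap (j : PIso A B S) (g : C(T', T)) (w : C(T' × ℝ, ℝ)) :
    PIso (A.comap g w) (B.comap g w) {z | (g z.1, w z) ∈ S} where
  J z hz := j.J _ hz
  smooth := by
    rintro _ ⟨b, hb, rfl⟩
    exact ((j.smooth b hb).comap g w).congr (fun _ h => h) fun _ _ => rfl

/-- Two families of isomorphisms over adjacent strips give one over their union. -/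
lemma smooth_of_sides {J : ∀ z ∈ S, A.r z ⟶ B.r z}
    (h : ∀ z ∈ S, ∃ S1 S2 : Set (T × ℝ), z ∈ S1 ∧ z ∈ S2 ∧ (∀ b ∈ B.atlas, A.IsSec ((b.2.pull S J).restrict S1)) ∧
      (∀ b ∈ B.atlas, A.IsSec ((b.2.pull S J).restrict S2)) ∧
      ∀ᶠ z' in 𝓝 z, z' ∈ S → ((z'.1, z.2) ∈ S ∧ (z'.1, z.2) ∈ S1 ∧ (z'.1, z.2) ∈ S2 ∧
        (z' ∈ S1 ∨ z' ∈ S2))) : ∀ b ∈ B.atlas, A.IsSec (b.2.pull S J) := by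
  intro b hb
  refine Pth.isSec_of_sides fun z hz => ?_
  obtain ⟨S1, S2, h1, h2, h3, h4, hE⟩ := h z hz.1
  refine ⟨S1, S2, h3 b hb, h4 b hb, h1, h2, ?_⟩
  filter_upwards [hE, (tendsto_level _).eventually ((B.isOpen b hb).mem_nhds hz.2)] with z' e1 e2 e3
  obtain ⟨e4, e5, e6, e7⟩ := e1 e3.1
  exact ⟨⟨e4, e2⟩, e5, e6, e7⟩

end PIso

namespace Pth

variable {r : T × ℝ → X.Obj}

lemma exists_thick {a : Sec r c} {b : Sec r c'} (z0 : T × ℝ) (hab : ∀ z, z ∈ a.N → z ∈ b.N → a.SmoothAt b z)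
    (hE : ∀ᶠ z in 𝓝 z0, (z.2 ≤ z0.2 → z ∈ a.N) ∧ (z0.2 ≤ z.2 → z ∈ b.N)) :
    ∃ (e : Sec r c') (G : T → X.Tran c c'), IsOpen e.N ∧ z0 ∈ e.N ∧ (∀ z ∈ e.N, ContinuousAt G z.1) ∧
      (∀ z (h : z ∈ e.N), z.2 ≤ z0.2 → ∃ (ha : z ∈ a.N) (hm : a.f z ∈ (X.map (G z.1)).source),
        (e.h z h).tr = (a.h z ha ≫ germ (G z.1) (a.f z) hm).tr) ∧
      (∀ z (h : z ∈ e.N), z0.2 ≤ z.2 → ∃ hb : z ∈ b.N, (e.h z h).tr = (b.h z hb).tr) := by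
  classical
  have ha0 : z0 ∈ a.N := hE.self_of_nhds.1 le_rfl
  have hb0 : z0 ∈ b.N := hE.self_of_nhds.2 le_rfl
  obtain ⟨G, hG, hGE⟩ := hab z0 ha0 hb0
  have hm0 : a.f z0 ∈ (X.map (G z0.1)).source := by rw [← (hGE.self_of_nhds ha0 hb0)]; exact (a.trans b z0 ha0 hb0).mem
  have hm := eventually_nhdsWithin_iff.1 ((Tendsto.prodMk_nhds ((hG.tendsto.comp continuous_fst.continuousAt).mono_left nhdsWithin_le_nhds) (a.cont z0 ha0)).eventually (eventually_mem_source hm0))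
  obtain ⟨O, hO, hOo, hzO⟩ := eventually_nhds_iff.1
    (hE.and (hGE.and hm))
  obtain ⟨M, V, hMo, hVo, hM, hV, hMV⟩ := isOpen_prod_iff.1 hOo z0.1 z0.2 hzO
  have hGc : ∀ t ∈ M, ContinuousAt G t := by
    intro t htM
    have htO : (t, z0.2) ∈ O := hMV ⟨htM, hV⟩
    obtain ⟨G', hG', hGE'⟩ := hab (t, z0.2) ((hO _ htO).1.1 le_rfl) ((hO _ htO).1.2 le_rfl)
    refine hG'.congr ?_
    have hv' : Tendsto (fun t' : T => (t', z0.2)) (𝓝 t) (𝓝 (t, z0.2)) := Continuous.tendsto' (by fun_prop) _ _ rfl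
    filter_upwards [hv'.eventually hGE', hMo.mem_nhds htM] with t' h1 h2
    have h3 := hO (t', z0.2) (hMV ⟨h2, hV⟩)
    rw [← h1 (h3.1.1 le_rfl) (h3.1.2 le_rfl), h3.2.1 (h3.1.1 le_rfl) (h3.1.2 le_rfl)]
  set N := M ×ˢ V
  have hA : ∀ {z}, z ∈ N → z.2 ≤ z0.2 → z ∈ a.N := fun h => (hO _ (hMV h)).1.1
  have hB : ∀ {z}, z ∈ N → z0.2 ≤ z.2 → z ∈ b.N := fun h => (hO _ (hMV h)).1.2
  set f : T × ℝ → X.C c' := fun z => if z.2 ≤ z0.2 then X.map (G z.1) (a.f z) else b.f z with hf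
  have hmem : ∀ z ∈ N, z.2 ≤ z0.2 → a.f z ∈ (X.map (G z.1)).source := fun z hz hl =>
    (hO z (hMV hz)).2.2 (hA hz hl)
  have key : ∀ z (h : z ∈ N) (hl : z.2 ≤ z0.2) (hr : z0.2 ≤ z.2),
      (a.h z (hA h hl) ≫ germ (G z.1) (a.f z) (hmem z h hl)).tr =
        (b.h z (hB h hr)).tr := by
    intro z h hl hr
    have h2 : b.h z (hB h hr) = a.h z (hA h hl) ≫
      a.trans b z (hA h hl) (hB h hr) := by simp [Sec.trans]
    rw [h2, comp_tr, comp_tr]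
    exact comp_congr rfl ((hO z (hMV h)).2.1 (hA h hl) (hB h hr)).symm rfl _ _
  have hfb : ∀ z ∈ N, z0.2 ≤ z.2 → f z = b.f z := by
    intro z hz hr
    by_cases hl : z.2 ≤ z0.2
    · have h2 := (a.h z (hA hz hl) ≫ germ (G z.1) (a.f z) (hmem z hz hl)).eq
      rw [(key z hz hl hr)] at h2
      simp only [hf, if_pos hl]
      exact h2.symm.trans ((b.h z (hB hz hr)).eq)
    · simp only [hf, if_neg hl]
  have hfc : ContinuousOn f N := by
    apply continuousOn_of_sides
    · refine (a.post (N ∩ {z | z.2 ≤ z0.2}) (fun z hz => hA hz.1 hz.2) G (fun z hz => hGc _ hz.1.1)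
        (fun z hz => hmem z hz.1 hz.2)).cont.congr fun z hz => ?_
      simp only [hf, if_pos (show z.2 ≤ z0.2 from hz.2)]
      rfl
    · exact (b.cont.mono fun z hz => hB hz.1 hz.2).congr fun z hz => hfb z hz.1 hz.2
  have hh : ∀ z (h : z ∈ N), ∃ m : r z ⟶ ⟨c', f z⟩,
      (z.2 ≤ z0.2 → ∃ (ha : z ∈ a.N) (hm : a.f z ∈ (X.map (G z.1)).source),
        m.tr = (a.h z ha ≫ germ (G z.1) (a.f z) hm).tr) ∧
      (z0.2 ≤ z.2 → ∃ hb : z ∈ b.N, m.tr = (b.h z hb).tr) := by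
    intro z h
    by_cases hl : z.2 ≤ z0.2
    · have e : f z = X.map (G z.1) (a.f z) := by simp only [hf, if_pos hl]
      rw [e]
      exact ⟨a.h z (hA h hl) ≫ germ (G z.1) (a.f z) (hmem z h hl),
        fun _ => ⟨_, _, rfl⟩, fun hr => ⟨hB h hr, key z h hl hr⟩⟩
    · have hr : z0.2 ≤ z.2 := (lt_of_not_ge hl).le
      rw [hfb z h hr]
      exact ⟨b.h z (hB h hr), fun h' => absurd h' hl, fun _ => ⟨_, rfl⟩⟩
  choose m hm1 hm2 using hh
  exact ⟨⟨N, f, hfc, m⟩, G, hMo.prod hVo, ⟨hM, hV⟩, fun z hz => hGc _ hz.1, hm1, hm2⟩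

/-- A family of compatible sections that covers from both sides gives a family of paths. -/
def ofSides (r : T × ℝ → X.Obj) (𝒜 : Set (Σ c, Sec r c))
    (compat : ∀ a ∈ 𝒜, ∀ b ∈ 𝒜, ∀ z, z ∈ a.2.N → z ∈ b.2.N → a.2.SmoothAt b.2 z)
    (vert : ∀ a ∈ 𝒜, ∀ z ∈ a.2.N, ∀ᶠ z' in 𝓝 z, z' ∈ a.2.N → (z'.1, z.2) ∈ a.2.N)
    (cover : ∀ z0 : T × ℝ, ∃ a ∈ 𝒜, ∃ b ∈ 𝒜, ∀ᶠ z in 𝓝 z0,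
      (z.2 ≤ z0.2 → z ∈ a.2.N) ∧ (z0.2 ≤ z.2 → z ∈ b.2.N)) : Pth X T where
  r := r
  atlas := {e | IsOpen e.2.N ∧ ∀ a ∈ 𝒜, ∀ z, z ∈ e.2.N → z ∈ a.2.N → e.2.SmoothAt a.2 z}
  isOpen e he := he.1
  compat e he e' he' z hz hz' := by
    obtain ⟨a, ha, b, hb, hE⟩ := cover z
    have haz := hE.self_of_nhds.1 le_rfl
    have hbz := hE.self_of_nhds.2 le_rfl
    refine Sec.SmoothAt.of_sides (S := {z' | z'.2 ≤ z.2}) (S' := {z' | z.2 ≤ z'.2}) ?_ ?_ ?_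
    · exact ((he.2 a ha z hz haz).restrict _).trans ((he'.2 a ha z hz' haz).symm hz' haz)
        ⟨hz, le_refl z.2⟩ haz hz' (hE.mono fun z' h h' _ => h.1 h'.2)
    · exact ((he.2 b hb z hz hbz).restrict _).trans ((he'.2 b hb z hz' hbz).symm hz' hbz)
        ⟨hz, le_refl z.2⟩ hbz hz' (hE.mono fun z' h h' _ => h.2 h'.2)
    · filter_upwards [(tendsto_level _).eventually (he.1.mem_nhds hz), (tendsto_level _).eventually (he'.1.mem_nhds hz')] with z' h1 h2 _ _
      exact ⟨h1, le_refl z.2, le_refl z.2, h2, le_total _ _⟩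
  cover z0 := by
    obtain ⟨a, ha, b, hb, hE⟩ := cover z0
    obtain ⟨e, G, ho, hz0, hG, hl, hr⟩ := exists_thick z0 (compat a ha b hb) hE
    refine ⟨⟨_, e⟩, ⟨ho, ?_⟩, hz0⟩
    intro d hd z hz hzd
    have hleft : z.2 ≤ z0.2 → (e.restrict {z | z.2 ≤ z0.2}).SmoothAt d.2 z := by
      intro hzl
      have hza : z ∈ a.2.N := (hl z hz hzl).1
      have h1 : a.2.SmoothAt (e.restrict {z | z.2 ≤ z0.2}) z := by
        refine ⟨G, hG z hz, Eventually.of_forall fun z' ha' he' => ?_⟩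
        obtain ⟨h2, h3, h4⟩ := hl z' he'.1 he'.2
        have h5 : (inv (a.2.h z' ha') ≫ (a.2.h z' ha' ≫ germ (G z'.1) (a.2.f z') h3)).tr = G z'.1 := by
          rw [IsIso.inv_hom_id_assoc]; rfl
        rw [← h5]
        exact comp_congr rfl h4 rfl _ _
      exact (h1.symm hza ⟨hz, hzl⟩).trans (compat a ha d hd z hza hzd) ⟨hz, hzl⟩ hza hzd
        (Eventually.of_forall fun z' h' _ => (hl z' h'.1 h'.2).1)
    have hright : z0.2 ≤ z.2 → (e.restrict {z | z0.2 ≤ z.2}).SmoothAt d.2 z := by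
      intro hzr
      have hzb : z ∈ b.2.N := (hr z hz hzr).1
      have h1 : (e.restrict {z | z0.2 ≤ z.2}).SmoothAt b.2 z := by
        refine ⟨fun _ => X.one _, continuousAt_const, Eventually.of_forall fun z' he' hb' => ?_⟩
        exact inv_comp_tr_eq_one _ _ (hr z' he'.1 he'.2).2
      exact h1.trans (compat b hb d hd z hzb hzd) ⟨hz, hzr⟩ hzb hzd
        (Eventually.of_forall fun z' h' _ => (hr z' h'.1 h'.2).1)
    have aux : ∀ {S : Set (T × ℝ)}, S ∈ 𝓝 z → (e.restrict S).SmoothAt d.2 z → e.SmoothAt d.2 z := by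
      rintro S hS ⟨G', hG', hE'⟩
      refine ⟨G', hG', ?_⟩
      filter_upwards [hE', hS] with z' h1 h2 h3 h4 using h1 ⟨h3, h2⟩ h4
    rcases lt_trichotomy z.2 z0.2 with h | h | h
    · refine aux ?_ (hleft h.le)
      exact (isOpen_lt continuous_snd continuous_const |>.mem_nhds h |> Filter.Eventually.mono)
        fun z' h' => le_of_lt h'
    · refine Sec.SmoothAt.of_sides (hleft h.le) (hright h.ge) ?_
      filter_upwards [(tendsto_level _).eventually (ho.mem_nhds hz), vert d hd z hzd] with z' h1 h2 h3 h4
      exact ⟨h1, h.le, h.ge, h2 h4, le_total _ _⟩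
    · refine aux ?_ (hright h.le)
      exact (isOpen_lt continuous_const continuous_snd |>.mem_nhds h |> Filter.Eventually.mono)
        fun z' h' => le_of_lt h'

lemma isSec_ofSides {r : T × ℝ → X.Obj} {𝒜 : Set (Σ c, Sec r c)} {h1 h2 h3} {a : Σ c, Sec r c}
    (ha : a ∈ 𝒜) : (ofSides r 𝒜 h1 h2 h3).IsSec a.2 :=
  fun _ he z hza hze => (he.2 a ha z hze hza).symm hze hza

/-- Two families of paths can be joined along an isomorphism over `s = a`. -/
lemma exists_glue (A B : Pth X T) (a : ℝ) (j : PIso A B {z | z.2 = a}) :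
    ∃ (D : Pth X T) (u : PIso A D {z | z.2 ≤ a}) (u' : PIso B D {z | a ≤ z.2}),
      ∀ (z : T × ℝ) (h : z.2 = a), j.J z h ≫ u'.J z h.ge = u.J z h.le := by
  have hch : ∀ z : T × ℝ, ∃ (x : X.Obj) (u : z.2 ≤ a → (A.r z ⟶ x)) (u' : a ≤ z.2 → (B.r z ⟶ x)),
      ∀ h : z.2 = a, j.J z h ≫ u' h.ge = u h.le := by
    intro z
    by_cases h : z.2 ≤ a
    · exact ⟨A.r z, fun _ => 𝟙 _, fun h' => inv (j.J z (le_antisymm h h')), fun h' => by simp⟩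
    · exact ⟨B.r z, fun h' => absurd h' h, fun _ => 𝟙 _, fun h' => absurd h'.le h⟩
  choose r u u' hu using hch
  let v : ∀ z ∈ {z : T × ℝ | z.2 ≤ a}, r z ⟶ A.r z := fun z hz => inv (u z hz)
  let v' : ∀ z ∈ {z : T × ℝ | a ≤ z.2}, r z ⟶ B.r z := fun z hz => inv (u' z hz)
  set 𝒜 : Set (Σ c, Sec r c) := {e | ∃ b ∈ A.atlas, e = ⟨b.1, b.2.pull _ v⟩} ∪
    {e | ∃ b ∈ B.atlas, e = ⟨b.1, b.2.pull _ v'⟩}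
  have cross : ∀ b ∈ A.atlas, ∀ b' ∈ B.atlas, ∀ z, z.2 = a → z ∈ b.2.N → z ∈ b'.2.N →
      (b.2.pull _ v).SmoothAt
        (b'.2.pull _ v') z := by
    intro b hb b' hb' z hz hzb hzb'
    obtain ⟨G, hG, hE⟩ := (isSec_atlas hb).smoothAt (j.smooth b' hb') hzb ⟨hz, hzb'⟩
    refine ⟨G, hG, hE.mono fun z' h h1 h2 => ?_⟩
    have hz' : z'.2 = a := le_antisymm h1.1 h2.1
    rw [← h h1.2 ⟨hz', h2.2⟩]
    simp [Sec.trans, Sec.pull, v, v', ← hu z' hz']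
  have hcompat : ∀ a ∈ 𝒜, ∀ b ∈ 𝒜, ∀ z, z ∈ a.2.N → z ∈ b.2.N → a.2.SmoothAt b.2 z := by
    rintro _ (⟨b, hb, rfl⟩ | ⟨b, hb, rfl⟩) _ (⟨b', hb', rfl⟩ | ⟨b', hb', rfl⟩) z hz hz'
    · exact (A.compat b hb b' hb' z hz.2 hz'.2).pull _ _
    · exact cross b hb b' hb' z (le_antisymm hz.1 hz'.1) hz.2 hz'.2
    · exact (cross b' hb' b hb z (le_antisymm hz'.1 hz.1) hz'.2 hz.2).symm hz' hz
    · exact (B.compat b hb b' hb' z hz.2 hz'.2).pull _ _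
  have hvert : ∀ a ∈ 𝒜, ∀ z ∈ a.2.N, ∀ᶠ z' in 𝓝 z, z' ∈ a.2.N → (z'.1, z.2) ∈ a.2.N := by
    rintro _ (⟨b, hb, rfl⟩ | ⟨b, hb, rfl⟩) z hz
    · filter_upwards [(tendsto_level _).eventually ((A.isOpen b hb).mem_nhds hz.2)] with z' h _ using ⟨hz.1, h⟩
    · filter_upwards [(tendsto_level _).eventually ((B.isOpen b hb).mem_nhds hz.2)] with z' h _ using ⟨hz.1, h⟩
  have hcover : ∀ z0 : T × ℝ, ∃ a ∈ 𝒜, ∃ b ∈ 𝒜, ∀ᶠ z in 𝓝 z0,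
      (z.2 ≤ z0.2 → z ∈ a.2.N) ∧ (z0.2 ≤ z.2 → z ∈ b.2.N) := by
    intro z0
    obtain ⟨b, hb, hzb⟩ := A.cover z0
    obtain ⟨b', hb', hzb'⟩ := B.cover z0
    have m1 : (⟨b.1, b.2.pull _ v⟩ : Σ c, Sec r c) ∈ 𝒜 := Or.inl ⟨b, hb, rfl⟩
    have m2 : (⟨b'.1, b'.2.pull _ v'⟩ : Σ c, Sec r c) ∈ 𝒜 := Or.inr ⟨b', hb', rfl⟩
    rcases lt_trichotomy z0.2 a with h | h | h
    · refine ⟨_, m1, _, m1, ?_⟩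
      filter_upwards [(A.isOpen b hb).mem_nhds hzb,
        (isOpen_lt continuous_snd continuous_const).mem_nhds h] with z h1 h2
      exact ⟨fun _ => ⟨le_of_lt h2, h1⟩, fun _ => ⟨le_of_lt h2, h1⟩⟩
    · refine ⟨_, m1, _, m2, ?_⟩
      filter_upwards [(A.isOpen b hb).mem_nhds hzb, (B.isOpen b' hb').mem_nhds hzb'] with z h1 h2
      exact ⟨fun h3 => ⟨h3.trans h.le, h1⟩, fun h3 => ⟨h.ge.trans h3, h2⟩⟩
    · refine ⟨_, m2, _, m2, ?_⟩
      filter_upwards [(B.isOpen b' hb').mem_nhds hzb',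
        (isOpen_lt continuous_const continuous_snd).mem_nhds h] with z h1 h2
      exact ⟨fun _ => ⟨le_of_lt h2, h1⟩, fun _ => ⟨le_of_lt h2, h1⟩⟩
  let D : Pth X T := ofSides r 𝒜 hcompat hvert hcover
  refine ⟨D, (PIso.symm ⟨v, fun b hb =>
      isSec_ofSides (a := ⟨b.1, _⟩) (Or.inl ⟨b, hb, rfl⟩)⟩),
    (PIso.symm ⟨v', fun b hb =>
      isSec_ofSides (a := ⟨b.1, _⟩) (Or.inr ⟨b, hb, rfl⟩)⟩), fun z h => ?_⟩
  change j.J z h ≫ inv (inv (u' z h.ge)) = inv (inv (u z h.le))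
  rw [IsIso.inv_inv, IsIso.inv_inv, hu z h]

end Pth

end Sections

lemma eq_of_eventually_eq {S : Set ℝ} (hS : _root_.IsPreconnected S) {α : Type*} (F : ∀ s ∈ S, α)
    (h : ∀ s hs, ∀ᶠ s' in 𝓝 s, ∀ hs', F s' hs' = F s hs) {s s' : ℝ} (hs : s ∈ S) (hs' : s' ∈ S) :
    F s hs = F s' hs' := by
  have := Subtype.preconnectedSpace hS
  have hl : IsLocallyConstant (fun x : S => F x.1 x.2) := by
    rw [IsLocallyConstant.iff_eventually_eq]
    intro x
    have := h x.1 x.2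
    exact (continuous_subtype_val.tendsto x).eventually this |>.mono fun y hy => hy y.2
  exact hl.apply_eq_of_preconnectedSpace ⟨s, hs⟩ ⟨s', hs'⟩

lemma icc_induction {P : ℝ → ℝ → Prop} {a b : ℝ} (hab : a ≤ b)
    (join : ∀ x y z, a ≤ x → x ≤ y → y ≤ z → z ≤ b → P x y → P y z → P x z)
    (loc : ∀ x ∈ Icc a b, ∃ V ∈ 𝓝 x, ∀ y z, y ≤ z → Icc y z ⊆ V → a ≤ y → z ≤ b → P y z) : P a b := by
  choose! V hV hP using loc
  obtain ⟨t, h0, hmono, ⟨m, hm⟩, hc⟩ := exists_monotone_Icc_subset_open_cover_Icc hab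

    (fun x => isOpen_interior.preimage continuous_subtype_val)
    (fun x _ => mem_iUnion.2 ⟨x, mem_interior_iff_mem_nhds.2 (hV x x.2)⟩)
  have key : ∀ n, P (t 0) (t n) := by
    intro n
    have hstep : ∀ k, P (t k) (t (k + 1)) := by
      intro k
      obtain ⟨x, hx⟩ := hc k
      refine hP x x.2 _ _ (hmono (Nat.le_succ k)) ?_ (t k).2.1 (t (k + 1)).2.2
      intro y hy
      exact interior_subset (hx (show (⟨y, (t k).2.1.trans hy.1, hy.2.trans (t (k + 1)).2.2⟩ : Icc a b) ∈ _ from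
        ⟨hy.1, hy.2⟩))
    induction n with
    | zero =>
      obtain ⟨x, hx⟩ := hc 0
      refine hP x x.2 _ _ le_rfl ?_ (t 0).2.1 (t 0).2.2
      intro y hy
      have : y = t 0 := le_antisymm hy.2 hy.1
      subst this
      exact interior_subset (hx ⟨le_rfl, hmono (Nat.le_succ 0)⟩)
    | succ n ih =>
      exact join _ _ _ (t 0).2.1 (hmono (Nat.zero_le n)) (hmono (Nat.le_succ n)) (t (n + 1)).2.2 ih (hstep n)
  have := key m
  rwa [h0, hm m le_rfl] at this

section Flat

namespace Pth

variable {A B D : Pth X T}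

/-- The second projection. -/
def sndMap (T : Type*) [TopologicalSpace T] : C(T × ℝ, ℝ) := ⟨Prod.snd, continuous_snd⟩

/-- The member of a family of paths at a parameter. -/
def at' (A : Pth X T) (t : T) : Pth X Unit := A.comap (ContinuousMap.const Unit t) (sndMap Unit)

lemma eventually_fst_eq {z0 : T × ℝ} {P : T × ℝ → Prop} (h : ∀ᶠ z in 𝓝 z0, P z) : ∀ᶠ s in 𝓝 z0.2, P (z0.1, s) :=
  (Continuous.tendsto' (by fun_prop) _ _ rfl).eventually h

lemma eventually_snd_eq {z0 : T × ℝ} {P : T × ℝ → Prop} (h : ∀ᶠ z in 𝓝 z0, P z) : ∀ᶠ t in 𝓝 z0.1, P (t, z0.2) :=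
  (Continuous.tendsto' (by fun_prop) _ _ rfl).eventually h

/-- Changes of sections are constant along the paths. -/
lemma IsSec.trans_const {a : Sec A.r c} {b : Sec A.r c'} (ha : A.IsSec a) (hb : A.IsSec b) {t : T}
    {S : Set ℝ} (hS : _root_.IsPreconnected S) (hSa : ∀ s ∈ S, (t, s) ∈ a.N) (hSb : ∀ s ∈ S, (t, s) ∈ b.N)
    {s s' : ℝ} (hs : s ∈ S) (hs' : s' ∈ S) :
    (a.trans b (t, s) (hSa s hs) (hSb s hs)).tr = (a.trans b (t, s') (hSa s' hs') (hSb s' hs')).tr := by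
  refine eq_of_eventually_eq hS (α := X.Tran c c')
    (fun s hs => (a.trans b (t, s) (hSa s hs) (hSb s hs)).tr) (fun s hs => ?_) hs hs'
  obtain ⟨G, -, hE⟩ := ha.smoothAt hb (hSa s hs) (hSb s hs)
  filter_upwards [eventually_fst_eq hE] with s' h hs'
  rw [h (hSa s' hs') (hSb s' hs'), (hE.self_of_nhds (hSa s hs) (hSb s hs))]

/-- A section through a given isomorphism. -/
lemma exists_isSec_through (A : Pth X T) (z0 : T × ℝ) {x : X.C c} (m : A.r z0 ⟶ ⟨c, x⟩) :
    ∃ (a : Sec A.r c) (h : z0 ∈ a.N), A.IsSec a ∧ IsOpen a.N ∧ (a.h z0 h).tr = m.tr := by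
  obtain ⟨d, b, hb, ho, hz⟩ := A.exists_isSec z0
  set ξ := (inv (b.h z0 hz) ≫ m).tr
  refine ⟨b.post (b.N ∩ b.f ⁻¹' (X.map ξ).source) inter_subset_left (fun _ => ξ)
    (fun _ _ => continuousAt_const) (fun z hz => hz.2), ⟨hz, ((inv (b.h z0 hz) ≫ m).mem)⟩, hb.post _ _ _ _ _,
    b.cont.isOpen_inter_preimage ho (X.map ξ).open_source, ?_⟩
  have e : m = b.h z0 hz ≫ (inv (b.h z0 hz) ≫ m) := by simp
  conv_rhs => rw [e]
  exact comp_congr rfl rfl rfl _ _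

lemma exists_continuousAt_trans {a : Sec A.r c} {b : Sec A.r c'} (ha : A.IsSec a) (hb : A.IsSec b)
    {t0 : T} {s : ℝ} (h : ∀ᶠ t in 𝓝 t0, (t, s) ∈ a.N ∧ (t, s) ∈ b.N) :
    ∃ G : T → X.Tran c c', ∀ᶠ t in 𝓝 t0, ContinuousAt G t ∧ ∀ ha hb, (a.trans b (t, s) ha hb).tr = G t := by
  obtain ⟨G, hG, hE⟩ := ha.smoothAt hb h.self_of_nhds.1 h.self_of_nhds.2
  refine ⟨G, ?_⟩
  filter_upwards [(eventually_snd_eq hE).eventually_nhds, h.eventually_nhds] with t h1 h2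
  refine ⟨?_, h1.self_of_nhds⟩
  obtain ⟨G', hG', hE'⟩ := ha.smoothAt hb h2.self_of_nhds.1 h2.self_of_nhds.2
  refine hG'.congr ?_
  filter_upwards [eventually_snd_eq hE', h1, h2] with t' e1 e2 e3
  rw [← e1 e3.1 e3.2, ← e2 e3.1 e3.2]

/-- Sections over two adjacent domains can be joined. -/
lemma exists_paste {e₁ e2 : Sec A.r c} (h₁ : A.IsSec e₁) (h₂ : A.IsSec e2) (b : ℝ)
    (N : Set (T × ℝ)) (hN1 : ∀ z ∈ N, z.2 ≤ b → z ∈ e₁.N) (hN2 : ∀ z ∈ N, b ≤ z.2 → z ∈ e2.N)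
    (hv : ∀ z ∈ N, ∀ᶠ z' in 𝓝 z, z' ∈ N → (z'.1, z.2) ∈ N)
    (hag : ∀ z (hz : z ∈ N) (h : z.2 = b), (e₁.h z (hN1 z hz h.le)).tr = (e2.h z (hN2 z hz h.ge)).tr) :
    ∃ e : Sec A.r c, A.IsSec e ∧ e.N = N ∧ (∀ z h h', z.2 ≤ b → (e.h z h).tr = (e₁.h z h').tr) ∧
      (∀ z h h', b ≤ z.2 → (e.h z h).tr = (e2.h z h').tr) := by
  classical
  set f : T × ℝ → X.C c := fun z => if z.2 ≤ b then e₁.f z else e2.f z with hf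
  have hf2 : ∀ z ∈ N, b ≤ z.2 → f z = e2.f z := by
    intro z hz hb
    by_cases h : z.2 ≤ b
    · have e1 := (e₁.h z (hN1 z hz h)).eq
      rw [(hag z hz (le_antisymm h hb))] at e1
      simp only [hf, if_pos h]
      exact e1.symm.trans ((e2.h z (hN2 z hz hb)).eq)
    · simp only [hf, if_neg h]
  have hfc : ContinuousOn f N := by
    apply continuousOn_of_sides
    · refine (e₁.cont.mono fun z hz => hN1 z hz.1 hz.2).congr fun z hz => ?_
      simp only [hf, if_pos (show z.2 ≤ b from hz.2)]
    · exact (e2.cont.mono fun z hz => hN2 z hz.1 hz.2).congr fun z hz => hf2 z hz.1 hz.2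
  have hh : ∀ z (hz : z ∈ N), ∃ m : A.r z ⟶ ⟨c, f z⟩,
      (∀ h', z.2 ≤ b → m.tr = (e₁.h z h').tr) ∧ (∀ h', b ≤ z.2 → m.tr = (e2.h z h').tr) := by
    intro z hz
    by_cases h : z.2 ≤ b
    · have e : f z = e₁.f z := by simp only [hf, if_pos h]
      rw [e]
      exact ⟨e₁.h z (hN1 z hz h), fun _ _ => rfl, fun _ hb => hag z hz (le_antisymm h hb)⟩
    · have hb : b ≤ z.2 := (lt_of_not_ge h).le
      rw [hf2 z hz hb]
      exact ⟨e2.h z (hN2 z hz hb), fun _ h' => absurd h' h, fun _ _ => rfl⟩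
  choose m hm1 hm2 using hh
  refine ⟨⟨N, f, hfc, m⟩, isSec_of_sides fun z hz => ?_, rfl, fun z h h' hl => hm1 z h h' hl,
    fun z h h' hl => hm2 z h h' hl⟩
  have hs1 : A.IsSec ((⟨N, f, hfc, m⟩ : Sec A.r c).restrict {z | z.2 ≤ b}) :=
    h₁.congr (fun z hz => hN1 z hz.1 hz.2) fun z hz => hm1 z hz.1 _ hz.2
  have hs2 : A.IsSec ((⟨N, f, hfc, m⟩ : Sec A.r c).restrict {z | b ≤ z.2}) :=
    h₂.congr (fun z hz => hN2 z hz.1 hz.2) fun z hz => hm2 z hz.1 _ hz.2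
  rcases lt_trichotomy z.2 b with h | h | h
  · refine ⟨_, _, hs1, hs1, h.le, h.le, ?_⟩
    filter_upwards [hv z hz, (isOpen_lt continuous_snd continuous_const).mem_nhds h] with z' h1 h2 h3
    exact ⟨h1 h3, h.le, h.le, Or.inl (le_of_lt h2 : z'.2 ≤ b)⟩
  · refine ⟨_, _, hs1, hs2, h.le, h.ge, ?_⟩
    filter_upwards [hv z hz] with z' h1 h2
    exact ⟨h1 h2, h.le, h.ge, le_total _ _⟩
  · refine ⟨_, _, hs2, hs2, h.le, h.le, ?_⟩
    filter_upwards [hv z hz, (isOpen_lt continuous_const continuous_snd).mem_nhds h] with z' h1 h2 h3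
    exact ⟨h1 h3, h.le, h.le, Or.inl (le_of_lt h2 : b ≤ z'.2)⟩

/-- The section of a member of a family given by a section of the family. -/
def secAt (a : Sec A.r c) (t : T) : Sec (A.at' t).r c := a.comap (ContinuousMap.const Unit t) (sndMap Unit)

lemma IsSec.secAt {a : Sec A.r c} (ha : A.IsSec a) (t : T) : (A.at' t).IsSec (secAt a t) := ha.comap _ _

/-- A section over one path of a family extends to the neighbouring paths, with prescribed values
at one place. -/
lemma exists_parallel (A : Pth X T) (t0 : T) {a b : ℝ} (hab : a ≤ b) {e0 : Sec (A.at' t0).r c}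
    (he0 : (A.at' t0).IsSec e0) (hN0 : ∀ s ∈ Icc a b, ((), s) ∈ e0.N) {s0 : ℝ} (hs0 : s0 ∈ Icc a b)
    {m : Sec A.r c} (hm : A.IsSec m) (hmN : ∀ᶠ t in 𝓝 t0, (t, s0) ∈ m.N)
    (hag : ∀ h h', (m.h (t0, s0) h).tr = (e0.h ((), s0) h').tr) :
    ∃ (M : Set T) (e : Sec A.r c), IsOpen M ∧ t0 ∈ M ∧ A.IsSec e ∧ e.N = M ×ˢ Icc a b ∧
      (∀ s h h', (e.h (t0, s) h).tr = (e0.h ((), s) h').tr) ∧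
      ∀ t ∈ M, ∀ h h', (e.h (t, s0) h).tr = (m.h (t, s0) h').tr := by
  revert s0 m
  apply icc_induction hab
  · intro x y z hx hxy hyz hz h1 h2 s0 hs0 m hm hmN hag
    have join : ∀ {M1 M2 : Set T} {e1 e2 : Sec A.r c},
        (IsOpen M1 ∧ t0 ∈ M1 ∧ A.IsSec e1 ∧ e1.N = M1 ×ˢ Icc x y ∧
          (∀ s h h', (e1.h (t0, s) h).tr = (e0.h ((), s) h').tr)) →
        (IsOpen M2 ∧ t0 ∈ M2 ∧ A.IsSec e2 ∧ e2.N = M2 ×ˢ Icc y z ∧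
          (∀ s h h', (e2.h (t0, s) h).tr = (e0.h ((), s) h').tr)) →
        (∀ t ∈ M1, t ∈ M2 → ∀ h h', (e1.h (t, y) h).tr = (e2.h (t, y) h').tr) →
        (s0 ≤ y ∧ (∀ t ∈ M1, ∀ h h', (e1.h (t, s0) h).tr = (m.h (t, s0) h').tr) ∨
          y ≤ s0 ∧ ∀ t ∈ M2, ∀ h h', (e2.h (t, s0) h).tr = (m.h (t, s0) h').tr) →
        ∃ (M : Set T) (e : Sec A.r c), IsOpen M ∧ t0 ∈ M ∧ A.IsSec e ∧ e.N = M ×ˢ Icc x z ∧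
          (∀ s h h', (e.h (t0, s) h).tr = (e0.h ((), s) h').tr) ∧
          ∀ t ∈ M, ∀ h h', (e.h (t, s0) h).tr = (m.h (t, s0) h').tr := by
      rintro M1 M2 e1 e2 ⟨ho1, ht1, he1, hN1, a1⟩ ⟨ho2, ht2, he2, hN2, a2⟩ h hl
      obtain ⟨e, he, hN, c1, c2⟩ := exists_paste he1 he2 y ((M1 ∩ M2) ×ˢ Icc x z)
        (fun z' hz' hl => hN1 ▸ ⟨hz'.1.1, hz'.2.1, hl⟩) (fun z' hz' hl => hN2 ▸ ⟨hz'.1.2, hl, hz'.2.2⟩)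
        (fun z' hz' => .of_forall fun z'' h => ⟨h.1, hz'.2⟩) (by
          rintro ⟨t, s⟩ hz' rfl
          exact h t hz'.1.1 hz'.1.2 _ _)
      refine ⟨_, e, ho1.inter ho2, ⟨ht1, ht2⟩, he, hN, fun s h h' => ?_, fun t ht h h' => ?_⟩
      · have hs := hN ▸ h
        rcases le_total s y with hsy | hsy
        · exact (c1 _ h (hN1 ▸ ⟨ht1, hs.2.1, hsy⟩) hsy).trans (a1 s _ h')
        · exact (c2 _ h (hN2 ▸ ⟨ht2, hsy, hs.2.2⟩) hsy).trans (a2 s _ h')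
      · rcases hl with ⟨hl, H⟩ | ⟨hl, H⟩
        · exact (c1 _ h (hN1 ▸ ⟨ht.1, hs0.1, hl⟩) hl).trans (H t ht.1 _ h')
        · exact (c2 _ h (hN2 ▸ ⟨ht.2, hl, hs0.2⟩) hl).trans (H t ht.2 _ h')
    rcases le_total s0 y with hl | hl
    · obtain ⟨M1, e1, ho1, ht1, he1, hN1, a1, b1⟩ := h1 ⟨hs0.1, hl⟩ hm hmN hag
      obtain ⟨M2, e2, ho2, ht2, he2, hN2, a2, b2⟩ := h2 ⟨le_rfl, hyz⟩ he1
        (mem_of_superset (ho1.mem_nhds ht1) fun t ht => hN1 ▸ ⟨ht, hxy, le_rfl⟩) (a1 y)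
      exact join ⟨ho1, ht1, he1, hN1, a1⟩ ⟨ho2, ht2, he2, hN2, a2⟩
        (fun t _ h2 h h' => (b2 t h2 h' h).symm) (.inl ⟨hl, b1⟩)
    · obtain ⟨M2, e2, ho2, ht2, he2, hN2, a2, b2⟩ := h2 ⟨hl, hs0.2⟩ hm hmN hag
      obtain ⟨M1, e1, ho1, ht1, he1, hN1, a1, b1⟩ := h1 ⟨hxy, le_rfl⟩ he2
        (mem_of_superset (ho2.mem_nhds ht2) fun t ht => hN2 ▸ ⟨ht, le_rfl, hyz⟩) (a2 y)
      exact join ⟨ho1, ht1, he1, hN1, a1⟩ ⟨ho2, ht2, he2, hN2, a2⟩ (fun t h _ => b1 t h) (.inr ⟨hl, b2⟩)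
  · intro x hx
    obtain ⟨d, β, hβ, ho, hβx⟩ := A.exists_isSec (t0, x)
    obtain ⟨M, V, hMo, hVo, hM, hV, hMV⟩ := isOpen_prod_iff.1 ho t0 x hβx
    refine ⟨V, hVo.mem_nhds hV, fun y z hyz hsub hay hzb s0 hs0 m hm hmN hag => ?_⟩
    have hyzN : ∀ s ∈ Icc y z, ((), s) ∈ e0.N := fun s hs => hN0 s ⟨hay.trans hs.1, hs.2.trans hzb⟩
    have hyzβ : ∀ s ∈ Icc y z, ((), s) ∈ (secAt β t0).N := fun s hs => hMV ⟨hM, hsub hs⟩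
    obtain ⟨G, hG⟩ := exists_continuousAt_trans hβ hm (by
      filter_upwards [hMo.mem_nhds hM, hmN] with t h1 h2
      exact ⟨hMV ⟨h1, hsub hs0⟩, h2⟩)
    have hconst : ∀ s (hs : s ∈ Icc y z), ((secAt β t0).trans e0 ((), s) (hyzβ s hs) (hyzN s hs)).tr = G t0 := by
      intro s hs
      rw [(hβ.secAt t0).trans_const he0 isPreconnected_Icc hyzβ hyzN hs hs0]
      rw [← (hG.self_of_nhds.2 (hMV ⟨hM, hsub hs0⟩) hmN.self_of_nhds)]
      exact comp_congr rfl (hag _ _).symm rfl _ _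
    have htube : ∀ᶠ t in 𝓝 t0, ∀ s ∈ Icc y z, β.f (t, s) ∈ (X.map (G t)).source := by
      refine (isCompact_Icc).eventually_forall_of_forall_eventually fun s hs => ?_
      have hm0 : β.f (t0, s) ∈ (X.map (G t0)).source := by
        rw [← hconst s hs]
        exact ((secAt β t0).trans e0 ((), s) (hyzβ s hs) (hyzN s hs)).mem
      have ht : Tendsto (fun z => (G z.1, β.f z)) (𝓝 (t0, s)) (𝓝 (G t0, β.f (t0, s))) :=
        Tendsto.prodMk_nhds (hG.self_of_nhds.1.tendsto.comp continuous_fst.continuousAt)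
          (β.cont.continuousAt (ho.mem_nhds (hMV ⟨hM, hsub hs⟩)))
      exact ht.eventually (eventually_mem_source hm0)
    obtain ⟨M', hM', hMo', ht'⟩ := eventually_nhds_iff.1 (hG.and (htube.and (hMo.mem_nhds hM)))
    have hsubN : M' ×ˢ Icc y z ⊆ β.N := fun w hw => hMV ⟨(hM' _ hw.1).2.2, hsub hw.2⟩
    refine ⟨M', β.post (M' ×ˢ Icc y z) hsubN G (fun w hw => (hM' _ hw.1).1.1)
      (fun w hw => (hM' _ hw.1).2.1 _ hw.2), hMo', ht', hβ.post _ _ _ _ _, rfl, ?_, ?_⟩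
    · intro s h h'
      have e : e0.h ((), s) h' = (secAt β t0).h ((), s) (hyzβ s h.2) ≫
        (secAt β t0).trans e0 ((), s) (hyzβ s h.2) h' := by simp [Sec.trans]
      rw [e, comp_tr]
      exact comp_congr rfl (hconst s h.2).symm rfl _ _
    · intro t htM h h'
      have e : m.h (t, s0) h' = β.h (t, s0) (hsubN h) ≫ β.trans m (t, s0) (hsubN h) h' := by simp [Sec.trans]
      rw [e, comp_tr]
      exact comp_congr rfl ((hM' t htM).1.2 _ _).symm rfl _ _

end Pth

namespace PIso

variable {A B : Pth X T} {S : Set (T × ℝ)}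

/-- The restriction of an isomorphism to one parameter. -/
def at' (j : PIso A B S) (t : T) : PIso (A.at' t) (B.at' t) {z | (t, z.2) ∈ S} :=
  j.comap (ContinuousMap.const Unit t) (Pth.sndMap Unit)

lemma trans_const (j : PIso A B S) {a : Sec A.r c} {b : Sec B.r c'} (ha : A.IsSec a)
    (hb : B.IsSec b) {t : T} {I : Set ℝ} (hI : _root_.IsPreconnected I)
    (hIS : ∀ s ∈ I, (t, s) ∈ S) (hIa : ∀ s ∈ I, (t, s) ∈ a.N) (hIb : ∀ s ∈ I, (t, s) ∈ b.N)
    {s s' : ℝ} (hs : s ∈ I) (hs' : s' ∈ I) :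
    (inv (a.h (t, s) (hIa s hs)) ≫ j.J (t, s) (hIS s hs) ≫ b.h (t, s) (hIb s hs)).tr =
    (inv (a.h (t, s') (hIa s' hs')) ≫ j.J (t, s') (hIS s' hs') ≫ b.h (t, s') (hIb s' hs')).tr :=
  ha.trans_const (j.isSec_pull hb) hI hIa (fun s hs => ⟨hIS s hs, hIb s hs⟩) hs hs'

/-- Isomorphisms that agree at one place of a path agree all along. -/
lemma eq_of_eq (j : PIso A B S) {S' : Set (T × ℝ)} (k : PIso A B S') {t : T} {I : Set ℝ}
    (hI : _root_.IsPreconnected I)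
    (hIS : ∀ s ∈ I, (t, s) ∈ S) (hIS' : ∀ s ∈ I, (t, s) ∈ S') {s s' : ℝ} (hs : s ∈ I) (hs' : s' ∈ I)
    (h : j.J (t, s) (hIS s hs) = k.J (t, s) (hIS' s hs)) :
    j.J (t, s') (hIS s' hs') = k.J (t, s') (hIS' s' hs') := by
  have key := eq_of_eventually_eq hI (fun s hs => j.J (t, s) (hIS s hs) = k.J (t, s) (hIS' s hs)) ?_ hs hs'
  · exact key ▸ h
  intro s hs
  obtain ⟨d, a, ha, hao, haz⟩ := A.exists_isSec (t, s)
  obtain ⟨d', b, hb, hbo, hbz⟩ := B.exists_isSec (t, s)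
  obtain ⟨G, -, hE⟩ := ha.smoothAt (j.isSec_pull hb) haz ⟨hIS s hs, hbz⟩
  obtain ⟨G', -, hE'⟩ := ha.smoothAt (k.isSec_pull hb) haz ⟨hIS' s hs, hbz⟩
  have aux : ∀ s' (hs' : s' ∈ I) (ha' : (t, s') ∈ a.N) (hb' : (t, s') ∈ b.N),
      (a.trans (b.pull S j.J) (t, s') ha' ⟨hIS s' hs', hb'⟩).tr = G t →
      (a.trans (b.pull S' k.J) (t, s') ha' ⟨hIS' s' hs', hb'⟩).tr = G' t →
      ((j.J (t, s') (hIS s' hs') = k.J (t, s') (hIS' s' hs')) ↔ G t = G' t) := by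
    intro s' hs' ha' hb' e1 e2
    rw [← e1, ← e2]
    constructor
    · intro e
      simp only [Sec.trans, Sec.pull, e]
    · intro e
      exact (cancel_mono _).1 (by simpa [Sec.trans, Sec.pull] using (hom_ext e))
  filter_upwards [Pth.eventually_fst_eq hE, Pth.eventually_fst_eq hE',
    Pth.eventually_fst_eq (hao.mem_nhds haz), Pth.eventually_fst_eq (hbo.mem_nhds hbz)]
    with s' h1 h2 h3 h4 hs'
  refine propext ((aux s' hs' h3 h4 (h1 _ _) (h2 _ _)).trans (aux s hs haz hbz ?_ ?_).symm)
  · exact hE.self_of_nhds _ _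
  · exact hE'.self_of_nhds _ _

/-- A family of isomorphisms that is flat along the paths is smooth if it is so at one place. -/
lemma smooth_of_flat {I : Set ℝ} (hI : I.OrdConnected) (J : ∀ z ∈ {z : T × ℝ | z.2 ∈ I}, A.r z ⟶ B.r z)
    (hflat : ∀ t, ∃ j : PIso (A.at' t) (B.at' t) {z | z.2 ∈ I}, ∀ s (hs : s ∈ I),
      j.J ((), s) hs = J (t, s) hs) {s0 : ℝ} (hs0 : s0 ∈ I)
    (hsm : ∀ b ∈ B.atlas, A.IsSec ((b.2.pull _ J).restrict {z | z.2 = s0})) :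
    ∀ b ∈ B.atlas, A.IsSec (b.2.pull _ J) := by
  have box : ∀ (t0 : T) (s : ℝ) {c c' : X.ι} (a : Sec A.r c) (b : Sec B.r c'), A.IsSec a →
      B.IsSec b → IsOpen a.N → IsOpen b.N → (t0, s) ∈ a.N → (t0, s) ∈ b.N →
      ∃ M ∈ 𝓝 t0, ∃ V ∈ 𝓝 s, M ×ˢ V ⊆ a.N ∧ M ×ˢ V ⊆ b.N ∧
        ∀ t ∈ M, ∀ s1 ∈ V, ∀ s2 ∈ V, s1 ∈ I → s2 ∈ I → ∀ h₁ h1' h₂ h2',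
          (a.trans (b.pull _ J) (t, s1) h₁ h1').tr = (a.trans (b.pull _ J) (t, s2) h₂ h2').tr := by
    intro t0 s c c' a b ha hb hao hbo hza hzb
    obtain ⟨M, V, hMo, hVo, hM, hV, hMV⟩ := isOpen_prod_iff.1 (hao.inter hbo) t0 s ⟨hza, hzb⟩
    obtain ⟨ε, hε, hball⟩ := Metric.isOpen_iff.1 hVo s hV
    refine ⟨M, hMo.mem_nhds hM, Metric.ball s ε, Metric.ball_mem_nhds s hε,
      fun z hz => (hMV ⟨hz.1, hball hz.2⟩).1, fun z hz => (hMV ⟨hz.1, hball hz.2⟩).2, ?_⟩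
    intro t ht s1 hs1 s2 hs2 hi₁ hi₂ h₁ h1' h₂ h2'
    obtain ⟨j, hj⟩ := hflat t
    have := j.trans_const (ha.secAt t) (hb.secAt t) (t := ())
      (((convex_ball s ε).ordConnected).inter hI).isPreconnected (fun s' hs' => hs'.2)
      (fun s' hs' => (hMV ⟨ht, hball hs'.1⟩).1) (fun s' hs' => (hMV ⟨ht, hball hs'.1⟩).2)
      ⟨hs1, hi₁⟩ ⟨hs2, hi₂⟩
    rwa [hj s1 hi₁, hj s2 hi₂] at this
  refine fun b hb => Pth.isSec_of_local fun ⟨t0, s⟩ hz => ?_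
  let Q : ℝ → Prop := fun s => ∃ (c c' : X.ι) (a : Sec A.r c) (b : Sec B.r c'), A.IsSec a ∧
    B.IsSec b ∧ IsOpen a.N ∧ IsOpen b.N ∧ (t0, s) ∈ a.N ∧ (t0, s) ∈ b.N ∧
    a.SmoothAt ((b.pull _ J).restrict {z | z.2 = s}) (t0, s)
  have change' : ∀ s ∈ I, Q s → ∀ {c c' : X.ι} (a : Sec A.r c) (b : Sec B.r c'), A.IsSec a →
    B.IsSec b → IsOpen a.N → IsOpen b.N → (t0, s) ∈ a.N → (t0, s) ∈ b.N →
    a.SmoothAt ((b.pull _ J).restrict {z | z.2 = s}) (t0, s) := by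
    rintro s hs ⟨d, d', a', b', ha', hb', hao', hbo', hza', hzb', hS⟩ c c' a b ha hb hao hbo hza hzb
    have h2 : ((b'.pull _ J).restrict {z | z.2 = s}).SmoothAt ((b.pull _ J).restrict {z | z.2 = s}) (t0, s) := by
      obtain ⟨G, hG, hE⟩ := (hb'.smoothAt hb hzb' hzb).pull {z | z.2 ∈ I} J
      exact ⟨G, hG, hE.mono fun z hz h h' => hz h.1 h'.1⟩
    exact ((ha.smoothAt ha' hza hza').trans hS hza hza' ⟨⟨hs, hzb'⟩, rfl⟩ (mem_of_superset (hao'.mem_nhds hza') fun z hz _ _ => hz)).trans h2 hza ⟨⟨hs, hzb'⟩, rfl⟩ ⟨⟨hs, hzb⟩, rfl⟩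
      (mem_of_superset (hbo'.mem_nhds hzb') fun z hz _ h => ⟨⟨h.1.1, hz⟩, h.2⟩)
  have hQ0 : Q s0 := by
    obtain ⟨d, a, ha, hao, hza⟩ := A.exists_isSec (t0, s0)
    obtain ⟨b, hb, hzb⟩ := B.cover (t0, s0)
    exact ⟨d, b.1, a, b.2, ha, Pth.isSec_atlas hb, hao, B.isOpen b hb, hza, hzb,
      ha.smoothAt (hsm b hb) hza ⟨⟨hs0, hzb⟩, rfl⟩⟩
  have hQ : ∀ s ∈ I, Q s := by
    intro s hs
    have key := eq_of_eventually_eq hI.isPreconnected (fun s _ => Q s) ?_ hs hs0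
    · exact key ▸ hQ0
    intro s hs
    obtain ⟨d, a, ha, hao, hza⟩ := A.exists_isSec (t0, s)
    obtain ⟨d', b, hb, hbo, hzb⟩ := B.exists_isSec (t0, s)
    obtain ⟨M, hM, V, hV, hMa, hMb, hbox⟩ := box t0 s a b ha hb hao hbo hza hzb
    have step : ∀ s1 ∈ V, ∀ s2 ∈ V, s1 ∈ I → s2 ∈ I → Q s1 → Q s2 := by
      intro s1 h1 s2 h2 hi1 hi2 hq
      have ht0 := mem_of_mem_nhds hM
      obtain ⟨G, hG, hE⟩ := change' s1 hi1 hq a b ha hb hao hbo (hMa ⟨ht0, h1⟩) (hMb ⟨ht0, h1⟩)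
      refine ⟨d, d', a, b, ha, hb, hao, hbo, hMa ⟨ht0, h2⟩, hMb ⟨ht0, h2⟩, G, hG, ?_⟩
      have hc : Tendsto (Prod.fst : T × ℝ → T) (𝓝 (t0, s2)) (𝓝 t0) := continuous_fst.tendsto _
      filter_upwards [hc.eventually (Pth.eventually_snd_eq hE), hc.eventually hM] with z h3 h4 h5 h6
      obtain ⟨t, s'⟩ := z
      obtain rfl : s' = s2 := h6.2
      rw [← (h3 (hMa ⟨h4, h1⟩) ⟨⟨hi1, hMb ⟨h4, h1⟩⟩, rfl⟩)]
      exact hbox t h4 _ h2 _ h1 hi2 hi1 h5 h6.1 (hMa ⟨h4, h1⟩) ⟨hi1, hMb ⟨h4, h1⟩⟩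
    filter_upwards [hV] with s' h hs'
    exact propext ⟨step s' h s (mem_of_mem_nhds hV) hs' hs, step s (mem_of_mem_nhds hV) s' h hs hs'⟩
  obtain ⟨d, a, ha, hao, hza⟩ := A.exists_isSec (t0, s)
  refine ⟨d, a, ha, hza, mem_of_superset (hao.mem_nhds hza) fun z hz _ => hz, ?_⟩
  refine Sec.SmoothAt.symm ?_ hza hz
  obtain ⟨M, hM, V, hV, hMa, hMb, hbox⟩ := box t0 s a b.2 ha (Pth.isSec_atlas hb) hao (B.isOpen b hb) hza hz.2
  obtain ⟨G, hG, hE⟩ := change' s hz.1 (hQ s hz.1) a b.2 ha (Pth.isSec_atlas hb) hao (B.isOpen b hb) hza hz.2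
  refine ⟨G, hG, ?_⟩
  have hc : Tendsto (Prod.fst : T × ℝ → T) (𝓝 (t0, s)) (𝓝 t0) := continuous_fst.tendsto _
  filter_upwards [hc.eventually (Pth.eventually_snd_eq hE), hc.eventually hM, (continuous_snd.tendsto _).eventually hV] with z h3 h4 h5 h6 h7
  rw [← (h3 (hMa ⟨h4, mem_of_mem_nhds hV⟩) ⟨⟨hz.1, hMb ⟨h4, mem_of_mem_nhds hV⟩⟩, rfl⟩)]
  exact hbox z.1 h4 _ h5 _ (mem_of_mem_nhds hV) h7.1 hz.1 h6 h7 (hMa ⟨h4, mem_of_mem_nhds hV⟩)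
    ⟨hz.1, hMb ⟨h4, mem_of_mem_nhds hV⟩⟩

end PIso

end Flat

end Orbispace

namespace Subdivision

variable (P : Subdivision)

lemma lt_succ (k : Fin (P.n + 2)) : P.t k.castSucc < P.t k.succ := P.strictMono Fin.castSucc_lt_succ

lemma nonneg (k) : 0 ≤ P.t k := by rw [← P.zero]; exact P.strictMono.monotone (Fin.zero_le k)

lemma le_one (k) : P.t k ≤ 1 := by rw [← P.one]; exact P.strictMono.monotone (Fin.le_last k)

lemma piece_subset_Icc (k : Fin (P.n + 2)) : P.piece k ⊆ Icc 0 1 := fun _ hs =>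
  ⟨(P.nonneg _).trans hs.1, hs.2.trans (P.le_one _)⟩

lemma left_mem (k : Fin (P.n + 2)) : P.t k.castSucc ∈ P.piece k := ⟨le_rfl, (P.lt_succ k).le⟩

lemma right_mem (k : Fin (P.n + 2)) : P.t k.succ ∈ P.piece k := ⟨(P.lt_succ k).le, le_rfl⟩

lemma zero_mem : (0 : ℝ) ∈ P.piece 0 := by
  have := P.left_mem 0
  rwa [Fin.castSucc_zero, P.zero] at this

lemma one_mem : (1 : ℝ) ∈ P.piece (Fin.last _) := by
  have := P.right_mem (Fin.last _)
  rwa [Fin.succ_last, P.one] at this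

lemma brk_mem_left (l : Fin (P.n + 1)) : P.brk l ∈ P.piece l.castSucc := P.right_mem _

lemma brk_mem_right (l : Fin (P.n + 1)) : P.brk l ∈ P.piece l.succ := by
  have := P.left_mem l.succ
  rwa [← Fin.succ_castSucc] at this

lemma isPreconnected_piece (k : Fin (P.n + 2)) : _root_.IsPreconnected (P.piece k) := isPreconnected_Icc

lemma exists_lt_le {s : ℝ} (h0 : 0 < s) (h1 : s ≤ 1) : ∃ k : Fin (P.n + 2), P.t k.castSucc < s ∧ s ≤ P.t k.succ := by
  have key : ∀ j : Fin (P.n + 3), s ≤ P.t j → ∃ k : Fin (P.n + 2), P.t k.castSucc < s ∧ s ≤ P.t k.succ := by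
    intro j
    induction j using Fin.induction with
    | zero => intro h; rw [P.zero] at h; exact absurd h (not_le.2 h0)
    | succ k ih =>
      intro h
      by_cases h' : s ≤ P.t k.castSucc
      · exact ih h'
      · exact ⟨k, not_le.1 h', h⟩
  exact key (Fin.last _) (by rwa [P.one])

lemma exists_le_lt {s : ℝ} (h0 : 0 ≤ s) (h1 : s < 1) : ∃ k : Fin (P.n + 2), P.t k.castSucc ≤ s ∧ s < P.t k.succ := by
  have key : ∀ j : Fin (P.n + 3), s < P.t j → ∃ k : Fin (P.n + 2), P.t k.castSucc ≤ s ∧ s < P.t k.succ := by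
    intro j
    induction j using Fin.induction with
    | zero => intro h; rw [P.zero] at h; exact absurd h (not_lt.2 h0)
    | succ k ih =>
      intro h
      by_cases h' : s < P.t k.castSucc
      · exact ih h'
      · exact ⟨k, not_lt.1 h', h⟩
  exact key (Fin.last _) (by rwa [P.one])

lemma exists_piece_left {s : ℝ} (hs : s ∈ Icc (0 : ℝ) 1) :
    ∃ k, s ∈ P.piece k ∧ ∀ᶠ s' in 𝓝 s, s' ≤ s → 0 ≤ s' → s' ∈ P.piece k := by
  rcases hs.1.eq_or_lt with h | h
  · subst h
    refine ⟨0, P.zero_mem, Eventually.of_forall fun s' h1 h2 => ?_⟩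
    rw [le_antisymm h1 h2]; exact P.zero_mem
  · obtain ⟨k, h1, h2⟩ := P.exists_lt_le h hs.2
    refine ⟨k, ⟨h1.le, h2⟩, ?_⟩
    filter_upwards [lt_mem_nhds h1] with s' h3 h4 _
    exact ⟨le_of_lt h3, h4.trans h2⟩

lemma exists_piece_right {s : ℝ} (hs : s ∈ Icc (0 : ℝ) 1) :
    ∃ k, s ∈ P.piece k ∧ ∀ᶠ s' in 𝓝 s, s ≤ s' → s' ≤ 1 → s' ∈ P.piece k := by
  rcases hs.2.eq_or_lt with h | h
  · subst h
    refine ⟨Fin.last _, P.one_mem, Eventually.of_forall fun s' h1 h2 => ?_⟩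
    rw [le_antisymm h2 h1]; exact P.one_mem
  · obtain ⟨k, h1, h2⟩ := P.exists_le_lt hs.1 h
    refine ⟨k, ⟨h1, h2.le⟩, ?_⟩
    filter_upwards [gt_mem_nhds h2] with s' h3 h4 _
    exact ⟨h1.trans h4, le_of_lt h3⟩

/-- Two intervals of a subdivision that meet are equal or adjacent. -/
lemma eq_or_adjacent {s : ℝ} {k k' : Fin (P.n + 2)} (hk : s ∈ P.piece k) (hk' : s ∈ P.piece k') :
    k = k' ∨ (∃ l : Fin (P.n + 1), k = l.castSucc ∧ k' = l.succ ∧ s = P.brk l) ∨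
      ∃ l : Fin (P.n + 1), k' = l.castSucc ∧ k = l.succ ∧ s = P.brk l := by
  have aux : ∀ {k k' : Fin (P.n + 2)}, s ∈ P.piece k → s ∈ P.piece k' → k < k' →
      ∃ l : Fin (P.n + 1), k = l.castSucc ∧ k' = l.succ ∧ s = P.brk l := by
    intro k k' hk hk' hlt
    have h2 : k'.castSucc ≤ k.succ := P.strictMono.le_iff_le.1 (hk'.1.trans hk.2)
    have h3 : (k' : ℕ) = k + 1 := by
      have a1 : (k' : ℕ) ≤ k + 1 := h2
      omega
    refine ⟨⟨k, by have := k'.2; omega⟩, Fin.ext rfl, Fin.ext h3, ?_⟩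
    have e : k'.castSucc = k.succ := Fin.ext h3
    refine le_antisymm hk.2 ?_
    have := hk'.1
    rw [e] at this
    exact this
  rcases lt_trichotomy k k' with h | h | h
  · exact Or.inr (Or.inl (aux hk hk' h))
  · exact Or.inl h
  · exact Or.inr (Or.inr (aux hk' hk h))

lemma brk_injective : Function.Injective P.brk := fun l l' h => by
  exact Fin.castSucc_injective _ (Fin.succ_injective _ (P.strictMono.injective h))

lemma eq_brk {s : ℝ} {l : Fin (P.n + 1)} (h : s ∈ P.piece l.castSucc) (h' : s ∈ P.piece l.succ) : s = P.brk l := by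
  refine le_antisymm h.2 ?_
  have := h'.1
  rwa [← Fin.succ_castSucc] at this

lemma exists_index {P P' : Subdivision} (h : range P.t ⊆ range P'.t) :
    ∃ θ : Fin (P'.n + 2) → Fin (P.n + 2), θ 0 = 0 ∧ θ (Fin.last _) = Fin.last _ ∧
      ∀ k, P'.piece k ⊆ P.piece (θ k) := by
  have hk : ∀ k : Fin (P'.n + 2), ∃ m : Fin (P.n + 2), P.t m.castSucc ≤ P'.t k.castSucc ∧
      P'.t k.castSucc < P.t m.succ := fun k =>
    P.exists_le_lt (P'.nonneg _) ((P'.lt_succ k).trans_le (P'.le_one _))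
  choose θ h1 h2 using hk
  have h3 : ∀ k, P'.t k.succ ≤ P.t (θ k).succ := by
    intro k
    obtain ⟨j, hj⟩ := h ⟨(θ k).succ, rfl⟩
    rw [← hj]
    apply P'.strictMono.monotone
    exact Fin.castSucc_lt_iff_succ_le.1 (P'.strictMono.lt_iff_lt.1 (by rw [hj]; exact h2 k))
  refine ⟨θ, ?_, ?_, fun k s hs => ⟨(h1 k).trans hs.1, hs.2.trans (h3 k)⟩⟩
  · have := h1 0
    rw [Fin.castSucc_zero, P'.zero, ← P.zero] at this
    exact Fin.ext (Nat.le_zero.1 (P.strictMono.le_iff_le.1 this))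
  · have := h3 (Fin.last _)
    rw [Fin.succ_last, P'.one, ← P.one] at this
    have h4 : P.n + 2 ≤ (θ (Fin.last _) : ℕ) + 1 := P.strictMono.le_iff_le.1 this
    refine Fin.ext ?_
    simp only [Fin.val_last]
    omega

lemma exists_common (P P' : Subdivision) : ∃ R : Subdivision, range P.t ⊆ range R.t ∧ range P'.t ⊆ range R.t := by
  classical
  set S : Finset ℝ := Finset.univ.image P.t ∪ Finset.univ.image P'.t with hS
  have hcard : P.n + 3 ≤ S.card := by
    have h1 : (Finset.univ.image P.t).card = P.n + 3 := by
      rw [Finset.card_image_of_injective _ P.strictMono.injective]; simp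
    rw [← h1]
    exact Finset.card_le_card Finset.subset_union_left
  obtain ⟨n, hn⟩ : ∃ n, S.card = n + 3 := ⟨S.card - 3, by omega⟩
  have hmem : ∀ x ∈ S, 0 ≤ x ∧ x ≤ 1 := by
    intro x hx
    simp only [hS, Finset.mem_union, Finset.mem_image, Finset.mem_univ, true_and] at hx
    rcases hx with ⟨k, rfl⟩ | ⟨k, rfl⟩
    · exact ⟨P.nonneg k, P.le_one k⟩
    · exact ⟨P'.nonneg k, P'.le_one k⟩
  have h0 : 0 ∈ S := by
    rw [← P.zero]; exact Finset.mem_union_left _ (Finset.mem_image_of_mem _ (Finset.mem_univ _))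
  have h1 : 1 ∈ S := by
    rw [← P.one]; exact Finset.mem_union_left _ (Finset.mem_image_of_mem _ (Finset.mem_univ _))
  have hr : range (S.orderEmbOfFin hn) = S := S.range_orderEmbOfFin hn
  refine ⟨⟨n, S.orderEmbOfFin hn, (S.orderEmbOfFin hn).strictMono, ?_, ?_⟩, ?_, ?_⟩
  · obtain ⟨k, hk⟩ : 0 ∈ range (S.orderEmbOfFin hn) := by rwa [hr]
    refine le_antisymm ?_ (hmem _ (S.orderEmbOfFin_mem hn 0)).1
    conv_rhs => rw [← hk]
    exact (S.orderEmbOfFin hn).monotone (Fin.zero_le k)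
  · obtain ⟨k, hk⟩ : 1 ∈ range (S.orderEmbOfFin hn) := by rwa [hr]
    refine le_antisymm (hmem _ (S.orderEmbOfFin_mem hn _)).2 ?_
    conv_lhs => rw [← hk]
    exact (S.orderEmbOfFin hn).monotone (Fin.le_last k)
  · rintro _ ⟨k, rfl⟩
    change _ ∈ range (S.orderEmbOfFin hn)
    rw [hr]
    exact Finset.mem_union_left _ (Finset.mem_image_of_mem _ (Finset.mem_univ _))
  · rintro _ ⟨k, rfl⟩
    change _ ∈ range (S.orderEmbOfFin hn)
    rw [hr]
    exact Finset.mem_union_right _ (Finset.mem_image_of_mem _ (Finset.mem_univ _))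

end Subdivision

namespace Orbispace

section ToAny

lemma toAny_inj_left {i j j' : X.ι} {ξ : X.Tran i j} {ξ' : X.Tran i j'} (h : toAny ξ = toAny ξ') :
    j = j' := (Sigma.mk.inj (eq_of_heq (Sigma.mk.inj h).2)).1

lemma eq_comp_eqToHom_of_toAny {x y y' : X.Obj} {m : x ⟶ y} {m' : x ⟶ y'}
    (h : toAny m.tr = toAny m'.tr) : ∃ e : y = y', m' = m ≫ eqToHom e := by
  obtain ⟨j, y⟩ := y
  obtain ⟨j', y'⟩ := y'
  obtain rfl : j = j' := toAny_inj_left h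
  have h' := toAny_injective h
  obtain rfl : y = y' := by
    have h1 := m.eq
    rw [h'] at h1
    exact h1.symm.trans m'.eq
  exact ⟨rfl, by rw [eqToHom_refl, Category.comp_id]; exact (hom_ext h').symm⟩

lemma eq_eqToHom_of_toAny {x y : X.Obj} {m : x ⟶ y} {i : X.ι} (h : toAny m.tr = toAny (X.one i)) :
    ∃ e : x = y, m = eqToHom e := by
  have hi : x.ch = i := (Sigma.mk.inj h).1
  subst hi
  obtain ⟨e, h'⟩ := eq_comp_eqToHom_of_toAny (m := 𝟙 x) h.symm
  exact ⟨e, by rw [h', Category.id_comp]⟩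

lemma obj_eq_of_basePoint_eq {i j : X.ι} {x : X.C i} {y : X.C j}
    (h : (⟨i, x⟩ : X.BasePoint) = ⟨j, y⟩) : (⟨i, x⟩ : X.Obj) = ⟨j, y⟩ := by
  obtain ⟨rfl, h⟩ := Sigma.mk.inj h
  rw [eq_of_heq h]

lemma basePoint_eq_of_obj_eq {i j : X.ι} {x : X.C i} {y : X.C j}
    (h : (⟨i, x⟩ : X.Obj) = ⟨j, y⟩) : (⟨i, x⟩ : X.BasePoint) = ⟨j, y⟩ := by
  obtain ⟨rfl, h⟩ := Obj.mk.inj h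
  rw [eq_of_heq h]

/-- A transition map of a path system as a morphism of germs. -/
def PathSys.mor {P : Subdivision} {c : Fin (P.n + 2) → X.ι} (τ : PathSys P c) (l : Fin (P.n + 1)) :
    (⟨c l.castSucc, τ.f l.castSucc (P.brk l)⟩ : X.Obj) ⟶ ⟨c l.succ, τ.f l.succ (P.brk l)⟩ :=
  ⟨τ.ξ l, τ.mem_source l, τ.glue l⟩

lemma Pth.IsSec.congr_toAny {T : Type*} [TopologicalSpace T] {A : Pth X T} {c c' : X.ι}
    {a : Sec A.r c} {b : Sec A.r c'} (ha : A.IsSec a) (hN : b.N ⊆ a.N)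
    (h : ∀ z (hb : z ∈ b.N), toAny (b.h z hb).tr = toAny (a.h z (hN hb)).tr) : A.IsSec b := by
  intro d hd z hz hz'
  obtain rfl : c' = c := toAny_inj_left (h z hz)
  exact ha.congr hN (fun z hb => toAny_injective (h z hb)) d hd z hz hz'

end ToAny

end Orbispace

namespace BasedSystem

variable (σ)

/-- The action of a based system on germs of transition maps. -/
def mor {α β : σ.Λ} {x : Y.C (σ.V α)} {y : Y.C (σ.V β)} (m : (⟨σ.V α, x⟩ : Y.Obj) ⟶ ⟨σ.V β, y⟩) :
    (⟨σ.W α, σ.f α x⟩ : X.Obj) ⟶ ⟨σ.W β, σ.f β y⟩ :=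
  ⟨σ.ρ α β m.tr, σ.mem_source _ _ m.mem, by
    have e : Y.map m.tr x = y := m.eq
    change X.map _ (σ.f α x) = σ.f β y
    rw [← σ.f_map _ _ m.mem, e]⟩

@[simp] lemma mor_tr {α β : σ.Λ} {x : Y.C (σ.V α)} {y : Y.C (σ.V β)}
    (m : (⟨σ.V α, x⟩ : Y.Obj) ⟶ ⟨σ.V β, y⟩) : (σ.mor m).tr = σ.ρ α β m.tr := rfl

@[simp] lemma mor_id {α : σ.Λ} (x : Y.C (σ.V α)) : σ.mor (𝟙 (⟨σ.V α, x⟩ : Y.Obj)) = 𝟙 _ := hom_ext (σ.ρ_one α)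

@[simp] lemma mor_comp {α β γ : σ.Λ} {x : Y.C (σ.V α)} {y : Y.C (σ.V β)} {z : Y.C (σ.V γ)}
    (m : (⟨σ.V α, x⟩ : Y.Obj) ⟶ ⟨σ.V β, y⟩) (n : (⟨σ.V β, y⟩ : Y.Obj) ⟶ ⟨σ.V γ, z⟩) :
    σ.mor (m ≫ n) = σ.mor m ≫ σ.mor n := by
  apply hom_ext
  rw [comp_tr]
  exact σ.ρ_comp m.tr n.tr x _ _

@[simp] lemma mor_inv {α β : σ.Λ} {x : Y.C (σ.V α)} {y : Y.C (σ.V β)}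
    (m : (⟨σ.V α, x⟩ : Y.Obj) ⟶ ⟨σ.V β, y⟩) : σ.mor (inv m) = inv (σ.mor m) := by
  apply IsIso.eq_inv_of_hom_inv_id
  rw [← mor_comp, IsIso.hom_inv_id, mor_id]

/-- A family of based relative loops. -/
structure PFam (T : Type*) [TopologicalSpace T] where
  A : Pth X T
  st : ∀ z : T × ℝ, z.2 = 0 → (A.r z ⟶ ⟨p.1, p.2⟩)
  st_sec : A.IsSec ⟨{z | z.2 = 0}, fun _ => p.2, continuousOn_const, st⟩
  α : σ.Λ
  v : C(T, Y.C (σ.V α))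
  en : ∀ z : T × ℝ, z.2 = 1 → (A.r z ⟶ ⟨σ.W α, σ.f α (v z.1)⟩)
  en_sec : A.IsSec ⟨{z | z.2 = 1}, fun z => σ.f α (v z.1), by fun_prop, en⟩

variable {σ}

namespace PFam

/-- Reparametrization of the parameter space. -/
def comap (F : σ.PFam T) (g : C(T', T)) : σ.PFam T' where
  A := F.A.comap g (Pth.sndMap T')
  st z hz := F.st (g z.1, z.2) hz
  st_sec := (F.st_sec.comap g (Pth.sndMap T')).congr (fun _ h => h) fun _ _ => rfl
  α := F.α
  v := F.v.comp g
  en z hz := F.en (g z.1, z.2) hz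
  en_sec := (F.en_sec.comap g (Pth.sndMap T')).congr (fun _ h => h) fun _ _ => rfl

/-- The member of the family at a parameter. -/
def at' (F : σ.PFam T) (t : T) : σ.PFam Unit := F.comap (ContinuousMap.const Unit t)

/-- Isomorphism of based relative loops. -/
def Iso (F F' : σ.PFam Unit) : Prop :=
  ∃ (j : PIso F.A F'.A {z | z.2 ∈ Icc (0 : ℝ) 1}) (ζ : (⟨σ.V F.α, F.v ()⟩ : Y.Obj) ⟶ ⟨σ.V F'.α, F'.v ()⟩),
    (∀ (z : Unit × ℝ) (hz : z.2 = 0), j.J z (by simp [hz]) ≫ F'.st z hz = F.st z hz) ∧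
    ∀ (z : Unit × ℝ) (hz : z.2 = 1), j.J z (by simp [hz]) ≫ F'.en z hz = F.en z hz ≫ σ.mor ζ

end PFam

/-- A system represents a based relative loop. -/
structure Rep (F : σ.PFam Unit) {P : Subdivision} {c : Fin (P.n + 2) → X.ι} {α : σ.Λ}
    (τ : σ.RelSys P c α) where
  h : ∀ k (z : Unit × ℝ), z.2 ∈ P.piece k → (F.A.r z ⟶ ⟨c k, τ.f k z.2⟩)
  sec : ∀ k, F.A.IsSec ⟨{z | z.2 ∈ P.piece k}, fun z => τ.f k z.2,
    (τ.continuousOn k).comp continuous_snd.continuousOn fun _ h => h, h k⟩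
  link : ∀ l (z : Unit × ℝ) (hz : z.2 = P.brk l),
    (inv (h l.castSucc z (hz ▸ P.brk_mem_left l)) ≫ h l.succ z (hz ▸ P.brk_mem_right l)).tr = τ.ξ l
  start : ∀ (z : Unit × ℝ) (hz : z.2 = 0), toAny (inv (F.st z hz) ≫ h 0 z (hz ▸ P.zero_mem)).tr = toAny (X.one p.1)
  fin : ∃ ζ : (⟨σ.V F.α, F.v ()⟩ : Y.Obj) ⟶ ⟨σ.V α, τ.v⟩, ∀ (z : Unit × ℝ) (hz : z.2 = 1),
    toAny (inv (F.en z hz) ≫ h (Fin.last _) z (hz ▸ P.one_mem)).tr = toAny (σ.ρ F.α α ζ.tr)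

namespace Rep

variable {F F' : σ.PFam Unit} {P P' : Subdivision} {c : Fin (P.n + 2) → X.ι} {c' : Fin (P'.n + 2) → X.ι}
  {τ : σ.RelSys P c α} {τ' : σ.RelSys P' c' α'}

lemma start_eq (R : Rep F τ) (z : Unit × ℝ) (hz : z.2 = 0) :
    ∃ e, R.h 0 z (hz ▸ P.zero_mem) = F.st z hz ≫ eqToHom e := by
  obtain ⟨e, h⟩ := eq_eqToHom_of_toAny (R.start z hz)
  exact ⟨e, (IsIso.inv_comp_eq _).1 h⟩

lemma fin_eq (R : Rep F τ) : ∃ ζ : (⟨σ.V F.α, F.v ()⟩ : Y.Obj) ⟶ ⟨σ.V α, τ.v⟩, ∀ z (hz : z.2 = 1),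
    ∃ e, R.h _ z (hz ▸ P.one_mem) = F.en z hz ≫ σ.mor ζ ≫ eqToHom e := by
  obtain ⟨ζ, hζ⟩ := R.fin
  refine ⟨ζ, fun z hz => ?_⟩
  obtain ⟨e, h⟩ := eq_comp_eqToHom_of_toAny
    (m := σ.mor ζ) (hζ z hz).symm
  exact ⟨e, (IsIso.inv_comp_eq _).1 h⟩

lemma link_tr (R : Rep F τ) {a b : Fin (P.n + 2)} {ζ : X.Tran (c a) (c b)} (hl : τ.Link a b ζ)
    {z : Unit × ℝ} (ha : z.2 ∈ P.piece a) (hb : z.2 ∈ P.piece b) :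
    (inv (R.h a z ha) ≫ R.h b z hb).tr = ζ := by
  cases hl with
  | same => simp
  | step l => exact R.link l z (P.eq_brk ha hb)

lemma exists_link (R : Rep F τ) {a b : Fin (P.n + 2)} (hab : a = b ∨ ∃ l : Fin (P.n + 1), a = l.castSucc ∧ b = l.succ)
    {z : Unit × ℝ} (ha : z.2 ∈ P.piece a) (hb : z.2 ∈ P.piece b) :
    τ.Link a b (inv (R.h a z ha) ≫ R.h b z hb).tr := by
  rcases hab with rfl | ⟨l, rfl, rfl⟩
  · have : (inv (R.h a z ha) ≫ R.h a z hb).tr = X.one (c a) := by simp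
    rw [this]; exact .same a
  · rw [R.link l z (P.eq_brk ha hb)]; exact .step l

lemma trans_const (R : Rep F τ) (R' : Rep F τ') {k : Fin (P.n + 2)} {k' : Fin (P'.n + 2)}
    {I : Set ℝ} (hI : _root_.IsPreconnected I) (hk : I ⊆ P.piece k) (hk' : I ⊆ P'.piece k')
    {s s' : ℝ} (hs : s ∈ I) (hs' : s' ∈ I) :
    (inv (R.h k ((), s) (hk hs)) ≫ R'.h k' ((), s) (hk' hs)).tr =
      (inv (R.h k ((), s') (hk hs')) ≫ R'.h k' ((), s') (hk' hs')).tr :=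
  (R.sec k).trans_const (R'.sec k') hI (fun _ h => hk h) (fun _ h => hk' h) hs hs'

lemma refines (R : Rep F τ) (R' : Rep F τ') (h : range P'.t ⊆ range P.t) :
    RelSystem.Refines σ ⟨P, c, α, τ⟩ ⟨P', c', α', τ'⟩ := by
  obtain ⟨θ, h0, h1, hθ⟩ := Subdivision.exists_index h
  let j : ∀ k, X.Tran (c k) (c' (θ k)) := fun k =>
    (inv (R.h k ((), P.t k.castSucc) (P.left_mem k)) ≫ R'.h (θ k) ((), P.t k.castSucc) (hθ k (P.left_mem k))).tr
  have hj : ∀ k (z : Unit × ℝ) (hz : z.2 ∈ P.piece k),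
      (inv (R.h k z hz) ≫ R'.h (θ k) z (hθ k hz)).tr = j k := fun k z hz =>
    R.trans_const R' (P.isPreconnected_piece k) subset_rfl (hθ k) hz (P.left_mem k)
  refine ⟨⟨θ, h0, h1, hθ, j, fun k s hs => ?_, fun k s hs => ?_, fun l => ?_⟩, ?_, ?_⟩
  · rw [← hj k ((), s) hs]
    exact (inv (R.h k ((), s) hs) ≫ R'.h (θ k) ((), s) (hθ k hs)).mem
  · rw [← hj k ((), s) hs]
    exact (inv (R.h k ((), s) hs) ≫ R'.h (θ k) ((), s) (hθ k hs)).eq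
  · set z : Unit × ℝ := ((), P.brk l)
    have ha : z.2 ∈ P.piece l.castSucc := P.brk_mem_left l
    have hb : z.2 ∈ P.piece l.succ := P.brk_mem_right l
    have hadj : θ l.castSucc = θ l.succ ∨ ∃ m : Fin (P'.n + 1), θ l.castSucc = m.castSucc ∧ θ l.succ = m.succ := by
      rcases P'.eq_or_adjacent (hθ _ ha) (hθ _ hb) with h | ⟨m, e1, e2, -⟩ | ⟨m, e1, e2, e3⟩
      · exact Or.inl h
      · exact Or.inr ⟨m, e1, e2⟩
      · exfalso
        have a1 := (hθ _ (P.left_mem l.castSucc)).1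
        rw [e2, ← Fin.succ_castSucc] at a1
        have : P'.brk m = P.brk l := e3.symm
        rw [Subdivision.brk, Subdivision.brk] at this
        rw [this] at a1
        exact absurd (P.lt_succ l.castSucc) (not_lt.2 a1)
    refine ⟨_, R'.exists_link hadj (hθ _ ha) (hθ _ hb), ?_⟩
    have e : (inv (R.h _ z ha) ≫ R.h _ z hb) ≫ (inv (R.h _ z hb) ≫ R'.h _ z (hθ _ hb)) =
      (inv (R.h _ z ha) ≫ R'.h _ z (hθ _ ha)) ≫ (inv (R'.h _ z (hθ _ ha)) ≫ R'.h _ z (hθ _ hb)) := by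
      simp
    have t1 := R.link l z rfl
    have t2 := hj l.succ z hb
    have t3 := hj l.castSucc z ha
    have m1 : τ.f l.castSucc (P.brk l) ∈ ((X.map (τ.ξ l)).trans (X.map (j l.succ))).source := by
      rw [← t1, ← t2]
      exact mem_trans_source (Mor.mem _) (by rw [Mor.eq]; exact Mor.mem _)
    have m2 : τ.f l.castSucc (P.brk l) ∈ ((X.map (j l.castSucc)).trans
        (X.map (inv (R'.h _ z (hθ _ ha)) ≫ R'.h _ z (hθ _ hb)).tr)).source := by
      rw [← t3]
      exact mem_trans_source (Mor.mem _) (by rw [Mor.eq]; exact Mor.mem _)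
    refine ⟨m1, m2, ?_⟩
    refine Eq.trans ?_ ((congrArg Mor.tr e).trans ?_)
    · exact comp_congr t1.symm t2.symm rfl _ _
    · exact comp_congr t3 rfl rfl _ _
  · change toAny (j 0) = _
    rw [← hj 0 ((), 0) P.zero_mem]
    have aux : ∀ m hm, m = 0 →
        toAny (inv (R.h 0 ((), 0) P.zero_mem) ≫ R'.h m ((), 0) hm).tr = toAny (X.one p.1) := by
      rintro m hm rfl
      obtain ⟨e1, h1⟩ := R.start_eq ((), 0) rfl
      obtain ⟨e2, h2⟩ := R'.start_eq ((), 0) rfl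
      have : inv (R.h 0 ((), 0) P.zero_mem) ≫ R'.h 0 ((), 0) hm = eqToHom (e1.symm.trans e2) := by rw [h1, h2]; simp
      rw [this, toAny_eqToHom', ← e1]
    exact aux _ _ h0
  · obtain ⟨ζ, hζ⟩ := R.fin_eq
    obtain ⟨ζ', hζ'⟩ := R'.fin_eq
    refine ⟨(inv ζ ≫ ζ').tr, (inv ζ ≫ ζ').mem, (inv ζ ≫ ζ').eq, ?_⟩
    change toAny (j (Fin.last _)) = _
    rw [← hj _ ((), 1) P.one_mem]
    have aux : ∀ m hm, m = Fin.last _ →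
        toAny (inv (R.h _ ((), 1) P.one_mem) ≫ R'.h m ((), 1) hm).tr = toAny (σ.ρ α α' (inv ζ ≫ ζ').tr) := by
      rintro m hm rfl
      obtain ⟨e1, h1⟩ := hζ ((), 1) rfl
      obtain ⟨e2, h2⟩ := hζ' ((), 1) rfl
      have : inv (R.h _ ((), 1) P.one_mem) ≫ R'.h _ ((), 1) hm =
          eqToHom e1.symm ≫ σ.mor (inv ζ ≫ ζ') ≫ eqToHom e2 := by
        rw [h1, h2]; simp
      rw [this, toAny_eqToHom_comp, toAny_comp_eqToHom, mor_tr]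
    exact aux _ _ h1

end Rep

/-- Sections over the intervals of a subdivision give a system. -/
lemma exists_rep_of_sections (F : σ.PFam Unit) (P : Subdivision) (c : Fin (P.n + 2) → X.ι)
    {α : σ.Λ} (v : Y.C (σ.V α)) (f : ∀ k, ℝ → X.C (c k)) (hf : ∀ k, ContinuousOn (f k) (P.piece k))
    (h : ∀ k (z : Unit × ℝ), z.2 ∈ P.piece k → (F.A.r z ⟶ ⟨c k, f k z.2⟩))
    (sec : ∀ k, F.A.IsSec ⟨{z | z.2 ∈ P.piece k}, fun z => f k z.2,
      (hf k).comp continuous_snd.continuousOn fun _ h => h, h k⟩)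
    (start : ∀ (z : Unit × ℝ) (hz : z.2 = 0),
      toAny (inv (F.st z hz) ≫ h 0 z (hz ▸ P.zero_mem)).tr = toAny (X.one p.1))
    (ζ : (⟨σ.V F.α, F.v ()⟩ : Y.Obj) ⟶ ⟨σ.V α, v⟩) (fin : ∀ (z : Unit × ℝ) (hz : z.2 = 1),
      toAny (inv (F.en z hz) ≫ h (Fin.last _) z (hz ▸ P.one_mem)).tr = toAny (σ.ρ F.α α ζ.tr)) :
    ∃ (τ : σ.RelSys P c α), Nonempty (Rep F τ) ∧ τ.f = f ∧ ∀ l, τ.ξ l =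
      (inv (h l.castSucc ((), P.brk l) (P.brk_mem_left l)) ≫ h l.succ ((), P.brk l) (P.brk_mem_right l)).tr := by
  refine ⟨⟨⟨f, hf, fun l => (inv (h l.castSucc ((), P.brk l) (P.brk_mem_left l)) ≫
        h l.succ ((), P.brk l) (P.brk_mem_right l)).tr, fun l => Mor.mem _, fun l => Mor.eq _⟩,
        ?_, v, ?_⟩, ⟨⟨h, sec, ?_, start, ζ, fin⟩⟩, rfl, fun l => rfl⟩
  · obtain ⟨e, -⟩ := eq_eqToHom_of_toAny (start ((), 0) rfl)
    exact (basePoint_eq_of_obj_eq e).symm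
  · obtain ⟨e, -⟩ := eq_comp_eqToHom_of_toAny
      (m := σ.mor ζ) (fin ((), 1) rfl).symm
    exact (basePoint_eq_of_obj_eq e).symm
  · rintro l ⟨⟨⟩, s⟩ hz
    obtain rfl : s = P.brk l := hz
    rfl

namespace Rep

variable {F F' : σ.PFam Unit} {P P' : Subdivision} {c : Fin (P.n + 2) → X.ι} {c' : Fin (P'.n + 2) → X.ι}
  {τ : σ.RelSys P c α} {τ' : σ.RelSys P' c' α'}

lemma exists_refine (R : Rep F τ) {P' : Subdivision} (h : range P.t ⊆ range P'.t) :
    ∃ (c' : Fin (P'.n + 2) → X.ι) (τ' : σ.RelSys P' c' α), Nonempty (Rep F τ') := by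
  obtain ⟨θ, h0, h1, hθ⟩ := Subdivision.exists_index h
  obtain ⟨ζ, hζ⟩ := R.fin
  obtain ⟨τ', hτ', -⟩ := exists_rep_of_sections F P' (fun k => c (θ k)) τ.v (fun k => τ.f (θ k))
    (fun k => (τ.continuousOn (θ k)).mono (hθ k)) (fun k z hz => R.h (θ k) z (hθ k hz))
    (fun k => (R.sec (θ k)).congr (fun z hz => hθ k hz) fun _ _ => rfl) (by
      intro z hz
      have aux : ∀ (m : Fin (P.n + 2)) (hm : z.2 ∈ P.piece m), m = 0 →
        toAny (inv (F.st z hz) ≫ R.h m z hm).tr = toAny (X.one p.1) := by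
        rintro m hm rfl; exact R.start z hz
      exact aux _ _ h0) ζ (by
      intro z hz
      have aux : ∀ (m : Fin (P.n + 2)) (hm : z.2 ∈ P.piece m), m = Fin.last _ →
        toAny (inv (F.en z hz) ≫ R.h m z hm).tr = toAny (σ.ρ F.α α ζ.tr) := by
        rintro m hm rfl; exact hζ z hz
      exact aux _ _ h1)
  exact ⟨_, τ', hτ'⟩

lemma mk_eq (R : Rep F τ) (R' : Rep F τ') : RelLoop.mk τ = RelLoop.mk τ' := by
  obtain ⟨P'', h1, h2⟩ := Subdivision.exists_common P P'
  obtain ⟨c'', τ'', ⟨R''⟩⟩ := R.exists_refine h1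
  exact (Quot.sound (R''.refines R h1)).symm.trans (Quot.sound (R''.refines R' h2))

lemma nonempty_of_iso (h : F.Iso F') (R : Rep F' τ) : Nonempty (Rep F τ) := by
  obtain ⟨j, ζ, h0, h1⟩ := h
  refine ⟨⟨fun k z hz => j.J z (P.piece_subset_Icc k hz) ≫ R.h k z hz, fun k => ?_, fun l z hz => ?_,
    fun z hz => ?_, ?_⟩⟩
  · exact (j.isSec_pull (R.sec k)).congr (fun z hz => ⟨P.piece_subset_Icc k hz, hz⟩) fun _ _ => rfl
  · rw [← R.link l z hz]; simp
  · rw [← R.start z hz, ← h0 z hz]; simp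
  · obtain ⟨ζ', hζ'⟩ := R.fin_eq
    refine ⟨ζ ≫ ζ', fun z hz => ?_⟩
    obtain ⟨e, he⟩ := hζ' z hz
    rw [he, ← mor_tr, mor_comp, ← toAny_comp_eqToHom _ e, ← Category.assoc (j.J z _), h1 z hz]
    simp

/-- Two based relative loops represented by the same system are isomorphic. -/
lemma iso (R : Rep F τ) (R' : Rep F' τ) : F.Iso F' := by
  have hJ : ∀ z : Unit × ℝ, z ∈ {z : Unit × ℝ | z.2 ∈ Icc 0 1} →
      ∃ J : F.A.r z ⟶ F'.A.r z, ∀ k (hk : z.2 ∈ P.piece k), J = R.h k z hk ≫ inv (R'.h k z hk) := by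
    intro z hz
    obtain ⟨k, hk, -⟩ := P.exists_piece_left hz
    refine ⟨R.h k z hk ≫ inv (R'.h k z hk), fun k' hk' => ?_⟩
    have adj : ∀ (l : Fin (P.n + 1)) (hl : z.2 ∈ P.piece l.castSucc) (hr : z.2 ∈ P.piece l.succ),
        R.h _ z hl ≫ inv (R'.h _ z hl) = R.h _ z hr ≫ inv (R'.h _ z hr) := by
      intro l hl hr
      have h3 := hom_ext
        ((R.link l z (P.eq_brk hl hr)).trans (R'.link l z (P.eq_brk hl hr)).symm)
      rw [IsIso.inv_comp_eq] at h3
      rw [h3]; simp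
    rcases P.eq_or_adjacent hk hk' with rfl | ⟨l, rfl, rfl, -⟩ | ⟨l, rfl, rfl, -⟩
    · rfl
    · exact adj l hk hk'
    · exact (adj l hk' hk).symm
  choose J hJ using hJ
  have smooth : ∀ b ∈ F'.A.atlas, F.A.IsSec (b.2.pull _ J) := by
    refine PIso.smooth_of_sides fun z hz => ?_
    obtain ⟨k, hk, hkE⟩ := P.exists_piece_left hz
    obtain ⟨k', hk', hkE'⟩ := P.exists_piece_right hz
    have hs : ∀ k, ∀ b ∈ F'.A.atlas, F.A.IsSec ((b.2.pull _ J).restrict {z | z.2 ∈ P.piece k}) := by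
      intro k b hb
      refine Pth.isSec_of_local fun z hz => ?_
      refine ⟨_, _, R.sec k, hz.2, Eventually.of_forall fun _ h => h.2, ?_⟩
      obtain ⟨G, hG, hE⟩ := (Pth.isSec_atlas hb).smoothAt (R'.sec k) hz.1.2 hz.2
      refine ⟨G, hG, hE.mono fun z h h1 h2 => ?_⟩
      rw [← h h1.1.2 h1.2]
      congr 1
      simp only [Sec.trans, Sec.restrict, Sec.pull]
      rw [IsIso.inv_comp_eq, hJ z _ k h1.2]
      simp
    refine ⟨_, _, hk, hk', hs k, hs k', ?_⟩
    have hc : Tendsto (Prod.snd : Unit × ℝ → ℝ) (𝓝 z) (𝓝 z.2) := continuous_snd.tendsto _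
    filter_upwards [hc.eventually hkE, hc.eventually hkE'] with z' h1 h2 h3
    refine ⟨hz, hk, hk', ?_⟩
    rcases le_total z'.2 z.2 with h | h
    · exact Or.inl (h1 h h3.1)
    · exact Or.inr (h2 h h3.2)
  obtain ⟨ζ, hζ⟩ := R.fin_eq
  obtain ⟨ζ', hζ'⟩ := R'.fin_eq
  refine ⟨⟨J, smooth⟩, ζ ≫ inv ζ', fun z hz => ?_, fun z hz => ?_⟩
  · change J z _ ≫ _ = _
    obtain ⟨e, h1⟩ := R.start_eq z hz
    obtain ⟨e', h2⟩ := R'.start_eq z hz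
    rw [hJ z _ 0 (hz ▸ P.zero_mem), h1, h2]; simp
  · change J z _ ≫ _ = _
    obtain ⟨e1, h1⟩ := hζ z hz
    obtain ⟨e2, h2⟩ := hζ' z hz
    rw [hJ z _ (Fin.last _) (hz ▸ P.one_mem), h1, h2]; simp

lemma nonempty_of_refines (h : RelSystem.Refines σ ⟨P, c, α, τ⟩ ⟨P', c', α', τ'⟩) (R' : Rep F τ') :
    Nonempty (Rep F τ) := by
  obtain ⟨r, h0, ζr, hζm, hζe, h1⟩ := h
  let jm : ∀ k (z : Unit × ℝ), z.2 ∈ P.piece k → ((⟨c k, τ.f k z.2⟩ : X.Obj) ⟶ ⟨c' (r.θ k), τ'.f (r.θ k) z.2⟩) :=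
    fun k z hz => ⟨r.j k, r.mem_source k _ hz, r.map_eq k _ hz⟩
  refine ⟨⟨fun k z hz => R'.h (r.θ k) z (r.piece_subset k hz) ≫ inv (jm k z hz),
    fun k => ?_, fun l z hz => ?_, fun z hz => ?_, ?_⟩⟩
  · refine Pth.isSec_of_local fun z hz => ⟨_, _, R'.sec (r.θ k), r.piece_subset k hz,
      Eventually.of_forall fun _ h => r.piece_subset k h, ⟨fun _ => r.j k, continuousAt_const,
        Eventually.of_forall fun z' h1 h2 => ?_⟩⟩
    have : (jm k z' h1).tr = r.j k := rfl
    rw [← this]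
    congr 1
    simp [Sec.trans]
  · have ha : z.2 ∈ P.piece l.castSucc := hz ▸ P.brk_mem_left l
    have hb : z.2 ∈ P.piece l.succ := hz ▸ P.brk_mem_right l
    obtain ⟨⟨⟩, s⟩ := z
    obtain rfl : s = P.brk l := hz
    obtain ⟨ζ, hl, m1, m2, e⟩ := r.comp_eq l
    have e2 : τ.mor l ≫ jm l.succ ((), P.brk l) hb = jm l.castSucc ((), P.brk l) ha ≫
        (inv (R'.h _ ((), P.brk l) (r.piece_subset _ ha)) ≫ R'.h _ ((), P.brk l) (r.piece_subset _ hb)) := by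
      apply hom_ext
      rw [comp_tr, comp_tr]
      refine (comp_congr rfl rfl rfl _ m1).trans (e.trans ?_)
      exact comp_congr rfl (R'.link_tr hl (r.piece_subset _ ha) (r.piece_subset _ hb)).symm rfl _ _
    have e3 : inv (R'.h (r.θ l.castSucc) ((), P.brk l) (r.piece_subset _ ha) ≫ inv (jm _ _ ha)) ≫
        (R'.h (r.θ l.succ) ((), P.brk l) (r.piece_subset _ hb) ≫ inv (jm _ _ hb)) = τ.mor l := by
      rw [← cancel_mono (jm _ _ hb), e2]
      simp
    exact congrArg Mor.tr e3
  · obtain ⟨e1, h3⟩ := eq_eqToHom_of_toAny (R'.start z hz)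
    have hz0 : z.2 ∈ P.piece 0 := hz ▸ P.zero_mem
    obtain ⟨e2, h4⟩ := eq_eqToHom_of_toAny (m := jm 0 z hz0) h0
    have aux : ∀ (m : Fin (P'.n + 2)) (hm : z.2 ∈ P'.piece m), m = 0 →
        ∃ e, inv (F.st z hz) ≫ R'.h m z hm = eqToHom e := by
      rintro m hm rfl; exact ⟨e1, h3⟩
    obtain ⟨e5, h5⟩ := aux (r.θ 0) (r.piece_subset 0 hz0) r.θ_zero
    have : inv (F.st z hz) ≫ R'.h (r.θ 0) z (r.piece_subset 0 hz0) ≫ inv (jm 0 z hz0) =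
        eqToHom (e5.trans e2.symm) := by
      rw [← Category.assoc, h5, h4, inv_eqToHom, eqToHom_trans]
    rw [this, toAny_eqToHom']
  · obtain ⟨ζ, hζ⟩ := R'.fin
    let ζm : (⟨σ.V α, τ.v⟩ : Y.Obj) ⟶ ⟨σ.V α', τ'.v⟩ := ⟨ζr, hζm, hζe⟩
    refine ⟨ζ ≫ inv ζm, fun z hz => ?_⟩
    have hz1 : z.2 ∈ P.piece (Fin.last _) := hz ▸ P.one_mem
    have aux : ∀ (m : Fin (P'.n + 2)) (hm : z.2 ∈ P'.piece m), m = Fin.last _ →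
        toAny (inv (F.en z hz) ≫ R'.h m z hm).tr = toAny (σ.ρ F.α α' ζ.tr) := by
      rintro m hm rfl; exact hζ z hz
    obtain ⟨e1, h3⟩ := eq_comp_eqToHom_of_toAny
      (m := σ.mor ζ) (aux _ (r.piece_subset _ hz1) r.θ_last).symm
    have e0 : (⟨c (Fin.last _), τ.f (Fin.last _) z.2⟩ : X.Obj) = ⟨σ.W α, σ.f α τ.v⟩ := by
      rw [hz]
      exact obj_eq_of_basePoint_eq τ.finish
    obtain ⟨e2, h4⟩ := eq_comp_eqToHom_of_toAny (m := eqToHom e0.symm ≫ jm _ z hz1) (m' := σ.mor ζm)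
      (by rwa [toAny_eqToHom_comp])
    have h6 : inv (jm _ z hz1) = eqToHom e2 ≫ inv (σ.mor ζm) ≫ eqToHom e0.symm := by rw [h4]; simp
    have : inv (F.en z hz) ≫ R'.h _ z (r.piece_subset _ hz1) ≫ inv (jm _ z hz1) =
        σ.mor (ζ ≫ inv ζm) ≫ eqToHom e0.symm := by
      rw [← Category.assoc, h3, h6]; simp
    rw [this, toAny_comp_eqToHom, mor_tr]

end Rep

end BasedSystem

/-- The subdivision into intervals of equal length. -/
def Subdivision.uniform (n : ℕ) : Subdivision where
  n := n
  t k := (k : ℕ) / (n + 2 : ℝ)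
  strictMono a b h := by
    have : ((a : ℕ) : ℝ) < (b : ℕ) := by exact_mod_cast h
    exact div_lt_div_of_pos_right this (by positivity)
  zero := by simp
  one := by
    rw [Fin.val_last]
    push_cast
    exact div_self (by positivity)

namespace Orbispace

section

lemma inv_comp_tr_congr {x : X.Obj} {c c' : X.ι} {y y' : X.C c} {w w' : X.C c'}
    {m : x ⟶ ⟨c, y⟩} {m' : x ⟶ ⟨c, y'⟩} {n : x ⟶ ⟨c', w⟩} {n' : x ⟶ ⟨c', w'⟩}
    (hm : m.tr = m'.tr) (hn : n.tr = n'.tr) : (inv m ≫ n).tr = (inv m' ≫ n').tr := by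
  obtain ⟨e, rfl⟩ := eq_comp_eqToHom_of_toAny (m := m) (m' := m') (congrArg toAny hm)
  obtain ⟨e', rfl⟩ := eq_comp_eqToHom_of_toAny (m := n) (m' := n') (congrArg toAny hn)
  obtain rfl : y = y' := eq_of_heq (Obj.mk.inj e).2
  obtain rfl : w = w' := eq_of_heq (Obj.mk.inj e').2
  simp

lemma toAny_inv_comp {x y y' : X.Obj} {m : x ⟶ y} {m' : x ⟶ y'} (h : toAny m.tr = toAny m'.tr) :
    toAny (inv m ≫ m').tr = toAny (X.one y.ch) := by
  obtain ⟨e, rfl⟩ := eq_comp_eqToHom_of_toAny h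
  rw [IsIso.inv_hom_id_assoc, toAny_eqToHom']

/-- The germs of a path system at one place, seen from a common object. -/
lemma PathSys.exists_obj {P : Subdivision} {c : Fin (P.n + 2) → X.ι} (τ : PathSys P c) {s : ℝ}
    (hs : s ∈ Icc (0 : ℝ) 1) :
    ∃ (x : X.Obj) (h : ∀ k, s ∈ P.piece k → (x ⟶ ⟨c k, τ.f k s⟩)),
      ∀ (l : Fin (P.n + 1)) (hl : s ∈ P.piece l.castSucc) (hr : s ∈ P.piece l.succ),
        (inv (h _ hl) ≫ h _ hr).tr = τ.ξ l := by
  by_cases hb : ∃ l, s = P.brk l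
  · obtain ⟨l, rfl⟩ := hb
    have hne : l.castSucc ≠ l.succ := (Fin.castSucc_lt_succ).ne
    have hch : ∀ k, P.brk l ∈ P.piece k → ∃ m : (⟨c l.castSucc, τ.f l.castSucc (P.brk l)⟩ : X.Obj) ⟶
        ⟨c k, τ.f k (P.brk l)⟩, (k = l.castSucc → toAny m.tr = toAny (X.one (c l.castSucc))) ∧
        (k = l.succ → toAny m.tr = toAny (τ.ξ l)) := by
      intro k hk
      rcases P.eq_or_adjacent (P.brk_mem_left l) hk with h | ⟨l', h1, h2, h3⟩ | ⟨l', h1, h2, h3⟩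
      · subst h
        exact ⟨𝟙 _, fun _ => rfl, fun h => absurd h hne⟩
      · obtain rfl := P.brk_injective h3
        subst h2
        exact ⟨τ.mor l, fun h => absurd h.symm hne, fun _ => rfl⟩
      · obtain rfl := P.brk_injective h3
        exact absurd h2 hne
    choose m hm1 hm2 using hch
    refine ⟨_, m, fun l' hl hr => ?_⟩
    obtain rfl := P.brk_injective (P.eq_brk hl hr)
    obtain ⟨e, he⟩ := eq_eqToHom_of_toAny (hm1 _ hl rfl)
    rw [he]
    apply toAny_injective
    rw [inv_eqToHom, toAny_eqToHom_comp, hm2 _ hr rfl]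
  · obtain ⟨k0, hk0, -⟩ := P.exists_piece_left hs
    have hch : ∀ k, s ∈ P.piece k → Nonempty ((⟨c k0, τ.f k0 s⟩ : X.Obj) ⟶ ⟨c k, τ.f k s⟩) := by
      intro k hk
      rcases P.eq_or_adjacent hk0 hk with h | ⟨l', -, -, h3⟩ | ⟨l', -, -, h3⟩
      · subst h; exact ⟨𝟙 _⟩
      all_goals exact absurd ⟨l', h3⟩ hb
    exact ⟨_, fun k hk => (hch k hk).some, fun l hl hr => absurd ⟨l, P.eq_brk hl hr⟩ hb⟩

end

end Orbispace

namespace BasedSystem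

/-- A continuous family of systems gives a family of based relative loops. -/
lemma exists_pfam_of_sys {P : Subdivision} {c : Fin (P.n + 2) → X.ι} {α : σ.Λ} (S : T → σ.RelSys P c α)
    (hf : ∀ k, ContinuousOn (fun z : T × ℝ => (S z.1).f k z.2) {z | z.2 ∈ P.piece k})
    (hξ : ∀ l, Continuous fun t => (S t).ξ l) (hv : Continuous fun t => (S t).v) :
    ∃ F : σ.PFam T, ∀ t, Nonempty (Rep (F.at' t) (S t)) := by
  set cl : ℝ → ℝ := fun s => max 0 (min s 1) with hcl
  have hcl1 : ∀ s, cl s ∈ Icc 0 1 := fun s => ⟨le_max_left _ _, max_le zero_le_one (min_le_right _ _)⟩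
  have hcl2 : ∀ s ∈ Icc 0 1, cl s = s := fun s hs => by
    simp only [hcl]; rw [min_eq_left hs.2, max_eq_right hs.1]
  have hclm : Monotone cl := fun a b h => max_le_max le_rfl (min_le_min h le_rfl)
  choose r H hlink using (fun z : T × ℝ => (S z.1).toPathSys.exists_obj (hcl1 z.2))
  let a : ∀ k, Sec r (c k) := fun k => ⟨{z | cl z.2 ∈ P.piece k}, fun z => (S z.1).f k (cl z.2),
    (hf k).comp (f := fun z : T × ℝ => (z.1, cl z.2)) (Continuous.continuousOn (by fun_prop))
      fun _ h => h, fun z hz => H z k hz⟩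
  have adj : ∀ (l : Fin (P.n + 1)) z, (a l.castSucc).SmoothAt (a l.succ) z := fun l z =>
    ⟨fun t => (S t).ξ l, (hξ l).continuousAt, Eventually.of_forall fun z h1 h2 => hlink z l h1 h2⟩
  let 𝒜 : Set (Σ c, Sec r c) := range fun k => ⟨c k, a k⟩
  have compat : ∀ a ∈ 𝒜, ∀ b ∈ 𝒜, ∀ z, z ∈ a.2.N → z ∈ b.2.N → a.2.SmoothAt b.2 z := by
    rintro _ ⟨k, rfl⟩ _ ⟨k', rfl⟩ z hz hz'
    rcases P.eq_or_adjacent hz hz' with rfl | ⟨l, rfl, rfl, -⟩ | ⟨l, rfl, rfl, -⟩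
    · exact ⟨fun _ => X.one _, continuousAt_const, Eventually.of_forall fun z h1 h2 => inv_comp_tr_eq_one _ _ rfl⟩
    · exact adj l z
    · exact (adj l z).symm hz' hz
  have vert : ∀ a ∈ 𝒜, ∀ z ∈ a.2.N, ∀ᶠ z' in 𝓝 z, z' ∈ a.2.N → (z'.1, z.2) ∈ a.2.N := by
    rintro _ ⟨k, rfl⟩ z hz
    exact Eventually.of_forall fun z' _ => hz
  have cover : ∀ z0 : T × ℝ, ∃ a ∈ 𝒜, ∃ b ∈ 𝒜, ∀ᶠ z in 𝓝 z0, (z.2 ≤ z0.2 → z ∈ a.2.N) ∧ (z0.2 ≤ z.2 → z ∈ b.2.N) := by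
    intro z0
    obtain ⟨k, -, hkE⟩ := P.exists_piece_left (hcl1 z0.2)
    obtain ⟨k', -, hkE'⟩ := P.exists_piece_right (hcl1 z0.2)
    refine ⟨_, ⟨k, rfl⟩, _, ⟨k', rfl⟩, ?_⟩
    have hc : Tendsto (fun z => cl z.2) (𝓝 z0) (𝓝 (cl z0.2)) := Continuous.tendsto (by fun_prop) _
    filter_upwards [hc.eventually hkE, hc.eventually hkE'] with z h1 h2
    exact ⟨fun h => h1 (hclm h) (hcl1 _).1, fun h => h2 (hclm h) (hcl1 _).2⟩
  let A : Pth X T := Pth.ofSides r 𝒜 compat vert cover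
  have hsec : ∀ k, A.IsSec (a k) := fun k => Pth.isSec_ofSides (a := ⟨c k, a k⟩) ⟨k, rfl⟩
  have e0 : ∀ z : T × ℝ, z.2 = 0 → cl z.2 = 0 := fun z hz => by rw [hz]; exact hcl2 0 ⟨le_rfl, zero_le_one⟩
  have e1 : ∀ z : T × ℝ, z.2 = 1 → cl z.2 = 1 := fun z hz => by rw [hz]; exact hcl2 1 ⟨zero_le_one, le_rfl⟩
  have m0 : ∀ z : T × ℝ, z.2 = 0 → cl z.2 ∈ P.piece 0 := fun z hz => by rw [e0 z hz]; exact P.zero_mem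
  have m1 : ∀ z : T × ℝ, z.2 = 1 → cl z.2 ∈ P.piece (Fin.last _) := fun z hz => by rw [e1 z hz]; exact P.one_mem
  have o0 : ∀ z : T × ℝ, z.2 = 0 → (⟨c 0, (S z.1).f 0 (cl z.2)⟩ : X.Obj) = ⟨p.1, p.2⟩ := fun z hz => by
    rw [e0 z hz]; exact obj_eq_of_basePoint_eq (S z.1).start
  have o1 : ∀ z : T × ℝ, z.2 = 1 → (⟨c (Fin.last _), (S z.1).f (Fin.last _) (cl z.2)⟩ : X.Obj) =
      ⟨σ.W α, σ.f α (S z.1).v⟩ := fun z hz => by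
    rw [e1 z hz]; exact obj_eq_of_basePoint_eq (S z.1).finish
  let F : σ.PFam T :=
    { A := A
      st := fun z hz => H z 0 (m0 z hz) ≫ eqToHom (o0 z hz)
      st_sec := (hsec 0).congr_toAny (fun z hz => m0 z hz) fun z hz => toAny_comp_eqToHom _ _
      α := α
      v := ⟨fun t => (S t).v, hv⟩
      en := fun z hz => H z (Fin.last _) (m1 z hz) ≫ eqToHom (o1 z hz)
      en_sec := (hsec (Fin.last _)).congr_toAny (fun z hz => m1 z hz) fun z hz => toAny_comp_eqToHom _ _ }
  refine ⟨F, fun t => ?_⟩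
  have mem : ∀ k (z : Unit × ℝ), z.2 ∈ P.piece k → cl z.2 ∈ P.piece k := fun k z hz => by
    rwa [hcl2 _ (P.piece_subset_Icc k hz)]
  let h : ∀ k (z : Unit × ℝ), z.2 ∈ P.piece k → (r (t, z.2) ⟶ ⟨c k, (S t).f k z.2⟩) := fun k z hz =>
    ⟨(H (t, z.2) k (mem k z hz)).tr, (H (t, z.2) k (mem k z hz)).mem, by
      refine (H (t, z.2) k (mem k z hz)).eq.trans ?_
      change (S t).f k (cl z.2) = _
      rw [hcl2 _ (P.piece_subset_Icc k hz)]⟩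
  refine ⟨⟨h, fun k => ?_, fun l z hz => ?_, fun z hz => ?_, 𝟙 _, fun z hz => ?_⟩⟩
  · exact ((hsec k).secAt t).congr (fun z hz => mem k z hz) fun z hz => rfl
  · rw [← hlink (t, z.2) l (mem _ z (hz ▸ P.brk_mem_left l)) (mem _ z (hz ▸ P.brk_mem_right l))]
    exact inv_comp_tr_congr rfl rfl
  · exact toAny_inv_comp (toAny_comp_eqToHom _ _)
  · exact (toAny_inv_comp (toAny_comp_eqToHom _ _)).trans (congrArg toAny (σ.ρ_one α).symm)

namespace Rep

variable {F F' : σ.PFam Unit} {P P' : Subdivision} {c : Fin (P.n + 2) → X.ι} {c' : Fin (P'.n + 2) → X.ι}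
  {τ : σ.RelSys P c α} {τ' : σ.RelSys P' c' α'}

lemma exists_pfam (τ : σ.RelSys P c α) : ∃ F : σ.PFam Unit, Nonempty (Rep F τ) := by
  obtain ⟨F, hF⟩ := exists_pfam_of_sys (T := Unit) (fun _ => τ)
    (fun k => (τ.continuousOn k).comp continuous_snd.continuousOn fun _ h => h)
    (fun l => continuous_const) continuous_const
  exact ⟨_, hF ()⟩

lemma nonempty_iff_of_mk_eq (h : RelLoop.mk τ = RelLoop.mk τ') : Nonempty (Rep F τ) ↔ Nonempty (Rep F τ') := by
  have key : ∀ a b : σ.RelSystem, Relation.EqvGen (RelSystem.Refines σ) a b →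
      (Nonempty (Rep F a.sys) ↔ Nonempty (Rep F b.sys)) := by
    intro a b hab
    induction hab with
    | rel a b hab =>
      refine ⟨fun ⟨R⟩ => ?_, fun ⟨R⟩ => nonempty_of_refines hab R⟩
      obtain ⟨F', ⟨R'⟩⟩ := exists_pfam b.sys
      obtain ⟨R''⟩ := nonempty_of_refines hab R'
      exact nonempty_of_iso (R.iso R'') R'
    | refl a => exact Iff.rfl
    | symm a b _ ih => exact ih.symm
    | trans a b c _ _ ih ih' => exact ih.trans ih'
  exact key _ _ (Quot.eqvGen_exact h)

end Rep

namespace PFam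

/-- Every based relative loop is represented by a system. -/
lemma exists_rep (F : σ.PFam Unit) : ∃ (P : Subdivision) (c : Fin (P.n + 2) → X.ι)
    (τ : σ.RelSys P c F.α), Nonempty (Rep F τ) := by
  have hO : ∀ x : ℝ, ∃ O : Set ℝ, IsOpen O ∧ x ∈ O ∧ ∃ (c : X.ι) (a : Sec F.A.r c), F.A.IsSec a ∧
      (∀ s ∈ O, ((), s) ∈ a.N) ∧
      (∀ h, 0 ∈ O → toAny (a.h ((), 0) h).tr = toAny (F.st ((), 0) rfl).tr) ∧
      (∀ h, 1 ∈ O → toAny (a.h ((), 1) h).tr = toAny (F.en ((), 1) rfl).tr) := by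
    intro x
    have pre : ∀ {c : X.ι} (a : Sec F.A.r c), IsOpen a.N → IsOpen {s : ℝ | ((), s) ∈ a.N} :=
      fun a ho => ho.preimage (by fun_prop)
    by_cases h0 : x = 0
    · subst h0
      obtain ⟨a, h, ha, ho, e⟩ := F.A.exists_isSec_through ((), 0) (F.st ((), 0) rfl)
      refine ⟨{s | ((), s) ∈ a.N} ∩ Iio 1, (pre a ho).inter isOpen_Iio, ⟨h, by simp⟩, _, a, ha,
        fun s hs => hs.1, fun _ _ => congrArg toAny e, fun _ h => absurd h.2 (by simp)⟩
    by_cases h1 : x = 1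
    · subst h1
      obtain ⟨a, h, ha, ho, e⟩ := F.A.exists_isSec_through ((), 1) (F.en ((), 1) rfl)
      refine ⟨{s | ((), s) ∈ a.N} ∩ Ioi 0, (pre a ho).inter isOpen_Ioi, ⟨h, by simp⟩, _, a, ha,
        fun s hs => hs.1, fun _ h => absurd h.2 (by simp), fun _ _ => congrArg toAny e⟩
    · obtain ⟨c, a, ha, ho, h⟩ := F.A.exists_isSec ((), x)
      refine ⟨{s | ((), s) ∈ a.N} ∩ ({0} ∪ {1})ᶜ, (pre a ho).inter
        (isClosed_singleton.union isClosed_singleton).isOpen_compl, ⟨h, by simp [h0, h1]⟩, c, a, ha,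
        fun s hs => hs.1, fun _ h => absurd h.2 (by simp), fun _ h => absurd h.2 (by simp)⟩
  choose O hOo hxO c a ha haN h0 h1 using hO
  obtain ⟨δ, hδ, hball⟩ := lebesgue_number_lemma_of_metric (isCompact_Icc) hOo
    (fun x _ => mem_iUnion.2 ⟨x, hxO x⟩)
  obtain ⟨n, hn⟩ := exists_nat_one_div_lt hδ
  let P := Subdivision.uniform n
  have hP : ∀ k, ∃ x, P.piece k ⊆ O x := by
    intro k
    obtain ⟨x, hx⟩ := hball (P.t k.castSucc) ⟨P.nonneg _, P.le_one _⟩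
    refine ⟨x, fun s hs => hx ?_⟩
    rw [Metric.mem_ball, Real.dist_eq, abs_of_nonneg (sub_nonneg.2 hs.1)]
    have h2 : P.t k.succ - P.t k.castSucc = 1 / (n + 2 : ℝ) := by
      change ((k.succ : ℕ) : ℝ) / (n + 2) - ((k.castSucc : ℕ) : ℝ) / (n + 2) = _
      rw [Fin.val_succ, Fin.val_castSucc]
      push_cast
      ring
    have h3 : 1 / (n + 2 : ℝ) ≤ 1 / ((n : ℝ) + 1) := one_div_le_one_div_of_le (by positivity) (by linarith)
    have := hs.2
    linarith
  choose x hx using hP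
  obtain ⟨τ, hτ, -⟩ := exists_rep_of_sections F P (fun k => c (x k)) (F.v ()) (fun k s => (a (x k)).f ((), s))
    (fun k => (a (x k)).cont.comp (Continuous.continuousOn (by fun_prop))
      fun s hs => haN _ s (hx k hs))
    (fun k z hz => (a (x k)).h z (haN _ z.2 (hx k hz)))
    (fun k => (ha (x k)).congr (fun z hz => haN _ z.2 (hx k hz)) fun _ _ => rfl)
    (by
      rintro ⟨⟨⟩, s⟩ hz
      obtain rfl : s = 0 := hz
      exact toAny_inv_comp (h0 (x 0) _ (hx 0 P.zero_mem)).symm)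
    (𝟙 _)
    (by
      rintro ⟨⟨⟩, s⟩ hz
      obtain rfl : s = 1 := hz
      exact (toAny_inv_comp (h1 _ _ (hx _ P.one_mem)).symm).trans (congrArg toAny (σ.ρ_one F.α).symm))
  exact ⟨P, _, τ, hτ⟩

/-- The based relative loop of a family over a point. -/
def cls (F : σ.PFam Unit) : σ.RelLoop := RelLoop.mk F.exists_rep.choose_spec.choose_spec.choose

lemma cls_eq_mk_iff {F : σ.PFam Unit} {P : Subdivision} {c : Fin (P.n + 2) → X.ι} {α : σ.Λ}
    {τ : σ.RelSys P c α} : F.cls = RelLoop.mk τ ↔ Nonempty (Rep F τ) := by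
  have h := F.exists_rep.choose_spec.choose_spec.choose_spec
  exact ⟨fun e => (Rep.nonempty_iff_of_mk_eq e).1 h, fun ⟨R⟩ => h.some.mk_eq R⟩

lemma exists_cls_eq (γ : σ.RelLoop) : ∃ F : σ.PFam Unit, F.cls = γ := by
  obtain ⟨⟨P, c, α, τ⟩, rfl⟩ := Quot.exists_rep γ
  obtain ⟨F, hF⟩ := Rep.exists_pfam τ
  exact ⟨F, cls_eq_mk_iff.2 hF⟩

lemma cls_eq_cls_iff {F F' : σ.PFam Unit} : F.cls = F'.cls ↔ F.Iso F' := by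
  obtain ⟨P, c, τ, ⟨R⟩⟩ := F'.exists_rep
  have e : F'.cls = RelLoop.mk τ := cls_eq_mk_iff.2 ⟨R⟩
  constructor
  · intro h
    obtain ⟨R'⟩ := cls_eq_mk_iff.1 (h.trans e)
    exact R'.iso R
  · intro h
    rw [e]
    exact cls_eq_mk_iff.2 (R.nonempty_of_iso h)

end PFam

end BasedSystem

namespace Orbispace

lemma Pth.exists_parallel_toAny {TX : Type u} [TopologicalSpace TX] {X : Orbispace TX} {T : Type*}
    [TopologicalSpace T] (A : Pth X T) (t0 : T) {a b : ℝ} (hab : a ≤ b) {c c' : X.ι}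
    {e0 : Sec (A.at' t0).r c}
    (he0 : (A.at' t0).IsSec e0) (hN0 : ∀ s ∈ Icc a b, ((), s) ∈ e0.N) {s0 : ℝ} (hs0 : s0 ∈ Icc a b)
    {m : Sec A.r c'} (hm : A.IsSec m) (hmN : ∀ᶠ t in 𝓝 t0, (t, s0) ∈ m.N)
    (hag : ∀ h h', toAny (m.h (t0, s0) h).tr = toAny (e0.h ((), s0) h').tr) :
    ∃ (M : Set T) (e : Sec A.r c), IsOpen M ∧ t0 ∈ M ∧ A.IsSec e ∧ e.N = M ×ˢ Icc a b ∧
      (∀ s h h', (e.h (t0, s) h).tr = (e0.h ((), s) h').tr) ∧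
      ∀ t ∈ M, ∀ h h', toAny (e.h (t, s0) h).tr = toAny (m.h (t, s0) h').tr := by
  obtain rfl : c' = c := toAny_inj_left (hag hmN.self_of_nhds (hN0 _ hs0))
  obtain ⟨M, e, h1, h2, h3, h4, h5, h6⟩ := A.exists_parallel t0 hab he0 hN0 hs0 hm hmN
    (fun h h' => toAny_injective (hag h h'))
  exact ⟨M, e, h1, h2, h3, h4, h5, fun t ht h h' => congrArg toAny (h6 t ht h h')⟩

end Orbispace

namespace BasedSystem

namespace PFam

/-- The sections over the intervals of a system of one member extend to neighbouring members. -/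
lemma exists_extension (F : σ.PFam T) (t0 : T) {P : Subdivision} {c : Fin (P.n + 2) → X.ι} {α : σ.Λ}
    {τ : σ.RelSys P c α} (R : Rep (F.at' t0) τ)
    (ζ : (⟨σ.V F.α, F.v t0⟩ : Y.Obj) ⟶ ⟨σ.V α, τ.v⟩) (hζ : ∀ (z : Unit × ℝ) (hz : z.2 = 1),
      ∃ e, R.h (Fin.last _) z (hz ▸ P.one_mem) = (F.at' t0).en z hz ≫ σ.mor ζ ≫ eqToHom e) (k : Fin (P.n + 2)) :
    ∃ (M : Set T) (e : Sec F.A.r (c k)), IsOpen M ∧ t0 ∈ M ∧ F.A.IsSec e ∧ e.N = M ×ˢ P.piece k ∧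
      (∀ s h h', (e.h (t0, s) h).tr = (R.h k ((), s) h').tr) ∧
      (k = 0 → ∀ t ∈ M, ∀ h, toAny (e.h (t, 0) h).tr = toAny (F.st (t, 0) rfl).tr) ∧
      (k = Fin.last _ → ∀ t ∈ M, ∀ h, ∃ hm : F.v t ∈ (Y.map ζ.tr).source,
        toAny (e.h (t, 1) h).tr = toAny (F.en (t, 1) rfl ≫ σ.mor (germ ζ.tr _ hm)).tr) := by
  have hne := (Fin.last_pos (n := P.n)).ne
  by_cases h0 : k = 0
  · subst h0
    obtain ⟨M, e, h1, h2, h3, h4, h5, h6⟩ := F.A.exists_parallel_toAny t0 (P.lt_succ 0).le (R.sec 0)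
      (fun s hs => hs) P.zero_mem F.st_sec (Eventually.of_forall fun t => rfl) (by
        intro h h'
        obtain ⟨e, he⟩ := R.start_eq ((), 0) rfl
        change _ = toAny (R.h 0 ((), 0) _).tr
        rw [he, toAny_comp_eqToHom]; rfl)
    exact ⟨M, e, h1, h2, h3, h4, h5, fun _ t ht h => h6 t ht h rfl, fun h => absurd h hne⟩
  by_cases h1 : k = Fin.last _
  · subst h1
    have hopen : IsOpen {t | F.v t ∈ (Y.map ζ.tr).source} := (Y.map ζ.tr).open_source.preimage F.v.continuous
    let m := (⟨{z | z.2 = 1}, fun z => σ.f F.α (F.v z.1), by fun_prop, F.en⟩ : Sec F.A.r _).post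
      ({z | z.2 = 1} ∩ {z | F.v z.1 ∈ (Y.map ζ.tr).source}) inter_subset_left
      (fun _ => σ.ρ F.α α ζ.tr) (fun _ _ => continuousAt_const) (fun z hz => (σ.mem_source ζ.tr) _ hz.2)
    obtain ⟨M, e, h1, h2, h3, h4, h5, h6⟩ := F.A.exists_parallel_toAny t0 (P.lt_succ (Fin.last _)).le
      (R.sec (Fin.last _)) (fun s hs => hs) P.one_mem (m := m) (F.en_sec.post _ _ _ _ _)
      (mem_of_superset (hopen.mem_nhds ζ.mem) fun t ht => ⟨rfl, ht⟩) (by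
        intro h h'
        obtain ⟨e, he⟩ := hζ ((), 1) rfl
        refine Eq.trans ?_ (congrArg (fun m => toAny m.tr) (he.trans (Category.assoc _ _ _).symm)).symm
        exact (toAny_comp_eqToHom (F.en (t0, 1) rfl ≫ σ.mor ζ) e).symm)
    refine ⟨M ∩ {t | F.v t ∈ (Y.map ζ.tr).source}, e.restrict {z | F.v z.1 ∈ (Y.map ζ.tr).source},
      h1.inter hopen, ⟨h2, ζ.mem⟩, h3.restrict _, ?_, fun s h h' => h5 s h.1 h',
      fun h => absurd h h0, fun _ t ht h => ⟨ht.2, h6 t ht.1 h.1 ⟨rfl, ht.2⟩⟩⟩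
    ext z
    change z ∈ e.N ∩ _ ↔ _
    rw [h4]
    simp only [mem_inter_iff, mem_prod, mem_ofPred_eq]
    change (_ ∧ z.2 ∈ P.piece (Fin.last _)) ∧ _ ↔ _
    tauto
  · obtain ⟨a, h, ha, ho, e⟩ := F.A.exists_isSec_through (t0, P.t k.castSucc)
      (R.h k ((), P.t k.castSucc) (P.left_mem k))
    obtain ⟨M, e, h1', h2, h3, h4, h5, h6⟩ := F.A.exists_parallel_toAny t0 (P.lt_succ k).le (R.sec k)
      (fun s hs => hs) (P.left_mem k) ha
      ((Continuous.tendsto' (by fun_prop) _ _ rfl).eventually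
        (ho.mem_nhds h)) (fun _ _ => congrArg toAny e)
    exact ⟨M, e, h1', h2, h3, h4, h5, fun h => absurd h h0, fun h => absurd h h1⟩

/-- The class of a family of based relative loops depends continuously on the parameter. -/
lemma continuous_cls (F : σ.PFam T) : Continuous fun t => (F.at' t).cls := by
  rw [continuous_generateFrom_iff]
  rintro _ ⟨P, c, α, K, D, A, hK, hD, hA, rfl⟩
  rw [isOpen_iff_mem_nhds]
  rintro t0 ⟨τ, hτ, hτK, hτA⟩
  obtain ⟨R⟩ := cls_eq_mk_iff.1 hτ.symm
  obtain ⟨ζ, hζ⟩ := R.fin_eq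
  choose M e hMo htM he hN hag hst hen using F.exists_extension t0 R ζ hζ
  have hM : ∀ᶠ t in 𝓝 t0, ∀ k, t ∈ M k := eventually_all.2 fun k => (hMo k).mem_nhds (htM k)
  have hval : ∀ k s (hs : s ∈ P.piece k), (e k).f (t0, s) = τ.f k s := by
    intro k s hs
    have h : (t0, s) ∈ (e k).N := by rw [hN]; exact ⟨htM k, hs⟩
    exact (hag k s h hs ▸ ((e k).h (t0, s) h).eq).symm.trans ((R.h k ((), s) hs).eq)
  have hKD : ∀ᶠ t in 𝓝 t0, ∀ k, ∀ s ∈ K k, (t, s) ∈ (e k).N → (e k).f (t, s) ∈ D k := by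
    refine eventually_all.2 fun k => ?_
    refine (hK k).1.eventually_forall_of_forall_eventually fun s hs => ?_
    have h : (t0, s) ∈ (e k).N := by rw [hN]; exact ⟨htM k, (hK k).2 hs⟩
    have := ((e k).cont _ h).eventually ((hD k).mem_nhds (by rw [hval k s ((hK k).2 hs)]; exact hτK k hs))
    exact eventually_nhdsWithin_iff.1 this
  have hξ : ∀ᶠ t in 𝓝 t0, ∀ l : Fin (P.n + 1), ∀ h1 h2,
      ((e l.castSucc).trans (e l.succ) (t, P.brk l) h1 h2).tr ∈ A l := by
    refine eventually_all.2 fun l => ?_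
    have h1 : (t0, P.brk l) ∈ (e l.castSucc).N := by rw [hN]; exact ⟨htM _, P.brk_mem_left l⟩
    have h2 : (t0, P.brk l) ∈ (e l.succ).N := by rw [hN]; exact ⟨htM _, P.brk_mem_right l⟩
    obtain ⟨G, hG, hE⟩ := (he l.castSucc).smoothAt (he l.succ) h1 h2
    have e2 : G t0 = τ.ξ l := by
      rw [← (hE.self_of_nhds h1 h2), ← R.link l ((), P.brk l) rfl]
      exact inv_comp_tr_congr (hag _ _ _ _) (hag _ _ _ _)
    have h3 : ∀ᶠ t in 𝓝 t0, G t ∈ A l := hG.eventually ((hA l).mem_nhds (by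
      change G t0 ∈ A l
      rw [e2]; exact hτA l))
    filter_upwards [h3, Pth.eventually_snd_eq hE] with t h3 h4 h5 h6
    rwa [h4 h5 h6]
  filter_upwards [hM, hKD, hξ] with t hM hKD hξ
  have hmem : ∀ k s, s ∈ P.piece k → (t, s) ∈ (e k).N := fun k s hs => by rw [hN]; exact ⟨hM k, hs⟩
  obtain ⟨hm, hen'⟩ := hen (Fin.last _) rfl t (hM _) (hmem _ 1 P.one_mem)
  obtain ⟨τ', hR', hf', hξ'⟩ := exists_rep_of_sections (F.at' t) P c
    (Y.map ζ.tr (F.v t)) (fun k s => (e k).f (t, s))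
    (fun k => (e k).cont.comp (Continuous.continuousOn (by fun_prop))
      fun s hs => hmem k s hs)
    (fun k z hz => (e k).h (t, z.2) (hmem k z.2 hz))
    (fun k => ((he k).secAt t).congr (fun z hz => hmem k z.2 hz) fun _ _ => rfl)
    (by
      rintro ⟨⟨⟩, s⟩ hz
      obtain rfl : s = 0 := hz
      exact toAny_inv_comp (hst 0 rfl t (hM 0) _).symm)
    (germ ζ.tr _ hm)
    (by
      rintro ⟨⟨⟩, s⟩ hz
      obtain rfl : s = 1 := hz
      obtain ⟨e', he'⟩ := eq_comp_eqToHom_of_toAny hen'.symm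
      have : inv (F.en (t, 1) rfl) ≫ (e (Fin.last _)).h (t, 1) (hmem _ 1 P.one_mem) =
        σ.mor (germ ζ.tr _ hm) ≫ eqToHom e' := by
        rw [he']; simp; rfl
      exact (congrArg (fun m : (⟨σ.W F.α, σ.f F.α (F.v t)⟩ : X.Obj) ⟶ _ => toAny m.tr) this).trans ((toAny_comp_eqToHom _ _).trans rfl))
  refine ⟨τ', (cls_eq_mk_iff.2 hR').symm, fun k s hs => ?_, fun l => ?_⟩
  · rw [hf']
    exact hKD k s hs (hmem k s ((hK k).2 hs))
  · rw [hξ' l]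
    exact hξ l _ _

/-- Families of based relative loops with the same members are isomorphic. -/
lemma exists_pIso (F F' : σ.PFam T) (h : ∀ t, (F.at' t).cls = (F'.at' t).cls) :
    ∃ (j : PIso F.A F'.A {z | z.2 ∈ Icc (0 : ℝ) 1}) (ζ : ∀ t, (⟨σ.V F.α, F.v t⟩ : Y.Obj) ⟶ ⟨σ.V F'.α, F'.v t⟩),
      (∀ (z : T × ℝ) (hz : z.2 = 0), j.J z (by simp [hz]) ≫ F'.st z hz = F.st z hz) ∧
      ∀ (z : T × ℝ) (hz : z.2 = 1), j.J z (by simp [hz]) ≫ F'.en z hz = F.en z hz ≫ σ.mor (ζ z.1) := by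
  choose j ζ h0 h1 using (fun t => cls_eq_cls_iff.1 (h t))
  let J : ∀ z ∈ {z : T × ℝ | z.2 ∈ Icc 0 1}, F.A.r z ⟶ F'.A.r z := fun z hz => (j z.1).J ((), z.2) hz
  refine ⟨⟨J, ?_⟩, ζ, fun z hz => h0 z.1 ((), z.2) hz, fun z hz => h1 z.1 ((), z.2) hz⟩
  refine PIso.smooth_of_flat ordConnected_Icc J (fun t => ⟨j t, fun s hs => rfl⟩)
    ⟨le_rfl, zero_le_one⟩ fun b hb => ?_
  refine Pth.isSec_of_local fun z hz => ⟨_, _, F.st_sec, hz.2, Eventually.of_forall fun _ h => h.2, ?_⟩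
  obtain ⟨G, hG, hE⟩ := (Pth.isSec_atlas hb).smoothAt F'.st_sec hz.1.2 hz.2
  refine ⟨G, hG, hE.mono fun z' h h1 h2 => ?_⟩
  rw [← h h1.1.2 h2]
  congr 1
  simp only [Sec.trans, Sec.restrict, Sec.pull]
  rw [IsIso.inv_comp_eq]
  have e1 : J z' h1.1.1 ≫ F'.st z' h2 = F.st z' h2 := h0 z'.1 ((), z'.2) h2
  rw [← e1]
  simp

end PFam

/-- Transition maps of `Y` that vary continuously after applying the system do so before. -/
lemma continuous_tr_of_mor {α β : σ.Λ} (hβ : IsEmbedding (σ.groupHom β)) {v : T → Y.C (σ.V α)}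
    (hv : Continuous v) {v' : T → Y.C (σ.V β)}
    (ζ : ∀ t, (⟨σ.V α, v t⟩ : Y.Obj) ⟶ ⟨σ.V β, v' t⟩)
    (h : Continuous fun t => σ.ρ α β (ζ t).tr) : Continuous (Y := Y.Tran (σ.V α) (σ.V β)) fun t => (ζ t).tr := by
  rw [continuous_iff_continuousAt]
  intro t0
  set ζ0 := (ζ t0).tr
  have hmem : ∀ᶠ t in 𝓝 t0, v t ∈ (Y.map ζ0).source :=
    hv.continuousAt.eventually ((Y.map ζ0).open_source.mem_nhds (ζ t0).mem)
  have hg : ∀ t, ∃ g : Y.G (σ.V β), v t ∈ (Y.map ζ0).source → (ζ t).tr = Y.act g ζ0 1 := by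
    intro t
    by_cases hm : v t ∈ (Y.map ζ0).source
    · obtain ⟨g, hg⟩ := (Y.aut (σ.V β)).surjective (inv (germ ζ0 (v t) hm) ≫ ζ t).tr
      refine ⟨g, fun _ => ?_⟩
      rw [aut_apply] at hg
      have e1 : ζ t = germ ζ0 (v t) hm ≫ (inv (germ ζ0 (v t) hm) ≫ ζ t) := by simp
      rw [e1, comp_tr]
      refine Eq.trans ?_ (comp_smulMor_tr (germ ζ0 (v t) hm) g)
      exact comp_congr rfl hg.symm rfl _ _
    · exact ⟨1, fun h => absurd h hm⟩
  choose g hg using hg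
  have hρ : ∀ t, v t ∈ (Y.map ζ0).source → σ.ρ α β (ζ t).tr = X.act (σ.groupHom β (g t)) (σ.ρ α β ζ0) 1 := by
    intro t hm
    have e3 : σ.ρ α β (Y.act (g t) ζ0 1) = (σ.mor (germ ζ0 (v t) hm ≫ smulMor (g t) _)).tr := by
      rw [mor_tr, comp_smulMor_tr]; rfl
    rw [hg t hm, e3, mor_comp, comp_tr]
    refine Eq.trans ?_ (X.comp_aut (σ.ρ α β ζ0) (σ.groupHom β (g t)) (σ.f α (v t)) ?_)
    · refine comp_congr rfl ?_ rfl _ _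
      rw [mor_tr, smulMor_tr]
      have : X.aut (σ.W β) (σ.groupHom β (g t)) = σ.ρ β β (Y.aut (σ.V β) (g t)) := Equiv.apply_symm_apply _ _
      rw [aut_apply, aut_apply] at this
      exact this.symm
    · refine mem_trans_source (σ.mem_source _ _ hm) ?_
      rw [source_act_left]; exact mem_source_one _ _
  have hlim : Tendsto (fun t => σ.groupHom β (g t)) (𝓝 t0) (𝓝 1) := by
    have h2 := (continuousAt_div (σ.ρ α β ζ0)).tendsto
    rw [Orbispace.div_self] at h2
    refine (h2.comp (h.continuousAt)).congr' ?_
    filter_upwards [hmem] with t hm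
    simp only [Function.comp, hρ t hm, div_act]
  have h3 := (continuous_act_left ζ0).continuousAt.tendsto.comp (by rw [hβ.tendsto_nhds_iff, _root_.map_one]; exact hlim)
  rw [Y.one_act_one] at h3
  refine Tendsto.congr' ?_ h3
  filter_upwards [hmem] with t hm
  simp only [Function.comp, hg t hm]

/-- The end transition maps of an isomorphism of families are continuous. -/
lemma PFam.continuous_tr {F F' : σ.PFam T} (hσ : ∀ α, IsEmbedding (σ.groupHom α))
    (j : PIso F.A F'.A {z | z.2 ∈ Icc (0 : ℝ) 1})
    (ζ : ∀ t, (⟨σ.V F.α, F.v t⟩ : Y.Obj) ⟶ ⟨σ.V F'.α, F'.v t⟩)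
    (h : ∀ (z : T × ℝ) (hz : z.2 = 1), j.J z (by simp [hz]) ≫ F'.en z hz = F.en z hz ≫ σ.mor (ζ z.1)) :
    Continuous (Y := Y.Tran (σ.V F.α) (σ.V F'.α)) fun t => (ζ t).tr := by
  refine continuous_tr_of_mor (hσ _) F.v.continuous ζ ?_
  rw [continuous_iff_continuousAt]
  intro t0
  obtain ⟨G, hG, hE⟩ := F.en_sec.smoothAt (z := (t0, 1)) (j.isSec_pull F'.en_sec) rfl ⟨⟨zero_le_one, le_rfl⟩, rfl⟩
  refine hG.congr ?_
  filter_upwards [Pth.eventually_snd_eq hE] with t ht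
  rw [← ht rfl ⟨⟨zero_le_one, le_rfl⟩, rfl⟩, ← mor_tr]
  congr 1
  change inv (F.en (t, 1) rfl) ≫ (j.J (t, 1) _ ≫ F'.en (t, 1) rfl) = _
  rw [h (t, 1) rfl]
  simp

end BasedSystem

namespace Orbispace

section Gauge

/-- The elements `g k` transform the transition maps `ξ` into `ξ'`. -/
def IsGauge {n : ℕ} {c : Fin (n + 2) → X.ι} (ξ' ξ : ∀ l : Fin (n + 1), X.Tran (c l.castSucc) (c l.succ))
    (g : ∀ k, X.G (c k)) : Prop :=
  g 0 = 1 ∧ ∀ l, X.act (g l.succ) (ξ l) 1 = X.act 1 (ξ' l) (g l.castSucc)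

variable {n : ℕ} {c : Fin (n + 2) → X.ι} {ξ ξ' ξ'' : ∀ l : Fin (n + 1), X.Tran (c l.castSucc) (c l.succ)}
  {g g' : ∀ k, X.G (c k)}

lemma IsGauge.mul (h' : IsGauge ξ'' ξ' g') (h : IsGauge ξ' ξ g) : IsGauge ξ'' ξ (fun k => g' k * g k) := by
  refine ⟨by simp [h.1, h'.1], fun l => ?_⟩
  have h1 := congrArg (fun η => X.act (g' l.succ) η 1) (h.2 l)
  have h2 := congrArg (fun η => X.act 1 η (g l.castSucc)) (h'.2 l)
  simp only [X.act_act, mul_one, one_mul] at h1 h2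
  exact h1.trans h2

lemma IsGauge.unique (h : IsGauge ξ' ξ g) (h' : IsGauge ξ' ξ g') (k) : g k = g' k := by
  induction k using Fin.induction with
  | zero => rw [h.1, h'.1]
  | succ l ih =>
    have h1 := h.2 l
    rw [ih, ← h'.2 l] at h1
    exact act_left_injective (ξ l) h1

open scoped Pointwise in
/-- Gauge transformations to a fixed system of transition maps exist near a given one and depend
continuously on the transition maps. -/
lemma IsGauge.exists_continuousAt (h : IsGauge ξ' ξ g) :
    ∃ F : ∀ k, (∀ l : Fin (n + 1), X.Tran (c l.castSucc) (c l.succ)) → X.G (c k),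
      (∀ k, ContinuousAt (F k) ξ) ∧ (∀ k, F k ξ = g k) ∧
      ∀ᶠ η in 𝓝 ξ, IsGauge ξ' η fun k => F k η := by
  let F : ∀ k, (∀ l : Fin (n + 1), X.Tran (c l.castSucc) (c l.succ)) → X.G (c k) := fun k η =>
    Fin.induction 1 (fun l a =>
      g l.succ * lam (ξ l) ((g l.castSucc)⁻¹ * a) * (div (ξ l) (η l))⁻¹) k
  have F0 : ∀ η, F 0 η = 1 := fun η => rfl
  have FS : ∀ l η, F (Fin.succ l) η = g l.succ * lam (ξ l) ((g l.castSucc)⁻¹ * F l.castSucc η) *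
    (div (ξ l) (η l))⁻¹ := fun l η => rfl
  have hF : ∀ k, ContinuousAt (F k) ξ ∧ F k ξ = g k := by
    intro k
    induction k using Fin.induction with
    | zero => exact ⟨continuousAt_const, (F0 ξ).trans h.1.symm⟩
    | succ l ih =>
      have e1 : (g l.castSucc)⁻¹ * F l.castSucc ξ = 1 := by rw [ih.2, inv_mul_cancel]
      constructor
      · have h2 : ContinuousAt (fun η => lam (ξ l) ((g l.castSucc)⁻¹ * F l.castSucc η)) ξ :=
          ContinuousAt.comp (g := lam (ξ l)) (by rw [e1]; exact continuousAt_lam _) (continuousAt_const.mul ih.1)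
        exact (continuousAt_const.mul h2).mul (ContinuousAt.comp (g := div (ξ l)) (continuousAt_div _) (continuous_apply l).continuousAt).inv
      · rw [FS, e1, lam_one, Orbispace.div_self]; simp
  refine ⟨F, fun k => (hF k).1, fun k => (hF k).2, ?_⟩
  have hs : ∀ᶠ η in 𝓝 ξ, ∀ l : Fin (n + 1), (g l.castSucc)⁻¹ * F l.castSucc η ∈
      MulAction.stabilizer (X.G (c l.castSucc)) (X.map (ξ l)).source ∧
      X.act (div (ξ l) (η l)) (ξ l) 1 = η l := by
    refine eventually_all.2 fun l => Filter.Eventually.and ?_ ?_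
    · have h1 : ContinuousAt (fun η => (g l.castSucc)⁻¹ * F l.castSucc η) ξ := continuousAt_const.mul (hF _).1
      refine h1.eventually ?_
      beta_reduce
      rw [(hF _).2, inv_mul_cancel]
      exact eventually_mem_stabilizer _
    · exact (continuous_apply l).continuousAt.eventually (eventually_act_div (ξ l))
  filter_upwards [hs] with η hη
  refine ⟨F0 η, fun l => ?_⟩
  obtain ⟨h1, h2⟩ := hη l
  have h4 := congrArg (fun ζ => X.act (g l.succ) ζ 1) (act_lam (ξ l) h1)
  have h5 := congrArg (fun ζ => X.act 1 ζ ((g l.castSucc)⁻¹ * F l.castSucc η)) (h.2 l)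
  simp only [X.act_act, mul_one, one_mul, mul_inv_cancel_left] at h4 h5
  rw [← h2]
  simp only [FS, X.act_act, mul_one, inv_mul_cancel_right, Orbispace.div_act]
  rw [h4, h5]

end Gauge

section Cast

variable {i j : X.ι}

/-- The groups of equal charts. -/
def castG (h : i = j) : X.G i ≃ₜ* X.G j := h ▸ ContinuousMulEquiv.refl _

lemma toAny_aut_castG (h : i = j) (g : X.G i) : toAny (X.aut j (castG h g)) = toAny (X.aut i g) := by subst h; rfl

lemma smul_castG (h : i = j) (g : X.G i) {x : X.C i} {y : X.C j} (e : (⟨i, x⟩ : X.BasePoint) = ⟨j, y⟩) :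
    (⟨i, g • x⟩ : X.BasePoint) = ⟨j, castG h g • y⟩ := by
  subst h
  obtain rfl : x = y := eq_of_heq (Sigma.mk.inj e).2
  rfl

/-- The spaces of equal charts. -/
def castC (h : i = j) : X.C i ≃ₜ X.C j := h ▸ Homeomorph.refl _

lemma castC_eq (h : i = j) {x : X.C i} {y : X.C j} (e : (⟨i, x⟩ : X.BasePoint) = ⟨j, y⟩) : castC h x = y := by
  subst h
  exact eq_of_heq (Sigma.mk.inj e).2

end Cast

end Orbispace

namespace BasedSystem

section

variable {P : Subdivision} {c : Fin (P.n + 2) → X.ι}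

lemma RelSys.chart_last (τ : σ.RelSys P c α) : c (Fin.last _) = σ.W α := (Sigma.mk.inj τ.finish).1

lemma aut_groupHom (α : σ.Λ) (γ : Y.G (σ.V α)) :
    X.aut (σ.W α) (σ.groupHom α γ) = σ.ρ α α (Y.aut (σ.V α) γ) := Equiv.apply_symm_apply _ _

lemma f_smul (α : σ.Λ) (γ : Y.G (σ.V α)) (x : Y.C (σ.V α)) : σ.f α (γ • x) = σ.groupHom α γ • σ.f α x := by
  have h1 : X.map (σ.ρ α α (Y.aut _ γ)) (σ.f α x) = σ.f α (γ • x) := (σ.mor (smulMor γ x)).eq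
  rw [← h1, ← aut_groupHom]
  exact ((smulMor (σ.groupHom α γ) (σ.f α x)).eq)

/-- Gauge transformations do not change the class of a system. -/
lemma exists_gauge_transform (τ : σ.RelSys P c α) {ξ' : ∀ l : Fin (P.n + 1), X.Tran (c l.castSucc) (c l.succ)}
    {d : ∀ k, X.G (c k)} (hd : IsGauge ξ' τ.ξ d) (γ : Y.G (σ.V α))
    (hγ : castG τ.chart_last (d (Fin.last _)) = σ.groupHom α γ) :
    ∃ τ' : σ.RelSys P c α, (∀ k s, τ'.f k s = d k • τ.f k s) ∧ τ'.ξ = ξ' ∧ τ'.v = γ • τ.v ∧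
      RelLoop.mk τ' = RelLoop.mk τ := by
  let m : ∀ l, (⟨c (Fin.castSucc l), d _ • τ.f l.castSucc (P.brk l)⟩ : X.Obj) ⟶
      ⟨c l.succ, d _ • τ.f l.succ (P.brk l)⟩ := fun l =>
    inv (smulMor _ _) ≫ τ.mor l ≫ smulMor _ _
  have hm : ∀ l, (m l).tr = ξ' l := by
    intro l
    have e1 : (smulMor (d l.castSucc) (τ.f l.castSucc (P.brk l)) ≫ m l).tr = X.act (d l.succ) (τ.ξ l) 1 := by
      simp only [m]
      rw [IsIso.hom_inv_id_assoc]
      exact comp_smulMor_tr _ _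
    rw [smulMor_comp_tr, hd.2 l] at e1
    simpa [X.act_act, X.one_act_one] using (congrArg (fun η => X.act 1 η (d l.castSucc)⁻¹) e1)
  let τ' : σ.RelSys P c α :=
    { f := fun k s => d k • τ.f k s
      continuousOn := fun k => (τ.continuousOn k).const_smul _
      ξ := ξ'
      mem_source := fun l => by rw [← hm l]; exact (m l).mem
      glue := fun l => by rw [← hm l]; exact (m l).eq
      start := by rw [hd.1, one_smul]; exact τ.start
      v := γ • τ.v
      finish := by
        rw [f_smul, ← hγ]
        exact smul_castG _ _ τ.finish }
  refine ⟨τ', fun k s => rfl, rfl, rfl, (Quot.sound ?_).symm⟩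
  refine ⟨⟨id, rfl, rfl, fun k => subset_rfl, fun k => X.aut (c k) (d k), fun k s hs => (smulMor _ _).mem,
    fun k s hs => (smulMor (d k) (τ.f k s)).eq, fun l => ⟨_, .step l, ?_, ?_, ?_⟩⟩, ?_, Y.aut _ γ,
    (smulMor γ τ.v).mem, (smulMor γ τ.v).eq, ?_⟩
  · exact mem_trans_source (τ.mem_source l) (by rw [X.source_eq_univ]; trivial)
  · refine mem_trans_source (smulMor _ _).mem ?_
    have e : X.map (X.aut (c l.castSucc) (d l.castSucc)) (τ.f l.castSucc (P.brk l)) = _ :=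
      (smulMor (d l.castSucc) (τ.f l.castSucc (P.brk l))).eq
    change _ ∈ (X.map (ξ' l)).source
    rw [← hm l]
    dsimp only [id]
    rw [e]
    exact (m l).mem
  · have e : τ.mor l ≫ smulMor (d l.succ) _ = smulMor (d l.castSucc) _ ≫ m l := by
      simp [m]
    exact (congrArg Mor.tr e).trans (comp_congr rfl (hm l) rfl _ _)
  · change toAny (X.aut (c 0) (d 0)) = _
    rw [hd.1, aut_one]
    exact congrArg (fun b => toAny (X.one b.1)) τ.start
  · change toAny (X.aut (c (Fin.last _)) (d (Fin.last _))) = _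
    rw [← toAny_aut_castG τ.chart_last, hγ, aut_groupHom]

/-- Systems over the same charts with the same class differ by a gauge transformation. -/
lemma exists_gauge_of_mk_eq {τ τ' : σ.RelSys P c α} (h : RelLoop.mk τ = RelLoop.mk τ') :
    ∃ (b : ∀ k, X.G (c k)) (γ : Y.G (σ.V α)), IsGauge τ'.ξ τ.ξ b ∧ (∀ k, ∀ s ∈ P.piece k, τ'.f k s = b k • τ.f k s) ∧
      castG τ.chart_last (b (Fin.last _)) = σ.groupHom α γ := by
  obtain ⟨F, hF⟩ := Rep.exists_pfam τ
  obtain ⟨R'⟩ := (Rep.nonempty_iff_of_mk_eq h).1 hF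
  obtain ⟨R⟩ := hF
  let m : ∀ k (z : Unit × ℝ) (hz : z.2 ∈ P.piece k),
    (⟨c k, τ.f k z.2⟩ : X.Obj) ⟶ ⟨c k, τ'.f k z.2⟩ := fun k z hz => inv (R.h k z hz) ≫ R'.h k z hz
  let b : ∀ k, X.G (c k) := fun k => (X.aut (c k)).symm (m k ((), P.t k.castSucc) (P.left_mem k)).tr
  have hb : ∀ k z hz, X.act (b k) (X.one _) 1 = (m k z hz).tr := by
    intro k z hz
    rw [← aut_apply, Equiv.apply_symm_apply]
    exact R.trans_const R' (P.isPreconnected_piece k) subset_rfl subset_rfl (P.left_mem k) hz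
  have hf : ∀ k, ∀ s ∈ P.piece k, τ'.f k s = b k • τ.f k s := by
    intro k s hs
    have h1 : X.map (m k ((), s) hs).tr (τ.f k s) = τ'.f k s := (m k ((), s) hs).eq
    rw [← h1, ← hb]
    exact (smulMor (b k) (τ.f k s)).eq
  obtain ⟨ζ, hζ⟩ := R.fin_eq
  obtain ⟨ζ', hζ'⟩ := R'.fin_eq
  refine ⟨b, (Y.aut _).symm (inv ζ ≫ ζ').tr, ⟨?_, fun l => ?_⟩, hf, ?_⟩
  · apply (X.aut (c 0)).injective
    rw [aut_one, aut_apply, hb 0 ((), 0) P.zero_mem]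
    obtain ⟨e1, h1⟩ := R.start_eq ((), 0) rfl
    obtain ⟨e2, h2⟩ := R'.start_eq ((), 0) rfl
    apply toAny_injective
    have : m 0 ((), 0) P.zero_mem = eqToHom (e1.symm.trans e2) := by
      simp only [m]
      rw [h1, h2]; simp
    rw [this, toAny_eqToHom]
  · set z : Unit × ℝ := ((), P.brk l)
    have ha : z.2 ∈ P.piece l.castSucc := P.brk_mem_left l
    have hb' : z.2 ∈ P.piece l.succ := P.brk_mem_right l
    have h1 : inv (R.h _ z ha) ≫ R.h _ z hb' = τ.mor l := hom_ext (R.link l z rfl)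
    have h2 : inv (R'.h _ z ha) ≫ R'.h _ z hb' = τ'.mor l := hom_ext (R'.link l z rfl)
    have e : τ.mor l ≫ m _ z hb' = m _ z ha ≫ τ'.mor l := by rw [← h1, ← h2]; simp [m]
    have e1 : ∀ k (hk : z.2 ∈ P.piece k), m k z hk = smulMor (b k) _ ≫ eqToHom (by rw [hf k z.2 hk]) := by
      intro k hk
      apply hom_ext
      apply toAny_injective
      rw [toAny_comp_eqToHom, ← hb k z hk]; rfl
    rw [e1, e1] at e
    apply toAny_injective
    have e2 := congrArg (fun m => toAny (Mor.tr m)) e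
    simp only [← Category.assoc, toAny_comp_eqToHom] at e2
    rw [comp_smulMor_tr, Category.assoc, smulMor_comp_tr] at e2
    refine e2.trans ?_
    congr 2
    apply toAny_injective
    rw [toAny_eqToHom_comp]
    rfl
  · apply (X.aut (σ.W α)).injective
    rw [aut_groupHom, Equiv.apply_symm_apply]
    apply toAny_injective
    rw [toAny_aut_castG, aut_apply, hb _ ((), 1) P.one_mem]
    obtain ⟨e1, h1'⟩ := hζ ((), 1) rfl
    obtain ⟨e2, h2'⟩ := hζ' ((), 1) rfl
    have : m (Fin.last _) ((), 1) P.one_mem = eqToHom e1.symm ≫ σ.mor (inv ζ ≫ ζ') ≫ eqToHom e2 := by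
      simp only [m]
      rw [h1', h2']; simp
    rw [this, toAny_eqToHom_comp, toAny_comp_eqToHom, mor_tr]

end

/-- Maps to the quotient groups of the system lift locally. -/
def LocalLift (σ : BasedSystem.{u, v, w} Y X q p) (T : Type*) [TopologicalSpace T] : Prop :=
  ∀ (α : σ.Λ) (t0 : T) (u : T → X.G (σ.W α) ⧸ (σ.groupHom α).range), (∀ᶠ t in 𝓝 t0, ContinuousAt u t) →
    ∃ h : T → X.G (σ.W α), ∀ᶠ t in 𝓝 t0, ContinuousAt h t ∧ (h t : X.G (σ.W α) ⧸ _) = u t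

/-- Systems near a given one over the same subdivision and charts. -/
lemma eventually_exists_sys {Φ : T → σ.RelLoop} (hΦ : Continuous Φ) {P : Subdivision}
    {c : Fin (P.n + 2) → X.ι} {α : σ.Λ} {t1 : T} {τ1 : σ.RelSys P c α} (h₁ : RelLoop.mk τ1 = Φ t1)
    {k : Fin (P.n + 2)} {K : Set ℝ} (hK : IsCompact K) (hKP : K ⊆ P.piece k) {D : Set (X.C (c k))}
    (hD : IsOpen D) (hKD : MapsTo (τ1.f k) K D)
    {S : Set (∀ l : Fin (P.n + 1), X.Tran (c l.castSucc) (c l.succ))} (hS : S ∈ 𝓝 τ1.ξ) :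
    ∀ᶠ t in 𝓝 t1, ∃ τ : σ.RelSys P c α, RelLoop.mk τ = Φ t ∧ MapsTo (τ.f k) K D ∧ τ.ξ ∈ S := by
  classical
  obtain ⟨S', hS', hS'o, hmS⟩ := mem_nhds_iff.1 hS
  obtain ⟨A, hA, hAS⟩ := isOpen_pi_iff'.1 hS'o _ hmS
  let K' : Fin (P.n + 2) → Set ℝ := Function.update (fun _ => ∅) k K
  let D' : ∀ k, Set (X.C (c k)) := Function.update (fun _ => univ) k D
  have hO : IsOpen {γ : σ.RelLoop | ∃ τ : σ.RelSys P c α,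
      RelLoop.mk τ = γ ∧ (∀ k, MapsTo (τ.f k) (K' k) (D' k)) ∧ ∀ l, τ.ξ l ∈ A l} := by
    refine .basic _ ⟨P, c, α, K', D', A, fun k' => ?_, fun k' => ?_, fun l => (hA l).1, rfl⟩ <;>
      obtain rfl | h := eq_or_ne k' k
    · simpa [K'] using ⟨hK, hKP⟩
    · simp [K', h]
    · simpa [D'] using hD
    · simp [D', h]
  have hm := hO.mem_nhds ⟨τ1, h₁, fun k' => (by
    obtain rfl | h := eq_or_ne k' k
    · simpa [K', D'] using hKD
    · simp [K', h, mapsTo_empty]), fun l => (hA l).2⟩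
  filter_upwards [hΦ.continuousAt.eventually hm] with t ht
  obtain ⟨τ, h1, h2, h3⟩ := ht
  refine ⟨τ, h1, ?_, hS' (hAS fun l _ => h3 l)⟩
  simpa only [K', D', Function.update_self] using (h2 k)

/-- Every continuous map to the based relative loop space comes locally from a family. -/
theorem exists_local_pfam (hf : ∀ α, IsEmbedding (σ.f α)) (hl : LocalLift σ T) {Φ : T → σ.RelLoop}
    (hΦ : Continuous Φ) (t0 : T) : ∃ M : Set T, IsOpen M ∧ t0 ∈ M ∧ ∃ F : σ.PFam M, ∀ t : M, (F.at' t).cls = Φ t := by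
  classical
  obtain ⟨⟨P, c, α, τ0⟩, h0⟩ := Quot.exists_rep (Φ t0)
  let Gd : Set T := {t | ∃ (τ : σ.RelSys P c α) (g : ∀ k, X.G (c k)), IsGauge τ0.ξ τ.ξ g ∧ RelLoop.mk τ = Φ t}
  have hGd0 : t0 ∈ Gd := ⟨τ0, fun _ => 1, ⟨rfl, fun l => rfl⟩, h0⟩
  have hGd : ∀ t ∈ Gd, ∀ᶠ t' in 𝓝 t, t' ∈ Gd := by
    rintro t ⟨τ, g, hg, hτ⟩
    obtain ⟨F, -, -, hF⟩ := hg.exists_continuousAt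
    filter_upwards [eventually_exists_sys hΦ hτ (k := 0) isCompact_empty (empty_subset _) isOpen_univ
      (fun _ _ => trivial) hF] with t' hτ'
    obtain ⟨τ', h1, -, h2⟩ := hτ'
    exact ⟨τ', _, h2, h1⟩
  have : Nonempty (σ.RelSys P c α) := ⟨τ0⟩
  choose! τ g hτ using fun t (h : t ∈ Gd) => h
  have hc : c (Fin.last _) = σ.W α := τ0.chart_last
  let cl : X.G (c (Fin.last _)) → X.G (σ.W α) ⧸ (σ.groupHom α).range := fun x => castG hc x
  have inv : ∀ t ∈ Gd, ∀ (τ' : σ.RelSys P c α) (g' : ∀ k, X.G (c k)), IsGauge τ0.ξ τ'.ξ g' →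
      RelLoop.mk τ' = Φ t → (∀ k, ∀ s ∈ P.piece k, g t k • (τ t).f k s = g' k • τ'.f k s) ∧
      cl (g t _) = cl (g' _) := by
    intro t ht τ' g' hg' hm'
    obtain ⟨hg, hm⟩ := hτ t ht
    obtain ⟨b, γ, hb, hbf, hbl⟩ := exists_gauge_of_mk_eq (hm.trans hm'.symm)
    have hgb := hg.unique (hg'.mul hb)
    refine ⟨fun k s hs => ?_, ?_⟩
    · rw [hbf k s hs, smul_smul, hgb]
    · simp only [cl]
      rw [hgb, map_mul, eq_comm, QuotientGroup.eq, inv_mul_cancel_left, hbl]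
      exact ⟨γ, rfl⟩
  have hfc : ∀ k, ∀ z1 : T × ℝ, z1.1 ∈ Gd → z1.2 ∈ P.piece k →
      ContinuousWithinAt (fun z => g z.1 k • (τ z.1).f k z.2) {z | z.2 ∈ P.piece k} z1 := by
    rintro k ⟨t1, s1⟩ ht hs N hN
    obtain ⟨hg, hm⟩ := hτ t1 ht
    obtain ⟨F, hFc, hFv, hF⟩ := hg.exists_continuousAt
    have hsm : Tendsto (fun w => w.1 • w.2)
      (𝓝 (g t1 k) ×ˢ 𝓝 ((τ t1).f k s1)) (𝓝 (g t1 k • (τ t1).f k s1)) := by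
      rw [← nhds_prod_eq]
      exact (continuous_smul).tendsto (g t1 k, (τ t1).f k s1)
    obtain ⟨B, hB, D, hD, hBD⟩ := mem_prod_iff.1 (hsm hN)
    obtain ⟨D', hD', hD'o, hmD⟩ := mem_nhds_iff.1 hD
    have h1 := ((τ t1).continuousOn k s1 hs) (hD'o.mem_nhds hmD)
    obtain ⟨ε, hε, hball⟩ := Metric.mem_nhdsWithin_iff.1 h1
    have hev := eventually_exists_sys hΦ hm ((isCompact_closedBall _ _).inter_right isClosed_Icc) inter_subset_right hD'o
      (fun s hs' => hball ⟨Metric.closedBall_subset_ball (half_lt_self hε) hs'.1, hs'.2⟩)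
      (hF.and ((hFc k).eventually (show B ∈ 𝓝 (F k (τ t1).ξ) by rwa [hFv])))
    rw [mem_map, mem_nhdsWithin_iff_eventually, nhds_prod_eq]
    filter_upwards [(hev.and (hGd t1 ht)).prod_mk (Metric.closedBall_mem_nhds s1 (half_pos hε))] with z hz h7
    obtain ⟨⟨⟨τ', h1, h2, h3, h4⟩, h5⟩, h6⟩ := hz
    change g z.1 k • (τ z.1).f k z.2 ∈ N
    rw [(inv z.1 h5 τ' _ h3 h1).1 k z.2 h7]
    exact hBD (show (F k τ'.ξ, τ'.f k z.2) ∈ B ×ˢ D from ⟨h4, hD' (h2 ⟨h6, h7⟩)⟩)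
  have huc : ∀ t1 ∈ Gd, ContinuousAt (fun t => cl (g t _)) t1 := by
    intro t1 ht N hN
    obtain ⟨hg, hm⟩ := hτ t1 ht
    obtain ⟨F, hFc, hFv, hF⟩ := hg.exists_continuousAt
    have hcm : ContinuousAt (fun η => cl (F _ η)) (τ t1).ξ :=
      ContinuousAt.comp (g := cl) (QuotientGroup.continuous_mk.comp (castG hc).continuous).continuousAt (hFc _)
    have hev := eventually_exists_sys hΦ hm (k := 0) isCompact_empty (empty_subset _) isOpen_univ
      (fun _ _ => trivial) (hF.and (hcm.eventually (show N ∈ _ by beta_reduce; rwa [hFv])))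
    rw [mem_map]
    filter_upwards [hev, hGd t1 ht] with t ht' h5
    obtain ⟨τ', h1, -, h3, h4⟩ := ht'
    rw [mem_preimage]
    beta_reduce
    rwa [(inv t h5 τ' _ h3 h1).2]
  obtain ⟨h, hh⟩ := hl α t0 _ ((hGd t0 hGd0).mono huc)
  obtain ⟨M, hM, hMo, ht₀M⟩ := eventually_nhds_iff.1 (hh.and (hGd t0 hGd0))
  refine ⟨M, hMo, ht₀M, ?_⟩
  let e : M → ∀ k, X.G (c k) := fun t => Function.update (fun _ => 1) (Fin.last _) ((castG hc).symm (h t)⁻¹)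
  have hec : Continuous e := by
    refine Continuous.update continuous_const _ ((castG hc).symm.continuous.comp (Continuous.inv ?_))
    rw [continuous_iff_continuousAt]
    exact fun t => (hM t t.2).1.1.comp continuous_subtype_val.continuousAt
  have he : ∀ t, IsGauge (fun l => X.act (e t l.succ) (τ0.ξ l) 1) τ0.ξ (e t) := by
    intro t
    refine ⟨Function.update_of_ne ((Fin.last_pos).ne) _ _, fun l => ?_⟩
    have : e t l.castSucc = 1 := Function.update_of_ne (Fin.castSucc_lt_last l).ne _ _
    rw [this, X.act_act]; simp
  have hS : ∀ t : M, ∃ τ' : σ.RelSys P c α, (∀ k s, τ'.f k s = e t k • g t k • (τ t).f k s) ∧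
      (∀ l, τ'.ξ l = X.act (e t l.succ) (τ0.ξ l) 1) ∧ RelLoop.mk τ' = Φ t := by
    intro t
    obtain ⟨⟨-, h2⟩, h3⟩ := hM t t.2
    rw [QuotientGroup.eq] at h2
    obtain ⟨γ, hγ⟩ := h2
    obtain ⟨τ', a1, a2, -, a4⟩ := exists_gauge_transform (τ t) ((he t).mul (hτ t h3).1) γ (by
      rw [map_mul, hγ]
      congr 1
      simp only [e, Function.update_self]
      exact (castG hc).apply_symm_apply _)
    exact ⟨τ', fun k s => by rw [a1, smul_smul], fun l => by rw [a2], a4.trans (hτ t h3).2⟩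
  choose S hSf hSξ hSm using hS
  have hSc : ∀ k, ContinuousOn (fun z : M × ℝ => (S z.1).f k z.2) {z | z.2 ∈ P.piece k} := by
    intro k z hz
    simp only [hSf]
    refine ContinuousWithinAt.smul (((continuous_apply k).comp hec).comp continuous_fst).continuousWithinAt ?_
    exact (hfc k (z.1, z.2) (hM z.1 z.1.2).2 hz).comp (f := fun z : M × ℝ => ((z.1 : T), z.2))
      (Continuous.continuousWithinAt (by fun_prop)) fun _ h => h
  obtain ⟨F, hF⟩ := exists_pfam_of_sys S hSc (fun l => by
      simp only [hSξ]
      exact (continuous_act_left (τ0.ξ l)).comp ((continuous_apply l.succ).comp hec)) (by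
      rw [(hf α).continuous_iff]
      have : (σ.f α) ∘ (fun t => (S t).v) = fun t => castC hc ((S t).f (Fin.last _) 1) := by
        funext t
        exact (castC_eq hc (S t).finish).symm
      rw [this]
      refine (castC hc).continuous.comp ?_
      rw [← continuousOn_univ]
      exact (hSc (Fin.last _)).comp (f := fun t => (t, 1))
        (Continuous.continuousOn (by fun_prop)) fun t _ => P.one_mem)
  exact ⟨F, fun t => (PFam.cls_eq_mk_iff.2 (hF t)).trans (hSm t)⟩

end BasedSystem

namespace Orbispace

/-- The one-point orbispace. -/
def onePoint : Orbispace PUnit.{v + 1} where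
  ι := PUnit
  U _ := univ
  U_injective _ _ _ := rfl
  isOpen_U _ := isOpen_univ
  isConnected_U _ := isConnected_univ
  isBasis := by
    refine TopologicalSpace.isTopologicalBasis_of_isOpen_of_nhds (by simp) fun a u ha hu =>
      ⟨univ, ⟨PUnit.unit, rfl⟩, trivial, fun x _ => ?_⟩
    rwa [Subsingleton.elim x a]
  C _ := PUnit
  G _ := PUnit
  proj _ _ := ⟨PUnit.unit, trivial⟩
  proj_isQuotientMap _ :=
    (⟨⟨fun _ => ⟨PUnit.unit, trivial⟩, fun _ => PUnit.unit, fun _ => rfl, fun _ => rfl⟩,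
      by fun_prop, by fun_prop⟩ : PUnit ≃ₜ (univ : Set PUnit)).isQuotientMap
  proj_eq_iff _ _ _ := ⟨fun _ => ⟨1, rfl⟩, fun _ => rfl⟩
  Tran _ _ := PUnit
  map _ := OpenPartialHomeomorph.refl _
  map_proj _ _ _ := rfl
  source_nonempty _ := ⟨PUnit.unit, trivial⟩
  source_eq _ x _ := by
    refine (eq_univ_of_forall fun y => ?_).symm
    rw [Subsingleton.elim y x]
    exact mem_connectedComponentIn (by trivial)
  target_eq _ x _ := by
    refine (eq_univ_of_forall fun y => ?_).symm
    rw [Subsingleton.elim y x]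
    exact mem_connectedComponentIn (by trivial)
  hom _ := ContinuousMulEquiv.refl _
  map_smul _ _ _ _ := rfl
  exists_tran _ _ _ _ := ⟨PUnit.unit, trivial⟩
  act _ _ _ := PUnit.unit
  one_act_one _ := rfl
  act_act _ _ _ _ _ := rfl
  map_act _ _ _ := ⟨by simp, fun _ _ => rfl⟩
  exists_act _ _ _ := ⟨1, 1, rfl⟩
  act_eq_iff _ _ _ := ⟨fun _ => ⟨one_mem _, rfl⟩, fun _ => rfl⟩
  one _ := PUnit.unit
  map_one _ := ⟨rfl, fun _ _ => rfl⟩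
  hom_one _ _ := rfl
  comp _ _ _ _ := PUnit.unit
  mem_source_comp _ _ _ _ := trivial
  map_comp _ _ _ _ _ _ := rfl
  comp_eq_comp _ _ _ _ _ _ _ := rfl
  comp_assoc _ _ _ _ _ _ _ _ := rfl
  comp_aut _ _ _ _ := rfl
  aut_comp _ _ _ _ := rfl

/-- The chart of the one-point orbispace. -/
def onePointChart : onePoint.{v}.ι := PUnit.unit

/-- The point of the one-point orbispace. -/
def onePointBase : onePoint.{v}.BasePoint := ⟨onePointChart, PUnit.unit⟩

end Orbispace

namespace BasedSystem

section Point

variable (p)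

/-- The inclusion of the base point. -/
def point : BasedSystem.{v, v, 0} onePoint.{v} X onePointBase p where
  Λ := Unit
  V _ := onePointChart
  W _ := p.1
  cover _ := ⟨(), trivial⟩
  f _ := ⟨fun _ => p.2, continuous_const⟩
  ρ _ _ _ := X.one p.1
  continuous_ρ _ _ := continuous_const
  mem_source _ _ _ := mem_source_one _ _
  f_map _ _ _ := (map_one_apply _ _).symm
  ρ_comp _ _ _ _ hx' := by exact (congrArg Mor.tr (Category.id_comp (𝟙 (⟨p.1, p.2⟩ : X.Obj)))).symm
  o := ()
  pt := PUnit.unit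
  base_source := rfl
  base_target := rfl

variable {p}

/-- A system of a based relative loop that ends at the base point, as a system of a based loop. -/
def RelSys.toLoopSys {P : Subdivision} {c : Fin (P.n + 2) → X.ι} {α} (τ : (point p).RelSys P c α) :
    LoopSys p P c where
  toPathSys := τ.toPathSys
  start := τ.start
  finish := τ.finish

/-- The based loop of a based relative loop that ends at the base point. -/
def toLoop : (point p).RelLoop → Loop p :=
  Quot.map (fun τ => ⟨τ.P, τ.c, τ.sys.toLoopSys⟩) (by
    rintro τ τ' ⟨r, h0, ζ, -, -, h1⟩
    exact ⟨r, h0, h1⟩)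

lemma toLoop_mk {P : Subdivision} {c : Fin (P.n + 2) → X.ι} {α} (τ : (point p).RelSys P c α) :
    toLoop (RelLoop.mk τ) = Loop.mk τ.toLoopSys := rfl

variable (p) in
/-- The based loop space as a based relative loop space. -/
def loopHomeo : (point p).RelLoop ≃ₜ Loop p where
  toFun := toLoop
  invFun := (point p).toRelLoop
  left_inv γ := by
    obtain ⟨⟨P, c, ⟨⟩, τ⟩, rfl⟩ := Quot.exists_rep γ
    rfl
  right_inv γ := by
    obtain ⟨⟨P, c, τ⟩, rfl⟩ := Quot.exists_rep γ
    rfl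
  continuous_toFun := by
    rw [continuous_generateFrom_iff]
    rintro _ ⟨P, c, K, D, A, hK, hD, hA, rfl⟩
    refine TopologicalSpace.isOpen_generateFrom_of_mem ⟨P, c, (), K, D, A, hK, hD, hA, ?_⟩
    ext γ
    constructor
    · rintro ⟨τ, h, h'⟩
      refine ⟨(point p).toRelSys τ, ?_, h'⟩
      obtain ⟨⟨P, c, ⟨⟩, τ'⟩, rfl⟩ := Quot.exists_rep γ
      exact congrArg (point p).toRelLoop h
    · rintro ⟨τ, rfl, h'⟩
      exact ⟨τ.toLoopSys, rfl, h'⟩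
  continuous_invFun := by
    rw [continuous_generateFrom_iff]
    rintro _ ⟨P, c, ⟨⟩, K, D, A, hK, hD, hA, rfl⟩
    refine TopologicalSpace.isOpen_generateFrom_of_mem ⟨P, c, K, D, A, hK, hD, hA, ?_⟩
    ext γ
    constructor
    · rintro ⟨τ, h, h'⟩
      refine ⟨τ.toLoopSys, ?_, h'⟩
      obtain ⟨⟨P, c, τ'⟩, rfl⟩ := Quot.exists_rep γ
      exact congrArg toLoop h
    · rintro ⟨τ, rfl, h'⟩
      exact ⟨(point p).toRelSys τ, rfl, h'⟩

end Point

section Lift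

lemma localLift_identity : LocalLift (identity q) T := by
  intro α t0 u _
  have hs : Function.Surjective ((identity q).groupHom α) := fun g => ⟨g, by
    apply (Y.aut α).injective
    exact aut_groupHom α g⟩
  have : Subsingleton (Y.G ((identity q).W α) ⧸ ((identity q).groupHom α).range) := by
    rw [MonoidHom.range_eq_top.2 hs]
    exact QuotientGroup.subsingleton_quotient_top
  exact ⟨fun _ => 1, Eventually.of_forall fun t => ⟨continuousAt_const, Subsingleton.elim _ _⟩⟩

lemma localLift_point : LocalLift (point p) T := by
  intro α t0 u hu
  refine ⟨fun t => (u t).out, hu.mono fun t ht => ⟨?_, QuotientGroup.out_eq' _⟩⟩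
  have hbot : ((point p).groupHom α).range = ⊥ := by
    rw [eq_bot_iff]
    rintro _ ⟨g, rfl⟩
    rw [Subgroup.mem_bot]
    exact _root_.map_one ((point p).groupHom α)
  have hinj : Function.Injective (QuotientGroup.mk : X.G ((point p).W α) → X.G ((point p).W α) ⧸ ((point p).groupHom α).range) := by
    intro a b h
    rw [QuotientGroup.eq] at h
    rw [hbot, Subgroup.mem_bot] at h
    exact inv_mul_eq_one.1 h
  have hemb : IsOpenEmbedding (QuotientGroup.mk : X.G ((point p).W α) → X.G ((point p).W α) ⧸ ((point p).groupHom α).range) :=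
    .of_continuous_injective_isOpenMap QuotientGroup.continuous_mk hinj QuotientGroup.isOpenMap_coe
  refine (hemb.isEmbedding.continuousAt_iff).2 ?_
  exact ht.congr (Eventually.of_forall fun t => (QuotientGroup.out_eq' (u t)).symm)

lemma LocalLift.of_homeo (h : LocalLift σ T) (e : T' ≃ₜ T) : LocalLift σ T' := by
  intro α t0 u hu
  obtain ⟨g, hg⟩ := h α (e t0) (u ∘ e.symm) (((e.symm.continuous.tendsto' _ _ (by simp)).eventually hu).mono fun t h =>
    ContinuousAt.comp h e.symm.continuous.continuousAt)
  refine ⟨g ∘ e, ((e.continuous.tendsto _).eventually hg).mono fun t h => ⟨h.1.comp e.continuous.continuousAt, ?_⟩⟩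
  simpa using h.2

lemma localLift_cube (hσ : ∀ α, IsWeakFibration
    (QuotientGroup.mk : X.G (σ.W α) → X.G (σ.W α) ⧸ (σ.groupHom α).range)) (n : ℕ) :
    LocalLift σ (Fin n → unitInterval) := by
  intro α t0 u hu
  have hI : ∃ a b : Fin n → unitInterval, a ≤ t0 ∧ t0 ≤ b ∧ Icc a b ∈ 𝓝 t0 ∧ ∀ t ∈ Icc a b, ContinuousAt u t := by
    rw [nhds_pi] at hu
    obtain ⟨I, -, V, hV, hVu⟩ := mem_pi.1 hu
    choose a b hab hN hs using (fun i => exists_Icc_mem_subset_of_mem_nhds (hV i))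
    refine ⟨a, b, fun i => (hab i).1, fun i => (hab i).2, ?_, fun t ht => hVu fun i _ => hs i ⟨ht.1 i, ht.2 i⟩⟩
    rw [← pi_univ_Icc]
    exact set_pi_mem_nhds finite_univ fun i _ => hN i
  obtain ⟨a, b, ha, hb, hN, hc⟩ := hI
  let ln : (Fin n → unitInterval) × unitInterval → (Fin n → unitInterval) := fun z i =>
    ⟨(1 - z.2) * t0 i + z.2 * z.1 i, by
      have h1 := z.2.2; have h2 := (t0 i).2; have h3 := (z.1 i).2
      constructor
      · exact add_nonneg (mul_nonneg (sub_nonneg.2 h1.2) h2.1) (mul_nonneg h1.1 h3.1)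
      · nlinarith [mul_le_of_le_one_right h1.1 h3.2, mul_le_of_le_one_right (sub_nonneg.2 h1.2) h2.2]⟩
  have hln : Continuous ln := by
    refine continuous_pi fun i => Continuous.subtype_mk ?_ _
    fun_prop
  let r : (Fin n → unitInterval) → (Fin n → unitInterval) := fun x => a ⊔ (x ⊓ b)
  have hr : Continuous r := by
    change Continuous fun x => a ⊔ (x ⊓ b)
    exact continuous_pi fun i => continuous_const.max ((continuous_apply i).min continuous_const)
  have hur : Continuous fun x => u (r x) := by
    rw [continuous_iff_continuousAt]
    exact fun x => ContinuousAt.comp (hc _ ((fun x => ⟨le_sup_left, sup_le (ha.trans hb) inf_le_right⟩) x)) hr.continuousAt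
  obtain ⟨g0, hg0⟩ := QuotientGroup.mk_surjective (u (r t0))
  obtain ⟨H', -, hH'⟩ := (hσ α).2 n (.const _ g0) ⟨fun z => u (r (ln z)), hur.comp hln⟩ (by
    intro x
    change u (r (ln (x, 0))) = _
    have : ln (x, 0) = t0 := by funext i; apply Subtype.ext; simp [ln]
    rw [this, ← hg0]; rfl)
  refine ⟨fun x => H' (x, 1), ?_⟩
  filter_upwards [hN] with x hx
  refine ⟨Continuous.continuousAt (by fun_prop), (hH' (x, 1)).trans ?_⟩
  change u (r (ln (x, 1))) = u x
  have h1 : ln (x, 1) = x := by funext i; apply Subtype.ext; simp [ln]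
  have h2 : r x = x := by simp only [r]; rw [inf_eq_left.2 hx.2, sup_eq_right.2 hx.1]
  rw [h1, h2]

lemma isEmbedding_f_identity (α) : IsEmbedding ((identity q).f α) := IsEmbedding.id

lemma isEmbedding_f_point (α) : IsEmbedding ((point p).f α) := by
  have : Subsingleton (onePoint.C ((point p).V α)) := inferInstanceAs (Subsingleton PUnit)
  exact .of_subsingleton _

end Lift

end BasedSystem

namespace Orbispace

lemma Sec.eqToHom_comp_tr {r : T × ℝ → X.Obj} (a : Sec r c) {z z' : T × ℝ} (e : z = z')
    (h : z ∈ a.N) (h' : z' ∈ a.N) :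
    (eqToHom (congrArg r e) ≫ a.h z' h').tr = (a.h z h).tr := by
  subst e; simp

section

variable {x x' y y' z z' t : X.Obj}

lemma comp_inv_eq_comp_inv {j : x ⟶ y} {i : y ⟶ y'} {j' : x' ⟶ y'} {k : x ⟶ z} {l : z ⟶ z'}
    {k' : x' ⟶ z'} {a : y ⟶ t} {a' : y' ⟶ t} {b : z ⟶ t} {b' : z' ⟶ t} (hm : j ≫ a = k ≫ b)
    (hm' : j' ≫ a' = k' ≫ b') (hi : i ≫ a' = a) (hl : l ≫ b' = b) :
    (j ≫ i) ≫ inv j' = (k ≫ l) ≫ inv k' := by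
  rw [← cancel_mono (j' ≫ a')]
  conv_rhs => rw [hm']
  simp [hi, hl, hm]

lemma comp_inv_comp {j : x ⟶ y} {i : y ⟶ y'} {j' : x' ⟶ y'} {a : y ⟶ t} {a' : y' ⟶ t}
    {b : x ⟶ t} {b' : x' ⟶ t} (h : j ≫ a = b) (h' : j' ≫ a' = b') (hi : i ≫ a' = a) :
    ((j ≫ i) ≫ inv j') ≫ b' = b := by
  rw [← h', ← h, ← hi]; simp

lemma comp_eqToHom_comp (j : x ⟶ y) (h h' : y = y) (m : y ⟶ z) :
    (j ≫ eqToHom h ≫ inv (eqToHom h')) ≫ m = j ≫ m := by simp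

end

namespace PIso

/-- Equal reparametrizations. -/
def ofEq (A : Pth X T) (g g' : C(T', T)) (w w' : C(T' × ℝ, ℝ)) (S : Set (T' × ℝ))
    (h : ∀ z ∈ S, (g z.1, w z) = (g' z.1, w' z)) : PIso (A.comap g w) (A.comap g' w') S where
  J z hz := eqToHom (congrArg A.r (h z hz))
  smooth := by
    rintro _ ⟨b, hb, rfl⟩
    refine ((Pth.isSec_atlas hb).comap g w).congr (fun z hz => ?_) fun z hz => ?_
    · change (g z.1, w z) ∈ b.2.N
      rw [h z hz.1]; exact hz.2
    · exact b.2.eqToHom_comp_tr (h z hz.1) _ _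

/-- Composed reparametrizations. -/
def ofComap (A : Pth X T) (g : C(T', T)) (w : C(T' × ℝ, ℝ)) (g' : C(T'', T')) (w' : C(T'' × ℝ, ℝ))
    (g'' : C(T'', T)) (w'' : C(T'' × ℝ, ℝ)) (S : Set (T'' × ℝ))
    (h : ∀ z ∈ S, (g (g' z.1), w (g' z.1, w' z)) = (g'' z.1, w'' z)) :
    PIso ((A.comap g w).comap g' w') (A.comap g'' w'') S where
  J z hz := eqToHom (congrArg A.r (h z hz))
  smooth := by
    rintro _ ⟨b, hb, rfl⟩
    refine (((Pth.isSec_atlas hb).comap g w).comap g' w').congr (fun z hz => ?_) fun z hz => ?_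
    · change (g (g' z.1), w (g' z.1, w' z)) ∈ b.2.N
      rw [h z hz.1]; exact hz.2
    · exact b.2.eqToHom_comp_tr (h z hz.1) _ _

/-- Isomorphisms over adjacent strips that agree on the common border. -/
lemma exists_union {A B : Pth X T} {x y y' : ℝ} (hxy : x ≤ y) (hyy' : y ≤ y')
    (j : PIso A B {z | z.2 ∈ Icc x y}) (k : PIso A B {z | z.2 ∈ Icc y y'})
    (h : ∀ (z : T × ℝ) (hz : z.2 = y), j.J z ⟨hz ▸ hxy, hz.le⟩ = k.J z ⟨hz.ge, hz ▸ hyy'⟩) :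
    ∃ l : PIso A B {z | z.2 ∈ Icc x y'}, (∀ z hz hz', l.J z hz = j.J z hz') ∧ ∀ z hz hz', l.J z hz = k.J z hz' := by
  have hch : ∀ z : T × ℝ, z ∈ {z : T × ℝ | z.2 ∈ Icc x y'} → ∃ J : A.r z ⟶ B.r z,
      (∀ hz', J = j.J z hz') ∧ ∀ hz', J = k.J z hz' := by
    intro z hz
    rcases lt_trichotomy z.2 y with hl | hl | hl
    · exact ⟨j.J z ⟨hz.1, hl.le⟩, fun _ => rfl, fun hz' => absurd hz'.1 (not_le.2 hl)⟩
    · exact ⟨j.J z ⟨hz.1, hl.le⟩, fun _ => rfl, fun hz' => h z hl⟩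
    · exact ⟨k.J z ⟨hl.le, hz.2⟩, fun hz' => absurd hz'.2 (not_le.2 hl), fun _ => rfl⟩
  choose J hJ hK using hch
  have h1 : ∀ b ∈ B.atlas, A.IsSec ((b.2.pull _ J).restrict {z | z.2 ≤ y}) := fun b hb =>
    (j.smooth b hb).congr (fun z hz => ⟨⟨hz.1.1.1, hz.2⟩, hz.1.2⟩) fun z hz => by
      simp only [Sec.restrict, Sec.pull, hJ z _ ⟨hz.1.1.1, hz.2⟩]
  have h2 : ∀ b ∈ B.atlas, A.IsSec ((b.2.pull _ J).restrict {z | y ≤ z.2}) := fun b hb =>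
    (k.smooth b hb).congr (fun z hz => ⟨⟨hz.2, hz.1.1.2⟩, hz.1.2⟩) fun z hz => by
      simp only [Sec.restrict, Sec.pull, hK z _ ⟨hz.2, hz.1.1.2⟩]
  refine ⟨⟨J, smooth_of_sides fun z hz => ?_⟩, hJ, hK⟩
  have hc : Tendsto (Prod.snd : T × ℝ → ℝ) (𝓝 z) (𝓝 z.2) := continuous_snd.tendsto _
  rcases lt_trichotomy z.2 y with hl | hl | hl
  · refine ⟨_, _, hl.le, hl.le, h1, h1, ?_⟩
    filter_upwards [hc.eventually (gt_mem_nhds hl)] with z' h' _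
    exact ⟨hz, hl.le, hl.le, Or.inl (le_of_lt h')⟩
  · exact ⟨_, _, hl.le, hl.ge, h1, h2, Eventually.of_forall fun z' _ => ⟨hz, hl.le, hl.ge, le_total z'.2 y⟩⟩
  · refine ⟨_, _, hl.le, hl.le, h2, h2, ?_⟩
    filter_upwards [hc.eventually (lt_mem_nhds hl)] with z' h' _
    exact ⟨hz, hl.le, hl.le, Or.inl (le_of_lt h')⟩

end PIso

/-- An identification of the members of a family of paths at the time `x` with points of a chart. -/
structure Frame (D : Pth X T) (x : T → ℝ) (a : C(T, X.C c)) where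
  h : ∀ z : T × ℝ, z.2 = x z.1 → (D.r z ⟶ ⟨c, a z.1⟩)
  sec : D.IsSec ⟨{z | z.2 = x z.1}, fun z => a z.1, by fun_prop, h⟩

namespace Frame

variable {D D' : Pth X T} {x : T → ℝ}

lemma eqToHom_comp (F : Frame D x a) {t : T} {s s' : ℝ} (e : s = s') (h : s = x t) (h' : s' = x t) :
    eqToHom (congrArg (fun s => D.r (t, s)) e) ≫ F.h (t, s') h' = F.h (t, s) h := by
  subst e; simp

/-- Reparametrization of a frame. -/
def comap (F : Frame D x a) (g : C(T', T)) (w : C(T' × ℝ, ℝ)) {x' : T' → ℝ}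
    (h : ∀ z : T' × ℝ, z.2 = x' z.1 → w z = x (g z.1)) : Frame (D.comap g w) x' (a.comp g) where
  h z hz := F.h (g z.1, w z) (h z hz)
  sec := (F.sec.comap g w).congr (fun z hz => h z hz) fun _ _ => rfl

/-- Reparametrization along the paths. -/
def re (F : Frame D x a) (w : C(T × ℝ, ℝ)) {x' : T → ℝ}
    (h : ∀ z : T × ℝ, z.2 = x' z.1 → w z = x z.1) : Frame (D.comap (.id T) w) x' a where
  h z hz := F.h (z.1, w z) (h z hz)
  sec := (F.sec.comap (.id T) w).congr (fun z hz => h z hz) fun _ _ => rfl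

/-- The pull-back of a frame under an isomorphism. -/
def pull {S : Set (T × ℝ)} (F : Frame D' x a) (j : PIso D D' S)
    (h : ∀ z : T × ℝ, z.2 = x z.1 → z ∈ S) : Frame D x a where
  h z hz := j.J z (h z hz) ≫ F.h z hz
  sec := (j.isSec_pull F.sec).congr (fun z hz => ⟨h z hz, hz⟩) fun _ _ => rfl

/-- Change of the frame by a continuous family of transition maps. -/
def post (F : Frame D x a) (ζ : ∀ t, (⟨c, a t⟩ : X.Obj) ⟶ ⟨c', b t⟩)
    (hζ : Continuous (Y := X.Tran c c') fun t => (ζ t).tr) : Frame D x b where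
  h z hz := F.h z hz ≫ ζ z.1
  sec := (F.sec.post _ subset_rfl (fun t => (ζ t).tr) (fun z _ => hζ.continuousAt)
    fun z _ => (ζ z.1).mem).congr subset_rfl fun _ _ => rfl

/-- Change of the frame by an equality. -/
def cast (F : Frame D x a) (e : ∀ t, (⟨c, a t⟩ : X.Obj) = ⟨c', b t⟩) : Frame D x b where
  h z hz := F.h z hz ≫ eqToHom (e z.1)
  sec := F.sec.congr_toAny subset_rfl fun _ _ => toAny_comp_eqToHom _ _

/-- The values of a section. -/
def ofSec {m : Sec D.r c} (hm : D.IsSec m) (hN : ∀ t, (t, x t) ∈ m.N) (ha : ∀ t, m.f (t, x t) = a t) :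
    Frame D x a where
  h z hz := ⟨(m.h z (by obtain ⟨t, s⟩ := z; obtain rfl : s = x t := hz; exact hN t)).tr, Mor.mem _, by
    refine (Mor.eq _).trans ?_
    obtain ⟨t, s⟩ := z
    obtain rfl : s = x t := hz
    exact ha t⟩
  sec := hm.congr (fun z hz => by obtain ⟨t, s⟩ := z; obtain rfl : s = x t := hz; exact hN t)
    fun _ _ => rfl

end Frame

/-- A family of paths from points `a` to points `b` of charts. -/
structure Arc (a : C(T, X.C c)) (b : C(T, X.C c')) where
  A : Pth X T
  st : Frame A (fun _ => 0) a
  en : Frame A (fun _ => 1) b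

/-- An affine reparametrization. -/
def lin (T : Type*) [TopologicalSpace T] (x y : ℝ) : C(T × ℝ, ℝ) := ⟨fun z => x + y * z.2, by fun_prop⟩

@[simp] lemma lin_apply (x y : ℝ) (z : T × ℝ) : lin T x y z = x + y * z.2 := rfl

namespace Arc

/-- Reparametrization of the parameter space. -/
def comap (A : Arc a b) (g : C(T', T)) : Arc (a.comp g) (b.comp g) where
  A := A.A.comap g (Pth.sndMap T')
  st := A.st.comap g _ fun _ h => h
  en := A.en.comap g _ fun _ h => h

/-- Isomorphism of families of paths, compatible with the frames. -/
def Iso (A A' : Arc a b) : Prop :=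
  ∃ j : PIso A.A A'.A {z | z.2 ∈ Icc (0 : ℝ) 1},
    (∀ (z : T × ℝ) (hz : z.2 = 0), j.J z (by simp [hz]) ≫ A'.st.h z hz = A.st.h z hz) ∧
    ∀ (z : T × ℝ) (hz : z.2 = 1), j.J z (by simp [hz]) ≫ A'.en.h z hz = A.en.h z hz

lemma Iso.refl (A : Arc a b) : A.Iso A :=
  ⟨PIso.refl _ _, fun _ _ => Category.id_comp _, fun _ _ => Category.id_comp _⟩

lemma Iso.symm {A A' : Arc a b} (h : A.Iso A') : A'.Iso A := by
  obtain ⟨j, h0, h1⟩ := h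
  refine ⟨j.symm, fun z hz => ?_, fun z hz => ?_⟩
  · rw [← h0 z hz]; simp [PIso.symm]
  · rw [← h1 z hz]; simp [PIso.symm]

lemma Iso.trans {A A' A'' : Arc a b} (h : A.Iso A') (h' : A'.Iso A'') : A.Iso A'' := by
  obtain ⟨j, h0, h1⟩ := h
  obtain ⟨j', h0', h1'⟩ := h'
  refine ⟨j.trans j', fun z hz => ?_, fun z hz => ?_⟩
  · rw [← h0 z hz, ← h0' z hz]; simp [PIso.trans]
  · rw [← h1 z hz, ← h1' z hz]; simp [PIso.trans]

/-- A part of a family of paths. -/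
def sub (D : Pth X T) (w : C(T × ℝ, ℝ)) {x y : T → ℝ} (F : Frame D x a) (G : Frame D y b)
    (h0 : ∀ t, w (t, 0) = x t) (h1 : ∀ t, w (t, 1) = y t) : Arc a b where
  A := D.comap (.id T) w
  st := F.re w fun z hz => by obtain ⟨t, s⟩ := z; obtain rfl : s = 0 := hz; exact h0 t
  en := G.re w fun z hz => by obtain ⟨t, s⟩ := z; obtain rfl : s = 1 := hz; exact h1 t

/-- The reversed paths. -/
def rev (A : Arc a b) : Arc b a := sub A.A (lin T 1 (-1)) A.en A.st (by simp) (by simp)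

/-- The path `C` is the concatenation of `A` and `B`. -/
def IsComp (A : Arc a b) (B : Arc b d) (C : Arc a d) : Prop :=
  ∃ (j : PIso C.A (A.A.comap (.id T) (lin T 0 2)) {z | z.2 ∈ Icc (0 : ℝ) (1 / 2)})
    (k : PIso C.A (B.A.comap (.id T) (lin T (-1) 2)) {z | z.2 ∈ Icc (1 / 2 : ℝ) 1}),
    (∀ (z : T × ℝ) (hz : z.2 = 0), j.J z (by simp [hz]) ≫ A.st.h (z.1, lin T 0 2 z) (by simp [hz]) = C.st.h z hz) ∧
    (∀ (z : T × ℝ) (hz : z.2 = 1 / 2), j.J z (by simp [hz]) ≫ A.en.h (z.1, lin T 0 2 z) (by simp [hz]) =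
      k.J z (by simp [hz]; norm_num) ≫ B.st.h (z.1, lin T (-1) 2 z) (by simp [hz])) ∧
    ∀ (z : T × ℝ) (hz : z.2 = 1),
      k.J z (by simp [hz]; norm_num) ≫ B.en.h (z.1, lin T (-1) 2 z) (by simp [hz]; norm_num) =
      C.en.h z hz

lemma exists_isComp (A : Arc a b) (B : Arc b d) : ∃ C : Arc a d, IsComp A B C := by
  let A' := A.A.comap (.id T) (lin T 0 2)
  let B' := B.A.comap (.id T) (lin T (-1) 2)
  let F : Frame A' (fun _ => 1 / 2) b := A.en.re _ fun z hz => by simp [hz]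
  let G : Frame B' (fun _ => 1 / 2) b := B.st.re _ fun z hz => by simp [hz]
  let J : ∀ z ∈ {z : T × ℝ | z.2 = 1 / 2}, A'.r z ⟶ B'.r z := fun z hz => F.h z hz ≫ inv (G.h z hz)
  let j : PIso A' B' {z | z.2 = 1 / 2} := ⟨J, fun e he => by
    refine Pth.isSec_of_local fun z hz => ⟨_, _, F.sec, hz.1, Eventually.of_forall fun _ h => h.1, ?_⟩
    obtain ⟨K, hK, hE⟩ := (Pth.isSec_atlas he).smoothAt G.sec hz.2 hz.1
    refine ⟨K, hK, hE.mono fun z' h h1 h2 => ?_⟩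
    rw [← h h1.2 h1.1]
    congr 1
    simp only [Sec.trans, Sec.pull, J]
    rw [IsIso.inv_comp_eq]
    simp⟩
  obtain ⟨D, k, k', hk⟩ := Pth.exists_glue A' B' (1 / 2) j
  refine ⟨⟨D, (A.st.re (lin T 0 2) fun z hz => by simp [hz]).pull k.symm
      (fun z hz => by simp [hz]), (B.en.re (lin T (-1) 2) fun z hz => by
        simp [hz]; norm_num).pull k'.symm
      (fun z hz => by simp [hz]; norm_num)⟩, k.symm.mono (fun z hz => hz.2),
      k'.symm.mono (fun z hz => hz.1), fun z hz => rfl, fun z hz => ?_, fun z hz => rfl⟩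
  have h2 : J z hz ≫ G.h z hz = F.h z hz := by simp [J]
  change inv (k.J z _) ≫ F.h z hz = inv (k'.J z _) ≫ G.h z hz
  rw [IsIso.inv_comp_eq, ← (hk z hz)]
  change _ = (J z hz ≫ _) ≫ _
  simp [h2]

/-- Concatenation is determined up to isomorphism. -/
lemma IsComp.iso {A A' : Arc a b} {B B' : Arc b d} {C C' : Arc a d} (h : IsComp A B C)
    (h' : IsComp A' B' C') (hA : A.Iso A') (hB : B.Iso B') : C.Iso C' := by
  obtain ⟨j, k, h0, hm, h1⟩ := h
  obtain ⟨j', k', h0', hm', h1'⟩ := h'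
  obtain ⟨i, i0, i1⟩ := hA
  obtain ⟨l, l0, l1⟩ := hB
  let u : PIso C.A C'.A {z | z.2 ∈ Icc 0 (1 / 2)} :=
    (j.trans ((i.comap (.id T) (lin T 0 2)).mono fun z hz => by
      obtain ⟨h1, h2⟩ := hz
      refine ⟨?_, ?_⟩ <;> simp <;> linarith)).trans j'.symm
  let u' : PIso C.A C'.A {z | z.2 ∈ Icc (1 / 2) 1} :=
    (k.trans ((l.comap (.id T) (lin T (-1) 2)).mono fun z hz => by
      obtain ⟨h1, h2⟩ := hz
      refine ⟨?_, ?_⟩ <;> simp <;> linarith)).trans k'.symm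
  obtain ⟨e, he, he'⟩ := PIso.exists_union (by norm_num) (by norm_num) u u' (by
    intro z hz
    exact comp_inv_eq_comp_inv (hm z hz) (hm' z hz) (i1 (z.1, lin T 0 2 z) (by simp [hz]))
      (l0 (z.1, lin T (-1) 2 z) (by simp [hz])))
  refine ⟨e, fun z hz => ?_, fun z hz => ?_⟩
  · rw [he z _ ⟨hz.ge, by rw [hz]; norm_num⟩]
    exact comp_inv_comp (h0 z hz) (h0' z hz) (i0 (z.1, lin T 0 2 z) (by simp [hz]))
  · rw [he' z _ ⟨by rw [hz]; norm_num, hz.le⟩]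
    exact comp_inv_comp (h1 z hz) (h1' z hz) (l1 (z.1, lin T (-1) 2 z) (by simp [hz]; norm_num))

/-- The concatenation of two families of paths. -/
def comp (A : Arc a b) (B : Arc b d) : Arc a d := (exists_isComp A B).choose

lemma isComp_comp (A : Arc a b) (B : Arc b d) : IsComp A B (comp A B) := (exists_isComp A B).choose_spec

lemma Iso.comp {A A' : Arc a b} {B B' : Arc b d} (hA : A.Iso A') (hB : B.Iso B') :
    (A.comp B).Iso (A'.comp B') := (isComp_comp A B).iso (isComp_comp A' B') hA hB

lemma IsComp.iso_comp {A : Arc a b} {B : Arc b d} {C : Arc a d} (h : IsComp A B C) :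
    C.Iso (A.comp B) := h.iso (isComp_comp A B) (Iso.refl _) (Iso.refl _)

lemma IsComp.comap {A : Arc a b} {B : Arc b d} {C : Arc a d} (h : IsComp A B C) (g : C(T', T)) :
    IsComp (A.comap g) (B.comap g) (C.comap g) := by
  obtain ⟨j, k, h0, hm, h1⟩ := h
  let e (D : Pth X T) (x y : ℝ) (S) : PIso ((D.comap (.id T) (lin T x y)).comap g (Pth.sndMap T'))
      ((D.comap g (Pth.sndMap T')).comap (.id T') (lin T' x y)) S :=
    (PIso.ofComap D (.id T) (lin T x y) g (Pth.sndMap T') g (lin T' x y) S fun _ _ => rfl).trans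
      (PIso.ofComap D g (Pth.sndMap T') (.id T') (lin T' x y) g (lin T' x y) S fun _ _ => rfl).symm
  refine ⟨(j.comap g _).trans (e A.A 0 2 _), (k.comap g _).trans (e B.A (-1) 2 _),
    fun z hz => ?_, fun z hz => ?_, fun z hz => ?_⟩
  · exact (comp_eqToHom_comp _ rfl rfl _).trans (h0 (g z.1, z.2) hz)
  · exact ((comp_eqToHom_comp _ rfl rfl _).trans (hm (g z.1, z.2) hz)).trans (comp_eqToHom_comp _ rfl rfl _).symm
  · exact (comp_eqToHom_comp _ rfl rfl _).trans (h1 (g z.1, z.2) hz)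

/-- Change of the starting points by equalities. -/
def castSt {c1 : X.ι} {a' : C(T, X.C c1)} (A : Arc a b)
    (ha : ∀ t, (⟨c, a t⟩ : X.Obj) = ⟨c1, a' t⟩) : Arc a' b := ⟨A.A, A.st.cast ha, A.en⟩

/-- Change of the end points by equalities. -/
def castEn {c1 : X.ι} {b' : C(T, X.C c1)} (A : Arc a b)
    (hb : ∀ t, (⟨c', b t⟩ : X.Obj) = ⟨c1, b' t⟩) : Arc a b' := ⟨A.A, A.st, A.en.cast hb⟩

lemma Iso.castSt {c1 : X.ι} {a' : C(T, X.C c1)} {A A' : Arc a b} (h : A.Iso A')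
    (ha : ∀ t, (⟨c, a t⟩ : X.Obj) = ⟨c1, a' t⟩) : (A.castSt ha).Iso (A'.castSt ha) := by
  obtain ⟨j, h0, h1⟩ := h
  refine ⟨j, fun z hz => ?_, h1⟩
  simp only [Arc.castSt, Frame.cast, ← Category.assoc, h0 z hz]

lemma Iso.castEn {c1 : X.ι} {b' : C(T, X.C c1)} {A A' : Arc a b} (h : A.Iso A')
    (hb : ∀ t, (⟨c', b t⟩ : X.Obj) = ⟨c1, b' t⟩) : (A.castEn hb).Iso (A'.castEn hb) := by
  obtain ⟨j, h0, h1⟩ := h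
  refine ⟨j, h0, fun z hz => ?_⟩
  simp only [Arc.castEn, Frame.cast, ← Category.assoc, h1 z hz]

/-- Change of the last frame. -/
def post {b' : C(T, X.C c'')} (A : Arc a b) (ζ : ∀ t, (⟨c', b t⟩ : X.Obj) ⟶ ⟨c'', b' t⟩)
    (hζ : Continuous (Y := X.Tran c' c'') fun t => (ζ t).tr) : Arc a b' where
  A := A.A
  st := A.st
  en := A.en.post ζ hζ

lemma Iso.rev {A A' : Arc a b} (h : A.Iso A') : A.rev.Iso A'.rev := by
  obtain ⟨j, h0, h1⟩ := h
  refine ⟨(j.comap (.id T) (lin T 1 (-1))).mono fun z hz => ?_, fun z hz => ?_, fun z hz => ?_⟩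
  · obtain ⟨h1, h2⟩ := hz
    refine ⟨?_, ?_⟩ <;> simp <;> linarith
  · exact h1 (z.1, lin T 1 (-1) z) (by simp [hz])
  · exact h0 (z.1, lin T 1 (-1) z) (by simp [hz])

end Arc

end Orbispace

namespace BasedSystem

variable (σ)

lemma exists_chart (y : Y.Obj) : ∃ (α : σ.Λ) (x : Y.C (σ.V α)), Nonempty (y ⟶ ⟨σ.V α, x⟩) := by
  obtain ⟨α, hα⟩ := σ.cover (Y.proj y.ch y.pt)
  obtain ⟨x, hx⟩ := (Y.proj_isQuotientMap (σ.V α)).surjective ⟨_, hα⟩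
  exact ⟨α, x, nonempty_hom (by simp [hx])⟩

/-- A chart of the system at a given point. -/
def chart (y : Y.Obj) : σ.Λ := (σ.exists_chart y).choose

/-- A point of the chart over a given point. -/
def chartPt (y : Y.Obj) : Y.C (σ.V (σ.chart y)) := (σ.exists_chart y).choose_spec.choose

/-- A germ of a transition map to the chart. -/
def toChart (y : Y.Obj) : y ⟶ ⟨σ.V (σ.chart y), σ.chartPt y⟩ := (σ.exists_chart y).choose_spec.choose_spec.some

/-- The image of a point. -/
def pushObj (y : Y.Obj) : X.Obj := ⟨σ.W (σ.chart y), σ.f _ (σ.chartPt y)⟩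

/-- The image of a germ to a chart of the system. -/
def pushHom {y : Y.Obj} {β : σ.Λ} {x : Y.C (σ.V β)} (m : y ⟶ ⟨σ.V β, x⟩) :
    σ.pushObj y ⟶ ⟨σ.W β, σ.f β x⟩ := σ.mor (inv (σ.toChart y) ≫ m)

/-- The image of a germ. -/
def pushMap {y y' : Y.Obj} (m : y ⟶ y') : σ.pushObj y ⟶ σ.pushObj y' := σ.pushHom (m ≫ σ.toChart y')

lemma pushHom_mor {y : Y.Obj} {β γ : σ.Λ} {x : Y.C (σ.V β)} {x' : Y.C (σ.V γ)}
    (m : y ⟶ ⟨σ.V β, x⟩) (n : (⟨σ.V β, x⟩ : Y.Obj) ⟶ ⟨σ.V γ, x'⟩) :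
    σ.pushHom m ≫ σ.mor n = σ.pushHom (m ≫ n) :=
  (σ.mor_comp _ _).symm.trans (congrArg σ.mor (Category.assoc _ _ _))

lemma pushMap_pushHom {y y' : Y.Obj} {β : σ.Λ} {x : Y.C (σ.V β)} (m : y ⟶ y')
    (n : y' ⟶ ⟨σ.V β, x⟩) : σ.pushMap m ≫ σ.pushHom n = σ.pushHom (m ≫ n) :=
  (σ.mor_comp _ _).symm.trans (congrArg σ.mor (by simp))

lemma inv_pushHom {y : Y.Obj} {β γ : σ.Λ} {x : Y.C (σ.V β)} {x' : Y.C (σ.V γ)}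
    (m : y ⟶ ⟨σ.V β, x⟩) (n : y ⟶ ⟨σ.V γ, x'⟩) :
    inv (σ.pushHom m) ≫ σ.pushHom n = σ.mor (inv m ≫ n) := by
  rw [IsIso.inv_comp_eq, pushHom_mor]; simp

variable {σ} in
/-- The image of a section. -/
def pushSec {r : T × ℝ → Y.Obj} {β : σ.Λ} (a : Sec r (σ.V β)) : Sec (fun z => σ.pushObj (r z)) (σ.W β) where
  N := a.N
  f z := σ.f β (a.f z)
  cont := (σ.f β).continuous.comp_continuousOn a.cont
  h z hz := σ.pushHom (a.h z hz)

lemma smoothAt_pushSec {r : T × ℝ → Y.Obj} {β γ : σ.Λ} {a : Sec r (σ.V β)} {b : Sec r (σ.V γ)}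
    {z : T × ℝ} (h : a.SmoothAt b z) : (pushSec a).SmoothAt (pushSec b) z := by
  obtain ⟨G, hG, hE⟩ := h
  refine ⟨fun t => σ.ρ β γ (G t), (σ.continuous_ρ β γ).continuousAt.comp hG, hE.mono fun z' h ha hb => ?_⟩
  exact Eq.trans (congrArg (fun m => Mor.tr m) (σ.inv_pushHom (a.h z' ha) (b.h z' hb))) (congrArg (σ.ρ β γ) (h ha hb))

/-- The image of a family of paths. -/
def pushPth (A : Pth Y T) : Pth X T where
  r z := σ.pushObj (A.r z)
  atlas := {a | ∃ (β : σ.Λ) (b : Sec A.r (σ.V β)), A.IsSec b ∧ IsOpen b.N ∧ a = ⟨σ.W β, pushSec b⟩}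
  isOpen := by
    rintro _ ⟨β, b, hb, ho, rfl⟩
    exact ho
  compat := by
    rintro _ ⟨β, b, hb, ho, rfl⟩ _ ⟨β', b', hb', ho', rfl⟩ z hz hz'
    exact σ.smoothAt_pushSec (hb.smoothAt hb' hz hz')
  cover z := by
    obtain ⟨a, h, ha, ho, -⟩ := Pth.exists_isSec_through A z (σ.toChart (A.r z))
    exact ⟨_, ⟨_, a, ha, ho, rfl⟩, h⟩

variable {σ}

lemma isSec_push {A : Pth Y T} {β : σ.Λ} {a : Sec A.r (σ.V β)} (ha : A.IsSec a) :
    (σ.pushPth A).IsSec (pushSec a) := by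
  refine Pth.isSec_of_local fun z hz => ?_
  obtain ⟨b, h, hb, ho, -⟩ := Pth.exists_isSec_through A z (σ.toChart (A.r z))
  exact ⟨_, _, Pth.isSec_atlas ⟨_, b, hb, ho, rfl⟩, h,
    mem_of_superset (ho.mem_nhds h) fun _ h _ => h,
    σ.smoothAt_pushSec (ha.smoothAt hb hz h)⟩

/-- The image of an isomorphism. -/
def pushIso {A B : Pth Y T} {S : Set (T × ℝ)} (j : PIso A B S) : PIso (σ.pushPth A) (σ.pushPth B) S where
  J z hz := σ.pushMap (j.J z hz)
  smooth := by
    rintro _ ⟨β, b, hb, ho, rfl⟩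
    refine (isSec_push (j.isSec_pull hb)).congr subset_rfl fun z hz => ?_
    exact congrArg (fun m => Mor.tr m) (σ.pushMap_pushHom (j.J z hz.1) (b.h z hz.2))

lemma inv_id_comp_comp {x y z : X.Obj} (m : x ⟶ y) (n : x ⟶ z) : inv (𝟙 x ≫ m) ≫ n = inv m ≫ n := by simp

lemma comp_inv_id_comp {x y z : X.Obj} (m : x ⟶ y) (n : y ⟶ z) : (m ≫ inv (𝟙 y)) ≫ n = m ≫ n := by simp

/-- Images and reparametrizations. -/
def pushComap (A : Pth Y T) (g : C(T', T)) (w : C(T' × ℝ, ℝ)) (S : Set (T' × ℝ)) :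
    PIso ((σ.pushPth A).comap g w) (σ.pushPth (A.comap g w)) S where
  J z _ := 𝟙 _
  smooth := by
    rintro _ ⟨β, b, hb, ho, rfl⟩
    refine Pth.isSec_of_local fun z hz => ?_
    obtain ⟨a, h, ha, ho, -⟩ := Pth.exists_isSec_through A (g z.1, w z) (σ.toChart (A.r (g z.1, w z)))
    refine ⟨_, _, (isSec_push ha).comap g w, h, ?_, ?_⟩
    · have : IsOpen {z : T' × ℝ | (g z.1, w z) ∈ a.N} :=
        ho.preimage (f := fun z : T' × ℝ => (g z.1, w z)) (by fun_prop)
      exact mem_of_superset (this.mem_nhds h) fun _ h _ => h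
    · obtain ⟨G, hG, hE⟩ := σ.smoothAt_pushSec (hb.smoothAt (ha.comap g w) hz.2 h)
      refine ⟨G, hG, hE.mono fun z' h h1 h2 => (Eq.trans ?_ (h h1.2 h2))⟩
      exact congrArg (fun m => Mor.tr m) (inv_id_comp_comp _ _)

end BasedSystem

namespace Orbispace

/-- The image of a frame. -/
def Frame.push {A : Pth Y T} {x : T → ℝ} {β : σ.Λ} {a : C(T, Y.C (σ.V β))}
    (F : Frame A x a) : Frame (σ.pushPth A) x ((σ.f β).comp a) where
  h z hz := σ.pushHom (F.h z hz)
  sec := (isSec_push F.sec).congr subset_rfl fun _ _ => rfl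

namespace Arc

variable {β γ δ : σ.Λ} {a : C(T, Y.C (σ.V β))} {b : C(T, Y.C (σ.V γ))} {d : C(T, Y.C (σ.V δ))}

/-- The image of a family of paths. -/
def push (A : Arc a b) : Arc ((σ.f β).comp a) ((σ.f γ).comp b) where
  A := σ.pushPth A.A
  st := A.st.push
  en := A.en.push

lemma Iso.push {A A' : Arc a b} (h : A.Iso A') : A.push.Iso A'.push := by
  obtain ⟨j, h0, h1⟩ := h
  refine ⟨pushIso j, fun z hz => ?_, fun z hz => ?_⟩
  · exact (σ.pushMap_pushHom _ _).trans (congrArg σ.pushHom (h0 z hz))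
  · exact (σ.pushMap_pushHom _ _).trans (congrArg σ.pushHom (h1 z hz))

lemma push_rev (A : Arc a b) : (A.push.rev).Iso A.rev.push :=
  ⟨pushComap A.A _ _ _, fun _ _ => Category.id_comp _, fun _ _ => Category.id_comp _⟩

lemma IsComp.push {A : Arc a b} {B : Arc b d} {C : Arc a d} (h : IsComp A B C) : IsComp A.push B.push C.push := by
  obtain ⟨j, k, h0, hm, h1⟩ := h
  refine ⟨(pushIso j).trans (pushComap A.A _ _ _).symm, (pushIso k).trans (pushComap B.A _ _ _).symm,
    fun z hz => ?_, fun z hz => ?_, fun z hz => ?_⟩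
  · exact (comp_inv_id_comp _ _).trans ((σ.pushMap_pushHom _ _).trans (congrArg σ.pushHom (h0 z hz)))
  · exact (comp_inv_id_comp _ _).trans (((σ.pushMap_pushHom _ _).trans (congrArg σ.pushHom (hm z hz))).trans
      ((σ.pushMap_pushHom _ _).symm.trans (comp_inv_id_comp _ _).symm))
  · exact (comp_inv_id_comp _ _).trans ((σ.pushMap_pushHom _ _).trans (congrArg σ.pushHom (h1 z hz)))

end Arc

/-- A family of paths in a chart. -/
def Pth.ofMap (f : C(T × ℝ, X.C c)) : Pth X T where
  r z := ⟨c, f z⟩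
  atlas := {⟨c, ⟨univ, f, f.continuous.continuousOn, fun _ _ => 𝟙 _⟩⟩}
  isOpen := by rintro _ rfl; exact isOpen_univ
  compat := by
    rintro _ rfl _ rfl z _ _
    refine ⟨fun _ => X.one c, continuousAt_const, Eventually.of_forall fun z' h h' => ?_⟩
    simp [Sec.trans]
  cover z := ⟨_, rfl, mem_univ z⟩

/-- The tautological frame of a family of paths in a chart. -/
def Frame.ofMap (f : C(T × ℝ, X.C c)) {x : T → ℝ} {a : C(T, X.C c)}
    (h : ∀ z : T × ℝ, z.2 = x z.1 → f z = a z.1) : Frame (Pth.ofMap f) x a where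
  h z hz := eqToHom (congrArg (Obj.mk c) (h z hz))
  sec := (Pth.isSec_atlas (A := Pth.ofMap f) (a := ⟨c, _⟩) rfl).congr_toAny (fun _ _ => trivial)
    fun z hz => toAny_eqToHom (congrArg (Obj.mk c) (h z hz))

namespace Arc

/-- The family of paths given by a homotopy in a chart. -/
def ofMap (f : C(T × ℝ, X.C c)) {a b : C(T, X.C c)} (h0 : ∀ z : T × ℝ, z.2 = 0 → f z = a z.1)
    (h1 : ∀ z : T × ℝ, z.2 = 1 → f z = b z.1) : Arc a b := ⟨Pth.ofMap f, Frame.ofMap f h0, Frame.ofMap f h1⟩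

/-- The constant paths. -/
def const (a : C(T, X.C c)) : Arc a a := ofMap (a.comp ContinuousMap.fst) (fun _ _ => rfl) fun _ _ => rfl

/-- The constant paths are flat. -/
lemma iso_const_of_frame {A : Arc a a} (F : ∀ z : T × ℝ, z.2 ∈ Icc (0 : ℝ) 1 → (A.A.r z ⟶ ⟨c, a z.1⟩))
    (hF : A.A.IsSec ⟨{z | z.2 ∈ Icc (0 : ℝ) 1}, fun z => a z.1, by fun_prop, F⟩)
    (h0 : ∀ (z : T × ℝ) (hz : z.2 = 0), F z (by simp [hz]) = A.st.h z hz)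
    (h1 : ∀ (z : T × ℝ) (hz : z.2 = 1), F z (by simp [hz]) = A.en.h z hz) : A.Iso (const a) := by
  refine ⟨⟨fun z hz => F z hz, ?_⟩, fun z hz => ?_, fun z hz => ?_⟩
  · rintro _ rfl
    exact hF.congr (fun z hz => hz.1) fun z hz => congrArg (fun m => Mor.tr m) (Category.comp_id _)
  · exact ((congrArg (F z _ ≫ ·) (eqToHom_refl _ rfl)).trans (Category.comp_id _)).trans (h0 z hz)
  · exact ((congrArg (F z _ ≫ ·) (eqToHom_refl _ rfl)).trans (Category.comp_id _)).trans (h1 z hz)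

lemma const_comap (a : C(T, X.C c)) (g : C(T', T)) : ((const a).comap g).Iso (const (a.comp g)) :=
  iso_const_of_frame (fun z _ => 𝟙 _)
    (((Pth.isSec_atlas (A := Pth.ofMap (a.comp ContinuousMap.fst)) rfl).comap g
      (Pth.sndMap T')).congr (fun _ _ => trivial) fun z hz => rfl)
    (fun _ _ => (eqToHom_refl _ rfl).symm) fun _ _ => (eqToHom_refl _ rfl).symm

end Arc

end Orbispace

namespace BasedSystem

section

variable (σ)

/-- A family of based relative loops with end points in a chart. -/
abbrev RArc {α : σ.Λ} (v : C(T, Y.C (σ.V α))) := Arc (ContinuousMap.const T p.2 : C(T, X.C p.1)) ((σ.f α).comp v)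

variable {σ}

/-- A family of based relative loops. -/
def PFam.ofArc (A : σ.RArc v) : σ.PFam T := ⟨A.A, A.st.h, A.st.sec, α, v, A.en.h, A.en.sec⟩

/-- The underlying family of paths of a family of based relative loops. -/
def PFam.arc (F : σ.PFam T) : σ.RArc F.v := ⟨F.A, ⟨F.st, F.st_sec⟩, ⟨F.en, F.en_sec⟩⟩

/-- Reparametrization of the parameter space. -/
def RArc.comap (A : σ.RArc v) (g : C(T', T)) : σ.RArc (v.comp g) := Arc.comap A g

/-- The class of a member of a family of based relative loops. -/
def RArc.cls (A : σ.RArc v) (t : T) : σ.RelLoop := ((PFam.ofArc A).at' t).cls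

namespace RArc

lemma continuous_cls (A : σ.RArc v) : Continuous (cls A) := PFam.continuous_cls _

lemma cls_comap (A : σ.RArc v) (g : C(T', T)) (t : T') : cls (comap A g) t = cls A (g t) := by
  refine PFam.cls_eq_cls_iff.2 ⟨PIso.ofComap A.A g (Pth.sndMap T') (.const Unit t) (Pth.sndMap Unit)
    (.const Unit (g t)) (Pth.sndMap Unit) _ fun _ _ => rfl, 𝟙 _, fun z hz => ?_, fun z hz => ?_⟩
  · exact Category.id_comp _
  · exact (Category.id_comp _).trans ((congrArg (A.en.h (g t, z.2) hz ≫ ·)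
      (σ.mor_id (v (g t)))).trans (Category.comp_id _)).symm

lemma cls_congr {A : σ.RArc v} {A' : σ.RArc v'} (j : PIso A.A A'.A {z | z.2 ∈ Icc (0 : ℝ) 1})
    (ζ : ∀ t, (⟨σ.V α, v t⟩ : Y.Obj) ⟶ ⟨σ.V α', v' t⟩)
    (h0 : ∀ (z : T × ℝ) (hz : z.2 = 0), j.J z (by simp [hz]) ≫ A'.st.h z hz = A.st.h z hz)
    (h1 : ∀ (z : T × ℝ) (hz : z.2 = 1), j.J z (by simp [hz]) ≫ A'.en.h z hz = A.en.h z hz ≫ σ.mor (ζ z.1)) (t : T) :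
    cls A t = cls A' t :=
  PFam.cls_eq_cls_iff.2 ⟨j.at' t, ζ t, fun z hz => h0 (t, z.2) hz, fun z hz => h1 (t, z.2) hz⟩

lemma cls_of_iso {A A' : σ.RArc v} (h : A.Iso A') (t : T) : cls A t = cls A' t := by
  obtain ⟨j, h0, h1⟩ := h
  exact cls_congr j (fun _ => 𝟙 _) h0 (fun z hz => by rw [mor_id]; simpa using h1 z hz) t

/-- Change of the chart of the end points. -/
def postMor (A : σ.RArc v) (ζ : ∀ t, (⟨σ.V α, v t⟩ : Y.Obj) ⟶ ⟨σ.V α', v' t⟩)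
    (hζ : Continuous (Y := Y.Tran (σ.V α) (σ.V α')) fun t => (ζ t).tr) : σ.RArc v' :=
  A.post (b' := (σ.f α').comp v') (fun t => σ.mor (ζ t)) ((σ.continuous_ρ _ _).comp hζ)

lemma cls_postMor (A : σ.RArc v) (ζ : ∀ t, (⟨σ.V α, v t⟩ : Y.Obj) ⟶ ⟨σ.V α', v' t⟩)
    (hζ : Continuous (Y := Y.Tran (σ.V α) (σ.V α')) fun t => (ζ t).tr) (t : T) :
    cls (postMor A ζ hζ) t = cls A t :=
  (cls_congr (A' := postMor A ζ hζ) (PIso.refl A.A _) ζ (fun _ _ => Category.id_comp _) (fun _ _ => Category.id_comp _) t).symm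

lemma exists_postMor_iso (hσ : ∀ α, IsEmbedding (σ.groupHom α)) (A : σ.RArc v) (A' : σ.RArc v')
    (h : ∀ t, cls A t = cls A' t) : ∃ (ζ : ∀ t, (⟨σ.V α, v t⟩ : Y.Obj) ⟶ ⟨σ.V α', v' t⟩) (hζ : _),
      (postMor A ζ hζ).Iso A' := by
  obtain ⟨j, ζ, h0, h1⟩ := PFam.exists_pIso (PFam.ofArc A) (PFam.ofArc A') h
  exact ⟨ζ, PFam.continuous_tr hσ j ζ h1, j, h0, h1⟩

lemma exists_cls_eq (γ : σ.RelLoop) : ∃ (α : σ.Λ) (v : C(Unit, Y.C (σ.V α))) (A : σ.RArc v), cls A () = γ := by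
  obtain ⟨F, rfl⟩ := PFam.exists_cls_eq γ
  refine ⟨F.α, F.v, F.arc, PFam.cls_eq_cls_iff.2 ⟨⟨fun z _ => 𝟙 (F.A.r z), ?_⟩, 𝟙 _, fun z hz => ?_, fun z hz => ?_⟩⟩
  · intro b hb
    exact ((Pth.isSec_atlas hb).comap (.const Unit ()) (Pth.sndMap Unit)).congr (fun _ h => h.2)
      fun z hz => congrArg (fun m => Mor.tr m) (Category.id_comp _)
  · exact Category.id_comp _
  · exact (Category.id_comp _).trans ((congrArg (F.en z hz ≫ ·) (σ.mor_id (F.v ()))).trans (Category.comp_id _)).symm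

lemma exists_local (hf : ∀ α, IsEmbedding (σ.f α)) (hl : LocalLift σ T) {Φ : T → σ.RelLoop}
    (hΦ : Continuous Φ) (t0 : T) : ∃ M : Set T, IsOpen M ∧ t0 ∈ M ∧
      ∃ (α : σ.Λ) (v : C(M, Y.C (σ.V α))) (A : σ.RArc v), ∀ t : M, cls A t = Φ t := by
  obtain ⟨M, hM, ht, F, hF⟩ := exists_local_pfam hf hl hΦ t0
  exact ⟨M, hM, ht, F.α, F.v, F.arc, hF⟩

end RArc

lemma isEmbedding_groupHom_identity (α) : IsEmbedding ((identity q).groupHom α) := by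
  have : ((identity q).groupHom α : Y.G α → Y.G α) = id := by
    funext g
    exact Equiv.symm_apply_apply _ _
  rw [this]
  exact IsEmbedding.id

lemma isEmbedding_groupHom_point (α) : IsEmbedding ((point p).groupHom α) :=
  haveI : Subsingleton (onePoint.G ((point p).V α)) := inferInstanceAs (Subsingleton PUnit)
  ⟨⟨by
    refine TopologicalSpace.ext_iff.2 fun s => ?_
    rcases Subsingleton.eq_empty_or_singleton (s := s) Set.subsingleton_of_subsingleton with rfl | ⟨x, rfl⟩
    · simp
    · have : ({x} : Set _) = univ := eq_univ_of_forall fun y => Subsingleton.elim _ _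
      rw [this]
      simp⟩, Function.injective_of_subsingleton _⟩

end

section Loop

variable (p T) in
/-- A family of based loops. -/
abbrev LArc := Arc (ContinuousMap.const T p.2 : C(T, X.C p.1)) (ContinuousMap.const T p.2 : C(T, X.C p.1))

namespace LArc

/-- A family of based loops as a family of relative loops of the base point. -/
def toPoint (A : LArc p T) : (point p).RArc (α := ()) (ContinuousMap.const T PUnit.unit) := A

/-- The class of a member of a family of based loops. -/
def cls (A : LArc p T) (t : T) : Loop p := loopHomeo p (RArc.cls A.toPoint t)

/-- Reparametrization of the parameter space. -/
def comap (A : LArc p T) (g : C(T', T)) : LArc p T' := Arc.comap A g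

lemma continuous_cls (A : LArc p T) : Continuous (cls A) := (loopHomeo p).continuous.comp (RArc.continuous_cls _)

lemma cls_comap (A : LArc p T) (g : C(T', T)) (t : T') : cls (comap A g) t = cls A (g t) :=
  congrArg (loopHomeo p) (RArc.cls_comap A.toPoint g t)

lemma cls_of_iso {A A' : LArc p T} (h : A.Iso A') (t : T) : cls A t = cls A' t :=
  congrArg (loopHomeo p) (RArc.cls_of_iso h t)

lemma iso_of_cls_eq {A A' : LArc p T} (h : ∀ t, cls A t = cls A' t) : A.Iso A' := by
  obtain ⟨ζ, hζ, j, h0, h1⟩ := RArc.exists_postMor_iso (isEmbedding_groupHom_point) A.toPoint A'.toPoint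
    fun t => (loopHomeo p).injective (h t)
  exact ⟨j, h0, fun z hz => (h1 z hz).trans (Category.comp_id (A.en.h z hz))⟩

lemma exists_cls_eq (γ : Loop p) : ∃ A : LArc p Unit, cls A () = γ := by
  obtain ⟨α, v, A, h⟩ := RArc.exists_cls_eq ((loopHomeo p).symm γ)
  exact ⟨A, by rw [← (loopHomeo p).apply_symm_apply γ, ← h]; rfl⟩

lemma exists_local {Φ : T → Loop p} (hΦ : Continuous Φ) (t0 : T) : ∃ M : Set T, IsOpen M ∧ t0 ∈ M ∧
    ∃ A : LArc p M, ∀ t : M, cls A t = Φ t := by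
  obtain ⟨M, hM, ht, α, v, A, h⟩ := RArc.exists_local isEmbedding_f_point localLift_point
    ((loopHomeo p).symm.continuous.comp hΦ) t0
  exact ⟨M, hM, ht, A, fun t => by
    rw [← (loopHomeo p).apply_symm_apply (Φ t)]
    exact congrArg (loopHomeo p) (h t)⟩

end LArc

end Loop

lemma continuous_of_local {T Z : Type*} [TopologicalSpace T] [TopologicalSpace Z] {f : T → Z}
    (h : ∀ t0, ∃ M : Set T, IsOpen M ∧ t0 ∈ M ∧ Continuous fun t : M => f t) : Continuous f := by
  refine continuous_iff_continuousAt.2 fun t0 => ?_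
  obtain ⟨M, hM, ht, hc⟩ := h t0
  exact (continuousOn_iff_continuous_restrict.2 hc).continuousAt (hM.mem_nhds ht)

variable (σ) in
lemma obj_source : (⟨q.1, q.2⟩ : Y.Obj) = ⟨σ.V σ.o, σ.pt⟩ := obj_eq_of_basePoint_eq σ.base_source.symm

variable (σ) in
lemma obj_target : (⟨σ.W σ.o, σ.f σ.o σ.pt⟩ : X.Obj) = ⟨p.1, p.2⟩ := obj_eq_of_basePoint_eq σ.base_target

variable (σ T) in
/-- The constant map at the base point in the chart of the system. -/
def cpt : C(T, Y.C (σ.V σ.o)) := ContinuousMap.const T σ.pt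

variable (σ) in
/-- Families of paths of `Y` from the base point to points of a chart of the system. -/
abbrev YArc {α : σ.Λ} (v : C(T, Y.C (σ.V α))) := Arc (ContinuousMap.const T q.2 : C(T, Y.C q.1)) v

namespace YArc

/-- The family of based relative loops of `(Y, Y, id)`. -/
def toRArc (B : σ.YArc v) : (identity q).RArc (α := σ.V α) v := B

/-- The class of a member of the family. -/
def cls (B : σ.YArc v) (t : T) : (identity q).RelLoop := RArc.cls B.toRArc t

/-- The image of a family of paths from the base point. -/
def image (B : σ.YArc v) : σ.RArc v :=
  (Arc.push (σ := σ) (a := σ.cpt T) (B.castSt fun _ => σ.obj_source)).castSt fun _ => σ.obj_target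

lemma image_iso {B B' : σ.YArc v} (h : B.Iso B') : (image B).Iso (image B') := ((h.castSt _).push).castSt _

lemma image_comap (B : σ.YArc v) (g : C(T', T)) : Arc.Iso (RArc.comap (image B) g) (image (σ := σ) (Arc.comap B g)) :=
  ⟨pushComap B.A g _ _, fun _ _ => Category.id_comp _, fun _ _ => Category.id_comp _⟩

/-- Change of the chart of the end points. -/
def post (B : σ.YArc v) (ζ : ∀ t, (⟨σ.V α, v t⟩ : Y.Obj) ⟶ ⟨σ.V α', v' t⟩)
    (hζ : Continuous (Y := Y.Tran (σ.V α) (σ.V α')) fun t => (ζ t).tr) : σ.YArc v' :=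
  Arc.post B ζ hζ

lemma image_post (B : σ.YArc v) (ζ : ∀ t, (⟨σ.V α, v t⟩ : Y.Obj) ⟶ ⟨σ.V α', v' t⟩)
    (hζ : Continuous (Y := Y.Tran (σ.V α) (σ.V α')) fun t => (ζ t).tr) :
    (image (post B ζ hζ)).Iso (RArc.postMor (image B) ζ hζ) := by
  refine ⟨PIso.refl _ _, fun _ _ => Category.id_comp _, fun z hz => ?_⟩
  exact (Category.id_comp _).trans (σ.pushHom_mor _ _)

lemma continuous_cls (B : σ.YArc v) : Continuous (cls B) := RArc.continuous_cls _

lemma cls_comap (B : σ.YArc v) (g : C(T', T)) (t : T') :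
    cls (σ := σ) (v := v.comp g) (Arc.comap B g) t = cls B (g t) := RArc.cls_comap B.toRArc g t

lemma cls_of_iso {B B' : σ.YArc v} (h : B.Iso B') (t : T) : cls B t = cls B' t :=
  RArc.cls_of_iso h t

lemma cls_post (B : σ.YArc v) (ζ : ∀ t, (⟨σ.V α, v t⟩ : Y.Obj) ⟶ ⟨σ.V α', v' t⟩)
    (hζ : Continuous (Y := Y.Tran (σ.V α) (σ.V α')) fun t => (ζ t).tr) (t : T) :
    cls (post B ζ hζ) t = cls B t :=
  RArc.cls_postMor B.toRArc ζ hζ t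

lemma exists_post_iso (B : σ.YArc v) (B' : σ.YArc v') (h : ∀ t, cls B t = cls B' t) :
    ∃ (ζ : ∀ t, (⟨σ.V α, v t⟩ : Y.Obj) ⟶ ⟨σ.V α', v' t⟩) (hζ : _), (post B ζ hζ).Iso B' :=
  RArc.exists_postMor_iso isEmbedding_groupHom_identity B.toRArc B'.toRArc h

lemma exists_local {Φ : T → (identity q).RelLoop} (hΦ : Continuous Φ) (t0 : T) :
    ∃ M : Set T, IsOpen M ∧ t0 ∈ M ∧ ∃ (α : σ.Λ) (v : C(M, Y.C (σ.V α))) (B : σ.YArc v), ∀ t : M, cls B t = Φ t := by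
  obtain ⟨M, hM, ht, i, v, B, hB⟩ := RArc.exists_local isEmbedding_f_identity localLift_identity hΦ t0
  set y : Y.Obj := ⟨i, v ⟨t0, ht⟩⟩
  let ξ := (σ.toChart y).tr
  let M' : Set T := Subtype.val '' (v ⁻¹' (Y.map ξ).source)
  have hM' : M' ⊆ M := by rintro _ ⟨t, -, rfl⟩; exact t.2
  have hmem : ∀ t : M', v ⟨t, hM' t.2⟩ ∈ (Y.map ξ).source := by rintro ⟨_, t, h, rfl⟩; exact h
  let g : C(M', M) := ⟨fun t => ⟨t, hM' t.2⟩, by fun_prop⟩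
  let v' : C(M', Y.C (σ.V (σ.chart y))) := ⟨fun t => Y.map ξ (v (g t)),
    (Y.map ξ).continuousOn.comp_continuous (v.comp g).continuous hmem⟩
  refine ⟨M', hM.isOpenMap_subtype_val _ ((Y.map ξ).open_source.preimage v.continuous), ⟨⟨t0, ht⟩, (σ.toChart y).mem, rfl⟩, σ.chart y, v',
    RArc.postMor (σ := identity q) (v' := v') (RArc.comap B g)
      (fun t => germ ξ _ (hmem t)) continuous_const, fun t => ?_⟩
  exact (RArc.cls_postMor (σ := identity q) (v' := v') (RArc.comap B g)
      (fun t => germ ξ _ (hmem t)) continuous_const t).trans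
    ((RArc.cls_comap B g t).trans (hB _))

lemma exists_cls_eq (κ : (identity q).RelLoop) :
    ∃ (α : σ.Λ) (v : C(Unit, Y.C (σ.V α))) (B : σ.YArc v), cls B () = κ := by
  obtain ⟨M, -, ht, α, v, B, hB⟩ := exists_local (σ := σ) continuous_const ()
  exact ⟨α, _, Arc.comap B (.const Unit ⟨(), ht⟩), (cls_comap B (.const Unit ⟨(), ht⟩) ()).trans (hB _)⟩

end YArc

variable (σ) in
/-- The map of based relative loop spaces induced by the morphism. -/
def relMap (κ : (identity q).RelLoop) : σ.RelLoop :=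
  RArc.cls (YArc.image (YArc.exists_cls_eq (σ := σ) κ).choose_spec.choose_spec.choose) ()

lemma relMap_eq {v : C(Unit, Y.C (σ.V α))} (B : σ.YArc v) {κ : (identity q).RelLoop}
    (h : YArc.cls B () = κ) : σ.relMap κ = RArc.cls (YArc.image B) () := by
  obtain ⟨ζ, hζ, hi⟩ := YArc.exists_post_iso _ B fun t => ((YArc.exists_cls_eq κ).choose_spec.choose_spec.choose_spec).trans h.symm
  rw [relMap, ← RArc.cls_of_iso (YArc.image_iso hi), RArc.cls_of_iso (YArc.image_post _ ζ hζ), RArc.cls_postMor]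

lemma relMap_cls (B : σ.YArc v) (t : T) : σ.relMap (YArc.cls B t) = RArc.cls (YArc.image B) t :=
  (relMap_eq (Arc.comap B (.const Unit t)) (YArc.cls_comap B (.const Unit t) ())).trans
    ((RArc.cls_of_iso (YArc.image_comap B (.const Unit t)) ()).symm.trans
      (RArc.cls_comap (YArc.image B) (.const Unit t) ()))

lemma continuous_relMap : Continuous σ.relMap := continuous_of_local fun κ => by
  obtain ⟨M, hM, ht, α, v, B, hB⟩ := YArc.exists_local (σ := σ) continuous_id κ
  refine ⟨M, hM, ht, (RArc.continuous_cls (YArc.image B)).congr fun t => ?_⟩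
  rw [← relMap_cls, hB]; rfl

/-- A family of based loops, seen in the chart of the system. -/
def LArc.toYArc (σ : BasedSystem.{u, v, w} Y X q p) (B : LArc q T) : σ.YArc (σ.cpt T) :=
  B.castEn fun _ => σ.obj_source

/-- The family of based relative loops of a family of based loops. -/
def LArc.toRArc (σ : BasedSystem.{u, v, w} Y X q p) (A : LArc p T) : σ.RArc (σ.cpt T) :=
  A.castEn fun _ => σ.obj_target.symm

/-- The family of based loops of a family of based relative loops that end at the base point. -/
def RArc.toLArc (A : σ.RArc (σ.cpt T)) : LArc p T := A.castEn fun _ => σ.obj_target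

/-- The image of a family of based loops. -/
def LArc.image (σ : BasedSystem.{u, v, w} Y X q p) (B : LArc q T) : LArc p T :=
  RArc.toLArc (YArc.image (LArc.toYArc σ B))

lemma comp_eqToHom_eqToHom {x y z : X.Obj} (m : x ⟶ y) (e : y = z) (e' : z = y) :
    (m ≫ eqToHom e) ≫ eqToHom e' = m := by simp

lemma toRArc_toLArc (A : σ.RArc (σ.cpt T)) : Arc.Iso (LArc.toRArc σ (RArc.toLArc A)) A :=
  ⟨PIso.refl _ _, fun _ _ => Category.id_comp _,
    fun _ _ => (Category.id_comp _).trans (comp_eqToHom_eqToHom _ σ.obj_target _).symm⟩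

lemma toLArc_toRArc (A : LArc p T) : Arc.Iso (RArc.toLArc (LArc.toRArc σ A)) A :=
  ⟨PIso.refl _ _, fun _ _ => Category.id_comp _,
    fun _ _ => (Category.id_comp _).trans (comp_eqToHom_eqToHom _ σ.obj_target.symm _).symm⟩

variable (σ) in
lemma LArc.image_iso {B B' : LArc q T} (h : B.Iso B') : (LArc.image σ B).Iso (LArc.image σ B') :=
  (YArc.image_iso (h.castEn _)).castEn _

variable (σ) in
lemma LArc.image_comap (B : LArc q T) (g : C(T', T)) :
    Arc.Iso (LArc.comap (LArc.image σ B) g) (LArc.image σ (LArc.comap B g)) :=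
  ⟨pushComap B.A g _ _, fun _ _ => Category.id_comp _, fun _ _ => Category.id_comp _⟩

variable (σ) in
/-- The map of based loop spaces induced by the morphism. -/
def loopMap (δ : Loop q) : Loop p := LArc.cls (LArc.image σ (LArc.exists_cls_eq δ).choose) ()

lemma loopMap_eq (B : LArc q Unit) {δ : Loop q} (h : LArc.cls B () = δ) :
    σ.loopMap δ = LArc.cls (LArc.image σ B) () :=
  LArc.cls_of_iso (LArc.image_iso σ (LArc.iso_of_cls_eq fun _ => (LArc.exists_cls_eq δ).choose_spec.trans h.symm)) ()

lemma loopMap_cls (B : LArc q T) (t : T) : σ.loopMap (LArc.cls B t) = LArc.cls (LArc.image σ B) t :=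
  (loopMap_eq (LArc.comap B (.const Unit t)) (LArc.cls_comap B (.const Unit t) ())).trans
    ((LArc.cls_of_iso (LArc.image_comap σ B (.const Unit t)) ()).symm.trans (LArc.cls_comap _ (.const Unit t) ()))

lemma continuous_loopMap : Continuous σ.loopMap := continuous_of_local fun κ => by
  obtain ⟨M, hM, ht, B, hB⟩ := LArc.exists_local continuous_id κ
  refine ⟨M, hM, ht, (LArc.continuous_cls (LArc.image σ B)).congr fun t => ?_⟩
  rw [← loopMap_cls, hB]; rfl

lemma toAny_inv_comp_eqToHom {x y y' z : X.Obj} (m : x ⟶ y) (e : y = y') (n : x ⟶ z) :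
    toAny (inv (m ≫ eqToHom e) ≫ n).tr = toAny (inv m ≫ n).tr := by subst e; simp

lemma toRelLoop_cls (A : LArc p T) (t : T) : σ.toRelLoop (LArc.cls A t) = RArc.cls (LArc.toRArc σ A) t := by
  obtain ⟨P, c, τ, ⟨R⟩⟩ := PFam.exists_rep ((PFam.ofArc A.toPoint).at' t)
  have h1 : LArc.cls A t = Loop.mk τ.toLoopSys := by
    rw [← toLoop_mk]
    exact congrArg (loopHomeo p) (PFam.cls_eq_mk_iff.2 ⟨R⟩)
  rw [h1]
  refine ((PFam.cls_eq_mk_iff (τ := σ.toRelSys τ.toLoopSys)).2 ⟨⟨R.h, R.sec, R.link, R.start,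
    𝟙 _, fun z hz => ?_⟩⟩).symm
  · obtain ⟨ζ, hζ⟩ := R.fin
    refine (toAny_inv_comp_eqToHom (A.en.h (t, z.2) hz) σ.obj_target.symm _).trans ((hζ z hz).trans ?_)
    exact Eq.trans (congrArg (fun x : X.Obj => toAny (X.one x.ch)) σ.obj_target.symm) (congrArg toAny (σ.ρ_one σ.o)).symm

lemma cls_toYArc (B : LArc q T) (t : T) : YArc.cls (LArc.toYArc σ B) t = (identity q).toRelLoop (LArc.cls B t) := by
  rw [toRelLoop_cls]
  refine RArc.cls_congr
    (PIso.refl B.A _)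
    (fun _ => eqToHom σ.obj_source.symm) (fun _ _ => Category.id_comp _) (fun z hz => ?_) t
  exact (Category.id_comp _).trans (Eq.trans ((congrArg (B.en.h z hz ≫ ·) (eqToHom_refl _ rfl)).trans (Category.comp_id _))
    (comp_eqToHom_eqToHom (B.en.h z hz) σ.obj_source σ.obj_source.symm).symm)

lemma continuous_toRelLoop : Continuous σ.toRelLoop := continuous_of_local fun γ => by
  obtain ⟨M, hM, ht, A, hA⟩ := LArc.exists_local continuous_id γ
  refine ⟨M, hM, ht, (RArc.continuous_cls (LArc.toRArc σ A)).congr fun t => ?_⟩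
  rw [← toRelLoop_cls, hA]; rfl

variable (p T) in
/-- The constant family at the constant loop. -/
def LArc.const : LArc p T := Arc.const _

lemma LArc.cls_const (t : T) : LArc.cls (LArc.const p T) t = Loop.const p := by
  refine congrArg (loopHomeo p) ((PFam.cls_eq_mk_iff
    (τ := (point p).toRelSys (Loop.constSys p))).2 ⟨⟨fun k z hz => 𝟙 (⟨p.1, p.2⟩ : X.Obj), fun k => ?_,
    fun l z hz => ?_, fun z hz => ?_, 𝟙 _, fun z hz => ?_⟩⟩)
  · exact ((Pth.isSec_atlas (A := Pth.ofMap _) rfl).comap (.const Unit t)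
      (Pth.sndMap Unit)).congr (fun _ _ => trivial) fun z hz => rfl
  · exact congrArg (fun m => Mor.tr m) (IsIso.inv_hom_id (𝟙 (⟨p.1, p.2⟩ : X.Obj)))
  · exact congrArg (fun m => toAny (Mor.tr m)) (IsIso.inv_hom_id (𝟙 (⟨p.1, p.2⟩ : X.Obj)))
  · exact congrArg (fun m => toAny (Mor.tr m)) (IsIso.inv_hom_id (𝟙 (⟨p.1, p.2⟩ : X.Obj)))

lemma toAny_mor_eqToHom {α β : σ.Λ} (h : α = β) {x : Y.C (σ.V α)} {y : Y.C (σ.V β)}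
    (e : (⟨σ.V α, x⟩ : Y.Obj) = ⟨σ.V β, y⟩) :
    toAny (σ.mor (eqToHom e)).tr = toAny (X.one (σ.W α)) := by
  subst h
  obtain rfl : x = y := by injection e
  exact congrArg toAny (σ.ρ_one α)

lemma toAny_one_target : toAny (X.one (σ.W σ.o)) = toAny (X.one p.1) :=
  congrArg (fun x => toAny (X.one x.ch)) σ.obj_target

/-- The images of sections at the base point. -/
lemma toAny_inv_pushHom {y : Y.Obj} {m : y ⟶ ⟨q.1, q.2⟩} {α : σ.Λ} (hα : α = σ.o) {x : Y.C (σ.V α)}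
    {n : y ⟶ ⟨σ.V α, x⟩} (h : toAny (inv m ≫ n).tr = toAny (Y.one q.1)) {z : X.Obj}
    (e : (⟨σ.W σ.o, σ.f σ.o σ.pt⟩ : X.Obj) = z) :
    toAny (inv (σ.pushHom (m ≫ eqToHom σ.obj_source) ≫ eqToHom e) ≫ σ.pushHom n).tr = toAny (X.one p.1) := by
  rw [toAny_inv_comp_eqToHom, inv_pushHom]
  obtain ⟨e', he⟩ := eq_eqToHom_of_toAny h
  have h1 : inv (m ≫ eqToHom σ.obj_source) ≫ n = eqToHom (σ.obj_source.symm.trans e') := by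
    rw [IsIso.inv_comp, Category.assoc, he]
    simp
  rw [h1, toAny_mor_eqToHom hα.symm, toAny_one_target]

lemma isSec_pushHom {A : Pth Y T} {g : C(T', T)} {w : C(T' × ℝ, ℝ)} {β : σ.Λ}
    {a : Sec (A.comap g w).r (σ.V β)} (ha : (A.comap g w).IsSec a) :
    ((σ.pushPth A).comap g w).IsSec (pushSec a) :=
  ((pushComap A g w univ).isSec_pull (isSec_push ha)).congr (fun _ h => ⟨trivial, h⟩) fun _ _ =>
    congrArg (fun m => Mor.tr m) (Category.id_comp _).symm

lemma isLoopMap_loopMap : σ.IsLoopMap σ.loopMap := by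
  intro P a τ h0 h1
  obtain ⟨B, hB⟩ := LArc.exists_cls_eq (Loop.mk τ)
  obtain ⟨R⟩ : Nonempty (Rep ((PFam.ofArc B.toPoint).at' ()) ((point q).toRelSys τ)) :=
    PFam.cls_eq_mk_iff.1 ((loopHomeo q).injective hB)
  rw [loopMap_eq B hB]
  refine congrArg (loopHomeo p) ((PFam.cls_eq_mk_iff
    (τ := (point p).toRelSys (σ.pushLoop τ h0 h1))).2 ⟨⟨fun k z hz => σ.pushHom (R.h k z hz),
      fun k => (isSec_pushHom (R.sec k)).congr subset_rfl fun _ _ => rfl, fun l z hz => ?_, fun z hz => ?_,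
      𝟙 _, fun z hz => ?_⟩⟩)
  · exact (congrArg (fun m => Mor.tr m) (σ.inv_pushHom _ _)).trans (congrArg (σ.ρ _ _) (R.link l z hz))
  · exact toAny_inv_pushHom h0 (R.start z hz) σ.obj_target
  · obtain ⟨ζ, hζ⟩ := R.fin
    exact toAny_inv_pushHom h1 (hζ z hz) σ.obj_target

lemma isRelMap_relMap : σ.IsRelMap σ.relMap := by
  intro P a τ h0
  obtain ⟨α, v, B, hB⟩ := YArc.exists_cls_eq (σ := σ) (RelLoop.mk τ)
  obtain ⟨R⟩ : Nonempty (Rep ((PFam.ofArc (YArc.toRArc B)).at' ()) τ) := PFam.cls_eq_mk_iff.1 hB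
  rw [relMap_eq B hB]
  obtain ⟨ζ, hζ⟩ := R.fin
  refine (PFam.cls_eq_mk_iff).2 ⟨⟨fun k z hz => σ.pushHom (R.h k z hz),
      fun k => (isSec_pushHom (R.sec k)).congr subset_rfl fun _ _ => rfl, fun l z hz => ?_, fun z hz => ?_,
      ζ, fun z hz => ?_⟩⟩
  · exact (congrArg (fun m => Mor.tr m) (σ.inv_pushHom _ _)).trans (congrArg (σ.ρ _ _) (R.link l z hz))
  · exact toAny_inv_pushHom h0 (R.start z hz) σ.obj_target
  · exact congrArg toAny ((congrArg (fun m => Mor.tr m) (σ.inv_pushHom _ _)).trans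
      (congrArg (σ.ρ α (a (Fin.last _))) (toAny_injective (hζ z hz))))

end BasedSystem

namespace Orbispace

lemma eqToHom_inv_eqToHom_comp {x y z w : X.Obj} (h : x = y) (h' : z = y) (m : z ⟶ w) (n : x ⟶ w)
    (hmn : eqToHom (h.trans h'.symm) ≫ m = n) : (eqToHom h ≫ inv (eqToHom h')) ≫ m = n := by
  subst h h'; simpa using hmn

lemma inv_eqToHom_comp {x y w : X.Obj} (h : x = y) (m : x ⟶ w) (n : y ⟶ w)
    (hmn : eqToHom h ≫ n = m) : inv (eqToHom h) ≫ m = n := by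
  subst h; simpa using hmn.symm

namespace Arc

lemma comap_comap (A : Arc a b) (g : C(T', T)) (g' : C(T'', T')) : ((A.comap g).comap g').Iso (A.comap (g.comp g')) :=
  ⟨PIso.ofComap A.A g _ g' _ (g.comp g') _ _ fun _ _ => rfl, fun _ _ => Category.id_comp _,
    fun _ _ => Category.id_comp _⟩

lemma comap_id (A : Arc a b) : (A.comap (.id T)).Iso A := by
  exact ⟨⟨fun z _ => 𝟙 (A.A.r z), fun e he => ((Pth.isSec_atlas he).comap (.id T) (Pth.sndMap T)).congr (fun _ h => h.2)
      fun z hz => congrArg (fun m => Mor.tr m) (Category.id_comp _)⟩, fun _ _ => Category.id_comp _, fun _ _ => Category.id_comp _⟩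

variable {D D' : Pth X T} {x y y' : T → ℝ}

lemma sub_congr {F : Frame D x a} {G : Frame D y b} {w w' : C(T × ℝ, ℝ)}
    (h : ∀ z : T × ℝ, z.2 ∈ Icc (0 : ℝ) 1 → w z = w' z) (h0 h1 h0' h1') :
    (sub D w F G h0 h1).Iso (sub D w' F G h0' h1') := by
  refine ⟨PIso.ofEq D (.id T) (.id T) w w' _ fun z hz => by rw [h z hz], fun z hz => ?_, fun z hz => ?_⟩
  · exact F.eqToHom_comp (h z (by simp [hz])) _ _
  · exact G.eqToHom_comp (h z (by simp [hz])) _ _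

lemma sub_iso {F : Frame D x a} {G : Frame D y b} {F' : Frame D' x a} {G' : Frame D' y b}
    {S : Set (T × ℝ)} (j : PIso D D' S) {w : C(T × ℝ, ℝ)}
    (hw : ∀ z : T × ℝ, z.2 ∈ Icc (0 : ℝ) 1 → (z.1, w z) ∈ S)
    (hF : ∀ (z : T × ℝ) (hz : z.2 = x z.1) (hS : z ∈ S), j.J z hS ≫ F'.h z hz = F.h z hz)
    (hG : ∀ (z : T × ℝ) (hz : z.2 = y z.1) (hS : z ∈ S), j.J z hS ≫ G'.h z hz = G.h z hz) (h0 h1) :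
    (sub D w F G h0 h1).Iso (sub D' w F' G' h0 h1) :=
  ⟨(j.comap (.id T) w).mono hw, fun _ _ => hF _ _ _, fun _ _ => hG _ _ _⟩

lemma sub_comap {F : Frame D x a} {G : Frame D y b} {w : C(T × ℝ, ℝ)} (h0 h1) (g : C(T', T))
    (w' : C(T' × ℝ, ℝ)) (hw : ∀ z : T' × ℝ, z.2 ∈ Icc (0 : ℝ) 1 → w (g z.1, z.2) = w' z) (h0' h1') :
    ((sub D w F G h0 h1).comap g).Iso (sub (D.comap g (Pth.sndMap T')) w'
      (F.comap g (Pth.sndMap T') (x' := x ∘ g) fun _ h => h)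
      (G.comap g (Pth.sndMap T') (x' := y ∘ g) fun _ h => h) h0' h1') := by
  refine ⟨(PIso.ofComap D (.id T) w g _ g w' _ fun z hz => Prod.ext rfl (hw z hz)).trans
    (PIso.ofComap D g _ (.id T') w' g w' _ fun _ _ => rfl).symm, fun z hz => ?_, fun z hz => ?_⟩
  · exact eqToHom_inv_eqToHom_comp (congrArg (fun s => D.r (g z.1, s)) (hw z (by simp [hz]))) rfl _ _ (F.eqToHom_comp (hw z (by simp [hz])) _ _)
  · exact eqToHom_inv_eqToHom_comp (congrArg (fun s => D.r (g z.1, s)) (hw z (by simp [hz]))) rfl _ _ (G.eqToHom_comp (hw z (by simp [hz])) _ _)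

lemma sub_sub {F : Frame D x a} {G : Frame D y b} {w w' w'' : C(T × ℝ, ℝ)} {x' y' : T → ℝ}
    (hx : ∀ z : T × ℝ, z.2 = x' z.1 → w z = x z.1) (hy : ∀ z : T × ℝ, z.2 = y' z.1 → w z = y z.1)
    (hw : ∀ z : T × ℝ, z.2 ∈ Icc (0 : ℝ) 1 → w (z.1, w' z) = w'' z) (h0 h1 h0' h1') :
    (sub (D.comap (.id T) w) w' (F.re w hx) (G.re w hy) h0 h1).Iso (sub D w'' F G h0' h1') := by
  refine ⟨PIso.ofComap D (.id T) w (.id T) w' (.id T) w'' _ fun z hz => Prod.ext rfl (hw z hz),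
    fun z hz => ?_, fun z hz => ?_⟩
  · exact F.eqToHom_comp (hw z (by simp [hz])) _ _
  · exact G.eqToHom_comp (hw z (by simp [hz])) _ _

lemma sub_const (F : Frame D x a) (w : C(T × ℝ, ℝ)) (hw : ∀ z : T × ℝ, z.2 ∈ Icc (0 : ℝ) 1 → w z = x z.1) (h0 h1) :
    (sub D w F F h0 h1).Iso (const a) :=
  iso_const_of_frame (fun z hz => F.h (z.1, w z) (hw z hz))
    ((F.sec.comap (.id T) w).congr hw fun _ _ => rfl) (fun _ _ => rfl) fun _ _ => rfl

lemma sub_self (A : Arc a b) (h0 h1) : (sub A.A (lin T 0 1) A.st A.en h0 h1).Iso A := by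
  refine ⟨⟨fun z _ => eqToHom (congrArg A.A.r (Prod.ext rfl (by simp))), fun e he => ?_⟩,
    fun z hz => ?_, fun z hz => ?_⟩
  · refine ((Pth.isSec_atlas he).comap (.id T) (lin T 0 1)).congr (fun z hz => ?_) fun z hz => ?_
    · change (z.1, 0 + 1 * z.2) ∈ e.2.N
      rw [zero_add, one_mul]; exact hz.2
    · exact e.2.eqToHom_comp_tr (z := (z.1, lin T 0 1 z)) (z' := z) (Prod.ext rfl (by simp)) _ _
  · exact A.st.eqToHom_comp (by simp) _ _
  · exact A.en.eqToHom_comp (by simp) _ _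

/-- The concatenation of two parts of a family of paths. -/
lemma isComp_sub {F : Frame D x a} {G : Frame D y b} {H : Frame D y' d} {w w' w'' : C(T × ℝ, ℝ)}
    (hw : ∀ z : T × ℝ, z.2 ∈ Icc (0 : ℝ) (1 / 2) → w'' z = w (z.1, 0 + 2 * z.2))
    (hw' : ∀ z : T × ℝ, z.2 ∈ Icc (1 / 2 : ℝ) 1 → w'' z = w' (z.1, -1 + 2 * z.2))
    (h0 h1 h0' h1' h0'' h1'') :
    IsComp (sub D w F G h0 h1) (sub D w' G H h0' h1') (sub D w'' F H h0'' h1'') := by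
  refine ⟨(PIso.ofComap D (.id T) w (.id T) (lin T 0 2) (.id T) w'' _ fun z hz => Prod.ext rfl (hw z hz).symm).symm,
    (PIso.ofComap D (.id T) w' (.id T) (lin T (-1) 2) (.id T) w'' _
      fun z hz => Prod.ext rfl (hw' z hz).symm).symm, fun z hz => ?_, fun z hz => ?_, fun z hz => ?_⟩
  · exact inv_eqToHom_comp (congrArg (fun s => D.r (z.1, s)) (hw z (by simp [hz])).symm) _ _
      (F.eqToHom_comp (hw z (by simp [hz])).symm _ _)
  · have hy : w'' z = y z.1 := by rw [hw z (by simp [hz]), ← h1 z.1]; congr 2; rw [hz]; norm_num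
    exact (inv_eqToHom_comp (congrArg (fun s => D.r (z.1, s)) (hw z (by simp [hz])).symm) _ _
      (G.eqToHom_comp (hw z (by simp [hz])).symm _ hy)).trans (inv_eqToHom_comp
      (congrArg (fun s => D.r (z.1, s)) (hw' z (by simp [hz]; norm_num)).symm) _ _
      (G.eqToHom_comp (hw' z (by simp [hz]; norm_num)).symm _ hy)).symm
  · exact inv_eqToHom_comp (congrArg (fun s => D.r (z.1, s)) (hw' z (by simp [hz]; norm_num)).symm) _ _
      (H.eqToHom_comp (hw' z (by simp [hz]; norm_num)).symm _ _)

/-- The parts of a concatenation. -/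
lemma IsComp.exists_split {A : Arc a b} {B : Arc b d} {C : Arc a d} (h : IsComp A B C) :
    ∃ (j : PIso C.A (A.A.comap (.id T) (lin T 0 2)) {z | z.2 ∈ Icc (0 : ℝ) (1 / 2)})
      (k : PIso C.A (B.A.comap (.id T) (lin T (-1) 2)) {z | z.2 ∈ Icc (1 / 2 : ℝ) 1})
      (G : Frame C.A (fun _ => 1 / 2) b),
      (∀ (z : T × ℝ) (hz : z.2 = 0), j.J z (by simp [hz]) ≫ A.st.h (z.1, lin T 0 2 z) (by simp [hz]) = C.st.h z hz) ∧
      (∀ (z : T × ℝ) (hz : z.2 = 1 / 2), j.J z (by simp [hz]) ≫ A.en.h (z.1, lin T 0 2 z) (by simp [hz]) = G.h z hz) ∧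
      (∀ (z : T × ℝ) (hz : z.2 = 1 / 2), k.J z (by simp [hz]; norm_num) ≫
        B.st.h (z.1, lin T (-1) 2 z) (by simp [hz]) = G.h z hz) ∧
      (∀ (z : T × ℝ) (hz : z.2 = 1), k.J z (by simp [hz]; norm_num) ≫
        B.en.h (z.1, lin T (-1) 2 z) (by simp [hz]; norm_num) = C.en.h z hz) ∧
      (sub C.A (lin T 0 (1 / 2)) C.st G (by simp) (by simp)).Iso A ∧
      (sub C.A (lin T (1 / 2) (1 / 2)) G C.en (by simp) (by simp; norm_num)).Iso B := by
  obtain ⟨j, k, h0, hm, h1⟩ := h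
  let G : Frame C.A (fun _ => 1 / 2) b :=
    (A.en.re (lin T 0 2) fun z hz => by simp [hz]).pull j fun z hz => by simp [hz]
  refine ⟨j, k, G, h0, fun _ _ => rfl, fun z hz => (hm z hz).symm, h1, ?_, ?_⟩
  · have i1 := sub_iso (G := G) (F' := A.st.re (lin T 0 2) fun z hz => by simp [hz])
      j (w := lin T 0 (1 / 2)) (fun z hz => by
        obtain ⟨h1, h2⟩ := hz
        refine ⟨?_, ?_⟩ <;> simp <;> linarith) (fun z hz _ => h0 z hz) (fun z hz _ => rfl)
        (by simp) (by simp)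
    exact (i1.trans (sub_sub _ _ (fun z hz => by simp) _ _ (by simp)
      (by simp))).trans (sub_self A _ _)
  · have i1 := sub_iso (F := G) (F' := B.st.re (lin T (-1) 2) fun z hz => by simp [hz])
      (G' := B.en.re (lin T (-1) 2) fun z hz => by simp [hz]; norm_num) k
      (w := lin T (1 / 2) (1 / 2)) (fun z hz => by
        obtain ⟨h1, h2⟩ := hz
        refine ⟨?_, ?_⟩ <;> simp <;> linarith) (fun z hz _ => (hm z hz).symm) (fun z hz _ => h1 z hz)
        (by simp) (by simp; norm_num)
    exact (i1.trans (sub_sub _ _ (fun z hz => by simp; ring) _ _ (by simp)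
      (by simp))).trans (sub_self B _ _)

end Arc

end Orbispace

namespace Orbispace.Arc

lemma comp_comap (A : Arc a b) (B : Arc b d) (g : C(T', T)) :
    ((A.comp B).comap g).Iso ((A.comap g).comp (B.comap g)) := ((isComp_comp A B).comap g).iso_comp

lemma rev_comap (A : Arc a b) (g : C(T', T)) : (A.rev.comap g).Iso (A.comap g).rev :=
  sub_comap _ _ g (lin T' 1 (-1)) (fun _ _ => rfl) _ _

lemma rev_rev (A : Arc a b) : A.rev.rev.Iso A :=
  (sub_sub _ _ (fun z _ => by simp) _ _ (by simp)
    (by simp)).trans (sub_self A _ _)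

lemma rev_const : (const a).rev.Iso (const a) := by
  exact iso_const_of_frame (fun z _ => 𝟙 _) (((Pth.isSec_atlas (A := Pth.ofMap (a.comp ContinuousMap.fst)) rfl).comap (.id T)
      (lin T 1 (-1))).congr (fun _ _ => trivial) fun z hz => rfl) (fun _ _ => (eqToHom_refl _ rfl).symm)
    fun _ _ => (eqToHom_refl _ rfl).symm

/-- Reparametrization of the first half and the second half of `[0, 1]`. -/
def bend (T : Type*) [TopologicalSpace T] (x y z : ℝ) : C(T × ℝ, ℝ) :=
  ⟨fun t => if t.2 ≤ 1 / 2 then x + (y - x) * (2 * t.2) else y + (z - y) * (2 * t.2 - 1), by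
    refine Continuous.if_le (by fun_prop) (by fun_prop) (by fun_prop) (by fun_prop) fun t ht => ?_
    rw [ht]; ring⟩

lemma bend_of_le {x y z : ℝ} {t : T × ℝ} (h : t.2 ≤ 1 / 2) : bend T x y z t = x + (y - x) * (2 * t.2) := if_pos h

lemma bend_of_ge {x y z : ℝ} {t : T × ℝ} (h : 1 / 2 ≤ t.2) : bend T x y z t = y + (z - y) * (2 * t.2 - 1) := by
  rcases h.eq_or_lt with h | h
  · rw [bend_of_le h.ge, ← h]; ring
  · exact if_neg (not_le.2 h)

@[simp] lemma bend_zero {x y z : ℝ} (t : T) : bend T x y z (t, 0) = x := by rw [bend_of_le (by norm_num)]; simp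

@[simp] lemma bend_one {x y z : ℝ} (t : T) : bend T x y z (t, 1) = z := by rw [bend_of_ge (by norm_num)]; simp; ring

lemma isComp_bend {D : Pth X T} {x y z : ℝ} (F : Frame D (fun _ => x) a) (G : Frame D (fun _ => y) b)
    (H : Frame D (fun _ => z) d) :
    IsComp (sub D (lin T x (y - x)) F G (by simp) (by simp))
      (sub D (lin T y (z - y)) G H (by simp) (by simp)) (sub D (bend T x y z) F H (by simp) (by simp)) :=
  isComp_sub (fun z hz => by rw [bend_of_le hz.2]; simp) (fun z hz => by
    rw [bend_of_ge hz.1]; simp; ring_nf; simp) _ _ _ _ _ _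

lemma comp_const_iso (A : Arc a b) : (A.comp (const b)).Iso (sub A.A (bend T 0 1 1) A.st A.en (by simp) (by simp)) :=
  ((isComp_bend A.st A.en A.en).iso (isComp_comp A (const b))
    ((sub_congr (fun z _ => by simp) _ _ (by simp) (by simp)).trans (sub_self A (by simp) (by simp)))
    (sub_const A.en _ (fun z _ => by simp) _ _)).symm

lemma const_comp_iso (A : Arc a b) : ((const a).comp A).Iso (sub A.A (bend T 0 0 1) A.st A.en (by simp) (by simp)) :=
  ((isComp_bend A.st A.st A.en).iso (isComp_comp (const a) A) (sub_const A.st _ (fun z _ => by simp) _ _)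
    ((sub_congr (fun z _ => by simp) _ _ (by simp) (by simp)).trans (sub_self A (by simp) (by simp)))).symm

lemma const_comp_const : ((const a).comp (const a)).Iso (const a) :=
  (comp_const_iso (const a)).trans (iso_const_of_frame (fun z _ => 𝟙 _)
    (((Pth.isSec_atlas (A := Pth.ofMap (a.comp ContinuousMap.fst)) rfl).comap (.id T)
      (bend T 0 1 1)).congr (fun _ _ => trivial) fun z hz => rfl)
    (fun _ _ => (eqToHom_refl _ rfl).symm) fun _ _ => (eqToHom_refl _ rfl).symm)

lemma sub_frame_congr {D : Pth X T} {x y : T → ℝ} {F F' : Frame D x a} {G G' : Frame D y b}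
    {w : C(T × ℝ, ℝ)} (hF : F.h = F'.h) (hG : G.h = G'.h) (h0 h1) :
    (sub D w F G h0 h1).Iso (sub D w F' G' h0 h1) :=
  sub_iso (PIso.refl D univ) (fun _ _ => trivial) (fun z hz _ => (Category.id_comp _).trans (by rw [hF]))
    (fun z hz _ => (Category.id_comp _).trans (by rw [hG])) _ _

/-- Parts of the first half of a concatenation. -/
lemma sub_pull_iso {A C : Pth X T} (j : PIso C (A.comap (.id T) (lin T 0 2)) {z | z.2 ∈ Icc (0 : ℝ) (1 / 2)})
    {x y x' y' : ℝ} {F : Frame A (fun _ => x) a} {G : Frame A (fun _ => y) b} (hx) (hy) (hx') (hy')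
    {w w' : C(T × ℝ, ℝ)} (hw : ∀ z : T × ℝ, z.2 ∈ Icc (0 : ℝ) 1 → w z ∈ Icc (0 : ℝ) (1 / 2))
    (hw' : ∀ z : T × ℝ, z.2 ∈ Icc (0 : ℝ) 1 → 0 + 2 * w z = w' z) (h0 h1 h0' h1') :
    (sub C w ((F.re (lin T 0 2) (x' := fun _ => x') hx).pull j hx')
      ((G.re (lin T 0 2) (x' := fun _ => y') hy).pull j hy') h0 h1).Iso (sub A w' F G h0' h1') :=
  (sub_iso j hw (fun _ _ _ => rfl) (fun _ _ _ => rfl) _ _).trans (sub_sub hx hy hw' _ _ _ _)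

/-- Associativity up to reparametrization. -/
lemma exists_assoc {c3 : X.ι} {e : C(T, X.C c3)} (A : Arc a b) (B : Arc b d) (C : Arc d e) :
    ∃ w : C(T × ℝ, ℝ), ∃ h0 h1, (∀ z : T × ℝ, z.2 ∈ Icc (0 : ℝ) 1 → w z ∈ Icc (0 : ℝ) 1) ∧ (A.comp (B.comp C)).Iso
      (sub ((A.comp B).comp C).A w ((A.comp B).comp C).st ((A.comp B).comp C).en h0 h1) := by
  obtain ⟨-, -, G', -, -, -, -, h3, h4⟩ := (isComp_comp A B).exists_split
  have hD := isComp_comp (A.comp B) C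
  generalize (A.comp B).comp C = D at hD ⊢
  obtain ⟨j, -, N, j0, j1, -, -, -, h2⟩ := hD.exists_split
  let M := (G'.re (lin T 0 2) (x' := fun _ => 1 / 4) fun z hz => by simp [hz]; norm_num).pull j
    fun z hz => by simp [hz]; norm_num
  let S := ((A.comp B).st.re (lin T 0 2) (x' := fun _ => 0) fun z hz => by simp [hz]).pull j
    fun z hz => by simp [hz]
  let N' := ((A.comp B).en.re (lin T 0 2) (x' := fun _ => 1 / 2) fun z hz => by simp [hz]).pull j
    fun z hz => by simp [hz]
  have hA : (sub D.A (lin T 0 (1 / 4 - 0)) D.st M (by simp) (by simp)).Iso A :=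
    ((sub_frame_congr (by funext z hz; exact (j0 z hz).symm) rfl _ _).trans (sub_pull_iso j _ _ _ _ (fun z hz => by
      obtain ⟨h1, h2⟩ := hz
      refine ⟨?_, ?_⟩ <;> simp <;> linarith) (fun z _ => by simp; ring) _ _ (by simp) (by simp))).trans h3
  have hB : (sub D.A (lin T (1 / 4) (1 / 2 - 1 / 4)) M N (by simp) (by simp)).Iso B :=
    ((sub_frame_congr rfl (by funext z hz; exact (j1 z hz).symm) _ _).trans (sub_pull_iso j _ _ _ _
      (fun z hz => by
        obtain ⟨h1, h2⟩ := hz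
        refine ⟨?_, ?_⟩ <;> simp <;> linarith) (fun z _ => by simp; ring) _ _ (by simp)
        (by simp; norm_num))).trans h4
  have hBC := (isComp_bend M N D.en).iso (isComp_comp B C) hB ((sub_congr (fun z _ => by simp only [lin_apply]; ring) _ _ _ _).trans h2)
  let w : C(T × ℝ, ℝ) := ⟨fun z => max (z.2 / 2) (max (z.2 - 1 / 4) (2 * z.2 - 1)), by fun_prop⟩
  have hw1 : ∀ z : T × ℝ, z.2 ≤ 1 / 2 → w z = z.2 / 2 := fun z hz => max_eq_left (max_le (by linarith) (by linarith))
  have hw2 : ∀ z : T × ℝ, 1 / 2 ≤ z.2 → z.2 ≤ 3 / 4 → w z = z.2 - 1 / 4 := fun z h1 h2 =>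
    (max_eq_right (le_max_of_le_left (by linarith))).trans (max_eq_left (by linarith))
  have hw3 : ∀ z : T × ℝ, 3 / 4 ≤ z.2 → w z = 2 * z.2 - 1 := fun z h1 =>
    (max_eq_right (le_max_of_le_left (by linarith))).trans (max_eq_right (by linarith))
  refine ⟨w, fun t => by rw [hw1 _ (by norm_num)]; simp, fun t => by rw [hw3 _ (by norm_num)]; norm_num,
    fun z hz => ⟨le_max_of_le_left (by linarith [hz.1]), max_le (by linarith [hz.2])
      (max_le (by linarith [hz.2]) (by linarith [hz.2]))⟩,
    (IsComp.iso (isComp_sub (fun z hz => ?_) (fun z hz => ?_) _ _ _ _ _ _) (isComp_comp A (B.comp C)) hA hBC).symm⟩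
  · rw [hw1 z hz.2]; simp; ring
  · rcases le_total z.2 (3 / 4) with h | h
    · rw [hw2 z hz.1 h, bend_of_le (by simp; linarith)]; simp; ring
    · rw [hw3 z h, bend_of_ge (by simp; linarith)]; simp; ring

end Orbispace.Arc

namespace BasedSystem

section Loop

lemma LArc.iso_comap {A : LArc p T} {A0 : LArc p Unit} {t : T} (h : LArc.cls A0 () = LArc.cls A t) :
    A0.Iso (LArc.comap A (.const Unit t)) :=
  LArc.iso_of_cls_eq fun _ => h.trans (LArc.cls_comap A (.const Unit t) ()).symm

lemma LArc.exists_local₂ {Φ Ψ : T → Loop p} (hΦ : Continuous Φ) (hΨ : Continuous Ψ) (t0 : T) :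
    ∃ M : Set T, IsOpen M ∧ t0 ∈ M ∧
    ∃ A B : LArc p M, (∀ t : M, cls A t = Φ t) ∧ ∀ t : M, cls B t = Ψ t := by
  obtain ⟨M, hM, ht, A, hA⟩ := LArc.exists_local hΦ t0
  obtain ⟨M', hM', ht', B, hB⟩ := LArc.exists_local hΨ t0
  refine ⟨M ∩ M', hM.inter hM', ⟨ht, ht'⟩,
    LArc.comap A ⟨fun t => ⟨t, t.2.1⟩, by fun_prop⟩, LArc.comap B ⟨fun t => ⟨t, t.2.2⟩, by fun_prop⟩,
    fun t => (LArc.cls_comap _ _ _).trans (hA _), fun t => (LArc.cls_comap _ _ _).trans (hB _)⟩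

/-- Concatenation of families of based loops. -/
def LArc.comp (A B : LArc p T) : LArc p T := Arc.comp A B

/-- Inversion of families of based loops. -/
def LArc.rev (A : LArc p T) : LArc p T := Arc.rev A

/-- Concatenation of based loops. -/
def conc (γ γ' : Loop p) : Loop p :=
  LArc.cls (LArc.comp (LArc.exists_cls_eq γ).choose (LArc.exists_cls_eq γ').choose) ()

/-- Inversion of based loops. -/
def invLoop (γ : Loop p) : Loop p := LArc.cls (LArc.rev (LArc.exists_cls_eq γ).choose) ()

lemma conc_cls (A B : LArc p T) (t : T) : conc (LArc.cls A t) (LArc.cls B t) = LArc.cls (LArc.comp A B) t := by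
  exact (LArc.cls_of_iso (((LArc.iso_comap (LArc.exists_cls_eq (LArc.cls A t)).choose_spec).comp (LArc.iso_comap (LArc.exists_cls_eq (LArc.cls B t)).choose_spec)).trans (Arc.comp_comap A B (.const Unit t)).symm) ()).trans
    (LArc.cls_comap (LArc.comp A B) (.const Unit t) ())

lemma invLoop_cls (A : LArc p T) (t : T) : invLoop (LArc.cls A t) = LArc.cls (LArc.rev A) t := by
  exact (LArc.cls_of_iso ((LArc.iso_comap (LArc.exists_cls_eq (LArc.cls A t)).choose_spec).rev.trans (Arc.rev_comap A (.const Unit t)).symm) ()).trans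
    (LArc.cls_comap (LArc.rev A) (.const Unit t) ())

lemma continuous_conc : Continuous fun z : Loop p × Loop p => conc z.1 z.2 :=
  continuous_of_local fun z => by
    obtain ⟨M, hM, ht, A, B, hA, hB⟩ := LArc.exists_local₂ continuous_fst continuous_snd z
    refine ⟨M, hM, ht, (LArc.continuous_cls (LArc.comp A B)).congr fun t => ?_⟩
    rw [← conc_cls, hA, hB]

lemma continuous_invLoop : Continuous (invLoop (p := p)) :=
  continuous_of_local fun z => by
    obtain ⟨M, hM, ht, A, hA⟩ := LArc.exists_local continuous_id z
    refine ⟨M, hM, ht, (LArc.continuous_cls (LArc.rev A)).congr fun t => ?_⟩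
    rw [← invLoop_cls, hA]; rfl

lemma invLoop_invLoop (γ : Loop p) : invLoop (invLoop γ) = γ := by
  obtain ⟨A, rfl⟩ := LArc.exists_cls_eq γ
  rw [invLoop_cls, invLoop_cls]
  exact LArc.cls_of_iso (Arc.rev_rev A) ()

lemma invLoop_const : invLoop (Loop.const p) = Loop.const p := by
  rw [← LArc.cls_const (), invLoop_cls]
  exact LArc.cls_of_iso Arc.rev_const ()

lemma conc_const_const : conc (Loop.const p) (Loop.const p) = Loop.const p := by
  rw [← LArc.cls_const (), conc_cls]
  exact LArc.cls_of_iso Arc.const_comp_const ()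

/-- Reparametrization of a family of based loops. -/
def LArc.re (A : LArc p T) (w : C(T × ℝ, ℝ)) (h0 : ∀ t, w (t, 0) = 0)
    (h1 : ∀ t, w (t, 1) = 1) : LArc p T := Arc.sub A.A w A.st A.en h0 h1

lemma LArc.re_iso {A A' : LArc p T} (h : A.Iso A') {w : C(T × ℝ, ℝ)} {h0 : ∀ t, w (t, 0) = 0}
    {h1 : ∀ t, w (t, 1) = 1} (hw : ∀ z : T × ℝ, z.2 ∈ Icc (0 : ℝ) 1 → w z ∈ Icc (0 : ℝ) 1) :
    (LArc.re A w h0 h1).Iso (LArc.re A' w h0 h1) := by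
  obtain ⟨j, j0, j1⟩ := h
  exact Arc.sub_iso j hw (fun z hz _ => j0 z hz) (fun z hz _ => j1 z hz) _ _

variable {Z : Type*} [TopologicalSpace Z] {w : C(Z × ℝ, ℝ)} {h0 : ∀ t, w (t, 0) = 0} {h1 : ∀ t, w (t, 1) = 1}

/-- Reparametrization of based loops. -/
def reLoop (w : C(Z × ℝ, ℝ)) (h0 : ∀ t, w (t, 0) = 0) (h1 : ∀ t, w (t, 1) = 1) (γ : Loop p) (ζ : Z) : Loop p :=
  LArc.cls (LArc.re (LArc.comap (LArc.exists_cls_eq γ).choose (.const Z ())) w h0 h1) ζ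

lemma reLoop_cls (hw : ∀ z : Z × ℝ, z.2 ∈ Icc (0 : ℝ) 1 → w z ∈ Icc (0 : ℝ) 1) (A : LArc p T)
    (g : C(T, Z)) (t : T) : reLoop w h0 h1 (LArc.cls A t) (g t) =
      LArc.cls (LArc.re A ⟨fun z => w (g z.1, z.2), by fun_prop⟩ (fun t => h0 _) fun t => h1 _) t := by
  set A0 := (LArc.exists_cls_eq (LArc.cls A t)).choose
  let w' : C(Unit × ℝ, ℝ) := ⟨fun z => w (g t, z.2), by fun_prop⟩
  have e1 : LArc.cls (LArc.comap (LArc.re (LArc.comap A0 (.const Z ())) w h0 h1) (.const Unit (g t))) () =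
      reLoop w h0 h1 (LArc.cls A t) (g t) := LArc.cls_comap _ _ _
  have e2 : LArc.cls (LArc.comap (LArc.re A ⟨fun z => w (g z.1, z.2), by fun_prop⟩ (fun t => h0 _)
      fun t => h1 _) (.const Unit t)) () = LArc.cls (LArc.re A ⟨fun z => w (g z.1, z.2), by fun_prop⟩
      (fun t => h0 _) fun t => h1 _) t := LArc.cls_comap _ _ _
  rw [← e1, ← e2]
  refine LArc.cls_of_iso ((Arc.sub_comap _ _ (.const Unit (g t)) w' (fun _ _ => rfl) (fun _ => h0 _)
    (fun _ => h1 _)).trans (Arc.Iso.trans ?_ (Arc.sub_comap (F := A.st) (G := A.en) (fun t => h0 _) (fun t => h1 _) (.const Unit t) w' (fun _ _ => rfl) (fun _ => h0 _) (fun _ => h1 _)).symm)) ()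
  refine LArc.re_iso
    (((Arc.comap_comap A0 (.const Z ()) (.const Unit (g t))).trans
      (Arc.comap_id A0)).trans (LArc.iso_comap (LArc.exists_cls_eq (LArc.cls A t)).choose_spec))
    fun z hz => hw _ hz

lemma continuous_reLoop (hw : ∀ z : Z × ℝ, z.2 ∈ Icc (0 : ℝ) 1 → w z ∈ Icc (0 : ℝ) 1) :
    Continuous fun z : Loop p × Z => reLoop w h0 h1 z.1 z.2 :=
  continuous_of_local fun z => by
    obtain ⟨M, hM, ht, A, hA⟩ := LArc.exists_local continuous_fst z
    exact ⟨M, hM, ht, (LArc.continuous_cls (LArc.re A ⟨fun z => w (z.1.1.2, z.2), by fun_prop⟩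
      (fun t => h0 _) fun t => h1 _)).congr fun t => (reLoop_cls hw A ⟨fun t : M => t.1.2, by fun_prop⟩ t).symm.trans (by rw [hA]; rfl)⟩

lemma LArc.re_const (w : C(T × ℝ, ℝ)) (h0 h1) : (LArc.re (LArc.const p T) w h0 h1).Iso (LArc.const p T) :=
  Arc.iso_const_of_frame (fun z _ => 𝟙 _)
    (((Pth.isSec_atlas (A := Pth.ofMap ((ContinuousMap.const T p.2).comp ContinuousMap.fst))
      rfl).comap (.id T) w).congr (fun _ _ => trivial) fun z hz => rfl)
    (fun _ _ => (eqToHom_refl _ rfl).symm) fun _ _ => (eqToHom_refl _ rfl).symm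

lemma reLoop_const (hw : ∀ z : Z × ℝ, z.2 ∈ Icc (0 : ℝ) 1 → w z ∈ Icc (0 : ℝ) 1) (ζ : Z) :
    reLoop w h0 h1 (Loop.const p) ζ = Loop.const p := by
  rw [← LArc.cls_const ζ]
  exact (reLoop_cls hw _ (.id Z) ζ).trans (LArc.cls_of_iso (LArc.re_const _ _ _) ζ)

end Loop

end BasedSystem

namespace Orbispace.Arc

lemma IsComp.of_iso {A : Arc a b} {B : Arc b d} {C C' : Arc a d} (h : IsComp A B C) (e : C'.Iso C) :
    IsComp A B C' := by
  obtain ⟨j, k, h0, hm, h1⟩ := h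
  obtain ⟨i, i0, i1⟩ := e
  refine ⟨(i.mono fun z hz => ⟨hz.1, hz.2.trans (by norm_num)⟩).trans j,
    (i.mono fun z hz => ⟨le_trans (by norm_num) hz.1, hz.2⟩).trans k, fun z hz => ?_, fun z hz => ?_,
    fun z hz => ?_⟩
  · exact (Category.assoc _ _ _).trans ((congrArg (i.J z _ ≫ ·) (h0 z hz)).trans (i0 z hz))
  · exact (Category.assoc _ _ _).trans ((congrArg (i.J z _ ≫ ·) (hm z hz)).trans (Category.assoc _ _ _).symm)
  · exact (Category.assoc _ _ _).trans ((congrArg (i.J z _ ≫ ·) (h1 z hz)).trans (i1 z hz))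

lemma IsComp.post_rev {c1 : X.ι} {b' : C(T, X.C c1)} {P : Arc a b} {Q : Arc d b} {C : Arc a d}
    (h : IsComp P Q.rev C) (ζ : ∀ t, (⟨c', b t⟩ : X.Obj) ⟶ ⟨c1, b' t⟩)
    (hζ : Continuous (Y := X.Tran c' c1) fun t => (ζ t).tr) :
    IsComp (P.post ζ hζ) (Q.post ζ hζ).rev C := by
  obtain ⟨j, k, h0, hm, h1⟩ := h
  exact ⟨j, k, h0, fun z hz => (Category.assoc _ _ _).symm.trans ((congrArg (· ≫ ζ z.1) (hm z hz)).trans (Category.assoc _ _ _)), h1⟩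

/-- Concatenation can be cancelled from the right. -/
lemma iso_of_comp_iso {A A' : Arc a b} {B B' : Arc b d} (h : (A.comp B).Iso (A'.comp B'))
    (hB : B.Iso B') : A.Iso A' := by
  obtain ⟨-, k, G, -, -, k0, k1, hA, -⟩ := (isComp_comp A B).exists_split
  obtain ⟨-, k', G', -, -, k0', k1', hA', -⟩ := (isComp_comp A' B').exists_split
  obtain ⟨J, J0, J1⟩ := h
  obtain ⟨l, l0, l1⟩ := hB
  let u : PIso (A.comp B).A (A'.comp B').A {z | z.2 ∈ Icc (1 / 2) 1} :=
    (k.trans ((l.comap (.id T) (lin T (-1) 2)).mono fun z hz => by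
      obtain ⟨h1, h2⟩ := hz
      refine ⟨?_, ?_⟩ <;> simp <;> linarith)).trans k'.symm
  have hG : ∀ (z : T × ℝ) (hz : z.2 = 1 / 2) (hS : z ∈ {z : T × ℝ | z.2 ∈ Icc 0 1}),
      J.J z hS ≫ G'.h z hz = G.h z hz := by
    rintro ⟨t, s⟩ hz hS
    have h1 : J.J (t, 1) (by simp) = u.J (t, 1) (by norm_num) := by
      rw [← cancel_mono ((A'.comp B').en.h (t, 1) rfl), J1 (t, 1) rfl]
      exact (comp_inv_comp (k1 (t, 1) rfl) (k1' (t, 1) rfl) (l1 (t, lin T (-1) 2 (t, 1)) (by simp; norm_num))).symm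
    exact (congrArg (· ≫ G'.h (t, s) hz) (J.eq_of_eq u isPreconnected_Icc (fun s hs => ⟨le_trans (by norm_num) hs.1, hs.2⟩) (fun s hs => hs) (by norm_num) (by rw [show s = 1 / 2 from hz]; norm_num) h1)).trans (comp_inv_comp (k0 (t, s) hz) (k0' (t, s) hz)
      (l0 (t, lin T (-1) 2 (t, s)) (by simp [show s = 1 / 2 from hz])))
  refine hA.symm.trans ((sub_iso J (fun z hz => ?_) (fun z hz _ => J0 z hz) hG _ _).trans hA')
  obtain ⟨h1, h2⟩ := hz
  refine ⟨?_, ?_⟩ <;> simp <;> linarith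

/-- A family whose members end with the members of a family `Q` is a concatenation with `Q`. -/
lemma exists_iso_comp (A : Arc a d) (Q : Arc b d)
    (h : ∀ t, ∃ P0 : Arc (a.comp (.const Unit t)) (b.comp (.const Unit t)),
      (A.comap (.const Unit t)).Iso (P0.comp (Q.comap (.const Unit t)))) :
    ∃ P : Arc a b, A.Iso (P.comp Q) := by
  choose P0 hP using h
  choose j k h0 hm h1 using fun t => (isComp_comp (P0 t) (Q.comap (.const Unit t))).of_iso (hP t)
  let e (t : T) (S) : PIso ((Q.A.comap (.const Unit t) (Pth.sndMap Unit)).comap (.id Unit) (lin Unit (-1) 2))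
      ((Q.A.comap (.id T) (lin T (-1) 2)).at' t) S :=
    (PIso.ofComap Q.A (.const Unit t) (Pth.sndMap Unit) (.id Unit) (lin Unit (-1) 2) (.const Unit t)
      (lin Unit (-1) 2) S fun _ _ => rfl).trans
    (PIso.ofComap Q.A (.id T) (lin T (-1) 2) (.const Unit t) (Pth.sndMap Unit) (.const Unit t)
      (lin Unit (-1) 2) S fun _ _ => rfl).symm
  let J : ∀ z ∈ {z : T × ℝ | z.2 ∈ Icc (1 / 2) 1}, A.A.r z ⟶ (Q.A.comap (.id T) (lin T (-1) 2)).r z :=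
    fun z hz => ((k z.1).trans (e z.1 _)).J ((), z.2) hz
  let F : Frame (Q.A.comap (.id T) (lin T (-1) 2)) (fun _ => 1) d :=
    Q.en.re (lin T (-1) 2) fun z hz => by simp [hz]; norm_num
  have hJ : ∀ (z : T × ℝ) (hz : z.2 = 1), J z (by simp [hz]; norm_num) ≫ F.h z hz = A.en.h z hz :=
    fun z hz => (comp_eqToHom_comp _ rfl rfl _).trans (h1 z.1 ((), z.2) hz)
  let K : PIso A.A (Q.A.comap (.id T) (lin T (-1) 2)) {z | z.2 ∈ Icc (1 / 2) 1} := ⟨J, by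
    refine PIso.smooth_of_flat ordConnected_Icc J (fun t => ⟨(k t).trans (e t _), fun s hs => rfl⟩)
      (s0 := 1) (by norm_num) fun b hb => ?_
    refine Pth.isSec_of_local fun z hz => ⟨_, _, A.en.sec, hz.2, Eventually.of_forall fun _ h => h.2, ?_⟩
    obtain ⟨G, hG, hE⟩ := (Pth.isSec_atlas hb).smoothAt F.sec hz.1.2 hz.2
    refine ⟨G, hG, hE.mono fun z' h h1 h2 => ?_⟩
    rw [← h h1.1.2 h2]
    congr 1
    simp only [Sec.trans, Sec.restrict, Sec.pull]
    rw [IsIso.inv_comp_eq, ← hJ z' h2]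
    simp⟩
  let G : Frame A.A (fun _ => 1 / 2) b :=
    (Q.st.re (lin T (-1) 2) fun z hz => by simp [hz]).pull K
      fun z hz => by simp [hz]; norm_num
  have hQ : (sub A.A (lin T (1 / 2) (1 / 2)) G A.en (by simp) (by simp; norm_num)).Iso Q :=
    ((sub_iso K (fun z hz => by
        obtain ⟨h1, h2⟩ := hz
        refine ⟨?_, ?_⟩ <;> simp <;> linarith) (fun _ _ _ => rfl) (fun z hz _ => hJ z hz) _ _).trans
      (sub_sub _ _ (fun z hz => by simp; ring) _ _ (by simp) (by simp))).trans
      (sub_self Q _ _)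
  refine ⟨sub A.A (lin T 0 (1 / 2)) A.st G (by simp) (by simp), (sub_self A (by simp) (by simp)).symm.trans
    ((isComp_sub (fun z hz => by simp) (fun z hz => by simp; ring) _ _ _ _ _ _).iso (isComp_comp _ Q)
      (Iso.refl _) hQ)⟩

lemma eq_id_of_post_iso {A : Arc a b} {ζ : ∀ t, (⟨c', b t⟩ : X.Obj) ⟶ ⟨c', b t⟩} {hζ}
    (h : (A.post ζ hζ).Iso A) (t : T) : ζ t = 𝟙 _ := by
  obtain ⟨j, j0, j1⟩ := h
  have h1 := j.eq_of_eq (PIso.refl A.A univ) isPreconnected_Icc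
    (fun s hs => hs) (fun s hs => trivial) (s' := 1) (by simp) (by simp) ((cancel_mono (A.st.h (t, 0) rfl)).1 ((j0 (t, 0) rfl).trans (Category.id_comp _).symm))
  exact (cancel_epi _).1 ((j1 (t, 1) rfl).symm.trans ((congrArg (· ≫ A.en.h (t, 1) rfl) h1).trans ((Category.id_comp _).trans (Category.comp_id _).symm)))

end Orbispace.Arc

namespace BasedSystem

/-- The based loops that run along `P` and back along the image of `B`. -/
def backLoop (B : σ.YArc v) (P : σ.RArc v) : LArc p T := Arc.comp P (Arc.rev (YArc.image B))

lemma backLoop_iso {B B' : σ.YArc v} {P P' : σ.RArc v} (hB : B.Iso B') (hP : P.Iso P') :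
    (backLoop B P).Iso (backLoop B' P') := hP.comp (YArc.image_iso hB).rev

lemma backLoop_comap (B : σ.YArc v) (P : σ.RArc v) (g : C(T', T)) :
    Arc.Iso (LArc.comap (backLoop B P) g) (backLoop (σ := σ) (v := v.comp g) (Arc.comap B g) (RArc.comap P g)) :=
  (Arc.comp_comap _ _ g).trans ((Arc.Iso.refl _).comp ((Arc.rev_comap _ g).trans (YArc.image_comap B g).rev))

lemma backLoop_post (B : σ.YArc v) (P : σ.RArc v) (ζ : ∀ t, (⟨σ.V α, v t⟩ : Y.Obj) ⟶ ⟨σ.V α', v' t⟩)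
    (hζ : Continuous (Y := Y.Tran (σ.V α) (σ.V α')) fun t => (ζ t).tr) :
    (backLoop (YArc.post B ζ hζ) (RArc.postMor P ζ hζ)).Iso (backLoop B P) :=
  ((Arc.Iso.refl _).comp (YArc.image_post B ζ hζ).rev).trans
    ((Arc.isComp_comp P (Arc.rev (YArc.image B))).post_rev (b' := (σ.f α').comp v')
      (fun t => σ.mor (ζ t)) ((σ.continuous_ρ _ _).comp hζ)).iso_comp.symm

variable (σ) in
/-- The space of pairs of a path of `Y` and a based relative loop with the same end. Such a pair is
determined by the path of `Y` and by the loop that runs along the relative loop and back along the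
path. -/
def Pullback : Type (max u v) := {x : (identity q).RelLoop × Loop p //
  ∃ (α : σ.Λ) (v : C(Unit, Y.C (σ.V α))) (B : σ.YArc v) (P : σ.RArc v),
    YArc.cls B () = x.1 ∧ LArc.cls (backLoop B P) () = x.2}

instance : TopologicalSpace σ.Pullback := inferInstanceAs (TopologicalSpace (Subtype _))

namespace Pullback

/-- The path of `Y`. -/
def path (x : σ.Pullback) : (identity q).RelLoop := x.1.1

/-- The loop of `X`. -/
def loop (x : σ.Pullback) : Loop p := x.1.2

lemma continuous_path : Continuous (path (σ := σ)) := continuous_fst.comp continuous_subtype_val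

lemma continuous_loop : Continuous (loop (σ := σ)) := continuous_snd.comp continuous_subtype_val

/-- The pairs given by a family of paths of `Y` and a family of based relative loops. -/
def of (B : σ.YArc v) (P : σ.RArc v) (t : T) : σ.Pullback :=
  ⟨(YArc.cls B t, LArc.cls (backLoop B P) t), α, _, Arc.comap B (.const Unit t),
    RArc.comap P (.const Unit t), YArc.cls_comap B (.const Unit t) (),
    (LArc.cls_of_iso (backLoop_comap B P (.const Unit t)).symm ()).trans
      (LArc.cls_comap (backLoop B P) (.const Unit t) ())⟩

lemma ext {x y : σ.Pullback} (h : x.path = y.path) (h' : x.loop = y.loop) : x = y := Subtype.ext (Prod.ext h h')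

lemma continuous_of (B : σ.YArc v) (P : σ.RArc v) : Continuous (of B P) :=
  ((YArc.continuous_cls B).prodMk (LArc.continuous_cls (backLoop B P))).subtype_mk _

lemma of_iso {B B' : σ.YArc v} {P P' : σ.RArc v} (hB : B.Iso B') (hP : P.Iso P') (t : T) :
    of B P t = of B' P' t := ext (YArc.cls_of_iso hB t) (LArc.cls_of_iso (backLoop_iso hB hP) t)

lemma of_comap (B : σ.YArc v) (P : σ.RArc v) (g : C(T', T)) (t : T') :
    of (σ := σ) (v := v.comp g) (Arc.comap B g) (RArc.comap P g) t = of B P (g t) :=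
  ext (YArc.cls_comap B g t) ((LArc.cls_of_iso (backLoop_comap B P g) t).symm.trans
    (LArc.cls_comap (backLoop B P) g t))

lemma of_post (B : σ.YArc v) (P : σ.RArc v) (ζ : ∀ t, (⟨σ.V α, v t⟩ : Y.Obj) ⟶ ⟨σ.V α', v' t⟩)
    (hζ : Continuous (Y := Y.Tran (σ.V α) (σ.V α')) fun t => (ζ t).tr) (t : T) :
    of (YArc.post B ζ hζ) (RArc.postMor P ζ hζ) t = of B P t :=
  ext (YArc.cls_post B ζ hζ t) (LArc.cls_of_iso (backLoop_post B P ζ hζ) t)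

lemma exists_post_iso {B : σ.YArc v} {P : σ.RArc v} {B' : σ.YArc v'} {P' : σ.RArc v'}
    (h : ∀ t, of B P t = of B' P' t) :
    ∃ (ζ : ∀ t, (⟨σ.V α, v t⟩ : Y.Obj) ⟶ ⟨σ.V α', v' t⟩) (hζ : _),
      (YArc.post B ζ hζ).Iso B' ∧ (RArc.postMor P ζ hζ).Iso P' := by
  obtain ⟨ζ, hζ, hi⟩ := YArc.exists_post_iso B B' fun t => congrArg path (h t)
  exact ⟨ζ, hζ, hi, Arc.iso_of_comp_iso ((backLoop_post B P ζ hζ).trans (LArc.iso_of_cls_eq fun t => congrArg loop (h t))) (YArc.image_iso hi).rev⟩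

lemma exists_of_eq (x : σ.Pullback) : ∃ (α : σ.Λ) (v : C(Unit, Y.C (σ.V α))) (B : σ.YArc v)
    (P : σ.RArc v), of B P () = x := by
  obtain ⟨α, v, B, P, h1, h2⟩ := x.2
  exact ⟨α, v, B, P, ext h1 h2⟩

/-- The relative loop of a pair. -/
def proj (x : σ.Pullback) : σ.RelLoop := RArc.cls (exists_of_eq x).choose_spec.choose_spec.choose_spec.choose ()

lemma proj_of (B : σ.YArc v) (P : σ.RArc v) (t : T) : proj (of B P t) = RArc.cls P t := by
  obtain ⟨ζ, hζ, -, hi⟩ := exists_post_iso fun _ => ((exists_of_eq (of B P t)).choose_spec.choose_spec.choose_spec.choose_spec).trans (of_comap B P (.const Unit t) ()).symm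
  exact ((RArc.cls_postMor _ ζ hζ ()).symm.trans (RArc.cls_of_iso hi ())).trans (RArc.cls_comap P (.const Unit t) ())

lemma exists_local {Φ : T → σ.Pullback} (hΦ : Continuous Φ) (t0 : T) :
    ∃ M : Set T, IsOpen M ∧ t0 ∈ M ∧ ∃ (α : σ.Λ) (v : C(M, Y.C (σ.V α))) (B : σ.YArc v) (P : σ.RArc v),
      ∀ t : M, of B P t = Φ t := by
  obtain ⟨M, hM, ht, α, v, B, hB⟩ := YArc.exists_local (σ := σ) (continuous_path.comp hΦ) t0
  obtain ⟨M', hM', ht', A, hA⟩ := LArc.exists_local (continuous_loop.comp hΦ) t0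
  let g : C((M ∩ M' : Set T), M) := ⟨fun t => ⟨t, t.2.1⟩, by fun_prop⟩
  let g' : C((M ∩ M' : Set T), M') := ⟨fun t => ⟨t, t.2.2⟩, by fun_prop⟩
  refine ⟨M ∩ M', hM.inter hM', ⟨ht, ht'⟩, α, v.comp g, Arc.comap B g, ?_⟩
  have hB' : ∀ t, YArc.cls (Arc.comap B g) t = (Φ t).path := fun t =>
    (YArc.cls_comap B g t).trans (hB (g t))
  have hA' : ∀ t, LArc.cls (LArc.comap A g') t = (Φ t).loop := fun t => (LArc.cls_comap A g' t).trans (hA (g' t))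
  generalize Arc.comap B g = B1 at hB' ⊢
  generalize LArc.comap A g' = A1 at hA'
  obtain ⟨P, hP⟩ := Arc.exists_iso_comp A1 (Arc.rev (YArc.image B1)) fun t => by
    obtain ⟨β, w, B0, P0, h⟩ := exists_of_eq (Φ t)
    obtain ⟨ζ, hζ, hi⟩ := YArc.exists_post_iso B0 (Arc.comap B1 (.const Unit t)) fun _ =>
      (congrArg path h).trans ((hB' t).symm.trans (YArc.cls_comap B1 (.const Unit t) ()).symm)
    refine ⟨RArc.postMor P0 ζ hζ, Arc.Iso.trans (LArc.iso_of_cls_eq (A := LArc.comap A1 (.const Unit t))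
      (A' := backLoop (YArc.post B0 ζ hζ) (RArc.postMor P0 ζ hζ)) fun _ => ?_)
      ((Arc.Iso.refl _).comp (((YArc.image_iso hi).trans (YArc.image_comap B1 _).symm).rev.trans
        (Arc.rev_comap _ _).symm))⟩
    rw [LArc.cls_comap, LArc.cls_of_iso (backLoop_post B0 P0 ζ hζ)]
    exact (hA' t).trans (congrArg loop h).symm
  exact ⟨P, fun t => ext (hB' t) ((LArc.cls_of_iso hP.symm t).trans (hA' t))⟩

lemma continuous_proj : Continuous (proj (σ := σ)) := continuous_of_local fun x => by
  obtain ⟨M, hM, ht, α, v, B, P, h⟩ := exists_local continuous_id x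
  refine ⟨M, hM, ht, (RArc.continuous_cls P).congr fun t => ?_⟩
  rw [← proj_of B P, h]; rfl

lemma exists_local_of_proj (hσ : ∀ α, IsEmbedding (σ.groupHom α)) {Φ : T → σ.Pullback}
    (hΦ : Continuous Φ) (P : σ.RArc v) (hP : ∀ t, RArc.cls P t = (Φ t).proj) (t0 : T) :
    ∃ M : Set T, IsOpen M ∧ t0 ∈ M ∧ ∃ B : σ.YArc (v.comp (⟨Subtype.val, by fun_prop⟩ : C(M, T))),
      ∀ t : M, of B (RArc.comap P ⟨Subtype.val, by fun_prop⟩) t = Φ t := by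
  obtain ⟨M, hM, ht, β, w, B, P', h⟩ := exists_local hΦ t0
  obtain ⟨ζ, hζ, hi⟩ := RArc.exists_postMor_iso hσ P' (RArc.comap P (⟨Subtype.val, by fun_prop⟩ : C(M, T)))
    fun t => by rw [← proj_of B P', h, RArc.cls_comap, hP]; rfl
  exact ⟨M, hM, ht, YArc.post B ζ hζ, fun t => (of_iso (Arc.Iso.refl _) hi.symm t).trans
    ((of_post B P' ζ hζ t).trans (h t))⟩

lemma iso_of_of_eq (hσ : ∀ α, IsEmbedding (σ.groupHom α)) {B B' : σ.YArc v} {P : σ.RArc v}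
    (h : ∀ t, of B P t = of B' P t) : B.Iso B' := by
  obtain ⟨ζ, hζ, hB, hP⟩ := exists_post_iso h
  have hid : ∀ t, ζ t = 𝟙 _ := fun t => by
    obtain ⟨g, hg⟩ := (Y.aut (σ.V α)).surjective (ζ t).tr
    have h2 : σ.groupHom α g = 1 := by
      apply (X.aut (σ.W α)).injective
      rw [aut_groupHom, hg, X.aut_one]
      exact congrArg (fun m => Mor.tr m) (Arc.eq_id_of_post_iso hP t)
    refine hom_ext (hg.symm.trans ?_)
    rw [(hσ α).injective (h2.trans (_root_.map_one _).symm), Y.aut_one]; rfl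
  have e : B.Iso (YArc.post B ζ hζ) := ⟨PIso.refl _ _, fun _ _ => Category.id_comp _, fun z hz =>
    (Category.id_comp _).trans ((congrArg (B.en.h z hz ≫ ·) (hid z.1)).trans (Category.comp_id _))⟩
  exact e.trans hB

end Pullback

end BasedSystem

namespace Orbispace.Arc

variable {c1 : X.ι} {b' : C(T, X.C c1)}

section

variable {x y y' z t : X.Obj}

lemma eq_of_comp_eq {j k : x ⟶ y} {m : y ⟶ t} {n : x ⟶ t} (h : j ≫ m = n) (h' : k ≫ m = n) : j = k :=
  (cancel_mono m).1 (h.trans h'.symm)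

lemma comp_comp_inv {e : x ⟶ y} {k : y ⟶ z} {i : y' ⟶ z} {a : y' ⟶ t} {a' : z ⟶ t} {b : x ⟶ t}
    {b' : y ⟶ t} (hi : i ≫ a' = a) (hk : k ≫ a' = b') (he : e ≫ b' = b) :
    ((e ≫ k) ≫ inv i) ≫ a = b := by
  rw [← hi, ← he, ← hk]; simp

lemma comp_comp_of_eq_inv {e : x ⟶ y} {k : y ⟶ z} {i : y' ⟶ z} {k0 : x ⟶ y'} {m : y' ⟶ t} {m' : z ⟶ t}
    (hk : k0 = (e ≫ k) ≫ inv i) (hi : i ≫ m' = m) : e ≫ k ≫ m' = k0 ≫ m := by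
  rw [hk, ← hi]; simp

lemma inv_comp_comp_eq {e : x ⟶ y} {k : x ⟶ z} {m : z ⟶ t} {b : y ⟶ t} {b' : x ⟶ t} (he : e ≫ b = b')
    (hk : k ≫ m = b') : (inv e ≫ k) ≫ m = b := by
  rw [Category.assoc, hk, ← he]; simp

lemma comp_comp_of_eq_inv_comp {e : x ⟶ y} {k : x ⟶ z} {k0 : y ⟶ z} {m : z ⟶ t} (hk : k0 = inv e ≫ k) :
    e ≫ k0 ≫ m = k ≫ m := by rw [hk]; simp

lemma comp_eq_comp_comp {k k' : x ⟶ y} {m : y ⟶ z} {n : z ⟶ t} {m' : y ⟶ t} (hk : k = k')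
    (hm : m' = m ≫ n) : k ≫ m' = (k' ≫ m) ≫ n := by rw [hk, hm]; simp

end

/-- The second half of a concatenation. -/
def compSnd (A : Arc a b) (Q : Arc b d) :
    PIso (A.comp Q).A (Q.A.comap (.id T) (lin T (-1) 2)) {z | z.2 ∈ Icc (1 / 2 : ℝ) 1} :=
  (isComp_comp A Q).exists_split.choose_spec.choose

lemma compSnd_one (A : Arc a b) (Q : Arc b d) (z : T × ℝ) (hz : z.2 = 1) :
    (compSnd A Q).J z (by simp [hz]; norm_num) ≫
      Q.en.h (z.1, lin T (-1) 2 z) (by simp [hz]; norm_num) = (A.comp Q).en.h z hz :=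
  (isComp_comp A Q).exists_split.choose_spec.choose_spec.choose_spec.2.2.2.1 z hz

lemma compSnd_unique {A : Arc a b} {Q : Arc b d}
    (k : PIso (A.comp Q).A (Q.A.comap (.id T) (lin T (-1) 2)) {z | z.2 ∈ Icc (1 / 2 : ℝ) 1})
    (hk : ∀ (z : T × ℝ) (hz : z.2 = 1), k.J z (by simp [hz]; norm_num) ≫
      Q.en.h (z.1, lin T (-1) 2 z) (by simp [hz]; norm_num) = (A.comp Q).en.h z hz)
    (z : T × ℝ) (hz : z.2 ∈ Icc (1 / 2 : ℝ) 1) : (compSnd A Q).J z hz = k.J z hz :=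
  (compSnd A Q).eq_of_eq k isPreconnected_Icc (fun _ h => h)
    (fun _ h => h) (by norm_num) hz
    (eq_of_comp_eq (compSnd_one A Q (z.1, 1) rfl) (hk (z.1, 1) rfl))

variable {l : C(T, ℝ)}

/-- The reparametrization onto the first part of a concatenation. -/
def extMap (l : C(T, ℝ)) : C(T × ℝ, ℝ) := ⟨fun z => (1 + l z.1) / 2 * z.2, by fun_prop⟩

@[simp] lemma extMap_apply (z : T × ℝ) : extMap l z = (1 + l z.1) / 2 * z.2 := rfl

/-- The frame of a concatenation at a time of the second half. -/
def extFrame (A : Arc a b) (Q : Arc b d) (hl : ∀ t, l t ∈ Icc (0 : ℝ) 1)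
    (F : Frame Q.A l b') : Frame (A.comp Q).A (fun t => (1 + l t) / 2) b' :=
  (F.re (lin T (-1) 2) (x' := fun t => (1 + l t) / 2) fun z hz => by simp [hz]; ring).pull (compSnd A Q)
    fun z hz => by
      obtain ⟨h1, h2⟩ := hl z.1
      rw [mem_ofPred_eq, hz]
      exact ⟨by linarith, by linarith⟩

/-- The concatenation of `A` and of the part of `Q` until the time `l`. -/
def ext (A : Arc a b) (Q : Arc b d) (hl : ∀ t, l t ∈ Icc (0 : ℝ) 1) (F : Frame Q.A l b') :
    Arc a b' :=
  sub (A.comp Q).A (extMap l) (A.comp Q).st (extFrame A Q hl F) (by simp) (by simp)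

lemma extMap_mem (hl : ∀ t, l t ∈ Icc (0 : ℝ) 1) (z : T × ℝ) (hz : z.2 ∈ Icc (0 : ℝ) 1) :
    extMap l z ∈ Icc (0 : ℝ) 1 := by
  obtain ⟨h1, h2⟩ := hl z.1
  obtain ⟨h3, h4⟩ := hz
  simp only [extMap_apply]
  exact ⟨by positivity, by nlinarith⟩

lemma ext_iso {A A' : Arc a b} {Q Q' : Arc b d} (hl : ∀ t, l t ∈ Icc (0 : ℝ) 1) {F : Frame Q.A l b'}
    {F' : Frame Q'.A l b'} (hA : A.Iso A') (i : PIso Q.A Q'.A {z | z.2 ∈ Icc (0 : ℝ) 1})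
    (i0 : ∀ (z : T × ℝ) (hz : z.2 = 0), i.J z (by simp [hz]) ≫ Q'.st.h z hz = Q.st.h z hz)
    (i1 : ∀ (z : T × ℝ) (hz : z.2 = 1), i.J z (by simp [hz]) ≫ Q'.en.h z hz = Q.en.h z hz)
    (hF : ∀ (z : T × ℝ) (hz : z.2 = l z.1), i.J z (by rw [mem_ofPred_eq, hz]; exact hl _) ≫ F'.h z hz = F.h z hz) :
    (ext A Q hl F).Iso (ext A' Q' hl F') := by
  obtain ⟨e, e0, e1⟩ := hA.comp ⟨i, i0, i1⟩
  let k : PIso (A.comp Q).A (Q.A.comap (.id T) (lin T (-1) 2)) {z | z.2 ∈ Icc (1 / 2) 1} :=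
    ((e.mono fun z hz => ⟨le_trans (by norm_num) hz.1, hz.2⟩).trans (compSnd A' Q')).trans
      ((i.comap (.id T) (lin T (-1) 2)).mono fun z hz => by
        obtain ⟨h1, h2⟩ := hz
        refine ⟨?_, ?_⟩ <;> simp <;> linarith).symm
  have hk := compSnd_unique k fun z hz =>
    comp_comp_inv (i1 (z.1, lin T (-1) 2 z) (by simp [hz]; norm_num)) (compSnd_one A' Q' z hz) (e1 z hz)
  refine sub_iso e (fun z hz => extMap_mem hl z hz) (fun z hz _ => e0 z hz) (fun z hz hS => ?_) _ _
  exact comp_comp_of_eq_inv (hk z _) (hF (z.1, lin T (-1) 2 z) (by simp [hz]; ring))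

lemma ext_comap (A : Arc a b) (Q : Arc b d) (hl : ∀ t, l t ∈ Icc (0 : ℝ) 1) (F : Frame Q.A l b')
    (g : C(T', T)) : ((ext A Q hl F).comap g).Iso (ext (l := l.comp g) (A.comap g) (Q.comap g)
      (fun t => hl (g t)) (F.comap g (Pth.sndMap T') (x' := l.comp g) fun _ h => h)) := by
  refine (sub_comap _ _ g (extMap (l.comp g)) (fun _ _ => rfl) (by simp) (by simp)).trans ?_
  obtain ⟨e, e0, e1⟩ := comp_comap A Q g
  let k : PIso ((A.comp Q).A.comap g (Pth.sndMap T')) ((Q.comap g).A.comap (.id T') (lin T' (-1) 2))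
      {z | z.2 ∈ Icc (1 / 2) 1} :=
    ((compSnd A Q).comap g (Pth.sndMap T')).trans
      ((PIso.ofComap Q.A (.id T) (lin T (-1) 2) g (Pth.sndMap T') g (lin T' (-1) 2) _ fun _ _ => rfl).trans
      (PIso.ofComap Q.A g (Pth.sndMap T') (.id T') (lin T' (-1) 2) g (lin T' (-1) 2) _ fun _ _ => rfl).symm)
  refine sub_iso e (fun z hz => extMap_mem (fun t => hl (g t)) z hz) (fun z hz _ => e0 z hz)
    (fun z hz hS => ?_) _ _
  exact (comp_comp_of_eq_inv_comp ((compSnd_unique ((e.mono fun z hz => ⟨le_trans (by norm_num) hz.1, hz.2⟩).symm.trans k) fun z hz => inv_comp_comp_eq (e1 z hz) ((comp_eqToHom_comp _ rfl rfl _).trans (compSnd_one A Q (g z.1, z.2) hz))) z _)).trans (comp_eqToHom_comp _ rfl rfl _)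

lemma post_id_iso (A : Arc a b) (h) : (A.post (fun _ => 𝟙 _) h).Iso A :=
  ⟨PIso.refl _ _, fun _ _ => Category.id_comp _,
    fun _ _ => (Category.id_comp _).trans (Category.comp_id _).symm⟩

/-- Extension by a part of length zero. -/
lemma ext_zero (A : Arc a b) (Q : Arc b d) (hl : ∀ t, l t ∈ Icc (0 : ℝ) 1) (h0 : ∀ t, l t = 0)
    (F : Frame Q.A l b') (ζ : ∀ t, (⟨c1, b' t⟩ : X.Obj) ⟶ ⟨c', b t⟩) (hζ)
    (hF : ∀ (z : T × ℝ) (hz : z.2 = l z.1) (hz' : z.2 = 0), F.h z hz ≫ ζ z.1 = Q.st.h z hz') :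
    ((ext A Q hl F).post ζ hζ).Iso A := by
  obtain ⟨-, k, G, -, -, k0, k1, hA, -⟩ := (isComp_comp A Q).exists_split
  refine Iso.trans (?_ : Iso _ (sub _ _ _ _ _ _)) hA
  refine ⟨PIso.ofEq (A.comp Q).A (.id T) (.id T) (extMap l) (lin T 0 (1 / 2)) _ fun z _ => ?_,
    fun z hz => ?_, fun z hz => ?_⟩
  · simp [h0]
  · exact (A.comp Q).st.eqToHom_comp (by simp [h0]) _ _
  · have h2 : extMap l z = 1 / 2 := by simp [h0, hz]
    refine (G.eqToHom_comp (s' := lin T 0 (1 / 2) z) (by simp [h0]) h2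
      (by simp [h0, hz])).trans ?_
    refine Eq.trans (k0 (z.1, extMap l z) h2).symm ?_
    refine comp_eq_comp_comp ((compSnd_unique k k1) (z.1, extMap l z) (by simp [h0, hz]; norm_num)).symm
      (hF (z.1, lin T (-1) 2 (z.1, extMap l z)) (by simp [h0, hz]) (by simp [h0, hz])).symm

end Orbispace.Arc

namespace BasedSystem

variable {S : Type*} [TopologicalSpace S]

/-- Local continuous choices of uniquely determined values fit together. -/
lemma exists_continuous_of_local {Z : Type*} [TopologicalSpace Z] (R : T → Z → Prop)
    (hu : ∀ t x y, R t x → R t y → x = y) (h : ∀ t0, ∃ M : Set T, IsOpen M ∧ t0 ∈ M ∧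
      ∃ f : M → Z, Continuous f ∧ ∀ t : M, R t (f t)) : ∃ f : T → Z, Continuous f ∧ ∀ t, R t (f t) := by
  have h1 : ∀ t, ∃ x, R t x := fun t => by
    obtain ⟨M, -, ht, f, -, hf⟩ := h t
    exact ⟨_, hf ⟨t, ht⟩⟩
  choose f hf using h1
  refine ⟨f, continuous_of_local fun t => ?_, hf⟩
  obtain ⟨M, hM, ht, f', hc, hf'⟩ := h t
  exact ⟨M, hM, ht, hc.congr fun t => hu t _ _ (hf' t) (hf t)⟩

namespace YArc

variable {v : C(S, Y.C (σ.V α))}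

/-- The prolongation of a family of paths of `Y` by paths in a chart. -/
def prolong (m : C(T × ℝ, S)) (l : C(T, ℝ)) (hl : ∀ t, l t ∈ Icc (0 : ℝ) 1)
    (B : σ.YArc (v.comp (m.comp ((ContinuousMap.id T).prodMk (.const T 0))))) :
    σ.YArc (v.comp (m.comp ((ContinuousMap.id T).prodMk l))) :=
  Arc.ext (l := l) B (Arc.ofMap (b := v.comp (m.comp ((ContinuousMap.id T).prodMk (.const T 1)))) (v.comp m)
    (fun z hz => by obtain ⟨t, s⟩ := z; obtain rfl : s = 0 := hz; rfl)
    (fun z hz => by obtain ⟨t, s⟩ := z; obtain rfl : s = 1 := hz; rfl)) hl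
    (Frame.ofMap (v.comp m) fun z hz => by obtain ⟨t, s⟩ := z; obtain rfl : s = l t := hz; rfl)

lemma prolong_iso (m : C(T × ℝ, S)) (l : C(T, ℝ)) (hl : ∀ t, l t ∈ Icc (0 : ℝ) 1)
    {B B' : σ.YArc (v.comp (m.comp ((ContinuousMap.id T).prodMk (.const T 0))))} (h : B.Iso B') :
    (prolong m l hl B).Iso (prolong m l hl B') :=
  Arc.ext_iso hl h (PIso.refl _ _) (fun _ _ => Category.id_comp _) (fun _ _ => Category.id_comp _)
    fun _ _ => Category.id_comp _

lemma prolong_comap (m : C(T × ℝ, S)) (l : C(T, ℝ)) (hl : ∀ t, l t ∈ Icc (0 : ℝ) 1)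
    (B : σ.YArc (v.comp (m.comp ((ContinuousMap.id T).prodMk (.const T 0))))) (g : C(T', T)) :
    ((prolong m l hl B).comap g).Iso (prolong (σ := σ) (v := v) (m.comp (g.prodMap (.id ℝ)))
      (l.comp g) (fun t => hl (g t)) (B.comap g)) := by
  refine (Arc.ext_comap _ _ hl _ g).trans (Arc.ext_iso _ (Arc.Iso.refl _) ⟨fun z _ => 𝟙 _, ?_⟩
    (fun z hz => ?_) (fun z hz => ?_) fun z hz => ?_)
  · rintro _ rfl
    exact ((Pth.isSec_atlas (A := Pth.ofMap (v.comp m)) rfl).comap g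
      (Pth.sndMap T')).congr (fun _ _ => trivial) fun z hz =>
        congrArg (fun m => Mor.tr m) (Category.comp_id _)
  all_goals exact Category.id_comp _

lemma prolong_zero (m : C(T × ℝ, S)) (hl)
    (B : σ.YArc (v.comp (m.comp ((ContinuousMap.id T).prodMk (.const T 0))))) :
    (prolong m (.const T 0) hl B).Iso B :=
  (Arc.post_id_iso _ (continuous_const (y := Y.one (σ.V α)))).symm.trans (Arc.ext_zero B _ hl
    (fun _ => rfl) _ (fun _ => 𝟙 _) (continuous_const (y := Y.one (σ.V α)))
    fun _ _ _ => Category.comp_id _)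

end YArc

namespace Pullback

/-- The transport of pairs along paths of relative loops that are given by a family. -/
lemma exists_transport (hσ : ∀ α, IsEmbedding (σ.groupHom α)) {v : C(S, Y.C (σ.V α))} (P : σ.RArc v)
    (m : C(T × ℝ, S)) (l : C(T, ℝ)) (hl : ∀ t, l t ∈ Icc (0 : ℝ) 1) {Φ : T → σ.Pullback}
    (hΦ : Continuous Φ) (hP : ∀ t, RArc.cls P (m (t, 0)) = (Φ t).proj) :
    ∃ Ψ : T → σ.Pullback, Continuous Ψ ∧
      ∀ t, (Ψ t).proj = RArc.cls P (m (t, l t)) ∧ (l t = 0 → Ψ t = Φ t) := by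
  let n (t : T) : C(Unit × ℝ, S) := m.comp ((ContinuousMap.const Unit t).prodMap (.id ℝ))
  have hl' : ∀ t u, (l.comp (.const Unit t)) u ∈ Icc 0 1 := fun t _ => hl t
  let R : T → σ.Pullback → Prop := fun t x =>
    ∃ B : σ.YArc (v.comp ((n t).comp ((ContinuousMap.id Unit).prodMk (.const Unit 0)))),
      of B (RArc.comap P _) () = Φ t ∧ x = of (YArc.prolong (n t) (l.comp (.const Unit t)) (hl' t) B)
        (RArc.comap P _) ()
  obtain ⟨Ψ, hc, hR⟩ := exists_continuous_of_local R (fun t x y => by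
    rintro ⟨B, hB, rfl⟩ ⟨B', hB', rfl⟩
    exact of_iso (YArc.prolong_iso _ _ _ (iso_of_of_eq hσ fun _ => hB.trans hB'.symm)) (Arc.Iso.refl _) ())
    fun t0 => by
      obtain ⟨M, hM, ht, B, hB⟩ := exists_local_of_proj hσ hΦ (RArc.comap P
        (m.comp ((ContinuousMap.id T).prodMk (.const T 0))))
        (fun t => (RArc.cls_comap P _ t).trans (hP t)) t0
      let g : C(M, T) := ⟨Subtype.val, by fun_prop⟩
      let B' : σ.YArc (v.comp ((m.comp (g.prodMap (.id ℝ))).comp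
        ((ContinuousMap.id M).prodMk (.const M 0)))) := B
      refine ⟨M, hM, ht, _, continuous_of (YArc.prolong (m.comp (g.prodMap (.id ℝ))) (l.comp g)
        (fun t => hl (g t)) B') (RArc.comap P _), fun t => ⟨Arc.comap B' (.const Unit t), ?_, ?_⟩⟩
      · exact Eq.trans (of_iso (Arc.Iso.refl _) (((Arc.comap_comap (P.comap (m.comp ((ContinuousMap.id T).prodMk
          (.const T 0)))) g (.const Unit t)).trans (Arc.comap_comap P _ _)).symm) ()) ((of_comap B _ (.const Unit t) ()).trans (hB t))
      · exact (of_comap _ _ (.const Unit t) ()).symm.trans (of_iso (YArc.prolong_comap _ _ _ B' (.const Unit t)) (Arc.comap_comap _ _ _) ())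
  refine ⟨Ψ, hc, fun t => ?_⟩
  obtain ⟨B, hB, h⟩ := hR t
  refine ⟨?_, fun h0 => ?_⟩
  · rw [h, proj_of, RArc.cls_comap]; rfl
  · have h1 : l.comp (.const Unit t) = .const Unit 0 := by ext; exact h0
    rw [h, ← hB]
    generalize hl' t = hl1
    revert hl1
    rw [h1]
    exact fun hl1 => of_iso (YArc.prolong_zero _ hl1 B) (Arc.Iso.refl _) ()

end Pullback

end BasedSystem

local notation "I" => unitInterval

/-- A cube as the product of a face and an interval. -/
def cubeHomeo (n : ℕ) : (Fin n → I) × I ≃ₜ (Fin (n + 1) → I) where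
  toFun z := Fin.cons z.2 z.1
  invFun y := (fun k => y k.succ, y 0)
  left_inv z := by simp
  right_inv y := Fin.cons_self_tail y
  continuous_toFun := by
    refine continuous_pi fun k => ?_
    refine Fin.cases ?_ (fun k => ?_) k
    · simpa using continuous_snd
    · simp only [Fin.cons_succ]; fun_prop
  continuous_invFun := by fun_prop

namespace BasedSystem.Pullback

section

variable {K : Type*} [TopologicalSpace K] {Φ : C(K × I, σ.RelLoop)} {x0 : C(K, σ.Pullback)}

/-- A lift of the homotopy `Φ`, stopped at the time `a`. -/
def LiftsUntil (Φ : C(K × I, σ.RelLoop)) (x0 : C(K, σ.Pullback)) (a : K → ℝ) : Prop :=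
  ∃ x : K × ℝ → σ.Pullback, Continuous x ∧ (∀ k, ∀ s ≤ 0, x (k, s) = x0 k) ∧
    ∀ k s, (x (k, s)).proj = Φ (k, projIcc 0 1 zero_le_one (min s (a k)))

lemma LiftsUntil.step (hσ : ∀ α, IsEmbedding (σ.groupHom α)) {a b : K → ℝ} (h : LiftsUntil Φ x0 a)
    (ha : Continuous a) (hb : Continuous b) (ha0 : ∀ k, 0 ≤ a k) (hab : ∀ k, a k ≤ b k)
    (hb1 : ∀ k, b k ≤ 1) {N C : Set K} (hN : IsOpen N) (hC : IsClosed C) (hCN : C ⊆ N)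
    (habC : ∀ k, k ∉ C → a k = b k) {M : Set (K × I)} {α : σ.Λ} {v : C(M, Y.C (σ.V α))} (P : σ.RArc v)
    (hP : ∀ z : M, RArc.cls P z = Φ z)
    (hM : ∀ k ∈ N, ∀ s, a k ≤ s → s ≤ b k → (k, projIcc 0 1 zero_le_one s) ∈ M) :
    LiftsUntil Φ x0 b := by
  obtain ⟨x, hx, hx0, hxp⟩ := h
  let T : Set (K × ℝ) := {z | z.1 ∈ N}
  let m : C(T × ℝ, M) := ⟨fun z => ⟨(z.1.1.1, projIcc 0 1 zero_le_one
      (min (a z.1.1.1 + max z.2 0) (b z.1.1.1))), hM _ z.1.2 _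
        (le_min (by linarith [le_max_right z.2 0]) (hab _)) (min_le_right _ _)⟩, by
    refine Continuous.subtype_mk ?_ _
    exact (by fun_prop : Continuous fun z : T × ℝ => z.1.1.1).prodMk (continuous_projIcc.comp (by fun_prop))⟩
  let l : C(T, ℝ) := ⟨fun z => max 0 (min (z.1.2 - a z.1.1) (b z.1.1 - a z.1.1)), by fun_prop⟩
  have hl : ∀ z, l z ∈ Icc 0 1 := fun z =>
    ⟨le_max_left _ _, max_le zero_le_one ((min_le_right _ _).trans (by linarith [ha0 z.1.1, hb1 z.1.1]))⟩
  obtain ⟨Ψ, hΨ, hΨ'⟩ := exists_transport hσ P m l hl (Φ := fun z => x (z.1.1, max z.1.2 (a z.1.1)))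
    (by fun_prop) (fun z => by
      rw [hP, hxp, min_eq_right (le_max_right _ _)]
      simp [m, hab])
  classical
  let y : K × ℝ → σ.Pullback := fun z => if h : z ∈ T ∧ a z.1 ≤ z.2 then Ψ ⟨z, h.1⟩ else x z
  have hy1 : ∀ z (hz : z ∈ T), a z.1 ≤ z.2 → y z = Ψ ⟨z, hz⟩ := fun z hz h => dif_pos ⟨hz, h⟩
  have hl0 : ∀ z : T, a z.1.1 = b z.1.1 ∨ z.1.2 ≤ a z.1.1 → l z = 0 := fun z hz =>
    max_eq_left (by
      rcases hz with h | h
      · exact (min_le_right _ _).trans (by linarith)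
      · exact (min_le_left _ _).trans (by linarith))
  have hyx : ∀ z : K × ℝ, a z.1 = b z.1 ∨ z.2 ≤ a z.1 → y z = x z := fun z hz => by
    by_cases h : z ∈ T ∧ a z.1 ≤ z.2
    · rw [hy1 z h.1 h.2, (hΨ' ⟨z, h.1⟩).2 (hl0 ⟨z, h.1⟩ hz), max_eq_left h.2]
    · exact dif_neg h
  refine ⟨y, continuous_of_local fun z => ?_, fun k s hs => ?_, fun k s => ?_⟩
  · by_cases hz : z.1 ∈ C
    · refine ⟨T, (hN.preimage continuous_fst), hCN hz, ?_⟩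
      have : (fun z : T => y z) = fun z => if a z.1.1 ≤ z.1.2 then Ψ z else x z := by
        funext z
        split_ifs with h
        · exact hy1 z z.2 h
        · exact dif_neg fun h' => h h'.2
      rw [this]
      refine Continuous.if_le hΨ (by fun_prop) (by fun_prop) (by fun_prop) fun z hz => ?_
      rw [← hy1 z.1 z.2 hz.le, hyx z.1 (Or.inr hz.ge)]
    · exact ⟨{z | z.1 ∉ C}, hC.isOpen_compl.preimage continuous_fst, hz, (hx.comp continuous_subtype_val).congr fun z => (hyx z.1 (Or.inl (habC _ z.2))).symm⟩
  · rw [hyx (k, s) (Or.inr (hs.trans (ha0 k))), hx0 k s hs]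
  · by_cases h : (k, s) ∈ T ∧ a k ≤ s
    · rw [hy1 _ h.1 h.2, (hΨ' _).1, hP]
      have : min (a k + max (max 0 (min (s - a k) (b k - a k))) 0) (b k) = min s (b k) := by
        rw [max_eq_left (le_max_left 0 _), max_eq_right (le_min (by linarith [h.2]) (by linarith [hab k])),
          ← min_add_add_left]
        simp
      simp only [m, l, ContinuousMap.coe_mk, this]
    · by_cases h' : k ∈ N
      · have hs : s ≤ a k := (not_le.1 fun h'' => h ⟨h', h''⟩).le
        rw [hyx (k, s) (Or.inr hs), hxp, min_eq_left hs, min_eq_left (hs.trans (hab k))]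
      · have e := habC k fun hc => h' (hCN hc)
        rw [hyx (k, s) (Or.inl e), hxp, e]

end

section

variable {K : Type*} [MetricSpace K] [CompactSpace K] {Φ : C(K × I, σ.RelLoop)}
  {x0 : C(K, σ.Pullback)}

/-- Lifting of homotopies over a compact space. -/
lemma exists_lift (hσ : σ.IsPseudoEmbedding) (hl : LocalLift σ (K × I)) (h : ∀ k, (x0 k).proj = Φ (k, 0)) :
    ∃ x : C(K × I, σ.Pullback), (∀ k, x (k, 0) = x0 k) ∧ ∀ z, (x z).proj = Φ z := by
  choose M hM hzM α v P hP using RArc.exists_local hσ.isEmbedding hl Φ.continuous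
  obtain ⟨δ, hδ, hball⟩ := lebesgue_number_lemma_of_metric isCompact_univ hM fun z _ => mem_iUnion.2 ⟨z, hzM z⟩
  obtain ⟨n, hn⟩ := exists_nat_one_div_lt hδ
  have hn0 : (0 : ℝ) < n + 1 := by positivity
  have key : ∀ i : ℕ, i ≤ n + 1 → LiftsUntil Φ x0 fun _ => i / (n + 1 : ℝ) := by
    intro i
    induction i with
    | zero =>
      intro _
      refine ⟨fun z => x0 z.1, by fun_prop, fun _ _ _ => rfl, fun k s => ?_⟩
      rw [h, projIcc_of_le_left _ (min_le_of_right_le (by simp))]; rfl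
    | succ i ih =>
      intro hi
      set c : ℝ := i / (n + 1 : ℝ) with hc
      set c' : ℝ := (i + 1 : ℕ) / (n + 1 : ℝ) with hc'
      have hc0 : 0 ≤ c := by positivity
      have hcc : c' = c + 1 / (n + 1 : ℝ) := by rw [hc, hc']; push_cast; ring
      have hc1 : c' ≤ 1 := by rw [hc', div_le_one hn0]; exact_mod_cast hi
      have hcc' : c ≤ c' := by rw [hcc]; linarith [one_div_pos.2 hn0]
      have main : ∀ a : K → ℝ, Continuous a → (∀ k, c ≤ a k ∧ a k ≤ c') → LiftsUntil Φ x0 a →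
          ∃ b : K → ℝ, Continuous b ∧ (∀ k, a k ≤ b k ∧ b k ≤ c') ∧ LiftsUntil Φ x0 b ∧
            ∀ k ∈ (univ : Set K), b k = c' := by
        refine isCompact_univ.induction_on ?_ ?_ ?_ ?_
        · exact fun a ha hac hL => ⟨a, ha, fun k => ⟨le_rfl, (hac k).2⟩, hL, fun _ h => h.elim⟩
        · intro S S' hS H a ha hac hL
          obtain ⟨b, h1, h2, h3, h4⟩ := H a ha hac hL
          exact ⟨b, h1, h2, h3, fun k hk => h4 k (hS hk)⟩
        · intro S S' H H' a ha hac hL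
          obtain ⟨b, h1, h2, h3, h4⟩ := H a ha hac hL
          obtain ⟨b', h1', h2', h3', h4'⟩ := H' b h1 (fun k => ⟨(hac k).1.trans (h2 k).1, (h2 k).2⟩) h3
          refine ⟨b', h1', fun k => ⟨(h2 k).1.trans (h2' k).1, (h2' k).2⟩, h3', fun k hk => ?_⟩
          rcases hk with hk | hk
          · exact le_antisymm (h2' k).2 ((h4 k hk).ge.trans (h2' k).1)
          · exact h4' k hk
        · intro k0 _
          refine ⟨Metric.closedBall k0 (δ / 4), mem_nhdsWithin_of_mem_nhds
            (Metric.closedBall_mem_nhds _ (by positivity)), fun a ha hac hL => ?_⟩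
          obtain ⟨z, hz⟩ := hball (k0, projIcc 0 1 zero_le_one c) trivial
          let θ : K → ℝ := fun k => max 0 (min 1 (2 - 4 * dist k k0 / δ))
          have hθ1 : ∀ k, θ k ≤ 1 := fun k => max_le zero_le_one (min_le_left _ _)
          have hb1 : ∀ k, max (a k) (c + (c' - c) * θ k) ≤ c' := fun k => max_le (hac k).2 (by nlinarith [hθ1 k])
          refine ⟨fun k => max (a k) (c + (c' - c) * θ k), by fun_prop, fun k => ⟨le_max_left _ _, hb1 k⟩,
            hL.step hσ.isEmbedding_groupHom ha (by fun_prop) (fun k => hc0.trans (hac k).1)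
              (fun k => le_max_left _ _) (fun k => (hb1 k).trans hc1) (N := Metric.ball k0 δ)
              (C := Metric.closedBall k0 (δ / 2)) Metric.isOpen_ball Metric.isClosed_closedBall
              (Metric.closedBall_subset_ball (by linarith)) (fun k hk => ?_) (P z) (hP z)
              (fun k hk s h1 h2 => hz ?_), fun k hk => ?_⟩
          · have h3 : δ / 2 < dist k k0 := not_le.1 hk
            have : θ k = 0 := max_eq_left ((min_le_right _ _).trans (by rw [sub_nonpos, le_div_iff₀ hδ]; linarith))
            rw [this, mul_zero, add_zero, max_eq_left (hac k).1]
          · rw [Metric.mem_ball, Prod.dist_eq, max_lt_iff]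
            refine ⟨hk, ?_⟩
            have h3 : c ≤ s := (hac k).1.trans h1
            have h4 : s ≤ c' := h2.trans (hb1 k)
            rw [Subtype.dist_eq, projIcc_of_mem _ ⟨hc0.trans h3, h4.trans hc1⟩,
              projIcc_of_mem _ ⟨hc0, hcc'.trans hc1⟩, Real.dist_eq, abs_of_nonneg (by simpa using h3)]
            simp only
            linarith
          · have h3 : dist k k0 ≤ δ / 4 := hk
            have : θ k = 1 := by
              have : 1 ≤ 2 - 4 * dist k k0 / δ := by rw [le_sub_comm, div_le_iff₀ hδ]; linarith
              simp only [θ, min_eq_left this]; simp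
            simp only [this]
            rw [mul_one, add_sub_cancel, max_eq_right (hac k).2]
      obtain ⟨b, -, -, hL, hb⟩ := main (fun _ => c) continuous_const (fun _ => ⟨le_rfl, hcc'⟩) (ih (by omega))
      obtain rfl : b = fun _ => c' := funext fun k => hb k trivial
      exact hL
  obtain ⟨x, hx, h0, hp⟩ := key (n + 1) le_rfl
  refine ⟨⟨fun z => x (z.1, z.2), by fun_prop⟩, fun k => h0 k 0 le_rfl, fun z => ?_⟩
  have h1 : ((n + 1 : ℕ) : ℝ) / (n + 1) = 1 := by push_cast; exact div_self hn0.ne'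
  refine (hp z.1 z.2).trans ?_
  rw [h1, min_eq_left z.2.2.2, projIcc_val]

end

lemma exists_lift_cube (hσ : σ.IsPseudoEmbedding) {n : ℕ} {Φ : C((Fin n → I) × I, σ.RelLoop)}
    {x0 : C(Fin n → I, σ.Pullback)} (h : ∀ k, (x0 k).proj = Φ (k, 0)) :
    ∃ x : C((Fin n → I) × I, σ.Pullback), (∀ k, x (k, 0) = x0 k) ∧ ∀ z, (x z).proj = Φ z :=
  exists_lift hσ ((localLift_cube hσ.isWeakFibration (n + 1)).of_homeo (cubeHomeo n)) h

end BasedSystem.Pullback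

/-- The part of the boundary of a cube that does not contain the last face. -/
def openBox (n : ℕ) : Set ((Fin n → I) × I) := {z | z.2 = 0 ∨ z.1 ∈ Cube.boundary (Fin n)}

/-- The gauge of the open box with respect to a point outside of the cube. -/
def boxGauge {n : ℕ} (z : (Fin n → I) × I) : ℝ :=
  max ((2 - z.2) / 2) ‖fun i => 2 * ((z.1 i : ℝ) - 1 / 2)‖

lemma continuous_boxGauge {n : ℕ} : Continuous (boxGauge (n := n)) := by unfold boxGauge; fun_prop

lemma boxGauge_mem {n : ℕ} (z : (Fin n → I) × I) : boxGauge z ∈ Icc (1 / 2 : ℝ) 1 := by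
  refine ⟨le_max_of_le_left (by linarith [z.2.2.2]), max_le (by linarith [z.2.2.1]) ?_⟩
  refine (pi_norm_le_iff_of_nonneg zero_le_one).2 fun i => ?_
  rw [Real.norm_eq_abs, abs_le]
  constructor <;> linarith [(z.1 i).2.1, (z.1 i).2.2]

lemma boxGauge_eq_one {n : ℕ} {z : (Fin n → I) × I} : boxGauge z = 1 ↔ z ∈ openBox n := by
  constructor
  · intro h
    by_contra hz
    simp only [openBox, mem_ofPred_eq, not_or, Cube.boundary, not_exists] at hz
    have h1 : (0 : ℝ) < z.2 := lt_of_le_of_ne z.2.2.1 fun e => hz.1 (Subtype.ext e.symm)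
    have h2 : boxGauge z < 1 := by
      refine max_lt (by linarith) ((pi_norm_lt_iff zero_lt_one).2 fun i => ?_)
      have h3 : (0 : ℝ) < z.1 i := lt_of_le_of_ne (z.1 i).2.1 fun e => (hz.2 i).1 (Subtype.ext e.symm)
      have h4 : (z.1 i : ℝ) < 1 := lt_of_le_of_ne (z.1 i).2.2 fun e => (hz.2 i).2 (Subtype.ext e)
      rw [Real.norm_eq_abs, abs_lt]
      constructor <;> linarith
    exact h2.ne h
  · rintro (h | ⟨i, h⟩)
    · refine le_antisymm (boxGauge_mem z).2 (le_max_of_le_left ?_)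
      rw [h]; norm_num
    · refine le_antisymm (boxGauge_mem z).2 (le_max_of_le_right ?_)
      refine le_trans (le_of_eq ?_) (norm_le_pi_norm (fun i => 2 * ((z.1 i : ℝ) - 1 / 2)) i)
      rw [Real.norm_eq_abs]
      rcases h with h | h <;> rw [h] <;> norm_num

/-- The motion of the points of a cube away from the open box. -/
lemma exists_boxMotion (n : ℕ) : ∃ R : C(((Fin n → I) × I) × I,
    (Fin n → I) × I), (∀ z, R (z, 0) ∈ openBox n) ∧
    (∀ z (t : I), (t : ℝ) = 1 - boxGauge z → R (z, t) = z) := by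
  let ρ : ((Fin n → I) × I) × I → ℝ := fun z =>
    max (boxGauge z.1) (1 - z.2) / boxGauge z.1
  have hpos : ∀ z : (Fin n → I) × I, 0 < boxGauge z := fun z =>
    lt_of_lt_of_le (by norm_num) (boxGauge_mem z).1
  have hρ : Continuous ρ := by
    have := continuous_boxGauge (n := n)
    exact Continuous.div (by fun_prop) (by fun_prop) fun z => (hpos z.1).ne'
  have h1 : ∀ z, 1 ≤ ρ z := fun z => (one_le_div (hpos z.1)).2 (le_max_left _ _)
  have hM : ∀ z, boxGauge z.1 * ρ z ≤ 1 := fun z => by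
    rw [mul_div_cancel₀ _ (hpos z.1).ne']
    exact max_le (boxGauge_mem z.1).2 (by linarith [z.2.2.1])
  have hw : ∀ (z : (Fin n → I) × I) i, |2 * ((z.1 i : ℝ) - 1 / 2)| ≤ boxGauge z :=
    fun z i => le_max_of_le_right (norm_le_pi_norm (fun i => 2 * ((z.1 i : ℝ) - 1 / 2)) i)
  have hs : ∀ z : (Fin n → I) × I, (2 - z.2) / 2 ≤ boxGauge z := fun z => le_max_left _ _
  have hy : ∀ (z : ((Fin n → I) × I) × I) i,
      1 / 2 + ((z.1.1 i : ℝ) - 1 / 2) * ρ z ∈ Icc 0 1 := fun z i => by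
    have h2 := abs_le.1 (hw z.1 i)
    have h3 : 0 ≤ ρ z := zero_le_one.trans (h1 z)
    constructor <;> nlinarith [hM z]
  have ht : ∀ z : ((Fin n → I) × I) × I,
      2 + ((z.1.2 : ℝ) - 2) * ρ z ∈ Icc 0 1 := fun z => by
    have h2 := hs z.1
    have h4 := z.1.2.2.2
    constructor <;> nlinarith [hM z, h1 z]
  refine ⟨⟨fun z => (fun i => ⟨_, hy z i⟩, ⟨_, ht z⟩), by fun_prop⟩, fun z => ?_, fun z t h => ?_⟩
  · rw [← boxGauge_eq_one]
    have h2 : ρ (z, 0) = (boxGauge z)⁻¹ := by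
      simp only [ρ]
      rw [max_eq_right (by simpa using (boxGauge_mem z).2)]; simp
    have h3 : (fun i => 2 * ((1 / 2 + ((z.1 i : ℝ) - 1 / 2) * ρ (z, 0)) - 1 / 2)) =
        (boxGauge z)⁻¹ • fun i => 2 * ((z.1 i : ℝ) - 1 / 2) := by
      funext i; simp only [h2, Pi.smul_apply, smul_eq_mul]; ring
    have h4 : (2 - (2 + ((z.2 : ℝ) - 2) * ρ (z, 0))) / 2 = (boxGauge z)⁻¹ * ((2 - z.2) / 2) := by rw [h2]; ring
    change max ((2 - (2 + ((z.2 : ℝ) - 2) * ρ (z, 0))) / 2)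
      ‖fun i => 2 * ((1 / 2 + ((z.1 i : ℝ) - 1 / 2) * ρ (z, 0)) - 1 / 2)‖ = 1
    rw [h3, h4, norm_smul, Real.norm_of_nonneg (inv_nonneg.2 (hpos z).le),
      ← mul_max_of_nonneg _ _ (inv_nonneg.2 (hpos z).le)]
    exact inv_mul_cancel₀ (hpos z).ne'
  · have h2 : ρ (z, t) = 1 := by
      simp only [ρ, h]
      rw [sub_sub_cancel, max_self, div_self (hpos z).ne']
    refine Prod.ext (funext fun i => Subtype.ext ?_) (Subtype.ext ?_) <;> simp [h2]

/-- A sequence of maps `A → E → B` such that `r` lifts homotopies of cubes and `k` identifies `A` with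
its fibre. -/
structure IsFibreSeq {A E B : Type*} [TopologicalSpace A] [TopologicalSpace E] [TopologicalSpace B]
    (k : C(A, E)) (r : C(E, B)) (a0 : A) : Prop where
  injective : Function.Injective k
  base : ∀ a, r (k a) = r (k a0)
  exists_fibre : ∀ {n : ℕ} (x : C(Fin n → I, E)), (∀ t, r (x t) = r (k a0)) →
    ∃ δ : C(Fin n → I, A), ∀ t, k (δ t) = x t
  exists_lift : ∀ {n : ℕ} (Φ : C((Fin n → I) × I, B)) (x0 : C(Fin n → I, E)),
    (∀ y, r (x0 y) = Φ (y, 0)) → ∃ x : C((Fin n → I) × I, E),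
      (∀ y, x (y, 0) = x0 y) ∧ ∀ z, r (x z) = Φ z

namespace IsFibreSeq

variable {A E B : Type*} [TopologicalSpace A] [TopologicalSpace E] [TopologicalSpace B] {k : C(A, E)}
  {r : C(E, B)} {a0 : A} (h : IsFibreSeq k r a0) {m : ℕ}

include h

/-- Lifting of homotopies with prescribed values on the open box. -/
lemma exists_relLift (Φ : C((Fin m → I) × I, B))
    {x0 : (Fin m → I) × I → E} (hx0 : ContinuousOn x0 (openBox m))
    (hr : ∀ z ∈ openBox m, r (x0 z) = Φ z) :
    ∃ x : C((Fin m → I) × I, E), (∀ z ∈ openBox m, x z = x0 z) ∧ ∀ z, r (x z) = Φ z := by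
  obtain ⟨R, hR0, hR1⟩ := exists_boxMotion m
  let e := cubeHomeo m
  obtain ⟨x, h0, h1⟩ := h.exists_lift (Φ.comp (R.comp ((e.symm : C(_, _)).prodMap (.id _))))
    ⟨fun y => x0 (R (e.symm y, 0)), hx0.comp_continuous (by fun_prop) fun y => hR0 _⟩
    fun y => hr _ (hR0 _)
  have hl : ∀ z : (Fin m → I) × I, 1 - boxGauge z ∈ Icc 0 1 := fun z => by
    obtain ⟨h1, h2⟩ := boxGauge_mem z
    constructor <;> linarith
  have hc := continuous_boxGauge (n := m)
  refine ⟨⟨fun z => x (e z, ⟨1 - boxGauge z, hl z⟩), by fun_prop⟩, fun z hz => ?_, fun z => ?_⟩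
  · have h2 : (⟨1 - boxGauge z, hl z⟩ : I) = 0 := Subtype.ext (by simp [boxGauge_eq_one.2 hz])
    simp only [ContinuousMap.coe_mk, h2, h0, e.symm_apply_apply, (hR1 z 0 (by simp [boxGauge_eq_one.2 hz]))]
  · exact (h1 _).trans (congrArg Φ ((congrArg (fun w => R (w, _)) (e.symm_apply_apply z)).trans (hR1 z _ rfl)))

end IsFibreSeq

/-- Two homotopies that fit together run through one after the other. -/
lemma exists_concat {T E : Type*} [TopologicalSpace T] [TopologicalSpace E]
    (x x' : C(T × I, E)) (h : ∀ t, x (t, 1) = x' (t, 0)) :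
    ∃ z : C(T × I, E),
      ∀ t s, z (t, s) = if (s : ℝ) ≤ 1 / 2 then x (t, projIcc 0 1 zero_le_one (2 * s))
        else x' (t, projIcc 0 1 zero_le_one (2 * s - 1)) := by
  refine ⟨⟨fun a => if (a.2 : ℝ) ≤ 1 / 2 then x (a.1, projIcc 0 1 zero_le_one (2 * a.2))
    else x' (a.1, projIcc 0 1 zero_le_one (2 * a.2 - 1)), ?_⟩, fun t s => rfl⟩
  have hp := continuous_projIcc (h := zero_le_one (α := ℝ))
  refine Continuous.if_le ?_ ?_ (by fun_prop) continuous_const fun a ha => ?_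
  · exact x.continuous.comp (continuous_fst.prodMk (hp.comp (by fun_prop)))
  · exact x'.continuous.comp (continuous_fst.prodMk (hp.comp (by fun_prop)))
  · rw [ha]
    norm_num
    exact h _

lemma projIcc_double_of_le {s : I} (hs : (s : ℝ) ≤ 1 / 2) :
    ((projIcc 0 1 zero_le_one (2 * (s : ℝ)) : I) : ℝ) = 2 * s := by
  rw [projIcc_of_mem zero_le_one ⟨by linarith [s.2.1], by linarith⟩]

lemma projIcc_double_sub_of_le {s : I} (hs : 1 / 2 ≤ (s : ℝ)) :
    ((projIcc 0 1 zero_le_one (2 * (s : ℝ) - 1) : I) : ℝ) = 2 * s - 1 := by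
  rw [projIcc_of_mem zero_le_one ⟨by linarith, by linarith [s.2.2]⟩]

lemma GenLoop.transAt_apply {N A : Type*} [TopologicalSpace A] {a : A} [DecidableEq N] (i : N)
    (f g : GenLoop N A a) (t : N → I) :
    GenLoop.transAt i f g t = if (t i : ℝ) ≤ 1 / 2
      then f (Function.update t i <| Set.projIcc 0 1 zero_le_one (2 * t i))
      else g (Function.update t i <| Set.projIcc 0 1 zero_le_one (2 * t i - 1)) := rfl

lemma Cube.cons_mem_boundary {m : ℕ} {s : I} {y : Fin m → I} :
    (Fin.cons s y : Fin (m + 1) → I) ∈ Cube.boundary (Fin (m + 1)) ↔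
      (s = 0 ∨ s = 1) ∨ y ∈ Cube.boundary (Fin m) := by
  constructor
  · rintro ⟨i, hi⟩
    induction i using Fin.cases with
    | zero => exact .inl hi
    | succ i => exact .inr ⟨i, hi⟩
  · rintro (h | ⟨i, hi⟩)
    · exact ⟨0, h⟩
    · exact ⟨i.succ, hi⟩

section PiMap

variable {A : Type u} {B : Type v} [TopologicalSpace A] [TopologicalSpace B] {a : A} {b : B}

lemma piMk_eq {n : ℕ} {f g : GenLoop (Fin n) A a} : piMk f = piMk g ↔ GenLoop.Homotopic f g :=
  Quotient.eq

lemma piMk_eq_of {n : ℕ} {f g : GenLoop (Fin n) A a} (H : C(I × (Fin n → I), A))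
    (h0 : ∀ y, H (0, y) = f y) (h1 : ∀ y, H (1, y) = g y)
    (hb : ∀ t, ∀ y ∈ Cube.boundary (Fin n), H (t, y) = a) : piMk f = piMk g :=
  piMk_eq.2 ⟨⟨⟨H, h0, h1⟩, fun t y hy => (hb t y hy).trans (f.2 y hy).symm⟩⟩

lemma exists_of_piMk_eq {n : ℕ} {f g : GenLoop (Fin n) A a} (h : piMk f = piMk g) :
    ∃ H : C(I × (Fin n → I), A), (∀ y, H (0, y) = f y) ∧
      (∀ y, H (1, y) = g y) ∧ ∀ t, ∀ y ∈ Cube.boundary (Fin n), H (t, y) = a := by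
  obtain ⟨H⟩ := piMk_eq.1 h
  exact ⟨H.toContinuousMap, H.apply_zero, H.apply_one, fun t y hy => (H.eq_fst t hy).trans (f.2 y hy)⟩

lemma exists_piMk {n : ℕ} (c : HomotopyGroup.Pi n A a) : ∃ f, piMk f = c := Quotient.exists_rep c

lemma mul_piMk {n : ℕ} (i : Fin (n + 1)) (f g : GenLoop (Fin (n + 1)) A a) :
    piMk f * piMk g = piMk (GenLoop.transAt i g f) := HomotopyGroup.mul_spec

/-- The image of a cube under a based map. -/
def GenLoop.map {N : Type*} (f : C(A, B)) (hf : f a = b) (g : GenLoop N A a) : GenLoop N B b :=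
  ⟨f.comp g.1, fun y hy => by rw [ContinuousMap.comp_apply, g.2 y hy, hf]⟩

lemma piMap_piMk (f : C(A, B)) (hf : f a = b) {n : ℕ} (g : GenLoop (Fin n) A a) :
    piMap f hf n (piMk g) = piMk (GenLoop.map f hf g) := rfl

lemma piMap_mul (f : C(A, B)) (hf : f a = b) {n : ℕ} (c c' : HomotopyGroup.Pi (n + 1) A a) :
    piMap f hf (n + 1) (c * c') = piMap f hf (n + 1) c * piMap f hf (n + 1) c' := by
  obtain ⟨g, rfl⟩ := exists_piMk c
  obtain ⟨g', rfl⟩ := exists_piMk c'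
  rw [mul_piMk 0, piMap_piMk, piMap_piMk, piMap_piMk, mul_piMk 0]
  congr 1
  ext y
  change f (GenLoop.transAt 0 g' g y) = _
  rw [GenLoop.transAt_apply, GenLoop.transAt_apply]
  split_ifs <;> rfl

lemma piMap_piBase (f : C(A, B)) (hf : f a = b) (n : ℕ) : piMap f hf n (piBase a n) = piBase b n :=
  congrArg piMk (GenLoop.ext _ _ fun _ => hf)

/-- Based homotopic maps induce the same map. -/
lemma piMap_eq_of_homotopy {f g : C(A, B)} (hf : f a = b) (hg : g a = b)
    (H : C(A × I, B)) (h0 : ∀ x, H (x, 0) = f x) (h1 : ∀ x, H (x, 1) = g x)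
    (hb : ∀ t, H (a, t) = b) (n : ℕ) (c : HomotopyGroup.Pi n A a) :
    piMap f hf n c = piMap g hg n c := by
  obtain ⟨x, rfl⟩ := exists_piMk c
  refine piMk_eq_of ⟨fun z => H (x.1 z.2, z.1), by fun_prop⟩ (fun y => h0 _) (fun y => h1 _)
    fun t y hy => ?_
  change H (x.1 y, t) = b
  rw [x.2 y hy, hb]

lemma piMap_comp {C : Type w} [TopologicalSpace C] {c : C} (f : C(A, B)) (hf : f a = b) (g : C(B, C))
    (hg : g b = c) (h : (g.comp f) a = c) (n : ℕ) (x : HomotopyGroup.Pi n A a) :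
    piMap (g.comp f) h n x = piMap g hg n (piMap f hf n x) := by
  obtain ⟨x, rfl⟩ := exists_piMk x
  rfl

lemma piMap_id (h : ContinuousMap.id A a = a) (n : ℕ) (x : HomotopyGroup.Pi n A a) : piMap (.id A) h n x = x := by
  obtain ⟨x, rfl⟩ := exists_piMk x
  rfl

end PiMap

/-- A cube `F` in `B` lifts to a homotopy from the base point to the cube `δ` in the fibre. -/
def LiftsTo {A E B : Type*} [TopologicalSpace A] [TopologicalSpace E] [TopologicalSpace B]
    (k : C(A, E)) (r : C(E, B)) {a0 : A} {b0 : B} {m : ℕ} (F : GenLoop (Fin (m + 1)) B b0)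
    (δ : GenLoop (Fin m) A a0) : Prop :=
  ∃ x : C((Fin m → I) × I, E),
    (∀ y s, r (x (y, s)) = F (Fin.cons s y : Fin (m + 1) → I)) ∧
      (∀ z ∈ openBox m, x z = k a0) ∧ ∀ y, x (y, 1) = k (δ y)

namespace IsFibreSeq

variable {A : Type u} {E : Type v} {B : Type w} [TopologicalSpace A] [TopologicalSpace E] [TopologicalSpace B]
  {k : C(A, E)} {r : C(E, B)} {a0 : A} {b0 : B} (h : IsFibreSeq k r a0) (hb : r (k a0) = b0) {m : ℕ}

include h hb

lemma exists_liftsTo (F : GenLoop (Fin (m + 1)) B b0) : ∃ δ : GenLoop (Fin m) A a0, LiftsTo k r F δ := by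
  obtain ⟨x, hx, hr⟩ := h.exists_relLift (F.1.comp ⟨cubeHomeo m, by fun_prop⟩)
    continuousOn_const fun z hz => hb.trans (F.2 _ (Cube.cons_mem_boundary.2 (hz.imp_left .inl))).symm
  obtain ⟨δ, hδ⟩ := h.exists_fibre (x.comp ⟨fun y => (y, 1), by fun_prop⟩) fun y =>
    (hr _).trans ((F.2 _ (Cube.cons_mem_boundary.2 (.inl (.inr rfl)))).trans hb.symm)
  exact ⟨⟨δ, fun y hy => h.injective ((hδ y).trans (hx _ (.inr hy)))⟩, x,
    fun y s => hr (y, s), hx, fun y => (hδ y).symm⟩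

lemma piMk_eq_of_liftsTo {F F' : GenLoop (Fin (m + 1)) B b0} {δ δ' : GenLoop (Fin m) A a0}
    (hF : LiftsTo k r F δ) (hF' : LiftsTo k r F' δ') (hFF' : piMk F = piMk F') :
    piMk δ = piMk δ' := by
  obtain ⟨x, hr, hx, hδ⟩ := hF
  obtain ⟨x', hr', hx', hδ'⟩ := hF'
  obtain ⟨H, h0, h1, hH⟩ := exists_of_piMk_eq hFF'
  let Φ : C((Fin (m + 1) → I) × I, B) :=
    ⟨fun z => H (z.1 0, (cubeHomeo m) (Fin.tail z.1, z.2)), by fun_prop⟩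
  have hbox : ∀ z ∈ openBox (m + 1), (z.1 0 = 0 ∨ z.1 0 = 1) ∨ (Fin.tail z.1, z.2) ∈ openBox m := by
    rintro ⟨w, s⟩ (hs | hw)
    · exact .inr (.inl hs)
    · obtain ⟨a, y, rfl⟩ : ∃ a y, w = (Fin.cons a y : Fin (m + 1) → I) :=
        ⟨w 0, Fin.tail w, (Fin.cons_self_tail w).symm⟩
      exact (Cube.cons_mem_boundary.1 hw).imp_right .inr
  let x0 : (Fin (m + 1) → I) × I → E := fun z =>
    if (z.1 0 : ℝ) ≤ 1 / 2 then x (Fin.tail z.1, z.2) else x' (Fin.tail z.1, z.2)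
  have hx0 : ContinuousOn x0 (openBox (m + 1)) := by
    refine ContinuousOn.if (fun z hz => ?_) ?_ ?_
    · have h2 : (z.1 0 : ℝ) = 1 / 2 := by
        exact (frontier_le_subset_eq (by fun_prop : Continuous fun z : (Fin (m + 1) → I) × I => (z.1 0 : ℝ)) continuous_const hz.2)
      obtain (h3 | h3) | h3 := hbox z hz.1
      · rw [h3] at h2; norm_num at h2
      · rw [h3] at h2; norm_num at h2
      · rw [hx _ h3, hx' _ h3]
    · exact Continuous.continuousOn (by unfold Fin.tail; fun_prop)
    · exact Continuous.continuousOn (by unfold Fin.tail; fun_prop)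
  have hr0 : ∀ z ∈ openBox (m + 1), r (x0 z) = Φ z := by
    intro z hz
    change r (ite _ _ _) = H (z.1 0, (Fin.cons z.2 (Fin.tail z.1) : Fin (m + 1) → I))
    obtain (h3 | h3) | h3 := hbox z hz
    · simp only [h3, h0]
      norm_num
      exact hr _ _
    · simp only [h3, h1]
      norm_num
      exact hr' _ _
    · rw [hx _ h3, hx' _ h3, ite_self, hb, hH _ _ (Cube.cons_mem_boundary.2 (h3.imp_left .inl))]
  obtain ⟨z, hz, hrz⟩ := h.exists_relLift Φ hx0 hr0
  obtain ⟨D, hD⟩ := h.exists_fibre (z.comp ⟨fun y => (y, 1), by fun_prop⟩) fun y =>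
    (hrz _).trans ((hH _ _ (Cube.cons_mem_boundary.2 (.inl (.inr rfl)))).trans hb.symm)
  have hD' : ∀ t y, k (D (Fin.cons t y : Fin (m + 1) → I)) =
      z ((Fin.cons t y : Fin (m + 1) → I), 1) := fun t y => hD _
  refine piMk_eq_of (D.comp ⟨fun z => cubeHomeo m (z.2, z.1), by fun_prop⟩) (fun y => h.injective ?_)
    (fun y => h.injective ?_) fun t y hy => h.injective ?_
  · refine (hD' 0 y).trans ((hz _ (.inr (Cube.cons_mem_boundary.2 (.inl (.inl rfl))))).trans ?_)
    simpa [x0] using hδ y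
  · refine (hD' 1 y).trans ((hz _ (.inr (Cube.cons_mem_boundary.2 (.inl (.inr rfl))))).trans ?_)
    simp only [x0, Fin.cons_zero, Fin.tail_cons]
    norm_num
    exact hδ' y
  · refine (hD' t y).trans ((hz _ (.inr (Cube.cons_mem_boundary.2 (.inr hy)))).trans ?_)
    simp only [x0, Fin.cons_zero, Fin.tail_cons]
    rw [hx _ (.inr hy), hx' _ (.inr hy), ite_self]

/-- The connecting map of a fibre sequence. -/
lemma exists_connecting (m : ℕ) : ∃ d : HomotopyGroup.Pi (m + 1) B b0 → HomotopyGroup.Pi m A a0,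
    ∀ (F : GenLoop (Fin (m + 1)) B b0) (δ : GenLoop (Fin m) A a0), LiftsTo k r F δ → d (piMk F) = piMk δ := by
  choose δ hδ using h.exists_liftsTo hb
  exact ⟨Quotient.lift (fun F => piMk (δ F)) fun F F' hF =>
    h.piMk_eq_of_liftsTo hb (hδ F) (hδ F') (piMk_eq.2 hF), fun F ε hε =>
    h.piMk_eq_of_liftsTo hb (hδ F) hε rfl⟩

omit h in
lemma liftsTo_transAt {F G : GenLoop (Fin (m + 1)) B b0} {δ ε : GenLoop (Fin m) A a0}
    (hF : LiftsTo k r F δ) (x' : C((Fin m → I) × I, E))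
    (h0 : ∀ y, x' (y, 0) = k (δ y)) (h1 : ∀ y, x' (y, 1) = k (ε y))
    (hr' : ∀ y s, r (x' (y, s)) = G (Fin.cons s y : Fin (m + 1) → I))
    (hy : ∀ y ∈ Cube.boundary (Fin m), ∀ s, x' (y, s) = k a0) :
    LiftsTo k r (GenLoop.transAt 0 F G) ε := by
  obtain ⟨x, hr, hx, hδ⟩ := hF
  obtain ⟨z, hz⟩ := exists_concat x x' fun y => (hδ y).trans (h0 y).symm
  refine ⟨z, fun y s => ?_, ?_, fun y => ?_⟩
  · rw [hz, GenLoop.transAt_apply, Fin.cons_zero, apply_ite r, hr, hr']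
    simp only [Fin.update_cons_zero]
  · rintro ⟨y, s⟩ (hs | hy' : _ ∨ y ∈ _) <;> rw [hz]
    · obtain rfl : s = 0 := hs
      simpa using hx _ (.inl rfl)
    · rw [hx (y, projIcc 0 1 zero_le_one (2 * s)) (.inr hy'), hy y hy', ite_self]
  · rw [hz]
    norm_num
    exact h1 y

omit h in
lemma exists_liftsTo_of_eq {F : GenLoop (Fin (m + 1)) B b0} {δ ε : GenLoop (Fin m) A a0}
    (hA : ∀ a, r (k a) = b0) (hF : LiftsTo k r F δ) (hδ : piMk δ = piMk ε) :
    ∃ F' : GenLoop (Fin (m + 1)) B b0, piMk F' = piMk F ∧ LiftsTo k r F' ε := by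
  obtain ⟨H, h0, h1, hH⟩ := exists_of_piMk_eq hδ
  refine ⟨GenLoop.transAt 0 F GenLoop.const, ?_, liftsTo_transAt hb hF
    ⟨fun z => k (H (z.2, z.1)), by fun_prop⟩ (fun y => congrArg k (h0 y)) (fun y => congrArg k (h1 y))
    (fun y s => hA _) fun y hy s => congrArg k (hH s y hy)⟩
  rw [← mul_piMk]
  exact one_mul _

omit h in
lemma liftsTo_transAt_one {F G : GenLoop (Fin (m + 2)) B b0} {δ ε : GenLoop (Fin (m + 1)) A a0}
    (hF : LiftsTo k r F δ) (hG : LiftsTo k r G ε) :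
    LiftsTo k r (GenLoop.transAt 1 F G) (GenLoop.transAt 0 δ ε) := by
  obtain ⟨x, hr, hx, hδ⟩ := hF
  obtain ⟨x', hr', hx', hε⟩ := hG
  have hp := continuous_projIcc (h := zero_le_one (α := ℝ))
  let z : C((Fin (m + 1) → I) × I, E) :=
    ⟨fun a => if (a.1 0 : ℝ) ≤ 1 / 2 then x (Function.update a.1 0 (projIcc 0 1 zero_le_one (2 * (a.1 0 : ℝ))), a.2)
      else x' (Function.update a.1 0 (projIcc 0 1 zero_le_one (2 * (a.1 0 : ℝ) - 1)), a.2), by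
    refine Continuous.if_le ?_ ?_ (by fun_prop) continuous_const fun a ha => ?_
    · exact x.continuous.comp ((continuous_fst.update 0 (hp.comp (by fun_prop))).prodMk continuous_snd)
    · exact x'.continuous.comp ((continuous_fst.update 0 (hp.comp (by fun_prop))).prodMk continuous_snd)
    · rw [ha, hx _ (.inr ⟨0, .inr (by simp)⟩), hx' _ (.inr ⟨0, .inl (by simp)⟩)]⟩
  refine ⟨z, fun y s => ?_, fun ⟨y, s⟩ hys => ?_, fun y => ?_⟩
  · have h2 : (Fin.cons s y : Fin (m + 2) → I) 1 = y 0 := rfl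
    rw [GenLoop.transAt_apply, h2]
    simp only [z, ContinuousMap.coe_mk, apply_ite r, hr, hr', Fin.cons_update]
    rfl
  · have key : ∀ c : I, (c : ℝ) = 2 * y 0 ∧ (y 0 : ℝ) ≤ 1 / 2 ∨ (c : ℝ) = 2 * y 0 - 1 ∧ 1 / 2 < (y 0 : ℝ) →
        (Function.update y 0 c, s) ∈ openBox (m + 1) := by
      intro c hc
      refine hys.imp id ?_
      rintro ⟨i, hi⟩
      induction i using Fin.cases with
      | zero =>
        refine ⟨0, ?_⟩
        simp only [Function.update_self]
        refine hi.imp (fun h0 : y 0 = 0 => ?_) fun h0 : y 0 = 1 => ?_ <;> rw [h0] at hc <;>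
          norm_num at hc ⊢ <;> exact hc
      | succ i => exact ⟨i.succ, by simpa using hi⟩
    change ite _ _ _ = _
    split_ifs with hc
    · exact hx _ (key _ (.inl ⟨projIcc_double_of_le hc, hc⟩))
    · exact hx' _ (key _ (.inr ⟨projIcc_double_sub_of_le (not_le.1 hc).le, not_le.1 hc⟩))
  · rw [GenLoop.transAt_apply, apply_ite k]
    change ite _ _ _ = _
    simp only [hδ, hε]

variable {d : ∀ m, HomotopyGroup.Pi (m + 1) B b0 → HomotopyGroup.Pi m A a0}
  (hd : ∀ m (F : GenLoop (Fin (m + 1)) B b0) (δ : GenLoop (Fin m) A a0), LiftsTo k r F δ → d m (piMk F) = piMk δ)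

include hd

lemma connecting_mul (a b : HomotopyGroup.Pi (m + 2) B b0) : d (m + 1) (a * b) = d (m + 1) a * d (m + 1) b := by
  obtain ⟨F, rfl⟩ := exists_piMk a
  obtain ⟨G, rfl⟩ := exists_piMk b
  obtain ⟨δ, hδ⟩ := h.exists_liftsTo hb F
  obtain ⟨ε, hε⟩ := h.exists_liftsTo hb G
  rw [mul_piMk 1, hd _ _ _ hδ, hd _ _ _ hε, mul_piMk 0, hd _ _ _ (liftsTo_transAt_one hb hε hδ)]

lemma map_fibre_eq_base (a : HomotopyGroup.Pi m A a0) : piMap k rfl m a = piBase _ m ↔ a ∈ range (d m) := by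
  constructor
  · intro ha
    obtain ⟨δ, rfl⟩ := exists_piMk a
    obtain ⟨H, h0, h1, hH⟩ := exists_of_piMk_eq ha.symm
    let x : C((Fin m → I) × I, E) := ⟨fun z => H (z.2, z.1), by fun_prop⟩
    have hx : ∀ z ∈ openBox m, x z = k a0 := by
      rintro ⟨y, s⟩ (hs | hy)
      · obtain rfl : s = 0 := hs
        exact h0 y
      · exact hH s y hy
    let F : GenLoop (Fin (m + 1)) B b0 := ⟨r.comp (x.comp ((cubeHomeo m).symm : C(_, _))), by
      intro w hw
      obtain ⟨⟨y, s⟩, rfl⟩ := (cubeHomeo m).surjective w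
      change r (x ((cubeHomeo m).symm (cubeHomeo m (y, s)))) = b0
      rw [(cubeHomeo m).symm_apply_apply]
      obtain (hs | hs) | hy := Cube.cons_mem_boundary.1 hw
      · rw [hx _ (.inl hs), hb]
      · obtain rfl : s = 1 := hs
        exact (congrArg r (h1 y)).trans ((h.base _).trans hb)
      · rw [hx _ (.inr hy), hb]⟩
    exact ⟨piMk F, hd _ _ _ ⟨x, fun y s => congrArg (fun z => r (x z)) ((cubeHomeo m).symm_apply_apply (y, s)).symm, hx, h1⟩⟩
  · rintro ⟨c, rfl⟩
    obtain ⟨F, rfl⟩ := exists_piMk c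
    obtain ⟨δ, hδ⟩ := h.exists_liftsTo hb F
    rw [hd _ _ _ hδ]
    obtain ⟨x, -, hx, h1⟩ := hδ
    exact (piMk_eq_of ⟨fun z => x (z.2, z.1), by fun_prop⟩ (fun y => hx _ (.inl rfl)) h1
      fun t y hy => hx _ (.inr hy)).symm

omit hd in
lemma map_total_eq_base (a : HomotopyGroup.Pi m E (k a0)) :
    piMap r hb m a = piBase _ m ↔ a ∈ range (piMap k rfl m) := by
  constructor
  · intro ha
    obtain ⟨x, rfl⟩ := exists_piMk a
    obtain ⟨H, h0, h1, hH⟩ := exists_of_piMk_eq ha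
    obtain ⟨z, hz, hr⟩ := h.exists_relLift ⟨fun z => H (z.2, z.1), by fun_prop⟩ (x0 := fun z => x.1 z.1)
      (by fun_prop) (by
        rintro ⟨y, s⟩ (hs | hy)
        · obtain rfl : s = 0 := hs
          exact (h0 y).symm
        · exact (congrArg r (x.2 y hy)).trans (hb.trans (hH s y hy).symm))
    obtain ⟨δ, hδ⟩ := h.exists_fibre (z.comp ⟨fun y => (y, 1), by fun_prop⟩) fun y =>
      (hr _).trans ((h1 y).trans hb.symm)
    have hz' : ∀ s, ∀ y ∈ Cube.boundary (Fin m), z (y, s) = k a0 := fun s y hy => (hz _ (.inr hy)).trans (x.2 y hy)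
    let ε : GenLoop (Fin m) A a0 := ⟨δ, fun y hy => h.injective ((hδ y).trans (hz' _ _ hy))⟩
    exact ⟨piMk ε, (piMk_eq_of (g := GenLoop.map k rfl ε) ⟨fun w => z (w.2, w.1), by fun_prop⟩
      (fun y => hz _ (.inl rfl)) (fun y => (hδ y).symm) hz').symm⟩
  · rintro ⟨c, rfl⟩
    obtain ⟨δ, rfl⟩ := exists_piMk c
    exact congrArg piMk (GenLoop.ext _ _ fun y => (h.base _).trans hb)

lemma connecting_eq_base (a : HomotopyGroup.Pi (m + 1) B b0) :
    d m a = piBase _ m ↔ a ∈ range (piMap r hb (m + 1)) := by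
  constructor
  · intro ha
    obtain ⟨F, rfl⟩ := exists_piMk a
    obtain ⟨δ, hδ⟩ := h.exists_liftsTo hb F
    rw [hd _ _ _ hδ] at ha
    obtain ⟨F', hF', x, hr, hx, h1⟩ := exists_liftsTo_of_eq hb (fun a => (h.base a).trans hb) hδ ha
    have hr' : ∀ w, r (x ((cubeHomeo m).symm w)) = F' w := fun w =>
      (hr _ _).trans (congrArg F' ((cubeHomeo m).apply_symm_apply w))
    refine ⟨piMk ⟨x.comp ((cubeHomeo m).symm : C(_, _)), fun w hw => ?_⟩, Eq.trans ?_ hF'⟩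
    · obtain ⟨⟨y, s⟩, rfl⟩ := (cubeHomeo m).surjective w
      change x ((cubeHomeo m).symm (cubeHomeo m (y, s))) = _
      rw [(cubeHomeo m).symm_apply_apply]
      obtain (hs | hs) | hy := Cube.cons_mem_boundary.1 hw
      · exact hx _ (.inl hs)
      · obtain rfl : s = 1 := hs
        exact h1 y
      · exact hx _ (.inr hy)
    · exact congrArg piMk (GenLoop.ext _ _ hr')
  · rintro ⟨c, rfl⟩
    obtain ⟨x, rfl⟩ := exists_piMk c
    refine hd _ _ _ ⟨x.1.comp (cubeHomeo m : C(_, _)), fun y s => rfl, fun z hz => ?_, fun y => ?_⟩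
    · exact x.2 _ (Cube.cons_mem_boundary.2 (hz.imp_left .inl))
    · exact x.2 _ (Cube.cons_mem_boundary.2 (.inl (.inr rfl)))

end IsFibreSeq

namespace Orbispace.Arc

variable {c1 : X.ι} {b' : C(T, X.C c1)}

lemma comp_comp_eq_of_eq {x y y' z z' : X.Obj} {m : x ⟶ y} {n : y ⟶ z} {m' : x ⟶ y'} {n' : y' ⟶ z}
    (h : m ≫ n = m' ≫ n') (e : z ⟶ z') : m ≫ n ≫ e = m' ≫ n' ≫ e := by
  rw [← Category.assoc, h, Category.assoc]

lemma IsComp.cast {A : Arc a b} {B : Arc b d} {C : Arc a d} (h : IsComp A B C)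
    (e : ∀ t, (⟨c', b t⟩ : X.Obj) = ⟨c1, b' t⟩) : IsComp (A.castEn e) (B.castSt e) C := by
  obtain ⟨j, k, h0, h1, h2⟩ := h
  exact ⟨j, k, h0, fun z hz => comp_comp_eq_of_eq (h1 z hz) (eqToHom (e z.1)), h2⟩

lemma comp_comp_eq_comp {x y z z' : X.Obj} {m : x ⟶ y} {n : y ⟶ z} {l : x ⟶ z}
    (h : m ≫ n = l) (e : z ⟶ z') : m ≫ n ≫ e = l ≫ e := by rw [← Category.assoc, h]

lemma IsComp.castSt {A : Arc a b} {B : Arc b d} {C : Arc a d} (h : IsComp A B C) {a' : C(T, X.C c1)}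
    (e : ∀ t, (⟨c, a t⟩ : X.Obj) = ⟨c1, a' t⟩) : IsComp (A.castSt e) B (C.castSt e) := by
  obtain ⟨j, k, h0, h1, h2⟩ := h
  exact ⟨j, k, fun z hz => comp_comp_eq_comp (h0 z hz) (eqToHom (e z.1)), h1, h2⟩

lemma IsComp.castEn {A : Arc a b} {B : Arc b d} {C : Arc a d} (h : IsComp A B C) {d' : C(T, X.C c1)}
    (e : ∀ t, (⟨c'', d t⟩ : X.Obj) = ⟨c1, d' t⟩) : IsComp A (B.castEn e) (C.castEn e) := by
  obtain ⟨j, k, h0, h1, h2⟩ := h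
  exact ⟨j, k, h0, h1, fun z hz => comp_comp_eq_comp (h2 z hz) (eqToHom (e z.1))⟩

lemma IsComp.post {A : Arc a b} {B : Arc b d} {C : Arc a d} (h : IsComp A B C) {d' : C(T, X.C c1)}
    (ζ : ∀ t, (⟨c'', d t⟩ : X.Obj) ⟶ ⟨c1, d' t⟩) (hζ) : IsComp A (B.post ζ hζ) (C.post ζ hζ) := by
  obtain ⟨j, k, h0, h1, h2⟩ := h
  exact ⟨j, k, h0, h1, fun z hz => comp_comp_eq_comp (h2 z hz) (ζ z.1)⟩

lemma castEn_castEn_iso (A : Arc a b) (e : ∀ t, (⟨c', b t⟩ : X.Obj) = ⟨c1, b' t⟩)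
    (e' : ∀ t, (⟨c1, b' t⟩ : X.Obj) = ⟨c', b t⟩) : ((A.castEn e).castEn e').Iso A :=
  ⟨PIso.refl _ _, fun _ _ => Category.id_comp _,
    fun z _ => (Category.id_comp _).trans (BasedSystem.comp_eqToHom_eqToHom _ (e z.1) _).symm⟩

end Orbispace.Arc

namespace BasedSystem

lemma exists_cls_eq₂ (γ : Loop p) (δ : Loop q) :
    ∃ (A : LArc p Unit) (D : LArc q Unit), LArc.cls A () = γ ∧ LArc.cls D () = δ := by
  obtain ⟨A, hA⟩ := LArc.exists_cls_eq γ
  obtain ⟨D, hD⟩ := LArc.exists_cls_eq δ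
  exact ⟨A, D, hA, hD⟩

lemma image_comp (A B : LArc q T) :
    (LArc.image σ (LArc.comp A B)).Iso (LArc.comp (LArc.image σ A) (LArc.image σ B)) := by
  exact (((((((((Arc.isComp_comp A B).castSt (a' := σ.cpt T) fun _ => σ.obj_source).castEn (d' := σ.cpt T) fun _ => σ.obj_source).cast (b' := σ.cpt T) fun _ => σ.obj_source).push).castSt (a' := .const T p.2) fun _ => σ.obj_target).castEn (d' := .const T p.2)
    fun _ => σ.obj_target).cast (b' := .const T p.2) fun _ => σ.obj_target)).iso_comp

lemma loopMap_conc (γ γ' : Loop q) : σ.loopMap (conc γ γ') = conc (σ.loopMap γ) (σ.loopMap γ') := by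
  obtain ⟨A, B, rfl, rfl⟩ := exists_cls_eq₂ γ γ'
  rw [conc_cls, loopMap_cls, loopMap_cls, loopMap_cls, conc_cls]
  exact LArc.cls_of_iso (image_comp A B) ()

lemma loopMap_invLoop (γ : Loop q) : σ.loopMap (invLoop γ) = invLoop (σ.loopMap γ) := by
  obtain ⟨A, rfl⟩ := LArc.exists_cls_eq γ
  rw [invLoop_cls, loopMap_cls, loopMap_cls, invLoop_cls]
  exact (LArc.cls_of_iso (((Arc.push_rev ((A.castSt (a' := σ.cpt Unit) fun _ => σ.obj_source).castEn (b' := σ.cpt Unit) fun _ => σ.obj_source)).castSt (a' := .const Unit p.2) fun _ => σ.obj_target).castEn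
    (b' := .const Unit p.2) fun _ => σ.obj_target) ()).symm

lemma loopMap_const : σ.loopMap (Loop.const q) = Loop.const p := by
  have h := isLoopMap_loopMap Subdivision.half (fun _ => σ.o)
  have h1 := σ.ρ_one σ.o
  obtain ⟨Λ, V, W, cover, f, ρ, cρ, ms, fm, ρc, o, pt, hq, hp⟩ := σ
  change ρ o o (Y.one (V o)) = X.one (W o) at h1
  subst hq hp
  refine (h (Loop.constSys _) rfl rfl).trans (congrArg Loop.mk ?_)
  simp only [pushLoop, pushPath, Loop.constSys, h1]

namespace Pullback

lemma backLoop_toYArc_toRArc (A : LArc p T) (D : LArc q T) :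
    (backLoop (LArc.toYArc σ D) (LArc.toRArc σ A)).Iso (LArc.comp A (LArc.rev (LArc.image σ D))) :=
  ((Arc.isComp_comp (LArc.toRArc σ A) (Arc.rev (YArc.image (LArc.toYArc σ D)))).cast
    (b' := .const T p.2) fun _ => σ.obj_target).iso (Arc.isComp_comp _ _) (toLArc_toRArc A) (.refl _)

variable (σ) in
/-- The pair of a loop of `Y` and of a loop of `X`. -/
def pair (γ : Loop p) (δ : Loop q) : σ.Pullback :=
  ⟨((identity q).toRelLoop δ, conc γ (invLoop (σ.loopMap δ))), by
    obtain ⟨A, D, rfl, rfl⟩ := exists_cls_eq₂ γ δ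
    refine ⟨_, _, LArc.toYArc σ D, LArc.toRArc σ A, cls_toYArc D (), ?_⟩
    rw [loopMap_cls, invLoop_cls, conc_cls]
    exact LArc.cls_of_iso (backLoop_toYArc_toRArc A D) ()⟩

lemma pair_cls (A : LArc p T) (D : LArc q T) (t : T) :
    pair σ (LArc.cls A t) (LArc.cls D t) = of (LArc.toYArc σ D) (LArc.toRArc σ A) t := by
  refine ext (cls_toYArc D t).symm ?_
  refine Eq.trans ?_ (LArc.cls_of_iso (backLoop_toYArc_toRArc A D) t).symm
  rw [← conc_cls, ← invLoop_cls, ← loopMap_cls]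
  rfl

lemma continuous_pair : Continuous fun z : Loop p × Loop q => pair σ z.1 z.2 := by
  have h2 : Continuous fun z : Loop p × Loop q => conc z.1 (invLoop (σ.loopMap z.2)) :=
    (continuous_conc).comp (f := fun z : Loop p × Loop q => (z.1, invLoop (σ.loopMap z.2)))
      (continuous_fst.prodMk (continuous_invLoop.comp ((continuous_loopMap).comp continuous_snd)))
  exact (((continuous_toRelLoop).comp continuous_snd).prodMk h2).subtype_mk _

@[simp] lemma proj_pair (γ : Loop p) (δ : Loop q) : (pair σ γ δ).proj = σ.toRelLoop γ := by
  obtain ⟨A, D, rfl, rfl⟩ := exists_cls_eq₂ γ δ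
  rw [pair_cls, proj_of, toRelLoop_cls]

lemma pair_right_injective (hσ : ∀ α, IsEmbedding (σ.groupHom α)) (γ : Loop p) {δ δ' : Loop q}
    (h : pair σ γ δ = pair σ γ δ') : δ = δ' := by
  obtain ⟨A, D, rfl, rfl⟩ := exists_cls_eq₂ γ δ
  obtain ⟨D', rfl⟩ := LArc.exists_cls_eq δ'
  rw [pair_cls, pair_cls] at h
  exact LArc.cls_of_iso (((Arc.castEn_castEn_iso D _ _).symm.trans ((iso_of_of_eq hσ fun _ => h).castEn (b' := .const Unit q.2) fun _ => σ.obj_source.symm)).trans (Arc.castEn_castEn_iso D' _ _)) ()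

variable (σ) in
/-- The inclusion of the fibre. -/
def fibre : C(Loop q, σ.Pullback) := ⟨pair σ (Loop.const p), continuous_pair.comp (Continuous.prodMk_right _)⟩

variable (σ) in
/-- The projection to the based relative loops. -/
def projMap : C(σ.Pullback, σ.RelLoop) := ⟨proj, continuous_proj⟩

lemma isFibreSeq (hσ : σ.IsPseudoEmbedding) : IsFibreSeq (fibre σ) (projMap σ) (Loop.const q) where
  injective _ _ h := pair_right_injective hσ.isEmbedding_groupHom _ h
  base _ := (proj_pair _ _).trans (proj_pair _ _).symm
  exists_lift Φ x0 h := exists_lift_cube hσ h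
  exists_fibre {n} x hx := by
    refine Exists.elim (exists_continuous_of_local (fun t δ => fibre σ δ = x t)
      (fun t δ δ' h h' => pair_right_injective hσ.isEmbedding_groupHom _ (h.trans h'.symm)) fun t0 => ?_)
      fun δ hδ => ⟨⟨δ, hδ.1⟩, hδ.2⟩
    obtain ⟨M, hM, ht, B, hB⟩ := exists_local_of_proj hσ.isEmbedding_groupHom x.continuous
      (LArc.toRArc σ (LArc.const p _)) (fun t => by
        rw [← toRelLoop_cls, LArc.cls_const]
        exact ((hx t).trans (proj_pair _ _)).symm) t0
    let D : LArc q M := B.castEn fun _ => σ.obj_source.symm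
    refine ⟨M, hM, ht, LArc.cls D, LArc.continuous_cls D, fun t => ?_⟩
    refine Eq.trans ?_ (hB t)
    refine (congrArg (pair σ · _) (LArc.cls_const t).symm).trans ((pair_cls _ D t).trans ?_)
    refine of_iso (Arc.castEn_castEn_iso B _ _) ?_ t
    exact Arc.Iso.trans (.refl _) ((Arc.const_comap (ContinuousMap.const _ p.2)
      (⟨Subtype.val, by fun_prop⟩ : C(M, Fin n → I))).symm.castEn
        (b' := (σ.f σ.o).comp (σ.cpt M)) fun _ => σ.obj_target.symm)

variable (σ) in
/-- The pair of a path of `Y` and of its image. -/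
def diag (κ : (identity q).RelLoop) : σ.Pullback :=
  of (YArc.exists_cls_eq (σ := σ) κ).choose_spec.choose_spec.choose
    (YArc.image (YArc.exists_cls_eq (σ := σ) κ).choose_spec.choose_spec.choose) ()

lemma diag_cls (B : σ.YArc v) (t : T) : diag σ (YArc.cls B t) = of B (YArc.image B) t := by
  obtain ⟨ζ, hζ, hi⟩ := YArc.exists_post_iso _ _ fun _ => ((YArc.exists_cls_eq (YArc.cls B t)).choose_spec.choose_spec.choose_spec).trans (YArc.cls_comap B (.const Unit t) ()).symm
  exact (of_post _ _ ζ hζ ()).symm.trans (Eq.trans (of_iso hi (((YArc.image_post _ ζ hζ).symm.trans (YArc.image_iso hi)).trans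
    (YArc.image_comap B (.const Unit t)).symm) ()) (of_comap B (YArc.image B) (.const Unit t) ()))

lemma continuous_diag : Continuous (diag σ) := continuous_of_local fun κ => by
  obtain ⟨M, hM, ht, α, v, B, hB⟩ := YArc.exists_local (σ := σ) continuous_id κ
  exact ⟨M, hM, ht, (continuous_of B _).congr fun t => by rw [← diag_cls, hB]; rfl⟩

lemma proj_diag (κ : (identity q).RelLoop) : (diag σ κ).proj = σ.relMap κ := by
  obtain ⟨α, v, B, rfl⟩ := YArc.exists_cls_eq (σ := σ) κ
  rw [diag_cls, proj_of, relMap_cls]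

lemma diag_toRelLoop (δ : Loop q) : diag σ ((identity q).toRelLoop δ) = pair σ (σ.loopMap δ) δ := by
  obtain ⟨D, rfl⟩ := LArc.exists_cls_eq δ
  rw [← cls_toYArc (σ := σ), diag_cls, loopMap_cls, pair_cls]
  exact of_iso (.refl _) (toRArc_toLArc _).symm ()

/-- Precomposition of the path of `Y` with a loop. -/
def act (δ : Loop q) (x : σ.Pullback) : σ.Pullback :=
  of (σ := σ) (Arc.comp (LArc.exists_cls_eq δ).choose (exists_of_eq x).choose_spec.choose_spec.choose)
    (exists_of_eq x).choose_spec.choose_spec.choose_spec.choose ()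

lemma act_of (D : LArc q T) (B : σ.YArc v) (P : σ.RArc v) (t : T) :
    act (LArc.cls D t) (of B P t) = of (σ := σ) (Arc.comp D B) P t := by
  obtain ⟨ζ, hζ, hB, hP⟩ := exists_post_iso fun _ => ((exists_of_eq (of B P t)).choose_spec.choose_spec.choose_spec.choose_spec).trans (of_comap B P (.const Unit t) ()).symm
  refine (of_post _ _ ζ hζ ()).symm.trans (Eq.trans ?_ (of_comap (Arc.comp D B) P (.const Unit t) ()))
  exact of_iso ((((Arc.isComp_comp _ _).post ζ hζ).iso (Arc.isComp_comp _ _) (LArc.iso_comap (LArc.exists_cls_eq (LArc.cls D t)).choose_spec) hB).trans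
    (Arc.comp_comap D B (.const Unit t)).symm) hP ()

lemma continuous_act (δ : Loop q) : Continuous (act (σ := σ) δ) := continuous_of_local fun x => by
  obtain ⟨M, hM, ht, α, v, B, P, h⟩ := exists_local continuous_id x
  obtain ⟨D, rfl⟩ := LArc.exists_cls_eq δ
  refine ⟨M, hM, ht, (continuous_of (Arc.comp (LArc.comap D (.const M ())) B) P).congr fun t => ?_⟩
  rw [← act_of, h, LArc.cls_comap]; rfl

lemma proj_act (δ : Loop q) (x : σ.Pullback) : (act δ x).proj = x.proj := by
  obtain ⟨α, v, B, P, rfl⟩ := exists_of_eq x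
  obtain ⟨D, rfl⟩ := LArc.exists_cls_eq δ
  rw [act_of, proj_of, proj_of]

lemma act_pair (δ δ' : Loop q) (γ : Loop p) : act δ (pair σ γ δ') = pair σ γ (conc δ δ') := by
  obtain ⟨A, D', rfl, rfl⟩ := exists_cls_eq₂ γ δ'
  obtain ⟨D, rfl⟩ := LArc.exists_cls_eq δ
  rw [conc_cls, pair_cls, pair_cls, act_of]
  exact of_iso ((Arc.isComp_comp D D').castEn _).iso_comp.symm (.refl _) ()

end Pullback

variable {β β' : σ.Λ} {l : C(T, ℝ)} {a : C(T, Y.C (σ.V β))} {a' : C(T, Y.C (σ.V β'))}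

namespace YArc

/-- The reparametrization that stops at the time `l`. -/
def truncMap (l : C(T, ℝ)) : C(T × ℝ, ℝ) := ⟨fun z => l z.1 * z.2, by fun_prop⟩

/-- A family of paths, stopped at the time `l`. -/
def trunc (B : σ.YArc v) (F : Frame B.A l a) : σ.YArc a :=
  Arc.sub B.A (truncMap l) B.st F (fun t => mul_zero (l t)) fun t => mul_one (l t)

lemma truncMap_mem (hl : ∀ t, l t ∈ Icc (0 : ℝ) 1) {z : T × ℝ} (hz : z.2 ∈ Icc (0 : ℝ) 1) :
    truncMap l z ∈ Icc (0 : ℝ) 1 := unitInterval.mul_mem (hl _) hz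

lemma comp_inv_comp_comp {x y z t : Y.Obj} (m : x ⟶ y) (j : x ⟶ z) (n : z ⟶ t) : j ≫ n = m ≫ inv m ≫ j ≫ n := by simp

lemma cls_trunc_congr {B : σ.YArc v} {B' : σ.YArc v'} (hl : ∀ t, l t ∈ Icc (0 : ℝ) 1)
    (j : PIso B.A B'.A {z | z.2 ∈ Icc (0 : ℝ) 1})
    (h0 : ∀ (z : T × ℝ) (hz : z.2 = 0), j.J z (by simp [hz]) ≫ B'.st.h z hz = B.st.h z hz)
    (F : Frame B.A l a) (F' : Frame B'.A l a') (t : T) : cls (trunc B F) t = cls (trunc B' F') t := by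
  have hm : ∀ t, l t * 1 = l t := fun t => mul_one _
  let ζ : ∀ t, (⟨σ.V β, a t⟩ : Y.Obj) ⟶ ⟨σ.V β', a' t⟩ := fun t => inv (F.h (t, l t * 1) (hm t)) ≫
    j.J (t, l t * 1) (by rw [mem_ofPred_eq, hm t]; exact hl t) ≫ F'.h (t, l t * 1) (hm t)
  refine RArc.cls_congr (A' := (trunc B' F').toRArc)
    ((j.comap (.id T) (truncMap l)).mono fun z hz => truncMap_mem hl hz) ζ (fun z hz => h0 _ _) (fun z hz => ?_) t
  obtain ⟨t, s⟩ := z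
  obtain rfl : s = 1 := hz
  exact comp_inv_comp_comp _ _ _

lemma cls_trunc_comap (B : σ.YArc v) (F : Frame B.A l a) (g : C(T', T)) (t : T') :
    cls (trunc (σ := σ) (v := v.comp g) (l := l.comp g) (Arc.comap B g)
      (F.comap g (Pth.sndMap T') (x' := l.comp g) fun _ h => h)) t = cls (trunc B F) (g t) := by
  exact Eq.trans ((cls_of_iso (Arc.sub_comap _ _ g (truncMap (l.comp g)) (fun _ _ => rfl) (by simp [truncMap])
    (by simp [truncMap])) t).symm) (cls_comap (trunc B F) g t)

/-- The frame that a section gives. -/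
def frameOfSec {A : Pth Y T} {c : Y.ι} {m : Sec A.r c} (hm : A.IsSec m) (hN : ∀ t, (t, l t) ∈ m.N) :
    Frame A l ⟨fun t => m.f (t, l t), m.cont.comp_continuous (by fun_prop) hN⟩ :=
  Frame.ofSec hm hN fun _ => rfl

variable (σ) in
lemma exists_trunc (κ : (identity q).RelLoop) (s : ℝ) : ∃ (κ' : (identity q).RelLoop) (α : σ.Λ)
    (v : C(Unit, Y.C (σ.V α))) (B : σ.YArc v) (β : σ.Λ) (a : C(Unit, Y.C (σ.V β)))
    (F : Frame B.A (ContinuousMap.const Unit s) a), cls B () = κ ∧ cls (trunc B F) () = κ' := by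
  obtain ⟨α, v, B, hB⟩ := exists_cls_eq (σ := σ) κ
  obtain ⟨m, h, hm, -, -⟩ := Pth.exists_isSec_through B.A ((), s) (σ.toChart _)
  exact ⟨_, α, v, B, _, _, frameOfSec hm fun _ => h, hB, rfl⟩

end YArc

open YArc

variable (σ) in
/-- A path of `Y`, stopped at the time `s`. -/
def truncPath (κ : (identity q).RelLoop) (s : ℝ) : (identity q).RelLoop := (exists_trunc σ κ s).choose

lemma truncPath_cls (B : σ.YArc v) (hl : ∀ t, l t ∈ Icc (0 : ℝ) 1) (F : Frame B.A l a) (t : T) :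
    truncPath σ (cls B t) (l t) = cls (trunc B F) t := by
  obtain ⟨α0, v0, B0, β0, a0, F0, h, h'⟩ := (exists_trunc σ (cls B t) (l t)).choose_spec
  obtain ⟨ζ, hζ, j, h0, -⟩ := exists_post_iso B0 _ fun _ => h.trans (cls_comap B (.const Unit t) ()).symm
  exact h'.symm.trans (Eq.trans (cls_trunc_congr (fun _ => hl t) j h0 F0 _ ()) (cls_trunc_comap B F (.const Unit t) ()))

lemma continuous_truncPath : Continuous fun z : (identity q).RelLoop × I => truncPath σ z.1 z.2 := by
  refine continuous_of_local fun z0 => ?_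
  obtain ⟨M, hM, hz0, α, v, B, hB⟩ := exists_local (σ := σ)
    continuous_fst z0
  refine ⟨M, hM, hz0, continuous_of_local fun z1 => ?_⟩
  obtain ⟨m, h, hm, ho, -⟩ := Pth.exists_isSec_through B.A (z1, (z1.1.2 : ℝ)) (σ.toChart _)
  let M' : Set M := {z | (z, (z.1.2 : ℝ)) ∈ m.N}
  let g : C(M', M) := ⟨Subtype.val, by fun_prop⟩
  let l : C(M', ℝ) := ⟨fun z => z.1.1.2, by fun_prop⟩
  let F := frameOfSec (l := l) (hm.comap g (Pth.sndMap M')) fun t => t.2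
  refine ⟨M', ho.preimage (by fun_prop), h,
    (continuous_cls (trunc (Arc.comap B g) F)).congr fun t => ?_⟩
  rw [← truncPath_cls (Arc.comap B g) (fun t => t.1.1.2.2) F t, cls_comap]
  exact congrArg (truncPath σ · _) (hB t)

lemma truncPath_one (κ : (identity q).RelLoop) : truncPath σ κ 1 = κ := by
  obtain ⟨α, v, B, rfl⟩ := YArc.exists_cls_eq (σ := σ) κ
  exact (truncPath_cls (l := .const Unit 1) B (fun _ => ⟨zero_le_one, le_rfl⟩) B.en ()).trans (cls_of_iso ((Arc.sub_congr (fun z _ => by simp [truncMap]) _ _ (by simp) (by simp)).trans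
    (Arc.sub_self B (by simp) (by simp))) ())

lemma cls_toYArc_const (t : T) : cls (LArc.toYArc σ (LArc.const q T)) t = (identity q).toRelLoop (Loop.const q) := by
  rw [cls_toYArc, LArc.cls_const]

lemma truncPath_zero (κ : (identity q).RelLoop) : truncPath σ κ 0 = (identity q).toRelLoop (Loop.const q) := by
  obtain ⟨α, v, B, rfl⟩ := YArc.exists_cls_eq (σ := σ) κ
  refine (truncPath_cls (l := .const Unit 0) B (fun _ => ⟨le_rfl, zero_le_one⟩)
    (B.st.cast (b := σ.cpt Unit) fun _ => σ.obj_source) ()).trans ?_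
  exact Eq.trans (cls_of_iso ((Arc.sub_const B.st _ (fun z _ => by simp [truncMap]) (by simp [truncMap]) (by simp [truncMap])).castEn
    (b' := σ.cpt Unit) fun _ => σ.obj_source) ()) (cls_toYArc_const ())

lemma truncPath_const {s : ℝ} (hs : s ∈ Icc (0 : ℝ) 1) :
    truncPath σ ((identity q).toRelLoop (Loop.const q)) s = (identity q).toRelLoop (Loop.const q) := by
  rw [← cls_toYArc_const (σ := σ) ()]
  refine (truncPath_cls (l := .const Unit s) _ (fun _ => hs)
    ((Frame.ofMap (a := .const Unit q.2) _ fun _ _ => rfl).cast (b := σ.cpt Unit) fun _ => σ.obj_source) ()).trans ?_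
  have h : Arc.Iso (Arc.sub (LArc.const q Unit).A (truncMap (.const Unit s)) (LArc.const q Unit).st
      (Frame.ofMap (x := fun _ => s) _ fun _ _ => rfl) (by simp [truncMap])
      (by simp [truncMap])) (LArc.const q Unit) :=
    Arc.iso_const_of_frame (fun z _ => 𝟙 _)
      (((Pth.isSec_atlas (A := Pth.ofMap ((ContinuousMap.const Unit q.2).comp ContinuousMap.fst))
        rfl).comap (.id Unit) _).congr (fun _ _ => trivial) fun z hz => rfl)
      (fun _ _ => (eqToHom_refl _ rfl).symm) fun _ _ => (eqToHom_refl _ rfl).symm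
  exact cls_of_iso (h.castEn (b' := σ.cpt Unit) fun _ => σ.obj_source) ()

namespace Pullback

/-- The reparametrizations of a loop that lengthen its first half. -/
def growMap : C(I × ℝ, ℝ) := ⟨fun z => min ((1 + z.1) * z.2) (z.1 + (1 - z.1) * z.2), by fun_prop⟩

lemma growMap_zero (u : I) : growMap (u, 0) = 0 := by simp [growMap, u.2.1]

lemma growMap_one (u : I) : growMap (u, 1) = 1 := by simp [growMap, u.2.1]

lemma growMap_mem (z : I × ℝ) (hz : z.2 ∈ Icc (0 : ℝ) 1) : growMap z ∈ Icc (0 : ℝ) 1 := by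
  obtain ⟨⟨u, hu⟩, s⟩ := z
  obtain ⟨h1, h2⟩ := hz
  obtain ⟨h3, h4⟩ := hu
  dsimp only at h1 h2
  refine ⟨le_min (by positivity) (by nlinarith), (min_le_right _ _).trans ?_⟩
  change u + (1 - u) * s ≤ 1
  nlinarith

lemma growMap_of_le {u : I} {s : ℝ} (hs : s ≤ 1 / 2) : growMap (u, s) = (1 + u) * s :=
  min_eq_left (by nlinarith [u.2.1])

lemma growMap_of_ge {u : I} {s : ℝ} (hs : 1 / 2 ≤ s) : growMap (u, s) = u + (1 - u) * s :=
  min_eq_right (by nlinarith [u.2.1])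

end Pullback

lemma image_trunc (B : σ.YArc v) (F : Frame B.A l a) : (YArc.image (trunc B F)).Iso
    (Arc.sub (YArc.image B).A (truncMap l) (YArc.image B).st F.push (fun t => mul_zero (l t)) fun t => mul_one (l t)) :=
  Arc.Iso.symm ⟨pushComap B.A (.id T) (truncMap l) _, fun _ _ => Category.id_comp _, fun _ _ => Category.id_comp _⟩

lemma exists_backLoop_re (B : σ.YArc v) (P : σ.RArc v) (g : C(T, I))
    (hl : ∀ t, l t = 1 - g t) (F : Frame B.A l a) (w : C(T × ℝ, ℝ))
    (hw : ∀ z : T × ℝ, w z = Pullback.growMap (g z.1, z.2)) (h0 h1) :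
    ∃ P' : σ.RArc a, (backLoop (trunc B F) P').Iso (LArc.re (backLoop B P) w h0 h1) := by
  let u : C(T, ℝ) := ⟨fun t => g t, by fun_prop⟩
  have hu : ∀ t, u t ∈ Icc 0 1 := fun t => (g t).2
  let Q := Arc.rev (YArc.image B)
  let FQ : Frame Q.A u ((σ.f β).comp a) := F.push.re (lin T 1 (-1)) fun z hz => by
    rw [lin_apply, hz, hl]; simp [u]; ring
  let w2 : C(T × ℝ, ℝ) := ⟨fun z => (1 + g z.1) / 2 + (1 - g z.1) / 2 * z.2, by fun_prop⟩
  let w3 : C(T × ℝ, ℝ) := ⟨fun z => g z.1 + (1 - g z.1) * z.2, by fun_prop⟩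
  let w4 : C(T × ℝ, ℝ) := ⟨fun z => (1 - g z.1) * (1 - z.2), by fun_prop⟩
  have hA : (Arc.rev (YArc.image (trunc B F))).Iso (Arc.sub (YArc.image B).A w4 F.push (YArc.image B).st
      (fun t => by simp [w4, hl]) (fun t => by simp [w4])) :=
    (image_trunc B F).rev.trans (Arc.sub_sub _ _ (fun z _ => by
      simp only [w4, truncMap, hl, ContinuousMap.coe_mk, lin_apply]; ring) _ _ _ _)
  have hB : (Arc.sub (P.comp Q).A w2 (Arc.extFrame P Q hu FQ) (P.comp Q).en (fun t => by simp [w2, u])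
      (fun t => by simp [w2]; ring)).Iso (Arc.sub Q.A w3 FQ Q.en (fun t => by simp [w3, u]) (fun t => by simp [w3])) := by
    refine Arc.Iso.trans (Arc.sub_iso (Arc.compSnd P Q)
      (G' := Q.en.re _ fun z hz => by simp [hz]; norm_num) (fun z hz => ?_) (fun z hz hS => rfl)
      (fun z hz hS => Arc.compSnd_one P Q z hz) _ _) (Arc.sub_sub _ _ (fun z _ => ?_) _ _ _ _)
    · have h1 := (g z.1).2.1
      have h2 := (g z.1).2.2
      obtain ⟨h3, h4⟩ := hz
      constructor <;> dsimp [w2] <;> nlinarith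
    · simp [w2, w3]; ring
  refine ⟨Arc.ext P Q hu FQ, Arc.Iso.trans (Arc.Iso.comp (.refl _) (hA.trans (hB.trans (Arc.sub_sub _ _ (fun z _ => by simp [w3, w4]; ring) _ _ _ _)).symm))
    (Arc.IsComp.iso_comp (Arc.isComp_sub (fun z hz => ?_) (fun z hz => ?_) _ _ _ _ _ _)).symm⟩
  · rw [hw, Pullback.growMap_of_le hz.2]
    simp [u]; ring
  · rw [hw, Pullback.growMap_of_ge hz.1]
    simp [w2]; ring

namespace Pullback

/-- The contraction of the path of `Y` along itself. -/
def contract (x : σ.Pullback) (u : I) : σ.Pullback :=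
  ⟨(truncPath σ x.path (unitInterval.symm u), reLoop growMap growMap_zero growMap_one x.loop u), by
    obtain ⟨α, v, B, P, rfl⟩ := exists_of_eq x
    obtain ⟨m, h, hm, -, -⟩ := Pth.exists_isSec_through B.A ((), ((unitInterval.symm u : I) : ℝ))
      (σ.toChart _)
    let F := frameOfSec (l := .const Unit ((unitInterval.symm u : I) : ℝ)) hm fun _ => h
    obtain ⟨P', hP'⟩ := exists_backLoop_re B P (.const Unit u) (fun _ => by simp) F
      ⟨fun z => growMap (ContinuousMap.const Unit u z.1, z.2), by fun_prop⟩ (fun _ => rfl)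
      (fun _ => growMap_zero u) fun _ => growMap_one u
    refine ⟨_, _, trunc B F, P', ?_, ?_⟩
    · exact (truncPath_cls (σ := σ) B (fun _ => (unitInterval.symm u).2) F ()).symm
    · exact (LArc.cls_of_iso hP' ()).trans (reLoop_cls growMap_mem (backLoop B P) (.const Unit u) ()).symm⟩

lemma continuous_contract : Continuous fun z : σ.Pullback × I => contract z.1 z.2 := by
  exact (((continuous_truncPath).comp ((continuous_path.comp continuous_fst).prodMk (unitInterval.continuous_symm.comp continuous_snd))).prodMk ((continuous_reLoop growMap_mem).comp ((continuous_loop.comp continuous_fst).prodMk continuous_snd))).subtype_mk _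

end Pullback

section

variable {Z : Type*} [TopologicalSpace Z] {w : C(Z × ℝ, ℝ)} {h0 : ∀ t, w (t, 0) = 0} {h1 : ∀ t, w (t, 1) = 1}

lemma reLoop_eq_self (hw : ∀ z : Z × ℝ, z.2 ∈ Icc (0 : ℝ) 1 → w z ∈ Icc (0 : ℝ) 1) {ζ : Z}
    (h : ∀ s ∈ Icc (0 : ℝ) 1, w (ζ, s) = s) (γ : Loop p) : reLoop w h0 h1 γ ζ = γ := by
  obtain ⟨A, rfl⟩ := LArc.exists_cls_eq γ
  exact (reLoop_cls hw A (.const Unit ζ) ()).trans (LArc.cls_of_iso ((Arc.sub_congr (fun z hz => by simpa using h z.2 hz) _ _ (by simp) (by simp)).trans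
    (Arc.sub_self A (by simp) (by simp))) ())

lemma reLoop_eq_conc_const (hw : ∀ z : Z × ℝ, z.2 ∈ Icc (0 : ℝ) 1 → w z ∈ Icc (0 : ℝ) 1) {ζ : Z}
    (h : ∀ s ∈ Icc (0 : ℝ) 1, w (ζ, s) = min (2 * s) 1) (γ : Loop p) :
    reLoop w h0 h1 γ ζ = conc γ (Loop.const p) := by
  obtain ⟨A, rfl⟩ := LArc.exists_cls_eq γ
  rw [← LArc.cls_const (), conc_cls]
  refine (reLoop_cls hw A (.const Unit ζ) ()).trans (LArc.cls_of_iso ?_ ())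
  refine Arc.Iso.trans (Arc.sub_congr (fun z hz => (h z.2 hz).trans ?_) _ _ (by simp) (by simp))
    (Arc.comp_const_iso A).symm
  obtain h2 | h2 := le_total z.2 (1 / 2)
  · rw [Arc.bend_of_le h2, min_eq_left (by linarith)]; ring
  · rw [Arc.bend_of_ge h2, min_eq_right (by linarith)]; ring

lemma reLoop_eq_const_conc (hw : ∀ z : Z × ℝ, z.2 ∈ Icc (0 : ℝ) 1 → w z ∈ Icc (0 : ℝ) 1) {ζ : Z}
    (h : ∀ s ∈ Icc (0 : ℝ) 1, w (ζ, s) = max 0 (2 * s - 1)) (γ : Loop p) :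
    reLoop w h0 h1 γ ζ = conc (Loop.const p) γ := by
  obtain ⟨A, rfl⟩ := LArc.exists_cls_eq γ
  rw [← LArc.cls_const (), conc_cls]
  refine (reLoop_cls hw A (.const Unit ζ) ()).trans (LArc.cls_of_iso ?_ ())
  refine Arc.Iso.trans (Arc.sub_congr (fun z hz => (h z.2 hz).trans ?_) _ _ (by simp) (by simp))
    (Arc.const_comp_iso A).symm
  obtain h2 | h2 := le_total z.2 (1 / 2)
  · rw [Arc.bend_of_le h2, max_eq_left (by linarith)]; ring
  · rw [Arc.bend_of_ge h2, max_eq_right (by linarith)]; ring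

end

namespace Pullback

lemma contract_zero (x : σ.Pullback) : contract x 0 = x := by
  refine ext ?_ (reLoop_eq_self growMap_mem (fun s _ => by simp [growMap]) _)
  change truncPath σ _ ((unitInterval.symm 0 : I) : ℝ) = _
  rw [unitInterval.symm_zero]
  exact truncPath_one _

lemma contract_one (x : σ.Pullback) : contract x 1 = pair σ x.loop (Loop.const q) := by
  refine ext ?_ ?_
  · change truncPath σ _ ((unitInterval.symm 1 : I) : ℝ) = _
    rw [unitInterval.symm_one]
    exact truncPath_zero _
  · refine (reLoop_eq_conc_const growMap_mem (fun s _ => by simp [growMap]; ring_nf) _).trans ?_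
    change _ = conc _ (invLoop (σ.loopMap (Loop.const q)))
    rw [loopMap_const, invLoop_const]

lemma contract_base (u : I) :
    contract (pair σ (Loop.const p) (Loop.const q)) u = pair σ (Loop.const p) (Loop.const q) := by
  refine ext (truncPath_const (unitInterval.symm u).2) ?_
  have h : conc (Loop.const p) (invLoop (σ.loopMap (Loop.const q))) = Loop.const p := by
    rw [loopMap_const, invLoop_const, conc_const_const]
  change reLoop growMap growMap_zero growMap_one (conc (Loop.const p) (invLoop (σ.loopMap (Loop.const q)))) u =
    conc (Loop.const p) (invLoop (σ.loopMap (Loop.const q)))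
  rw [h, reLoop_const growMap_mem]

end Pullback

variable (σ)

/-- The continuous map of based loop spaces. -/
def loopMapC : C(Loop q, Loop p) := ⟨σ.loopMap, continuous_loopMap⟩

/-- The continuous map from the based loops to the based relative loops. -/
def toRelLoopC : C(Loop p, σ.RelLoop) := ⟨σ.toRelLoop, continuous_toRelLoop⟩

variable (p) in
/-- The inversion of loops as a continuous map. -/
def invLoopC : C(Loop p, Loop p) := ⟨invLoop, continuous_invLoop⟩

variable {σ}

lemma loopMapC_const : σ.loopMapC (Loop.const q) = Loop.const p := loopMap_const

lemma toRelLoopC_const : σ.toRelLoopC (Loop.const p) = σ.constRel := rfl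

lemma invLoopC_const : invLoopC p (Loop.const p) = Loop.const p := invLoop_const

variable (σ)

/-- The reparametrizations of a loop that delay its second half. -/
def lateMap : C(I × ℝ, ℝ) := ⟨fun z => max ((1 - z.1) * z.2) ((1 + z.1) * z.2 - z.1), by fun_prop⟩

lemma lateMap_zero (u : I) : lateMap (u, 0) = 0 := by simp [lateMap, u.2.1]

lemma lateMap_one (u : I) : lateMap (u, 1) = 1 := by simp [lateMap, u.2.1]

lemma lateMap_mem (z : I × ℝ) (hz : z.2 ∈ Icc (0 : ℝ) 1) : lateMap z ∈ Icc (0 : ℝ) 1 := by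
  obtain ⟨⟨u, hu⟩, s⟩ := z
  obtain ⟨h1, h2⟩ := hz
  obtain ⟨h3, h4⟩ := hu
  dsimp only at h1 h2
  refine ⟨le_max_of_le_left (mul_nonneg (sub_nonneg.2 h4) h1), max_le ?_ ?_⟩
  · change (1 - u) * s ≤ 1
    nlinarith
  · change (1 + u) * s - u ≤ 1
    nlinarith

namespace Pullback

/-- The loops of `X` in the pullback. -/
def inc : C(Loop p, σ.Pullback) := ⟨fun γ => pair σ γ (Loop.const q), continuous_pair.comp (Continuous.prodMk_left _)⟩

/-- The loop of an element of the pullback. -/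
def loopC : C(σ.Pullback, Loop p) := ⟨loop, continuous_loop⟩

variable {σ}

lemma loop_pair_const (γ : Loop p) : (pair σ γ (Loop.const q)).loop = conc γ (Loop.const p) := by
  change conc γ (invLoop (σ.loopMap (Loop.const q))) = _
  rw [loopMap_const, invLoop_const]

lemma loopC_base : loopC σ (fibre σ (Loop.const q)) = Loop.const p := (loop_pair_const _).trans conc_const_const

lemma inc_base : inc σ (Loop.const p) = fibre σ (Loop.const q) := rfl

lemma projMap_base : projMap σ (fibre σ (Loop.const q)) = σ.constRel := proj_pair _ _

variable {m : ℕ}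

lemma piMap_loopC_inc (a : HomotopyGroup.Pi m (Loop p) (Loop.const p)) :
    piMap (loopC σ) loopC_base m (piMap (inc σ) inc_base m a) = a := by
  have h : ((loopC σ).comp (inc σ)) (Loop.const p) = Loop.const p := loopC_base
  rw [← piMap_comp (inc σ) inc_base (loopC σ) loopC_base h]
  refine (piMap_eq_of_homotopy rfl h ⟨_, continuous_reLoop (h0 := growMap_zero)
    (h1 := growMap_one) growMap_mem⟩ (fun γ => ?_) (fun γ => ?_) (fun u => ?_) m a).symm.trans (piMap_id rfl m a)
  · exact reLoop_eq_self growMap_mem (fun s _ => by simp [growMap]) γ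
  · exact (reLoop_eq_conc_const growMap_mem (fun s _ => by simp [growMap]; ring_nf) γ).trans
      (loop_pair_const γ).symm
  · exact reLoop_const growMap_mem u

lemma piMap_inc_loopC (a : HomotopyGroup.Pi m σ.Pullback (fibre σ (Loop.const q))) :
    piMap (inc σ) inc_base m (piMap (loopC σ) loopC_base m a) = a := by
  have h : ((inc σ).comp (loopC σ)) (fibre σ (Loop.const q)) = fibre σ (Loop.const q) := congrArg (inc σ) loopC_base
  rw [← piMap_comp (loopC σ) loopC_base (inc σ) inc_base h]
  exact (piMap_eq_of_homotopy rfl h ⟨_, continuous_contract⟩ contract_zero contract_one contract_base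
    m a).symm.trans (piMap_id rfl m a)

lemma piMap_loopC_fibre (a : HomotopyGroup.Pi m (Loop q) (Loop.const q)) :
    piMap (loopC σ) loopC_base m (piMap (fibre σ) rfl m a) =
      piMap (invLoopC p) invLoopC_const m (piMap σ.loopMapC loopMapC_const m a) := by
  have h : ((loopC σ).comp (fibre σ)) (Loop.const q) = Loop.const p := loopC_base
  have h' : ((invLoopC p).comp σ.loopMapC) (Loop.const q) = Loop.const p :=
    (congrArg (invLoopC p) loopMap_const).trans invLoop_const
  rw [← piMap_comp (fibre σ) rfl (loopC σ) loopC_base h, ← piMap_comp σ.loopMapC loopMapC_const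
    (invLoopC p) invLoopC_const h']
  refine (piMap_eq_of_homotopy h' h ((⟨_, continuous_reLoop (h0 := lateMap_zero)
    (h1 := lateMap_one) lateMap_mem⟩ : C(Loop p × I, Loop p)).comp
      (((invLoopC p).comp σ.loopMapC).prodMap (.id _))) (fun δ => ?_) (fun δ => ?_) (fun u => ?_) m a).symm
  · exact reLoop_eq_self lateMap_mem (fun s _ => by simp [lateMap]) _
  · exact reLoop_eq_const_conc lateMap_mem (fun s _ => by simp [lateMap]; ring_nf) _
  · exact Eq.trans (congrArg (fun γ => reLoop lateMap lateMap_zero lateMap_one γ u) h') (reLoop_const lateMap_mem u)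

lemma piMap_invLoopC_invLoopC (a : HomotopyGroup.Pi m (Loop p) (Loop.const p)) :
    piMap (invLoopC p) invLoopC_const m (piMap (invLoopC p) invLoopC_const m a) = a := by
  obtain ⟨f, rfl⟩ := exists_piMk a
  exact congrArg piMk (GenLoop.ext _ _ fun y => invLoop_invLoop (f y))

lemma piMap_loopMapC_invLoopC (a : HomotopyGroup.Pi m (Loop q) (Loop.const q)) :
    piMap σ.loopMapC loopMapC_const m (piMap (invLoopC q) invLoopC_const m a) =
      piMap (invLoopC p) invLoopC_const m (piMap σ.loopMapC loopMapC_const m a) := by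
  obtain ⟨f, rfl⟩ := exists_piMk a
  exact congrArg piMk (GenLoop.ext _ _ fun y => loopMap_invLoop (f y))

lemma piMap_projMap_inc (a : HomotopyGroup.Pi m (Loop p) (Loop.const p)) :
    piMap (projMap σ) projMap_base m (piMap (inc σ) inc_base m a) = piMap σ.toRelLoopC toRelLoopC_const m a := by
  obtain ⟨f, rfl⟩ := exists_piMk a
  exact congrArg piMk (GenLoop.ext _ _ fun y => proj_pair _ _)

lemma toRelLoopC_eq_base (hσ : σ.IsPseudoEmbedding) (a : HomotopyGroup.Pi m (Loop p) (Loop.const p)) :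
    piMap σ.toRelLoopC toRelLoopC_const m a = piBase _ m ↔ a ∈ range (piMap σ.loopMapC loopMapC_const m) := by
  rw [← piMap_projMap_inc, (isFibreSeq hσ).map_total_eq_base projMap_base]
  constructor
  · rintro ⟨b, hb⟩
    refine ⟨piMap (invLoopC q) invLoopC_const m b, ?_⟩
    rw [piMap_loopMapC_invLoopC, ← piMap_loopC_fibre, hb, piMap_loopC_inc]
  · rintro ⟨b, rfl⟩
    refine ⟨piMap (invLoopC q) invLoopC_const m b, ?_⟩
    rw [← piMap_inc_loopC (piMap (fibre σ) rfl m _), piMap_loopC_fibre, piMap_loopMapC_invLoopC,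
      piMap_invLoopC_invLoopC]

variable {d : ∀ m, HomotopyGroup.Pi (m + 1) σ.RelLoop σ.constRel → HomotopyGroup.Pi m (Loop q) (Loop.const q)}
  (hd : ∀ m (F : GenLoop (Fin (m + 1)) σ.RelLoop σ.constRel) (δ : GenLoop (Fin m) (Loop q) (Loop.const q)),
    LiftsTo (fibre σ) (projMap σ) F δ → d m (piMk F) = piMk δ)

include hd

lemma loopMapC_eq_base (hσ : σ.IsPseudoEmbedding) (a : HomotopyGroup.Pi m (Loop q) (Loop.const q)) :
    piMap σ.loopMapC loopMapC_const m a = piBase _ m ↔ a ∈ range (d m) := by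
  rw [← (isFibreSeq hσ).map_fibre_eq_base projMap_base hd]
  constructor
  · intro h
    rw [← piMap_inc_loopC (piMap (fibre σ) rfl m a), piMap_loopC_fibre, h, piMap_piBase, piMap_piBase]
  · intro h
    rw [← piMap_invLoopC_invLoopC (piMap σ.loopMapC loopMapC_const m a), ← piMap_loopC_fibre, h,
      piMap_piBase, piMap_piBase]

lemma connecting_eq_base (hσ : σ.IsPseudoEmbedding) (a : HomotopyGroup.Pi (m + 1) σ.RelLoop σ.constRel) :
    d m a = piBase _ m ↔ a ∈ range (piMap σ.toRelLoopC toRelLoopC_const (m + 1)) := by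
  rw [(isFibreSeq hσ).connecting_eq_base projMap_base hd]
  constructor
  · rintro ⟨b, rfl⟩
    exact ⟨piMap (loopC σ) loopC_base _ b, by rw [← piMap_projMap_inc, piMap_inc_loopC]⟩
  · rintro ⟨b, rfl⟩
    exact ⟨_, piMap_projMap_inc b⟩

lemma isConnecting : σ.IsConnecting σ.loopMap σ.relMap m (d m) := by
  intro γ H' H F hH'0 hH'1 hH'b hH0 hH1 hHb hF hF'
  let x1 : C((Fin m → I) × I, σ.Pullback) :=
    ⟨fun z => diag σ (H' (z.2, z.1)), continuous_diag.comp (by fun_prop)⟩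
  let x2 : C((Fin m → I) × I, σ.Pullback) :=
    ⟨fun z => pair σ (H (unitInterval.symm z.2, z.1)) (γ.1 z.1), continuous_pair.comp (f := fun
      z : (Fin m → I) × I => (H (unitInterval.symm z.2, z.1), γ.1 z.1)) (by fun_prop)⟩
  have hc : diag σ (identity q).constRel = fibre σ (Loop.const q) :=
    (diag_toRelLoop _).trans (congrArg (pair σ · _) loopMap_const)
  have h1 : ∀ y, x1 (y, 1) = x2 (y, 0) := fun y => by
    change diag σ (H' (1, y)) = pair σ (H (unitInterval.symm 0, y)) (γ y)
    rw [hH'1, diag_toRelLoop, unitInterval.symm_zero, hH1]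
  obtain ⟨x, hx⟩ := exists_concat x1 x2 h1
  refine hd m F γ ⟨x, fun y s => ?_, ?_, fun y => ?_⟩
  · rw [hx]
    split_ifs with hs
    · refine (proj_diag _).trans (hF (Fin.cons s y) (projIcc 0 1 zero_le_one (2 * s)) ?_).symm
      rw [projIcc_double_of_le hs]
      simp
    · refine (proj_pair _ _).trans (hF' (Fin.cons s y) (unitInterval.symm
        (projIcc 0 1 zero_le_one (2 * s - 1))) ?_).symm
      rw [unitInterval.coe_symm_eq, projIcc_double_sub_of_le (not_le.1 hs).le]
      simp
      ring
  · rintro ⟨y, s⟩ (hs | hy)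
    · obtain rfl : s = 0 := hs
      rw [hx]
      simpa [x1, hH'0] using hc
    · replace hy : y ∈ Cube.boundary (Fin m) := hy
      have h2 : ∀ s, x1 (y, s) = fibre σ (Loop.const q) := fun s => (congrArg (diag σ) (hH'b s y hy)).trans hc
      have h3 : ∀ s, x2 (y, s) = fibre σ (Loop.const q) := fun s => congrArg₂ (pair σ) (hHb _ y hy) (γ.2 y hy)
      rw [hx, h2, h3, ite_self]
  · rw [hx]
    norm_num
    change pair σ (H (unitInterval.symm 1, y)) (γ y) = _
    rw [unitInterval.symm_one, hH0]
    rfl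

/-- Multiplicativity of the first connecting map. -/
lemma exists_connecting_transAt (hσ : σ.IsPseudoEmbedding)
    (hc : ∀ δ : Loop q, piZeroMk (Loop.const q) (conc δ (Loop.const q)) = piZeroMk _ δ)
    (f g : GenLoop (Fin 1) σ.RelLoop σ.constRel) : ∃ δ δ' : Loop q, d 0 (piMk f) = piZeroMk _ δ ∧
      d 0 (piMk g) = piZeroMk _ δ' ∧ d 0 (piMk (GenLoop.transAt 0 f g)) = piZeroMk _ (conc δ δ') := by
  obtain ⟨δ, hδ⟩ := (isFibreSeq hσ).exists_liftsTo projMap_base f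
  obtain ⟨ε, hε⟩ := (isFibreSeq hσ).exists_liftsTo projMap_base g
  have key : ∀ δ : GenLoop (Fin 0) (Loop q) (Loop.const q), piZeroMk _ (δ 0) = piMk δ := fun δ =>
    congrArg piMk ((genLoopHomeoOfIsEmpty (Fin 0) _).symm_apply_apply δ)
  obtain ⟨f', hf, hf'⟩ := IsFibreSeq.exists_liftsTo_of_eq projMap_base
    (fun a => ((isFibreSeq hσ).base a).trans projMap_base) hδ ((key δ).symm.trans (hc (δ 0)).symm)
  refine ⟨δ 0, ε 0, (hd _ _ _ hδ).trans (key δ).symm, (hd _ _ _ hε).trans (key ε).symm, ?_⟩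
  have hfg : piMk (GenLoop.transAt 0 f g) = piMk (GenLoop.transAt 0 f' g) := by rw [← mul_piMk, ← mul_piMk, hf]
  rw [hfg]
  obtain ⟨x, hr, hx, h1⟩ := hε
  refine hd _ _ _ (IsFibreSeq.liftsTo_transAt projMap_base hf'
    ⟨fun z => act (δ 0) (x z), (continuous_act _).comp x.continuous⟩ (fun y => ?_) (fun y => ?_)
    (fun y s => (proj_act _ _).trans (hr y s)) fun y hy => hy.choose.elim0)
  · exact (congrArg (act (δ 0)) (hx _ (.inl rfl))).trans (act_pair _ _ _)
  · refine (congrArg (act (δ 0)) (h1 y)).trans ((act_pair _ _ _).trans ?_)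
    rw [Subsingleton.elim y 0]
    rfl

end Pullback

end BasedSystem

lemma piZeroMk_eq_iff {A : Type u} [TopologicalSpace A] {a x y : A} : piZeroMk a x = piZeroMk a y ↔ Joined x y := by
  constructor
  · intro h
    obtain ⟨H, h0, h1, -⟩ := exists_of_piMk_eq h
    exact ⟨⟨⟨fun t => H (t, 0), by fun_prop⟩, h0 0, h1 0⟩⟩
  · rintro ⟨γ⟩
    exact piMk_eq_of ⟨fun z => γ z.1, by fun_prop⟩ (fun _ => γ.source) (fun _ => γ.target)
      fun _ _ hy => hy.choose.elim0

lemma exists_piZeroMk {A : Type u} [TopologicalSpace A] {a : A} (c : HomotopyGroup.Pi 0 A a) :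
    ∃ x, piZeroMk a x = c := by
  obtain ⟨f, rfl⟩ := exists_piMk c
  exact ⟨f 0, congrArg piMk ((genLoopHomeoOfIsEmpty (Fin 0) a).symm_apply_apply f)⟩

namespace BasedSystem

section Loop

lemma joined_conc {γ γ' δ δ' : Loop p} (h : Joined γ γ') (h' : Joined δ δ') : Joined (conc γ δ) (conc γ' δ') :=
  ⟨(h.somePath.prod h'.somePath).map continuous_conc⟩

lemma joined_reLoop {w : C(I × ℝ, ℝ)} {h0 : ∀ t, w (t, 0) = 0} {h1 : ∀ t, w (t, 1) = 1}
    (hw : ∀ z : I × ℝ, z.2 ∈ Icc (0 : ℝ) 1 → w z ∈ Icc (0 : ℝ) 1) (γ : Loop p) :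
    Joined (reLoop w h0 h1 γ 0) (reLoop w h0 h1 γ 1) := by
  exact ⟨⟨⟨_, ((continuous_reLoop hw).comp (Continuous.prodMk_right γ))⟩, rfl, rfl⟩⟩

lemma joined_re (A : LArc p Unit) (w : C(Unit × ℝ, ℝ)) (h0 h1)
    (hw : ∀ z : Unit × ℝ, z.2 ∈ Icc (0 : ℝ) 1 → w z ∈ Icc (0 : ℝ) 1) :
    Joined (LArc.cls (LArc.re A w h0 h1) ()) (LArc.cls A ()) := by
  obtain ⟨W, hW⟩ : ∃ W : C(I × ℝ, ℝ), ∀ z, W z = (1 - z.1) * w ((), z.2) + z.1 * z.2 :=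
    ⟨⟨fun z => (1 - z.1) * w ((), z.2) + z.1 * z.2, by fun_prop⟩, fun _ => rfl⟩
  have hW0 : ∀ t, W (t, 0) = 0 := fun t => by simp [hW, h0]
  have hW1 : ∀ t, W (t, 1) = 1 := fun t => by simp [hW, h1]
  have hW' : ∀ z : I × ℝ, z.2 ∈ Icc 0 1 → W z ∈ Icc 0 1 := fun z hz => by
    rw [hW]
    exact convex_Icc 0 1 (hw ((), z.2) hz) hz (by linarith [z.1.2.2]) z.1.2.1 (by ring)
  have h := joined_reLoop (h0 := hW0) (h1 := hW1) hW' (LArc.cls A ())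
  rw [(reLoop_eq_self hW' (ζ := 1) (fun s _ => by simp [hW]) (LArc.cls A ()))] at h
  refine Joined.trans ?_ h
  refine (congrArg (Joined · _) (Eq.trans (LArc.cls_of_iso
    (Arc.sub_congr (fun z _ => ?_) h0 h1 _ _) ()) (reLoop_cls hW' A (.const Unit 0) ()).symm)).mpr (Joined.refl _)
  simp [hW]

lemma joined_conc_assoc (γ γ' γ'' : Loop p) : Joined (conc γ (conc γ' γ'')) (conc (conc γ γ') γ'') := by
  obtain ⟨A, B, rfl, rfl⟩ := exists_cls_eq₂ γ γ'
  obtain ⟨C, rfl⟩ := LArc.exists_cls_eq γ''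
  obtain ⟨w, h0, h1, hw, h⟩ := Arc.exists_assoc A B C
  rw [conc_cls, conc_cls, conc_cls, conc_cls]
  exact (LArc.cls_of_iso h ()).symm ▸ joined_re (LArc.comp (LArc.comp A B) C) w h0 h1 hw

lemma joined_conc_const (γ : Loop p) : Joined (conc γ (Loop.const p)) γ := by
  have h := joined_reLoop (h0 := Pullback.growMap_zero) (h1 := Pullback.growMap_one) Pullback.growMap_mem γ
  rw [reLoop_eq_self Pullback.growMap_mem (fun s _ => by simp [Pullback.growMap]),
    reLoop_eq_conc_const Pullback.growMap_mem (fun s _ => by simp [Pullback.growMap]; ring_nf)] at h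
  exact h.symm

lemma loopMap_identity (γ : Loop p) : (identity p).loopMap γ = γ := by
  obtain ⟨⟨P, c, τ⟩, rfl⟩ := Quot.exists_rep γ
  exact isLoopMap_loopMap (σ := identity p) P c τ (congrArg Sigma.fst τ.start) (congrArg Sigma.fst τ.finish)

lemma joined_conc_invLoop (γ : Loop p) : Joined (conc γ (invLoop γ)) (Loop.const p) := by
  let κ := (identity p).toRelLoop γ
  let f : C(I, Loop p) := ⟨fun u => (Pullback.diag (identity p) (truncPath (identity p) κ u)).loop,
    Pullback.continuous_loop.comp (Pullback.continuous_diag.comp (continuous_truncPath.comp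
      (Continuous.prodMk_right κ)))⟩
  have h : ∀ δ : Loop p, (Pullback.diag (identity p) ((identity p).toRelLoop δ)).loop = conc δ (invLoop δ) :=
    fun δ => by
      rw [Pullback.diag_toRelLoop]
      change conc _ (invLoop _) = _
      rw [loopMap_identity]
  refine Joined.symm ⟨⟨f, ?_, ?_⟩⟩
  · refine (congrArg (fun κ => (Pullback.diag (identity p) κ).loop) (truncPath_zero κ)).trans ((h _).trans ?_)
    rw [invLoop_const, conc_const_const]
  · exact (congrArg (fun κ => (Pullback.diag (identity p) κ).loop) (truncPath_one κ)).trans (h γ)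

variable (p) in
/-- The multiplication of homotopy classes of loops. -/
def piOneMul (a b : HomotopyGroup.Pi 0 (Loop p) (Loop.const p)) : HomotopyGroup.Pi 0 (Loop p) (Loop.const p) :=
  piZeroMk _ (conc (exists_piZeroMk a).choose (exists_piZeroMk b).choose)

lemma piOneMul_mk (γ δ : Loop p) : piOneMul p (piZeroMk _ γ) (piZeroMk _ δ) = piZeroMk _ (conc γ δ) :=
  piZeroMk_eq_iff.2 (joined_conc (piZeroMk_eq_iff.1 (exists_piZeroMk (piZeroMk (Loop.const p) γ)).choose_spec)
    (piZeroMk_eq_iff.1 (exists_piZeroMk (piZeroMk (Loop.const p) δ)).choose_spec))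

lemma piOneMul_assoc (a b c : HomotopyGroup.Pi 0 (Loop p) (Loop.const p)) :
    piOneMul p (piOneMul p a b) c = piOneMul p a (piOneMul p b c) := by
  obtain ⟨γ, rfl⟩ := exists_piZeroMk a
  obtain ⟨γ', rfl⟩ := exists_piZeroMk b
  obtain ⟨γ'', rfl⟩ := exists_piZeroMk c
  rw [piOneMul_mk, piOneMul_mk, piOneMul_mk, piOneMul_mk]
  exact (piZeroMk_eq_iff.2 (joined_conc_assoc γ γ' γ'')).symm

lemma piOneMul_one (a : HomotopyGroup.Pi 0 (Loop p) (Loop.const p)) :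
    piOneMul p a (piZeroMk _ (Loop.const p)) = a := by
  obtain ⟨γ, rfl⟩ := exists_piZeroMk a
  rw [piOneMul_mk]
  exact piZeroMk_eq_iff.2 (joined_conc_const γ)

lemma exists_piOneMul_eq_one (a : HomotopyGroup.Pi 0 (Loop p) (Loop.const p)) :
    ∃ b, piOneMul p a b = piZeroMk _ (Loop.const p) := by
  obtain ⟨γ, rfl⟩ := exists_piZeroMk a
  refine ⟨piZeroMk _ (invLoop γ), ?_⟩
  rw [piOneMul_mk]
  exact piZeroMk_eq_iff.2 (joined_conc_invLoop γ)

variable (p) in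
/-- The fundamental group. -/
@[reducible] def piOneGroup : Group (HomotopyGroup.Pi 0 (Loop p) (Loop.const p)) :=
  @Group.ofRightAxioms _ ⟨piOneMul p⟩ ⟨fun a => (exists_piOneMul_eq_one a).choose⟩
    ⟨piZeroMk _ (Loop.const p)⟩ piOneMul_assoc piOneMul_one
    fun a => (exists_piOneMul_eq_one a).choose_spec

/-- A loop that is a part of a represented loop. -/
lemma cls_sub_eq_mk {F0 : (point p).PFam Unit} {P P' : Subdivision} {c' : Fin (P'.n + 2) → X.ι}
    {τ' : LoopSys p P' c'} (R : Rep F0 ((point p).toRelSys τ')) {c : Fin (P.n + 2) → X.ι} (τ : LoopSys p P c)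
    {θ : Fin (P.n + 2) → Fin (P'.n + 2)} {x y x' y' : ℝ}
    (hp : ∀ k, ∀ s ∈ P.piece k, x + y * s ∈ P'.piece (θ k))
    (hf : ∀ k, ∀ s ∈ P.piece k, (⟨c' (θ k), τ'.f (θ k) (x + y * s)⟩ : X.BasePoint) = ⟨c k, τ.f k s⟩)
    (hl : ∀ l, ∃ l', θ l.castSucc = l'.castSucc ∧ θ l.succ = l'.succ ∧ x + y * P.brk l = P'.brk l' ∧
      toAny (τ'.ξ l') = toAny (τ.ξ l)) {F : Frame F0.A (fun _ => x') (ContinuousMap.const Unit p.2)}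
    {G : Frame F0.A (fun _ => y') (ContinuousMap.const Unit p.2)}
    (hF : ∀ z hz hz', toAny (inv (F.h z hz) ≫ R.h (θ 0) z hz').tr = toAny (X.one p.1))
    (hG : ∀ z hz hz', toAny (inv (G.h z hz) ≫ R.h (θ (Fin.last _)) z hz').tr = toAny (X.one p.1)) (h0 h1) :
    LArc.cls (Arc.sub F0.A (lin Unit x y) F G h0 h1) () = Loop.mk τ := by
  have hlink : ∀ (l' : Fin (P'.n + 1)) (k k' : Fin (P'.n + 2)), k = l'.castSucc → k' = l'.succ →
      ∀ (z : Unit × ℝ) (hz : z.2 = P'.brk l') hk hk',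
      toAny (inv (R.h k z hk) ≫ R.h k' z hk').tr = toAny (τ'.ξ l') := by
    rintro l' _ _ rfl rfl z hz hk hk'
    exact congrArg toAny (R.link l' z hz)
  have hcast : ∀ {a b b' d d' : X.Obj} (m : a ⟶ b) (n : a ⟶ d) (e : b = b') (e' : d = d'),
      toAny (inv (m ≫ eqToHom e) ≫ n ≫ eqToHom e').tr = toAny (inv m ≫ n).tr := by
    rintro a b _ d _ m n rfl rfl
    simp
  have hcast' : ∀ {a b d d' : X.Obj} (m : a ⟶ b) (n : a ⟶ d) (e' : d = d'),
      toAny (inv m ≫ n ≫ eqToHom e').tr = toAny (inv m ≫ n).tr := by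
    rintro a b d _ m n rfl
    simp
  refine congrArg (loopHomeo p) ((PFam.cls_eq_mk_iff (τ := (point p).toRelSys τ)).2 ⟨⟨fun k z hz =>
    R.h (θ k) ((), x + y * z.2) (hp k _ hz) ≫ eqToHom ((fun k s hs => obj_eq_of_basePoint_eq (hf k s hs)) k _ hz), fun k => ?_,
    fun l z hz => ?_, fun z hz => ?_, 𝟙 _, fun z hz => ?_⟩⟩)
  · exact (((R.sec (θ k)).comap (.id Unit) (lin Unit x y)).comap (.const Unit ()) (Pth.sndMap Unit)).congr_toAny
      (fun z hz => hp k _ hz) fun z hz => toAny_comp_eqToHom _ _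
  · obtain ⟨l', e1, e2, e3, e4⟩ := hl l
    exact toAny_injective ((hcast _ _ _ _).trans ((hlink l' _ _ e1 e2 _ ((congrArg (fun s => x + y * s) hz).trans e3) _ _).trans e4))
  · exact (hcast' _ _ _).trans (hF _ _ _)
  · exact (hcast' _ _ _).trans (hG _ _ _)

lemma toAny_inv_comp_eq_one {x y z z' : X.Obj} {m : x ⟶ y} {n : x ⟶ z} {i : X.ι} (e : z = z')
    (h : toAny (inv m ≫ n).tr = toAny (X.one i)) : toAny (inv (n ≫ eqToHom e) ≫ m).tr = toAny (X.one i) := by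
  subst e
  obtain ⟨e', he⟩ := eq_eqToHom_of_toAny h
  have h1 : n = m ≫ eqToHom e' := by rw [← he]; simp
  subst e' h1
  simpa using h

lemma conc_mk_mk {τ τ' τ'' : LoopSystem p} (h : IsConcat τ τ' τ'') :
    conc (Loop.mk τ.sys) (Loop.mk τ'.sys) = Loop.mk τ''.sys := by
  have hn := h.n_eq
  have hmid : τ''.P.t ⟨τ.P.n + 2, by omega⟩ = 1 / 2 := by
    refine ((h.right 0 ⟨τ.P.n + 2, by omega⟩ (by simp)).1).trans ?_
    rw [Fin.castSucc_zero, τ'.P.zero, add_zero]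
  have htl : ∀ (k : Fin (τ.P.n + 3)) (k'' : Fin (τ''.P.n + 3)), (k'' : ℕ) = k → τ''.P.t k'' = τ.P.t k / 2 := by
    intro k k'' hk
    induction k using Fin.lastCases with
    | last =>
      rw [show k'' = ⟨τ.P.n + 2, by omega⟩ from Fin.ext hk, hmid, τ.P.one]
    | cast k => exact (h.left k ⟨k'', by have := k.2; simp at hk; omega⟩ (by simpa using hk)).1
  have htr : ∀ (k : Fin (τ'.P.n + 3)) (k'' : Fin (τ''.P.n + 3)), (k'' : ℕ) = τ.P.n + 2 + k →
      τ''.P.t k'' = (1 + τ'.P.t k) / 2 := by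
    intro k k'' hk
    induction k using Fin.lastCases with
    | last =>
      obtain rfl : k'' = Fin.last _ := Fin.ext (by simp at hk ⊢; omega)
      rw [τ'.P.one, τ''.P.one]; norm_num
    | cast k => exact (h.right k ⟨k'', by have := k.2; simp at hk; omega⟩ (by simpa using hk)).1
  obtain ⟨A, hA⟩ := LArc.exists_cls_eq (Loop.mk τ''.sys)
  let L : LArc p Unit := LArc.comap A (.const Unit ())
  have hL : LArc.cls L () = Loop.mk τ''.sys := (LArc.cls_comap A _ _).trans hA
  obtain ⟨R⟩ : Nonempty (Rep ((PFam.ofArc A.toPoint).at' ()) ((point p).toRelSys τ''.sys)) :=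
    PFam.cls_eq_mk_iff.1 ((loopHomeo p).injective hA)
  let km : Fin (τ''.P.n + 2) := ⟨τ.P.n + 2, by omega⟩
  let lm : Fin (τ''.P.n + 1) := ⟨τ.P.n + 1, by omega⟩
  have hbm : τ''.P.brk lm = 1 / 2 := hmid
  have hkm : (1 / 2) ∈ τ''.P.piece km := hbm ▸ τ''.P.brk_mem_right lm
  have hpt : ∀ s : ℝ, s = 1 / 2 → (⟨τ''.c km, τ''.sys.f km s⟩ : X.Obj) = ⟨p.1, p.2⟩ := by
    intro s hs
    have h1 := (h.right 0 km (by simp [km])).2 0 τ'.P.zero_mem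
    rw [add_zero, ← hs] at h1
    exact obj_eq_of_basePoint_eq (h1.trans τ'.sys.start)
  let G : Frame L.A (fun _ => 1 / 2) (ContinuousMap.const Unit p.2) :=
    ⟨fun z hz => R.h km z (by rwa [show z.2 = 1 / 2 from hz]) ≫ eqToHom (hpt _ hz),
      (R.sec km).congr_toAny (fun z hz => by rwa [mem_ofPred_eq, show z.2 = 1 / 2 from hz])
        fun z hz => toAny_comp_eqToHom _ _⟩
  have hl := cls_sub_eq_mk R τ.sys (x := 0) (y := 1 / 2) (θ := fun k => ⟨k, by omega⟩) (F := L.st) (G := G)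
    (fun k s hs => ?_) (fun k s hs => ?_) (fun l => ?_) ?_ ?_ (by simp) (by simp)
  have hr := cls_sub_eq_mk R τ'.sys (x := 1 / 2) (y := 1 / 2) (θ := fun k => ⟨τ.P.n + 2 + k, by omega⟩)
    (F := G) (G := L.en)
    (fun k s hs => ?_) (fun k s hs => ?_) (fun l => ?_) ?_ ?_ (by simp) (by simp; norm_num)
  · rw [← hl, ← hr, conc_cls, ← hL]
    exact LArc.cls_of_iso ((Arc.isComp_sub (fun z _ => by simp) (fun z _ => by simp; ring) (by simp) (by simp) (by simp) (by norm_num) (by simp) (by simp)).iso_comp.symm.trans (Arc.sub_self L _ _)) ()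
  · obtain ⟨h1, h2⟩ := hs
    exact ⟨by rw [(htr k.castSucc (⟨τ.P.n + 2 + k, by omega⟩ : Fin (τ''.P.n + 2)).castSucc rfl)]; linarith, by rw [(htr k.succ (⟨τ.P.n + 2 + k, by omega⟩ : Fin (τ''.P.n + 2)).succ (by simp; omega))]; linarith⟩
  · have := (h.right k ⟨τ.P.n + 2 + k, by omega⟩ rfl).2 s hs
    rwa [show (1 + s) / 2 = 1 / 2 + 1 / 2 * s by ring] at this
  · refine ⟨⟨τ.P.n + 2 + l, by omega⟩, rfl, rfl, ?_, h.right_tran l _ rfl⟩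
    refine Eq.trans ?_ (htr l.castSucc.succ (⟨τ.P.n + 2 + l, by omega⟩ : Fin (τ''.P.n + 1)).castSucc.succ (by simp; omega)).symm
    simp only [Subdivision.brk]; ring
  · intro z hz hz'
    have : ∀ k, k = km → ∀ hk, toAny (inv (G.h z hz) ≫ R.h k z hk).tr = toAny (X.one p.1) := by
      rintro _ rfl hk
      exact (toAny_inv_comp_eqToHom _ _ _).trans ((congrArg (fun m => toAny (Mor.tr m)) (IsIso.inv_hom_id (R.h km z hk))).trans
        (congrArg (fun x : X.Obj => toAny (X.one x.ch)) (hpt _ hz)))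
    exact this _ (Fin.ext (by simp [km])) hz'
  · intro z hz hz'
    have : ∀ k, k = Fin.last _ → ∀ hk, toAny (inv (L.en.h z hz) ≫ R.h k z hk).tr = toAny (X.one p.1) := by
      rintro _ rfl hk
      obtain ⟨ζ, hζ⟩ := R.fin
      exact hζ z hz
    exact this _ (Fin.ext (by simp; omega)) hz'
  · obtain ⟨h1, h2⟩ := hs
    exact ⟨by rw [(htl k.castSucc (⟨k, by omega⟩ : Fin (τ''.P.n + 2)).castSucc rfl)]; linarith, by rw [(htl k.succ (⟨k, by omega⟩ : Fin (τ''.P.n + 2)).succ (by simp))]; linarith⟩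
  · have := (h.left k ⟨k, by omega⟩ rfl).2 s hs
    rwa [show s / 2 = 0 + 1 / 2 * s by ring] at this
  · refine ⟨⟨l, by omega⟩, rfl, rfl, ?_, h.left_tran l _ rfl⟩
    refine Eq.trans ?_ (htl l.castSucc.succ (⟨l, by omega⟩ : Fin (τ''.P.n + 1)).castSucc.succ (by simp)).symm
    simp only [Subdivision.brk]; ring
  · intro z hz hz'
    have : ∀ k, k = 0 → ∀ hk, toAny (inv (L.st.h z hz) ≫ R.h k z hk).tr = toAny (X.one p.1) := by
      rintro _ rfl hk
      exact R.start z hz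
    exact this _ (Fin.ext (by simp)) hz'
  · intro z hz hz'
    have : ∀ k, k = lm.castSucc → ∀ hk, toAny (inv (G.h z hz) ≫ R.h k z hk).tr = toAny (X.one p.1) := by
      rintro _ rfl hk
      exact toAny_inv_comp_eq_one _ ((congrArg toAny (R.link lm z (hz.trans hbm.symm))).trans (h.middle_tran lm rfl))
    exact this _ (Fin.ext (by simp [lm])) hz'

lemma isPi1Group_piOneGroup : IsPi1Group p (piOneGroup p) := fun τ τ' τ'' h =>
  (piOneMul_mk _ _).trans (congrArg (piZeroMk _) (conc_mk_mk h))

end Loop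

end BasedSystem

namespace Orbispace

lemma exists_proj_eq (a : TX) : ∃ x : X.Obj, (X.proj x.ch x.pt : TX) = a := by
  obtain ⟨_, ⟨i, rfl⟩, hy, -⟩ := X.isBasis.exists_subset_of_mem_open (mem_univ a) isOpen_univ
  obtain ⟨x, hx⟩ := (X.proj_isQuotientMap i).surjective ⟨a, hy⟩
  exact ⟨⟨i, x⟩, congrArg Subtype.val hx⟩

/-- Two points of charts are joined by a path. -/
def Linked (x y : X.Obj) : Prop := Nonempty (Arc (ContinuousMap.const Unit x.pt) (ContinuousMap.const Unit y.pt))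

lemma Linked.congr {x x' y y' : X.Obj} (h : Linked x y) (hx : (X.proj x.ch x.pt : TX) = X.proj x'.ch x'.pt)
    (hy : (X.proj y.ch y.pt : TX) = X.proj y'.ch y'.pt) : Linked x' y' := by
  obtain ⟨A⟩ := h
  obtain ⟨m⟩ := nonempty_hom hx
  obtain ⟨n⟩ := nonempty_hom hy
  exact ⟨⟨A.A, A.st.post (fun _ => m) continuous_const, A.en.post (fun _ => n) continuous_const⟩⟩

end Orbispace

namespace BasedSystem

section

lemma RArc.endpoint_cls (A : σ.RArc v) (t : T) : (RArc.cls A t).endpoint = Y.proj _ (v t) := by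
  obtain ⟨P, c, τ, ⟨R⟩⟩ := PFam.exists_rep ((PFam.ofArc A).at' t)
  rw [show RArc.cls A t = RelLoop.mk τ from PFam.cls_eq_mk_iff.2 ⟨R⟩]
  exact (proj_eq_of_hom R.fin.choose).symm

lemma endpoint_toRelLoop (γ : Loop p) : (σ.toRelLoop γ).endpoint = Y.proj _ q.2 := by
  obtain ⟨τ, rfl⟩ := Quot.exists_rep γ
  exact (congrArg (fun b => (Y.proj b.1 b.2 : TY)) σ.base_source)

end

end BasedSystem

namespace Orbispace

lemma linked_iff {x y : X.Obj} : Linked x y ↔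
    ∃ (P : Subdivision) (c : Fin (P.n + 2) → X.ι) (τ : PathSys P c), (X.proj _ (τ.f 0 0) : TX) = X.proj x.ch x.pt ∧
      (X.proj _ (τ.f (Fin.last _) 1) : TX) = X.proj y.ch y.pt := by
  constructor
  · rintro ⟨A⟩
    let A' : (identity (⟨x.ch, x.pt⟩ : X.BasePoint)).RArc (ContinuousMap.const Unit y.pt) := A
    obtain ⟨P, c, τ, ⟨R⟩⟩ := PFam.exists_rep ((PFam.ofArc A').at' ())
    exact ⟨P, c, τ.toPathSys, congrArg (fun b : X.BasePoint => (X.proj b.1 b.2 : TX)) τ.start, (congrArg (fun b : X.BasePoint => (X.proj b.1 b.2 : TX)) τ.finish).trans (proj_eq_of_hom R.fin.choose).symm⟩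
  · rintro ⟨P, c, τ, hx, hy⟩
    let τ' : (identity (⟨c 0, τ.f 0 0⟩ : X.BasePoint)).RelSys P c (c (Fin.last _)) :=
      { toPathSys := τ, start := rfl, v := τ.f (Fin.last _) 1, finish := rfl }
    obtain ⟨α, v, A, hA⟩ := RArc.exists_cls_eq (RelLoop.mk τ')
    exact Linked.congr (x := ⟨c 0, τ.f 0 0⟩) (y := ⟨α, v ()⟩) ⟨A⟩ hx (((RArc.endpoint_cls A ()).symm.trans (congrArg RelLoop.endpoint hA)).trans hy)

lemma pi0_mk_eq_iff {x y : X.Obj} : Pi0.mk X (X.proj x.ch x.pt) = Pi0.mk X (X.proj y.ch y.pt) ↔ Linked x y := by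
  rw [linked_iff]
  refine Equivalence.quot_mk_eq_iff ⟨?_, ?_, ?_⟩ _ _
  · intro a
    obtain ⟨x, rfl⟩ := exists_proj_eq (X := X) a
    exact linked_iff.1 ⟨Arc.const _⟩
  · intro a b h
    obtain ⟨x, rfl⟩ := exists_proj_eq (X := X) a
    obtain ⟨y, rfl⟩ := exists_proj_eq (X := X) b
    exact linked_iff.1 ⟨(linked_iff.2 h).some.rev⟩
  · intro a b c h h'
    obtain ⟨x, rfl⟩ := exists_proj_eq (X := X) a
    obtain ⟨y, rfl⟩ := exists_proj_eq (X := X) b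
    obtain ⟨z, rfl⟩ := exists_proj_eq (X := X) c
    exact linked_iff.1 ⟨(linked_iff.2 h).some.comp (linked_iff.2 h').some⟩

end Orbispace

namespace BasedSystem

lemma pi0_endpoint_eq (hσ : σ.IsPseudoEmbedding) {φ ψ : σ.RelLoop} (h : Joined φ ψ) :
    Pi0.mk Y φ.endpoint = Pi0.mk Y ψ.endpoint := by
  obtain ⟨γ⟩ := h
  have : LocallyPathConnectedSpace I :=
    (isQuotientMap_projIcc (h := zero_le_one (α := ℝ))).locallyPathConnectedSpace
  have hc : IsLocallyConstant fun t => Pi0.mk Y (γ t).endpoint := by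
    rw [IsLocallyConstant.iff_eventually_eq]
    intro t0
    obtain ⟨M, hM, ht, α, v, A, hA⟩ := RArc.exists_local hσ.isEmbedding ((localLift_cube hσ.isWeakFibration 1).of_homeo (Homeomorph.funUnique (Fin 1) I).symm) γ.continuous t0
    filter_upwards [pathComponentIn_mem_nhds (hM.mem_nhds ht)] with t h
    obtain ⟨δ, hδ⟩ := h
    have hp : Continuous fun z : Unit × ℝ => (⟨δ.extend z.2, hδ _⟩ : M) :=
      (δ.continuous_extend.comp continuous_snd).subtype_mk _
    have h0 := fun t => (congrArg RelLoop.endpoint (hA t)).symm.trans (RArc.endpoint_cls A t)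
    have ht' : t ∈ M := by simpa using hδ 1
    rw [show (γ t).endpoint = _ from h0 ⟨t, ht'⟩, show (γ t0).endpoint = _ from h0 ⟨t0, ht⟩]
    exact (pi0_mk_eq_iff (x := ⟨_, v ⟨t0, ht⟩⟩) (y := ⟨_, v ⟨t, ht'⟩⟩)).2 ⟨Arc.ofMap (v.comp ⟨_, hp⟩)
      (fun z hz => congrArg v (Subtype.ext (by simp [hz]))) fun z hz => congrArg v (Subtype.ext (by simp [hz]))⟩ |>.symm
  have := hc.apply_eq_of_preconnectedSpace 0 1
  simpa using this

variable (σ) in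
/-- The map of sets of path components that sends a relative loop to its end point. -/
def endPi0 (a : HomotopyGroup.Pi 0 σ.RelLoop σ.constRel) : Y.Pi0 := Pi0.mk Y (exists_piZeroMk a).choose.endpoint

lemma endPi0_mk (hσ : σ.IsPseudoEmbedding) (γ : σ.RelLoop) : σ.endPi0 (piZeroMk _ γ) = Pi0.mk Y γ.endpoint :=
  pi0_endpoint_eq hσ (piZeroMk_eq_iff.1 (exists_piZeroMk (piZeroMk σ.constRel γ)).choose_spec)

variable (σ) in
lemma exists_pi0_mk_eq (b : Y.Pi0) : ∃ (α : σ.Λ) (y : Y.C (σ.V α)), Pi0.mk Y (Y.proj _ y) = b := by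
  obtain ⟨y, rfl⟩ := Quot.exists_rep b
  obtain ⟨x, rfl⟩ := exists_proj_eq (X := Y) y
  obtain ⟨α, z, ⟨m⟩⟩ := σ.exists_chart x
  exact ⟨α, z, congrArg (Pi0.mk Y) (proj_eq_of_hom m).symm⟩

variable (σ) in
/-- The map of sets of path components induced by a morphism. -/
def pi0Map (b : Y.Pi0) : X.Pi0 := Pi0.mk X (X.proj _ (σ.f _ (exists_pi0_mk_eq σ b).choose_spec.choose))

lemma isPi0Map_pi0Map : σ.IsPi0Map σ.pi0Map := by
  intro α y
  obtain ⟨A⟩ := (pi0_mk_eq_iff (x := ⟨_, _⟩) (y := ⟨_, y⟩)).1 ((exists_pi0_mk_eq σ (Pi0.mk Y (Y.proj _ y))).choose_spec.choose_spec)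
  exact (pi0_mk_eq_iff (x := ⟨_, _⟩) (y := ⟨_, σ.f α y⟩)).2 ⟨Arc.push A⟩

lemma piMap_piZeroMk {A : Type u} {B : Type v} [TopologicalSpace A] [TopologicalSpace B] {a : A} {b : B}
    (f : C(A, B)) (hf : f a = b) (x : A) : piMap f hf 0 (piZeroMk a x) = piZeroMk b (f x) := rfl

lemma endPi0_eq_base (hσ : σ.IsPseudoEmbedding) (a : HomotopyGroup.Pi 0 σ.RelLoop σ.constRel) :
    σ.endPi0 a = Pi0.mk Y (Y.proj _ q.2) ↔ a ∈ range (piMap σ.toRelLoopC toRelLoopC_const 0) := by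
  constructor
  · intro h
    obtain ⟨φ, rfl⟩ := exists_piZeroMk a
    obtain ⟨α, v, P, rfl⟩ := RArc.exists_cls_eq φ
    obtain ⟨y, rfl⟩ : ∃ y, v = ContinuousMap.const Unit y := ⟨v (), rfl⟩
    rw [endPi0_mk hσ, RArc.endpoint_cls] at h
    obtain ⟨B⟩ := (pi0_mk_eq_iff (x := ⟨q.1, q.2⟩) (y := ⟨_, y⟩)).1 h.symm
    let B' : σ.YArc (ContinuousMap.const Unit y) := B
    let x := Pullback.of B' P ()
    refine ⟨piZeroMk _ x.loop, (piMap_piZeroMk _ _ _).trans (piZeroMk_eq_iff.2 (Joined.symm ?_))⟩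
    refine ⟨⟨⟨_, (Pullback.continuous_proj.comp (Pullback.continuous_contract.comp (Continuous.prodMk_right x)))⟩, ?_, ?_⟩⟩
    · exact (congrArg Pullback.proj (Pullback.contract_zero x)).trans (Pullback.proj_of B' P ())
    · exact (congrArg Pullback.proj (Pullback.contract_one x)).trans (Pullback.proj_pair _ _)
  · rintro ⟨b, rfl⟩
    obtain ⟨γ, rfl⟩ := exists_piZeroMk b
    rw [piMap_piZeroMk, endPi0_mk hσ]
    exact congrArg (Pi0.mk Y) (endpoint_toRelLoop γ)

lemma pi0Map_eq_base (hσ : σ.IsPseudoEmbedding) (b : Y.Pi0) :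
    σ.pi0Map b = Pi0.mk X (X.proj _ p.2) ↔ b ∈ range σ.endPi0 := by
  constructor
  · intro h
    obtain ⟨α, y, rfl⟩ := exists_pi0_mk_eq σ b
    rw [isPi0Map_pi0Map] at h
    obtain ⟨A⟩ := (pi0_mk_eq_iff (x := ⟨p.1, p.2⟩) (y := ⟨_, σ.f α y⟩)).1 h.symm
    let A' : σ.RArc (ContinuousMap.const Unit y) := A
    exact ⟨piZeroMk _ (RArc.cls A' ()), (endPi0_mk hσ _).trans (congrArg (Pi0.mk Y) (RArc.endpoint_cls A' ()))⟩
  · rintro ⟨a, rfl⟩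
    obtain ⟨φ, rfl⟩ := exists_piZeroMk a
    obtain ⟨α, v, P, rfl⟩ := RArc.exists_cls_eq φ
    rw [endPi0_mk hσ, RArc.endpoint_cls, isPi0Map_pi0Map]
    exact ((pi0_mk_eq_iff (x := ⟨p.1, p.2⟩) (y := ⟨_, σ.f α (v ())⟩)).2 ⟨P⟩).symm

end BasedSystem

end

open Orbispace BasedSystem in
theorem theorem3p3p3 {Y : Type u} {X : Type v} [TopologicalSpace Y] [TopologicalSpace X]
    (𝒴 : Orbispace Y) (𝒳 : Orbispace X) (q : 𝒴.BasePoint) (p : 𝒳.BasePoint)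
    (σ : BasedSystem.{u, v, w} 𝒴 𝒳 q p) (hσ : σ.IsPseudoEmbedding) :
    ∃ (i : C(Loop q, Loop p)) (j : C(Loop p, σ.RelLoop)) (e : C((identity q).RelLoop, σ.RelLoop))
      (hi : i (Loop.const q) = Loop.const p) (hj : j (Loop.const p) = σ.constRel)
      (i₀ : 𝒴.Pi0 → 𝒳.Pi0)
      (d₀ : HomotopyGroup.Pi 0 σ.RelLoop σ.constRel → 𝒴.Pi0)
      (d : ∀ m : ℕ, HomotopyGroup.Pi (m + 1) σ.RelLoop σ.constRel → HomotopyGroup.Pi m (Loop q) (Loop.const q))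
      (gY : Group (HomotopyGroup.Pi 0 (Loop q) (Loop.const q)))
      (gX : Group (HomotopyGroup.Pi 0 (Loop p) (Loop.const p))),
      -- the maps are the ones induced by the morphism, and `d` is the connecting map
      σ.IsLoopMap i ∧ (∀ γ, j γ = σ.toRelLoop γ) ∧ σ.IsRelMap e ∧ σ.IsPi0Map i₀ ∧
      (∀ γ : σ.RelLoop, d₀ (piZeroMk _ γ) = Pi0.mk 𝒴 γ.endpoint) ∧
      (∀ m, σ.IsConnecting i e m (d m)) ∧
      -- they are homomorphisms wherever source and target are groups
      IsPi1Group q gY ∧ IsPi1Group p gX ∧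
      (∀ a b, piMap i hi 0 (a * b) = piMap i hi 0 a * piMap i hi 0 b) ∧
      (∀ m a b, piMap i hi (m + 1) (a * b) = piMap i hi (m + 1) a * piMap i hi (m + 1) b) ∧
      (∀ m a b, piMap j hj (m + 1) (a * b) = piMap j hj (m + 1) a * piMap j hj (m + 1) b) ∧
      (∀ f g : GenLoop (Fin 1) σ.RelLoop σ.constRel,
        d 0 (piMk (GenLoop.transAt 0 f g)) = d 0 (piMk f) * d 0 (piMk g)) ∧
      (∀ m a b, d (m + 1) (a * b) = d (m + 1) a * d (m + 1) b) ∧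
      -- exactness
      (∀ m a, piMap j hj m a = piBase _ m ↔ a ∈ Set.range (piMap i hi m)) ∧
      (∀ m a, piMap i hi m a = piBase _ m ↔ a ∈ Set.range (d m)) ∧
      (∀ m a, d m a = piBase _ m ↔ a ∈ Set.range (piMap j hj (m + 1))) ∧
      (∀ a, d₀ a = Pi0.mk 𝒴 (𝒴.proj _ q.2) ↔ a ∈ Set.range (piMap j hj 0)) ∧
      (∀ b, i₀ b = Pi0.mk 𝒳 (𝒳.proj _ p.2) ↔ b ∈ Set.range d₀) := by
  choose d hd using fun m => (Pullback.isFibreSeq hσ).exists_connecting Pullback.projMap_base m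
  refine ⟨σ.loopMapC, σ.toRelLoopC, ⟨σ.relMap, continuous_relMap⟩, loopMapC_const, toRelLoopC_const,
    σ.pi0Map, σ.endPi0, d, piOneGroup q, piOneGroup p, isLoopMap_loopMap, fun _ => rfl, isRelMap_relMap,
    isPi0Map_pi0Map, endPi0_mk hσ, fun m => Pullback.isConnecting hd, isPi1Group_piOneGroup,
    isPi1Group_piOneGroup, fun a b => ?_, fun m => piMap_mul _ _, fun m => piMap_mul _ _, fun f g => ?_,
    fun m => (Pullback.isFibreSeq hσ).connecting_mul Pullback.projMap_base hd,
    fun m => Pullback.toRelLoopC_eq_base hσ, fun m => Pullback.loopMapC_eq_base hd hσ,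
    fun m => Pullback.connecting_eq_base hd hσ, endPi0_eq_base hσ, pi0Map_eq_base hσ⟩
  · obtain ⟨γ, rfl⟩ := exists_piZeroMk a
    obtain ⟨δ, rfl⟩ := exists_piZeroMk b
    change piMap σ.loopMapC _ 0 (piOneMul q _ _) = piOneMul p (piMap σ.loopMapC _ 0 _) (piMap σ.loopMapC _ 0 _)
    rw [piOneMul_mk, piMap_piZeroMk, piMap_piZeroMk, piMap_piZeroMk, piOneMul_mk]
    exact congrArg (piZeroMk _) (loopMap_conc γ δ)
  · obtain ⟨δ, δ', h, h', e⟩ := Pullback.exists_connecting_transAt hd hσ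
      (fun δ => piZeroMk_eq_iff.2 (joined_conc_const δ)) f g
    rw [e, h, h']
    exact (piOneMul_mk δ δ').symm
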